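/- **Setting.** Let $M$ be a closed smooth Riemannian surface with a smooth positive area, let $(f_1,\dots,f_m)$ be a tuple of area-preserving $C^2$ diffeomorphisms of $M$, and for a word $\omega\in\{1,\dots,m\}^{\mathbb N}$ put $f^n_\omega=f_{\omega_n}\circ\dots\circ f_{\omega_1}$. Angles between directions are taken in $[0,\pi/2]$. * The point $x$ is *$(C,\lambda,\epsilon)$-tempered at time $n$* for $\omega$ if there are unit vectors $e^s,e^u\in T_xM$ such that for all $k,j\ge 0$ with $k+j\le n$: $\|D_xf^{k+j}_\omega e^u\|\ge e^{-C}e^{\lambda j}e^{-\epsilon k}\|D_xf^k_\omega e^u\|$, $\|D_xf^{k+j}_\omega e^s\|\le e^{C}e^{-\lambda j}e^{\epsilon k}\|D_xf^k_\omega e^s\|$, and $\angle(D_xf^k_\omega e^s,D_xf^k_\omega e^u)\ge e^{-C}e^{-\epsilon k}$. * $E^s_n(x)$ is the most contracted singular direction of $D_xf^n_\omega$; it is defined when the two singular values differ. For a cone $\mathcal C\subset T_xM$ (a union of lines), $\omega$ is *$(C,\lambda,\epsilon,\mathcal C,n,n+1)$-tempered* (at $x$) if $x$ is $(C,\lambda,\epsilon)$-tempered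 at time $n+1$ and, for $i=n,n+1$, $E^s_i(x)$ is defined and lies in $\mathcal C$. * Fix $\nu_1,\nu_2>0$ and a finite atlas in which $C^2$ norms of line fields are measured (through the spanning field of unit vectors in the charts, on fixed compact subsets of the chart domains that cover $M$). Given a set $K$ of $(C,\lambda,\epsilon)$-tempered points at time $n$, a *smoothed image distribution* at time $n$ with parameters $(\eta,D_1,D_2,D_3)$ is a $C^2$ line field $\widetilde V_n$ on an open set that contains all points within distance $D_1e^{-\eta\nu_1n}$ of $f^n_\omega(K)$, with $\|\widetilde V_n\|_{C^2}\le D_2e^{\eta\nu_1n}$, and making at each $f^n_\omega(y)$, $y\in K$, where $E^s_n(y)$ is defined, an angle less than $D_3e^{-\eta\nu_2n}$ with $D_yf^n_\omega(E^s_n(y))$. For $x\in K$ the *fake stable manifold* $W^s_{n,r}(x)$ of radius $r$ is the segment of radius $r$ (in arclength) about $x$ in the preimage under $f^n_\omega$ of the integral curve of $\widetilde V_n$ through $f^n_\omega(x)$. * A *$C$-good curve* is a $C^2$ curve $\gamma\colon[a,b]\to M$ parametrized by arclength, of length at least $e^{-C}$ and with $C^2$ norm (the supremum of its geodesic curvature)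 at most $e^{C}$. **Proposition.** For all $\lambda,C_1,\theta_0,\nu_1,\nu_2>0$ there is $\epsilon_0>0$ such that for all $0\le\epsilon<\epsilon_0$, $0<\eta<\epsilon_0$, and $C,D_1,D_2,D_3>0$ there are $N\in\mathbb N$ and $\delta_0>0$ such that the following holds for every $0<\delta\le\delta_0$. Let $x\in M$, let $\mathcal C\subset T_xM$ be a cone, extended by parallel transport along minimizing geodesics from $x$ to a cone field over the ball $B_{2\delta}(x)$, and let $\gamma$ be a $C$-good curve with $d(x,\gamma)<\delta$ that makes an angle at least $\theta_0$ with this cone field at each of its points in $B_{2\delta}(x)$. Let $n\ge N$, let $\omega$ be $(C_1,\lambda,\epsilon,\mathcal C,n,n+1)$-tempered at $x$, and let $W=W^s_{n,4\delta_0}(x)$ and $W'=W^s_{n+1,4\delta_0}(x)$ be fake stable manifolds of times $n$ and $n+1$ defined by any smoothed image distributions at these times with parameters $(\eta,D_1,D_2,D_3)$, for any sets of $(C_1,\lambda,\epsilon)$-tempered points (at time $n$, respectively $n+1$) containing $x$. Then $$d_\gamma(W\cap\gamma,\;W'\cap\gamma)\le r:=e^{-1.99\ln\|D_xf^n_\omega\|}$$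 in the following sense: 1. if $p\in W$ and $p'\in W'$ are the endpoints of an arc of $\gamma$ contained in $B_{2\delta}(x)$, then that arc has length at most $r$; 2. if $\gamma$ meets one of $W$, $W'$ at a point of $B_{2\delta}(x)$, and continues for length at least $r$ on both sides of this point, then it meets the other one within distance $r$ along $\gamma$ of this point. -/

import Mathlib

open Set Manifold Bundle Filter Topology
open scoped ContDiff ENNReal

noncomputable section

namespace FakeStable

/-- The model plane. -/
abbrev Plane : Type := EuclideanSpace ℝ (Fin 2)

variable {M : Type*} [EMetricSpace M] [ChartedSpace Plane M]
  [RiemannianBundle (fun x : M => TangentSpace (𝓡 2) x)]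

/-! ### Linear algebra in the tangent planes -/

/-- The area of the parallelogram spanned by two vectors of an inner product space. -/
def parallelogramArea {V : Type*} [NormedAddCommGroup V] [InnerProductSpace ℝ V] (u v : V) : ℝ :=
  Real.sqrt (‖u‖ ^ 2 * ‖v‖ ^ 2 - inner ℝ u v ^ 2)

/-- The angle, in `[0, π / 2]`, between the lines spanned by two nonzero vectors. -/
def lineAngle {V : Type*} [NormedAddCommGroup V] [InnerProductSpace ℝ V] (u v : V) : ℝ :=
  min (InnerProductGeometry.angle u v) (Real.pi - InnerProductGeometry.angle u v)

/-- `L` is the most contracted singular direction of `A`. The inequality is strict, so that there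
is at most one such `L`, and for maps of planes there is one iff the singular values differ. -/
def IsMostContracted {V W : Type*} [NormedAddCommGroup V] [InnerProductSpace ℝ V]
    [NormedAddCommGroup W] [InnerProductSpace ℝ W] (A : V →L[ℝ] W) (L : Submodule ℝ V) : Prop :=
  Module.finrank ℝ L = 1 ∧ ∀ v ∈ L, v ≠ 0 → ∀ w, w ∉ L → ‖A v‖ * ‖w‖ < ‖A w‖ * ‖v‖

/-- A (two-sided) cone: a set of vectors that is a union of lines through the origin. -/
def IsCone {V : Type*} [AddCommGroup V] [Module ℝ V] (S : Set V) : Prop :=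
  ∀ v ∈ S, ∀ c : ℝ, c • v ∈ S

/-! ### Random dynamics -/

/-- `g` preserves the smooth area whose density with respect to the Riemannian area is `ρ`. -/
def PreservesArea (ρ : M → ℝ) (g : M → M) : Prop :=
  ∀ (x : M) (u v : TangentSpace (𝓡 2) x),
    ρ (g x) * parallelogramArea (mfderiv (𝓡 2) (𝓡 2) g x u) (mfderiv (𝓡 2) (𝓡 2) g x v) =
      ρ x * parallelogramArea u v

/-- The composition of the first `n` maps along the word `wd` (the first letter is `wd 0`). -/
def wordMap {m : ℕ} (f : Fin m → M ≃ₘ^2⟮𝓡 2, 𝓡 2⟯ M) (wd : ℕ → Fin m) : ℕ → M → M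
  | 0 => id
  | n + 1 => f (wd n) ∘ wordMap f wd n

/-- The differential at `x` of the composition of the first `n` maps along the word `wd`. -/
def wordDeriv {m : ℕ} (f : Fin m → M ≃ₘ^2⟮𝓡 2, 𝓡 2⟯ M) (wd : ℕ → Fin m) (n : ℕ) (x : M) :
    TangentSpace (𝓡 2) x →L[ℝ] TangentSpace (𝓡 2) (wordMap f wd n x) :=
  mfderiv (𝓡 2) (𝓡 2) (wordMap f wd n) x

/-- The sequence of the first `n` differentials along the orbit of `x` has a
`(C, lam, ε)`-tempered splitting: `eu` is expanded, `es` is contracted, and the angle between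
their images does not decay too fast. -/
def IsTempered {m : ℕ} (f : Fin m → M ≃ₘ^2⟮𝓡 2, 𝓡 2⟯ M) (wd : ℕ → Fin m) (C lam ε : ℝ) (n : ℕ)
    (x : M) : Prop :=
  ∃ es eu : TangentSpace (𝓡 2) x, ‖es‖ = 1 ∧ ‖eu‖ = 1 ∧
    (∀ k j : ℕ, k + j ≤ n →
      Real.exp (-C) * Real.exp (lam * j) * Real.exp (-ε * k) * ‖wordDeriv f wd k x eu‖ ≤
        ‖wordDeriv f wd (k + j) x eu‖) ∧
    (∀ k j : ℕ, k + j ≤ n →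
      ‖wordDeriv f wd (k + j) x es‖ ≤
        Real.exp C * Real.exp (-lam * j) * Real.exp (ε * k) * ‖wordDeriv f wd k x es‖) ∧
    (∀ k : ℕ, k ≤ n →
      Real.exp (-C) * Real.exp (-ε * k) ≤
        lineAngle (wordDeriv f wd k x es) (wordDeriv f wd k x eu))

/-- `wd` is `(C, lam, ε, 𝒞, n₁, n₂)`-tempered at `x`: the orbit is tempered up to time `n₂` and for
`n₁ ≤ i ≤ n₂` the most contracted direction of the time `i` differential is defined and lies
in `𝒞`. -/
def IsConeTempered {m : ℕ} (f : Fin m → M ≃ₘ^2⟮𝓡 2, 𝓡 2⟯ M) (wd : ℕ → Fin m) (C lam ε : ℝ)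
    (x : M) (𝒞 : Set (TangentSpace (𝓡 2) x)) (n₁ n₂ : ℕ) : Prop :=
  IsTempered f wd C lam ε n₂ x ∧
    ∀ i, n₁ ≤ i → i ≤ n₂ →
      ∃ L : Submodule ℝ (TangentSpace (𝓡 2) x),
        IsMostContracted (wordDeriv f wd i x) L ∧ (L : Set (TangentSpace (𝓡 2) x)) ⊆ 𝒞

/-! ### Riemannian geometry in charts -/

/-- The Riemannian metric in the preferred chart at `z`, at the point with coordinates `p`. -/
def chartMetric (z : M) (p u v : Plane) : ℝ :=
  inner ℝ (mfderiv 𝓘(ℝ, Plane) (𝓡 2) (extChartAt (𝓡 2) z).symm p u)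
    (mfderiv 𝓘(ℝ, Plane) (𝓡 2) (extChartAt (𝓡 2) z).symm p v)

/-- The Christoffel symbols of the first kind of the Levi-Civita connection in the preferred chart
at `z`, as a trilinear form: `g(∇_u v, w)` for constant coordinate vector fields `u`, `v`, `w`. -/
def christoffel (z : M) (p u v w : Plane) : ℝ :=
  (fderiv ℝ (fun q => chartMetric z q v w) p u + fderiv ℝ (fun q => chartMetric z q u w) p v
    - fderiv ℝ (fun q => chartMetric z q u v) p w) / 2

/-- The velocity of a curve. -/
def velocity (c : ℝ → M) (t : ℝ) : TangentSpace (𝓡 2) (c t) :=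
  mfderiv 𝓘(ℝ, ℝ) (𝓡 2) c t (1 : ℝ)

/-- The velocity of a curve defined on a set `S` of times. -/
def velocityWithin (c : ℝ → M) (S : Set ℝ) (t : ℝ) : TangentSpace (𝓡 2) (c t) :=
  mfderivWithin 𝓘(ℝ, ℝ) (𝓡 2) c S t (1 : ℝ)

/-- The coordinates, in the preferred chart at `z`, of a vector field `Y` along the curve `c`. -/
def coordField (z : M) (c : ℝ → M) (Y : ∀ t, TangentSpace (𝓡 2) (c t)) (t : ℝ) : Plane :=
  mfderiv (𝓡 2) 𝓘(ℝ, Plane) (extChartAt (𝓡 2) z) (c t) (Y t)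

/-- The inner product of the Levi-Civita covariant derivative at time `t` of the vector field `Y`
along the curve `c` with the tangent vector at `c t` whose coordinates are `w`, in the preferred
chart at `c t`. -/
def covDeriv (c : ℝ → M) (Y : ∀ t, TangentSpace (𝓡 2) (c t)) (t : ℝ) (w : Plane) : ℝ :=
  let z := c t
  let p := extChartAt (𝓡 2) z z
  chartMetric z p (deriv (coordField z c Y) t) w +
    christoffel z p (deriv (fun s => extChartAt (𝓡 2) z (c s)) t) (coordField z c Y t) w

/-- The geodesic curvature at time `t` of the unit speed curve `c`, which is the norm of the
covariant derivative of its velocity, is at most `κ`. For a unit speed curve this norm is the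
absolute value of the second derivative at the origin of the function whose graph, over the
tangent line at `c t` in the exponential chart at `c t`, is the curve. -/
def CurvatureLE (c : ℝ → M) (t κ : ℝ) : Prop :=
  ∀ w : Plane, |covDeriv c (velocity c) t w| ≤
    κ * Real.sqrt (chartMetric (c t) (extChartAt (𝓡 2) (c t) (c t)) w w)

/-- `γ : [a, b] → M` is a `C`-good curve: a `C²` curve parametrized by arclength, of length at
least `e^{-C}` and of `C²` norm at most `e^C`. -/
structure IsGoodCurve (C a b : ℝ) (γ : ℝ → M) : Prop where
  contMDiffOn : ContMDiffOn 𝓘(ℝ, ℝ) (𝓡 2) 2 γ (Icc a b)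
  unit_speed : ∀ t ∈ Icc a b, ‖velocityWithin γ (Icc a b) t‖ = 1
  length_ge : Real.exp (-C) ≤ b - a
  curvature_le : ∀ t ∈ Ioo a b, CurvatureLE γ t (Real.exp C)

/-- `c : [0, 1] → M` is a minimizing geodesic from `x` to `y`. -/
structure IsMinGeodesic (x y : M) (c : ℝ → M) : Prop where
  contMDiffOn : ContMDiffOn 𝓘(ℝ, ℝ) (𝓡 2) ∞ c (Icc 0 1)
  source : c 0 = x
  target : c 1 = y
  edist_eq : ∀ s ∈ Icc (0 : ℝ) 1, ∀ t ∈ Icc (0 : ℝ) 1,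
    edist (c s) (c t) = ENNReal.ofReal |s - t| * edist x y

section Transport

variable [IsManifold (𝓡 2) ∞ M]

/-- `Y` is a parallel vector field along the curve `c : [0, 1] → M`. -/
structure IsParallel (c : ℝ → M) (Y : ∀ t, TangentSpace (𝓡 2) (c t)) : Prop where
  contMDiffOn : ContMDiffOn 𝓘(ℝ, ℝ) (𝓡 2).tangent 1
    (fun t => (⟨c t, Y t⟩ : TangentBundle (𝓡 2) M)) (Icc 0 1)
  covDeriv_eq_zero : ∀ t ∈ Ioo (0 : ℝ) 1, ∀ w, covDeriv c Y t w = 0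

/-- The extension by parallel transport of a subset `𝒞` of the tangent plane at `x`: its value at
`y` consists of the parallel transports of the elements of `𝒞` along the minimizing geodesic from
`x` to `y` (unique when `y` is close to `x`). -/
def transportCone (x : M) (𝒞 : Set (TangentSpace (𝓡 2) x)) (y : M) :
    Set (TangentSpace (𝓡 2) y) :=
  {w | ∃ (c : ℝ → M) (Y : ∀ t, TangentSpace (𝓡 2) (c t)),
    IsMinGeodesic x y c ∧ IsParallel c Y ∧
    (∃ v ∈ 𝒞, (⟨c 0, Y 0⟩ : TangentBundle (𝓡 2) M) = ⟨x, v⟩) ∧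
    (⟨c 1, Y 1⟩ : TangentBundle (𝓡 2) M) = ⟨y, w⟩}

/-- The curve `γ : [a, b] → M` is `θ`-transverse to the cone field over the ball of radius `r`
about `x` obtained by parallel transport of `𝒞`. -/
def IsTransverse (θ : ℝ) (x : M) (𝒞 : Set (TangentSpace (𝓡 2) x)) (r a b : ℝ) (γ : ℝ → M) : Prop :=
  ∀ t ∈ Icc a b, γ t ∈ Metric.eball x (ENNReal.ofReal r) →
    ∀ v ∈ transportCone x 𝒞 (γ t), v ≠ 0 → θ ≤ lineAngle (velocityWithin γ (Icc a b) t) v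

end Transport

/-! ### One-dimensional distributions -/

variable (M) in
/-- A finite atlas made of preferred charts, with compact subsets of the chart domains that
cover `M`. It serves to measure `C²` norms. -/
structure FiniteAtlas where
  centers : Finset M
  core : M → Set M
  isCompact_core : ∀ z ∈ centers, IsCompact (core z)
  core_subset : ∀ z ∈ centers, core z ⊆ (chartAt Plane z).source
  cover : ∀ y : M, ∃ z ∈ centers, y ∈ core z

variable (M) in
/-- A one-dimensional distribution (field of lines) on an open subset of `M`. -/
structure LineField where
  domain : Set M
  isOpen_domain : IsOpen domain
  dir : ∀ y : M, Submodule ℝ (TangentSpace (𝓡 2) y)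
  finrank_dir : ∀ y ∈ domain, Module.finrank ℝ (dir y) = 1

/-- The distribution `V` is `C²` with `C²` norm at most `B`: in the charts of the atlas it is
spanned by a `C²` field `φ` of unit vectors of the plane (locally unique up to sign) whose first
and second derivatives are at most `B`. -/
def LineField.C2NormLE (V : LineField M) (𝒜 : FiniteAtlas M) (B : ℝ) : Prop :=
  ∀ z ∈ 𝒜.centers, ∀ y ∈ 𝒜.core z ∩ V.domain, ∃ φ : Plane → Plane,
    ContDiffAt ℝ 2 φ (extChartAt (𝓡 2) z y) ∧
    (∀ᶠ q in 𝓝 (extChartAt (𝓡 2) z y), ‖φ q‖ = 1 ∧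
      mfderiv 𝓘(ℝ, Plane) (𝓡 2) (extChartAt (𝓡 2) z).symm q (φ q) ∈
        V.dir ((extChartAt (𝓡 2) z).symm q)) ∧
    ∀ i : ℕ, 1 ≤ i → i ≤ 2 → ‖iteratedFDeriv ℝ i φ (extChartAt (𝓡 2) z y)‖ ≤ B

/-- `V` is a smooth approximation at time `n` of the image under the time `n` differential of the
most contracted directions at the points of `K`: its domain contains the `D₁ e^{-η ν₁ n}`
neighbourhood of the image of `K`, its `C²` norm is at most `D₂ e^{η ν₁ n}`, and on the image
of `K` it is within angle `D₃ e^{-η ν₂ n}` of the image of the most contracted direction. -/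
structure IsSmoothedImage {m : ℕ} (f : Fin m → M ≃ₘ^2⟮𝓡 2, 𝓡 2⟯ M) (wd : ℕ → Fin m)
    (𝒜 : FiniteAtlas M) (ν₁ ν₂ η D₁ D₂ D₃ : ℝ) (n : ℕ) (K : Set M) (V : LineField M) : Prop where
  mem_domain : ∀ x ∈ K, ∀ y : M,
    edist (wordMap f wd n x) y ≤ ENNReal.ofReal (D₁ * Real.exp (-(η * ν₁ * n))) → y ∈ V.domain
  c2Norm_le : V.C2NormLE 𝒜 (D₂ * Real.exp (η * ν₁ * n))
  angle_lt : ∀ x ∈ K, ∀ L, IsMostContracted (wordDeriv f wd n x) L → ∀ v ∈ L, v ≠ 0 →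
    ∀ w ∈ V.dir (wordMap f wd n x), w ≠ 0 →
      lineAngle (wordDeriv f wd n x v) w < D₃ * Real.exp (-(η * ν₂ * n))

/-- The segment of radius `r` about `x` of the leaf through `x` of the time `n` fake stable
foliation, which is the pullback under the time `n` map of the foliation by integral curves of the
distribution `V`: the points that are reached from `x` by unit speed curves of length at most `r`
that are mapped by the time `n` map to curves tangent to `V`. -/
def fakeStableLeaf {m : ℕ} (f : Fin m → M ≃ₘ^2⟮𝓡 2, 𝓡 2⟯ M) (wd : ℕ → Fin m) (n : ℕ)
    (V : LineField M) (x : M) (r : ℝ) : Set M :=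
  {y | ∃ (T : ℝ) (σ : ℝ → M), 0 < T ∧ T ≤ r ∧ ContMDiffOn 𝓘(ℝ, ℝ) (𝓡 2) 1 σ (Icc 0 T) ∧
    σ 0 = x ∧ y ∈ σ '' Icc 0 T ∧
    ∀ s ∈ Icc 0 T, ‖velocityWithin σ (Icc 0 T) s‖ = 1 ∧ wordMap f wd n (σ s) ∈ V.domain ∧
      wordDeriv f wd n (σ s) (velocityWithin σ (Icc 0 T) s) ∈ V.dir (wordMap f wd n (σ s))}

/-- The distance along `γ : [a, b] → M`, inside the ball of radius `r₀` about `x`, between the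
intersections of `γ` with `W` and with `W'` is at most `r`. First, two points of intersection with
`W` and with `W'` that lie on a common arc of `γ` inside the ball are at distance at most `r`
along `γ`. Second, if `γ` meets one of the two sets in the ball and continues for length `r` on
both sides of that point, then it meets the other set within distance `r` along `γ`. -/
def IntersectionsWithin (W W' : Set M) (x : M) (r₀ a b : ℝ) (γ : ℝ → M) (r : ℝ) : Prop :=
  (∀ s ∈ Icc a b, ∀ t ∈ Icc a b, γ '' uIcc s t ⊆ Metric.eball x (ENNReal.ofReal r₀) →
    γ s ∈ W → γ t ∈ W' → |s - t| ≤ r) ∧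
  (∀ s, Icc (s - r) (s + r) ⊆ Icc a b → γ s ∈ Metric.eball x (ENNReal.ofReal r₀) →
    (γ s ∈ W → ∃ t ∈ Icc (s - r) (s + r), γ t ∈ W') ∧
    (γ s ∈ W' → ∃ t ∈ Icc (s - r) (s + r), γ t ∈ W))

end FakeStable

end

/-!
Fake stable manifolds of consecutive times meet a transverse curve in nearly the same points, because
expansion and contraction compete on the chords between them. Let `p` and `p'` be points of the
curve on the two leaves. The chord from `p` to `p'` is transverse to the contracting direction, so
the dynamics expands it like the vector `eu` of the tempered splitting at `x`. At time `n`, however,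
both points are close to the orbit of `x`, at a distance comparable to the length of the image of
`es`. Hence the chord is at most of the order of the ratio `s / u` of the lengths of the images of
`es` and `eu`, up to subexponential factors. Since the area is preserved, `s * u` is subexponential,
and `u` is comparable to the norm of the differential, so that `s / u` is close to the power `-2` of
this norm (`IsSplitting.ratio_le_radius`). The exponent `-1.99` leaves room for all errors.

To make this precise one works in finitely many charts, with bounds that are uniform by compactness
(`eventually_uniformBounds`). A tempered splitting becomes a hyperbolic sequence `HypSeq` of linear
maps of the plane. Orbits that stay in the tube of radii `β * exp (-lam * k / 2)` about the orbit
of `x` (`InTube`), their tangent vectors and their differences are pseudo-orbits of this sequence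
with exponentially small relative errors. For pseudo-orbits there are two estimates, in coordinates
in which the linear maps are the identity: the component along `eu` does not decrease if it
dominates at time `0` (`HypSeq.expanding_bound`), and a pseudo-orbit that is away from the expanding
direction at time `n` is contracted and starts almost parallel to `es` (`HypSeq.contracting_bound`).

The second estimate controls the leaves. A smoothed image distribution is away from the expanding
direction on a ball about the image of `x` that contains the end of the tube, because it is close
to the image of the most contracted direction at one point, and its `C²` norm grows more slowly than
the tube shrinks (`isConeField_of_smoothedImage`). Leaves are therefore contracted, and by continuity
short leaves never leave the tube (`IsAdapted.leaf_inTube`). They exist on both sides of `x`, with a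
length that does not depend on `n` (`IsAdapted.exists_leafCurve`), and they are graphs of small slope
over the contracting direction (`IsAdapted.exists_graph`).

The curve is transverse to the contracting direction, because the most contracted direction is close
to `es` and parallel transport along short minimizing geodesics hardly changes coordinates in a
chart. The cone field is defined by parallel transport along minimizing geodesics, and for this step
such geodesics have to be exhibited (`GoodChart.exists_mem_transportCone`): solutions of the boundary
value problem are constructed by a contraction argument (`exists_geodesic`), and they minimize
length by a comparison of energies (`geodesic_speed_le_length`).

Now the bound for chords gives the estimate for arcs between the two leaves
(`IsSplitting.abs_sub_le_of_mem`). If the curve meets one leaf, then the other one is a graph that is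
closer to this point, in the expanding direction, than the curve moves in length `r`, so the curve
crosses it by the intermediate value theorem (`IsSplitting.exists_mem_of_mem`).
-/

noncomputable section

namespace FakeStable

set_option linter.unusedSectionVars false
set_option maxSynthPendingDepth 3

/-! ### Charts, coordinates of tangent vectors and the metric in coordinates -/

section Charts

variable {M : Type*} [EMetricSpace M] [ChartedSpace Plane M] [IsManifold (𝓡 2) ∞ M]

/-- The coordinates of tangent vectors at `y` in the preferred chart at `z`. -/
def toChart (z y : M) : TangentSpace (𝓡 2) y →L[ℝ] Plane :=
  mfderiv (𝓡 2) 𝓘(ℝ, Plane) (extChartAt (𝓡 2) z) y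

/-- The tangent vector, at the point with coordinates `p` in the preferred chart at `z`, with given
coordinates. -/
def ofChart (z : M) (p : Plane) :
    Plane →L[ℝ] TangentSpace (𝓡 2) ((extChartAt (𝓡 2) z).symm p) :=
  mfderiv 𝓘(ℝ, Plane) (𝓡 2) (extChartAt (𝓡 2) z).symm p

theorem isOpen_target (z : M) : IsOpen (extChartAt (𝓡 2) z).target := isOpen_extChartAt_target z

theorem symm_mem_source {z : M} {p : Plane} (hp : p ∈ (extChartAt (𝓡 2) z).target) :
    (extChartAt (𝓡 2) z).symm p ∈ (chartAt Plane z).source := by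
  simpa using (extChartAt (𝓡 2) z).map_target hp

theorem coord_mem_target {z y : M} (hy : y ∈ (chartAt Plane z).source) :
    extChartAt (𝓡 2) z y ∈ (extChartAt (𝓡 2) z).target :=
  (extChartAt (𝓡 2) z).map_source (by simpa using hy)

theorem symm_coord {z y : M} (hy : y ∈ (chartAt Plane z).source) :
    (extChartAt (𝓡 2) z).symm (extChartAt (𝓡 2) z y) = y :=
  (extChartAt (𝓡 2) z).left_inv (by simpa using hy)

theorem coord_symm {z : M} {p : Plane} (hp : p ∈ (extChartAt (𝓡 2) z).target) :
    extChartAt (𝓡 2) z ((extChartAt (𝓡 2) z).symm p) = p :=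
  (extChartAt (𝓡 2) z).right_inv hp

theorem exists_coord {z y : M} (hy : y ∈ (chartAt Plane z).source) :
    ∃ p ∈ (extChartAt (𝓡 2) z).target, (extChartAt (𝓡 2) z).symm p = y :=
  ⟨_, coord_mem_target hy, symm_coord hy⟩

theorem toChart_ofChart {z : M} {p : Plane} (hp : p ∈ (extChartAt (𝓡 2) z).target) (v : Plane) :
    toChart z _ (ofChart z p v) = v := by
  have h := mfderiv_extChartAt_comp_mfderivWithin_extChartAt_symm (I := 𝓡 2) hp
  rw [ModelWithCorners.range_eq_univ, mfderivWithin_univ] at h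
  exact congrArg (fun A : Plane →L[ℝ] Plane => A v) h

theorem ofChart_toChart {z : M} {p : Plane} (hp : p ∈ (extChartAt (𝓡 2) z).target)
    (v : TangentSpace (𝓡 2) ((extChartAt (𝓡 2) z).symm p)) :
    ofChart z p (toChart z _ v) = v := by
  have h := mfderivWithin_extChartAt_symm_comp_mfderiv_extChartAt' (I := 𝓡 2)
    (x := z) (y := (extChartAt (𝓡 2) z).symm p) (by simpa using symm_mem_source hp)
  rw [coord_symm hp] at h
  rw [ModelWithCorners.range_eq_univ, mfderivWithin_univ] at h
  exact congrArg (fun A : Plane →L[ℝ] Plane => A v) h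

theorem toChart_injective {z y : M} (hy : y ∈ (chartAt Plane z).source) :
    Function.Injective (toChart z y) := by
  obtain ⟨p, hp, rfl⟩ := exists_coord hy
  exact Function.LeftInverse.injective (ofChart_toChart hp)

theorem ofChart_injective {z : M} {p : Plane} (hp : p ∈ (extChartAt (𝓡 2) z).target) :
    Function.Injective (ofChart z p) :=
  Function.LeftInverse.injective (toChart_ofChart hp)

/-- The map `g` in the preferred charts at `z` and `z'`. -/
def chartMap (g : M → M) (z z' : M) (p : Plane) : Plane :=
  extChartAt (𝓡 2) z' (g ((extChartAt (𝓡 2) z).symm p))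

/-- The domain of `chartMap g z z'`. -/
def chartDomain (g : M → M) (z z' : M) : Set Plane :=
  {p ∈ (extChartAt (𝓡 2) z).target | g ((extChartAt (𝓡 2) z).symm p) ∈ (chartAt Plane z').source}

theorem isOpen_chartDomain {g : M → M} (hg : Continuous g) (z z' : M) :
    IsOpen (chartDomain g z z') :=
  ((continuousOn_extChartAt_symm z).isOpen_inter_preimage (isOpen_target z)
    ((chartAt Plane z').open_source.preimage hg))

theorem contDiffOn_chartMap {g : M → M} {n : ℕ∞ω} (hn : n ≤ (∞ : ℕ∞ω)) (hg : ContMDiff (𝓡 2) (𝓡 2) n g)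
    (z z' : M) :
    ContDiffOn ℝ n (chartMap g z z') (chartDomain g z z') := by
  rw [← contMDiffOn_iff_contDiffOn]
  have : IsManifold (𝓡 2) n M := IsManifold.of_le hn
  have h1 : ContMDiffOn (𝓡 2) 𝓘(ℝ, Plane) n (extChartAt (𝓡 2) z') (chartAt Plane z').source :=
    contMDiffOn_extChartAt
  have h2 : ContMDiffOn 𝓘(ℝ, Plane) (𝓡 2) n (extChartAt (𝓡 2) z).symm
      (extChartAt (𝓡 2) z).target := contMDiffOn_extChartAt_symm z
  exact h1.comp (hg.comp_contMDiffOn (h2.mono fun p hp => hp.1)) fun p hp => hp.2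

/-- In charts, the differential of a map is the derivative of its coordinate expression. -/
theorem toChart_mfderiv {g : M → M} {z z' y : M} (hg : MDifferentiableAt (𝓡 2) (𝓡 2) g y)
    (hy : y ∈ (chartAt Plane z).source) (hy' : g y ∈ (chartAt Plane z').source)
    (v : TangentSpace (𝓡 2) y) :
    toChart z' (g y) (mfderiv (𝓡 2) (𝓡 2) g y v) =
      fderiv ℝ (chartMap g z z') (extChartAt (𝓡 2) z y) (toChart z y v) := by
  obtain ⟨p, hp, rfl⟩ := exists_coord hy
  obtain ⟨w, rfl⟩ : ∃ w, ofChart z p w = v := ⟨_, ofChart_toChart hp v⟩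
  rw [toChart_ofChart hp, coord_symm hp, ← mfderiv_eq_fderiv]
  have h1 : MDifferentiableAt 𝓘(ℝ, Plane) (𝓡 2) (extChartAt (𝓡 2) z).symm p :=
    (mdifferentiableOn_extChartAt_symm p hp).mdifferentiableAt ((isOpen_target z).mem_nhds hp)
  have h2 : MDifferentiableAt (𝓡 2) 𝓘(ℝ, Plane) (extChartAt (𝓡 2) z')
      (g ((extChartAt (𝓡 2) z).symm p)) := mdifferentiableAt_extChartAt hy'
  have e : chartMap g z z' = extChartAt (𝓡 2) z' ∘ (g ∘ (extChartAt (𝓡 2) z).symm) := rfl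
  rw [e, mfderiv_comp p h2 (hg.comp p h1), mfderiv_comp p hg h1]
  rfl

theorem hasDerivWithinAt_coord {c : ℝ → M} {S : Set ℝ} {t : ℝ} {z : M}
    (hc : MDifferentiableWithinAt 𝓘(ℝ, ℝ) (𝓡 2) c S t) (hS : UniqueDiffWithinAt ℝ S t)
    (ht : c t ∈ (chartAt Plane z).source) :
    HasDerivWithinAt (fun s => extChartAt (𝓡 2) z (c s)) (toChart z (c t) (velocityWithin c S t))
      S t := by
  have h2 : MDifferentiableAt (𝓡 2) 𝓘(ℝ, Plane) (extChartAt (𝓡 2) z) (c t) :=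
    mdifferentiableAt_extChartAt ht
  have h3 := (h2.comp_mdifferentiableWithinAt t hc).differentiableWithinAt.hasFDerivWithinAt
  rw [← mfderivWithin_eq_fderivWithin, mfderiv_comp_mfderivWithin t h2 hc
    hS.uniqueMDiffWithinAt] at h3
  exact h3.hasDerivWithinAt

/-- The velocity of a curve given in coordinates. -/
theorem velocityWithin_symm_comp {c : ℝ → Plane} {S : Set ℝ} {t : ℝ} {z : M} {v : Plane}
    (hc : HasDerivWithinAt c v S t) (hS : UniqueDiffWithinAt ℝ S t)
    (ht : c t ∈ (extChartAt (𝓡 2) z).target) :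
    velocityWithin (fun s => (extChartAt (𝓡 2) z).symm (c s)) S t = ofChart z (c t) v := by
  have h1 : MDifferentiableAt 𝓘(ℝ, Plane) (𝓡 2) (extChartAt (𝓡 2) z).symm (c t) :=
    (mdifferentiableOn_extChartAt_symm _ ht).mdifferentiableAt ((isOpen_target z).mem_nhds ht)
  have h := mfderiv_comp_mfderivWithin t h1
    hc.differentiableWithinAt.mdifferentiableWithinAt hS.uniqueMDiffWithinAt
  have h' : mfderivWithin 𝓘(ℝ, ℝ) 𝓘(ℝ, Plane) c S t (1 : ℝ) = v := by
    rw [mfderivWithin_eq_fderivWithin]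
    exact hc.derivWithin hS
  change mfderivWithin 𝓘(ℝ, ℝ) (𝓡 2) ((extChartAt (𝓡 2) z).symm ∘ c) S t (1 : ℝ) = _
  rw [h]
  exact congrArg (ofChart z (c t)) h'

variable [RiemannianBundle (fun x : M => TangentSpace (𝓡 2) x)]

/-- The Riemannian metric in the preferred chart at `z`, as a field of bilinear forms. -/
def gram (z : M) (p : Plane) : Plane →L[ℝ] Plane →L[ℝ] ℝ :=
  (innerSL ℝ).bilinearComp (ofChart z p) (ofChart z p)

theorem gram_apply (z : M) (p u v : Plane) : gram z p u v = chartMetric z p u v := rfl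

theorem gram_comm (z : M) (p u v : Plane) : gram z p u v = gram z p v u :=
  real_inner_comm (ofChart z p v) (ofChart z p u)

theorem inner_eq_gram {z y : M} (hy : y ∈ (chartAt Plane z).source) (v w : TangentSpace (𝓡 2) y) :
    inner ℝ v w = gram z (extChartAt (𝓡 2) z y) (toChart z y v) (toChart z y w) := by
  obtain ⟨p, hp, rfl⟩ := exists_coord hy
  rw [coord_symm hp]
  change _ = inner ℝ (ofChart z p (toChart z _ v)) (ofChart z p (toChart z _ w))
  rw [ofChart_toChart hp, ofChart_toChart hp]

theorem norm_sq_eq_gram {z y : M} (hy : y ∈ (chartAt Plane z).source) (v : TangentSpace (𝓡 2) y) :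
    ‖v‖ ^ 2 = gram z (extChartAt (𝓡 2) z y) (toChart z y v) (toChart z y v) := by
  rw [← inner_eq_gram hy, real_inner_self_eq_norm_sq]

theorem norm_sq_ofChart (z : M) (p v : Plane) : ‖ofChart z p v‖ ^ 2 = gram z p v v :=
  (real_inner_self_eq_norm_sq _).symm

theorem gram_pos {z : M} {p : Plane} (hp : p ∈ (extChartAt (𝓡 2) z).target) {v : Plane}
    (hv : v ≠ 0) : 0 < gram z p v v := by
  rw [← norm_sq_ofChart]
  have : ofChart z p v ≠ 0 := fun h => hv (ofChart_injective hp (by rw [h, map_zero]))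
  positivity

theorem contMDiffOn_ofChart (z : M) (w : Plane) :
    ContMDiffOn 𝓘(ℝ, Plane) (𝓡 2).tangent ∞ (fun p : Plane =>
      (⟨(extChartAt (𝓡 2) z).symm p, ofChart z p w⟩ : TangentBundle (𝓡 2) M))
      (extChartAt (𝓡 2) z).target := by
  have h1 := (contMDiffOn_extChartAt_symm (I := 𝓡 2) (n := ∞) z).contMDiffOn_tangentMapWithin
    (m := ∞) (by simp) (isOpen_target z).uniqueMDiffOn
  have h2 : ContMDiffOn 𝓘(ℝ, Plane) 𝓘(ℝ, Plane).tangent ∞ (fun p : Plane =>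
      (⟨p, w⟩ : TangentBundle 𝓘(ℝ, Plane) Plane)) (extChartAt (𝓡 2) z).target := by
    intro p hp
    exact contMDiffWithinAt_vectorSpace_iff_contDiffWithinAt.2 contDiffWithinAt_const
  refine (h1.comp h2 fun p hp => hp).congr fun p hp => ?_
  simp only [tangentMapWithin, Function.comp]
  rw [mfderivWithin_of_isOpen (isOpen_target z) hp]
  rfl

variable [IsContMDiffRiemannianBundle (𝓡 2) ∞ Plane (fun x : M => TangentSpace (𝓡 2) x)]

theorem contDiffOn_gram (z : M) : ContDiffOn ℝ ∞ (gram z) (extChartAt (𝓡 2) z).target := by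
  rw [contDiffOn_clm_apply]
  intro u
  rw [contDiffOn_clm_apply]
  intro v
  rw [← contMDiffOn_iff_contDiffOn]
  exact (contMDiffOn_ofChart z u).inner_bundle (contMDiffOn_ofChart z v)

end Charts

/-! ### The Levi-Civita connection of a metric on an open subset of a vector space -/

section Connection

variable {E : Type*} [NormedAddCommGroup E] [NormedSpace ℝ E]

/-- The Christoffel symbols of the first kind of the field `g` of bilinear forms, as a trilinear
form: `g(∇_u v, w)` for constant vector fields `u`, `v`, `w`. -/
def christoffelForm (g : E → E →L[ℝ] E →L[ℝ] ℝ) (p : E) :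
    E →L[ℝ] E →L[ℝ] E →L[ℝ] ℝ :=
  (1 / 2 : ℝ) • (fderiv ℝ g p + (fderiv ℝ g p).flip -
    (ContinuousLinearMap.flipₗᵢ ℝ E E ℝ :
      (E →L[ℝ] E →L[ℝ] ℝ) →L[ℝ] (E →L[ℝ] E →L[ℝ] ℝ)).comp (fderiv ℝ g p).flip)

theorem christoffelForm_apply (g : E → E →L[ℝ] E →L[ℝ] ℝ) (p u v w : E) :
    christoffelForm g p u v w =
      (fderiv ℝ g p u v w + fderiv ℝ g p v u w - fderiv ℝ g p w u v) / 2 := by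
  have h : christoffelForm g p u v w =
      1 / 2 * (fderiv ℝ g p u v w + fderiv ℝ g p v u w - fderiv ℝ g p w u v) := rfl
  rw [h]
  ring

/-- The Christoffel symbols of the second kind of the metric `g`, as a field of bilinear maps:
the covariant derivative `∇_u v` for constant vector fields `u`, `v`. -/
def spray (g : E → E →L[ℝ] E →L[ℝ] ℝ) (p : E) : E →L[ℝ] E →L[ℝ] E :=
  (ContinuousLinearMap.compL ℝ E (E →L[ℝ] ℝ) E (g p).inverse).comp
    (christoffelForm g p)

theorem isInvertible_of_pos [FiniteDimensional ℝ E] {b : E →L[ℝ] E →L[ℝ] ℝ} (hb : ∀ v, v ≠ 0 → 0 < b v v) :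
    b.IsInvertible := by
  have hinj : Function.Injective (b : E →ₗ[ℝ] E →L[ℝ] ℝ) := by
    rw [injective_iff_map_eq_zero]
    intro v hv
    by_contra h
    have h1 := hb v h
    have h2 : b v = 0 := hv
    rw [h2] at h1
    simp at h1
  have hdim : Module.finrank ℝ E = Module.finrank ℝ (E →L[ℝ] ℝ) := by
    rw [← (LinearMap.toContinuousLinearMap : (E →ₗ[ℝ] ℝ) ≃ₗ[ℝ] _).finrank_eq]
    exact (Subspace.dual_finrank_eq (K := ℝ) (V := E)).symm
  refine ⟨(LinearEquiv.ofInjectiveOfFinrankEq (b : E →ₗ[ℝ] E →L[ℝ] ℝ) hinj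
    hdim).toContinuousLinearEquiv, ?_⟩
  ext v w
  rfl

theorem apply_spray [FiniteDimensional ℝ E] {g : E → E →L[ℝ] E →L[ℝ] ℝ} {p : E}
    (hg : ∀ v, v ≠ 0 → 0 < g p v v) (u v w : E) :
    g p (spray g p u v) w = christoffelForm g p u v w := by
  have h : g p ((g p).inverse (christoffelForm g p u v)) = christoffelForm g p u v :=
    (isInvertible_of_pos hg).self_apply_inverse _
  exact congrArg (fun l : E →L[ℝ] ℝ => l w) h

theorem contDiffOn_spray [FiniteDimensional ℝ E] {g : E → E →L[ℝ] E →L[ℝ] ℝ} {U : Set E} (hU : IsOpen U)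
    (hg : ContDiffOn ℝ ∞ g U) (hpos : ∀ p ∈ U, ∀ v, v ≠ 0 → 0 < g p v v) :
    ContDiffOn ℝ ∞ (spray g) U := by
  have hD : ContDiffOn ℝ ∞ (fderiv ℝ g) U := hg.fderiv_of_isOpen hU (by simp)
  have hD' : ∀ u v w, ContDiffOn ℝ ∞ (fun p => fderiv ℝ g p u v w) U := fun u v w =>
    ((hD.clm_apply contDiffOn_const).clm_apply contDiffOn_const).clm_apply contDiffOn_const
  have h1 : ContDiffOn ℝ ∞ (christoffelForm g) U := by
    refine contDiffOn_clm_apply.2 fun u => contDiffOn_clm_apply.2 fun v =>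
      contDiffOn_clm_apply.2 fun w => ?_
    simp only [christoffelForm_apply]
    exact (((hD' u v w).add (hD' v u w)).sub (hD' w u v)).div_const 2
  have h2 : ContDiffOn ℝ ∞ (fun p => (g p).inverse) U := by
    intro p hp
    obtain ⟨e, he⟩ := isInvertible_of_pos (hpos p hp)
    have h := contDiffAt_map_inverse (𝕜 := ℝ) (n := ∞) e
    rw [he] at h
    exact h.comp_contDiffWithinAt p (hg p hp)
  exact ((ContinuousLinearMap.compL ℝ E (E →L[ℝ] ℝ) E).contDiff.comp_contDiffOn
    h2).clm_comp h1

/-- The transformation rule of covariant derivatives under a change `τ` of coordinates: `g'` is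
the pullback of `g`, and `c'`, `Y'` are a curve and a vector field along it in the new
coordinates. -/
theorem covariant_transform {g g' : E → E →L[ℝ] E →L[ℝ] ℝ} {τ : E → E}
    {p' : E} {c' Y' : ℝ → E} {dc dY : E} {t : ℝ}
    (hsymm : ∀ q u v, g q u v = g q v u)
    (hτ : ContDiffAt ℝ 2 τ p') (hg : DifferentiableAt ℝ g (τ p'))
    (hg' : ∀ᶠ q in 𝓝 p', ∀ v w, g' q v w = g (τ q) (fderiv ℝ τ q v) (fderiv ℝ τ q w))
    (hg'd : DifferentiableAt ℝ g' p') (hp : c' t = p')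
    (hc : HasDerivAt c' dc t) (hY : HasDerivAt Y' dY t) (w : E) :
    g (τ p') (deriv (fun s => fderiv ℝ τ (c' s) (Y' s)) t) (fderiv ℝ τ p' w) +
      christoffelForm g (τ p') (deriv (fun s => τ (c' s)) t) (fderiv ℝ τ p' (Y' t))
        (fderiv ℝ τ p' w) =
    g' p' dY w + christoffelForm g' p' dc (Y' t) w := by
  subst hp
  have hA : HasFDerivAt (fderiv ℝ τ) (fderiv ℝ (fderiv ℝ τ) (c' t)) (c' t) :=
    ((hτ.fderiv_right (m := 1) le_rfl).differentiableAt one_ne_zero).hasFDerivAt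
  have hτd : HasFDerivAt τ (fderiv ℝ τ (c' t)) (c' t) :=
    (hτ.differentiableAt two_ne_zero).hasFDerivAt
  have hsy : ∀ u v, fderiv ℝ (fderiv ℝ τ) (c' t) u v = fderiv ℝ (fderiv ℝ τ) (c' t) v u :=
    hτ.isSymmSndFDerivAt (by simp)
  have hd1 : HasDerivAt (fun s => fderiv ℝ τ (c' s) (Y' s))
      (fderiv ℝ (fderiv ℝ τ) (c' t) dc (Y' t) + fderiv ℝ τ (c' t) dY) t :=
    (hA.comp_hasDerivAt t hc).clm_apply hY
  have hd2 : HasDerivAt (fun s => τ (c' s)) (fderiv ℝ τ (c' t) dc) t := hτd.comp_hasDerivAt t hc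
  -- the derivative of the pullback metric: besides the derivative of `g`, it involves the second
  -- derivative of `τ`
  have hgD : ∀ u v w, fderiv ℝ g' (c' t) u v w =
      fderiv ℝ g (τ (c' t)) (fderiv ℝ τ (c' t) u) (fderiv ℝ τ (c' t) v) (fderiv ℝ τ (c' t) w) +
      g (τ (c' t)) (fderiv ℝ (fderiv ℝ τ) (c' t) u v) (fderiv ℝ τ (c' t) w) +
      g (τ (c' t)) (fderiv ℝ τ (c' t) v) (fderiv ℝ (fderiv ℝ τ) (c' t) u w) := by
    intro u v w
    have e1 : HasFDerivAt (fun q => g' q v w)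
      (((ContinuousLinearMap.apply ℝ ℝ w).comp
        ((ContinuousLinearMap.apply ℝ (E →L[ℝ] ℝ) v).comp (fderiv ℝ g' (c' t))))) (c' t) :=
      ((ContinuousLinearMap.apply ℝ ℝ w).comp
        (ContinuousLinearMap.apply ℝ (E →L[ℝ] ℝ) v)).hasFDerivAt.comp (c' t) hg'd.hasFDerivAt
    have e2 := ((hg.hasFDerivAt.comp (c' t) hτd).clm_apply
      (hA.clm_apply (hasFDerivAt_const v (c' t)))).clm_apply
        (hA.clm_apply (hasFDerivAt_const w (c' t)))
    have e3 := e1.unique (e2.congr_of_eventuallyEq (hg'.mono fun q hq => (hq v w : _)))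
    have e4 := congrArg (fun l : E →L[ℝ] ℝ => l u) e3
    simp at e4
    rw [e4]
    ring
  -- in the combination that defines the Christoffel symbols, the second derivatives of `τ` cancel
  -- because they are symmetric
  rw [hd1.deriv, hd2.deriv, hg'.self_of_nhds dY w]
  simp only [christoffelForm_apply, hgD, map_add, add_apply]
  rw [hsy (Y' t) dc, hsy w dc, hsy w (Y' t),
    hsymm _ (fderiv ℝ τ (c' t) dc) (fderiv ℝ (fderiv ℝ τ) (c' t) (Y' t) w),
    hsymm _ (fderiv ℝ τ (c' t) (Y' t)) (fderiv ℝ (fderiv ℝ τ) (c' t) dc w)]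
  ring

end Connection

/-! ### Geodesics between nearby points -/

section Geodesic

variable {E : Type*} [NormedAddCommGroup E] [NormedSpace ℝ E]

open intervalIntegral in
/-- The boundary value problem for geodesics: nearby points `p` and `p + e` are joined by a
solution `c` of `c'' = -Γ(c)(c', c')`. The velocity is the fixed point of a contraction. -/
theorem exists_geodesic [CompleteSpace E] {Γ : E → E →L[ℝ] E →L[ℝ] E} {p e : E} {R B : ℝ}
    (hB : 1 ≤ B)
    (hΓ : ∀ q ∈ Metric.ball p R, ‖Γ q‖ ≤ B)
    (hΓL : ∀ q ∈ Metric.ball p R, ∀ q' ∈ Metric.ball p R, ‖Γ q - Γ q'‖ ≤ B * ‖q - q'‖)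
    (heR : 2 * ‖e‖ < R) (heB : 32 * B * ‖e‖ ≤ 1) :
    ∃ c v : ℝ → E, c 0 = p ∧ c 1 = p + e ∧
      ∀ t ∈ Icc (0 : ℝ) 1, HasDerivWithinAt c (v t) (Icc 0 1) t ∧
        HasDerivWithinAt v (-Γ (c t) (v t) (v t)) (Icc 0 1) t ∧ ‖v t‖ ≤ 2 * ‖e‖ ∧
        ‖c t - p‖ ≤ 2 * ‖e‖ := by
  have he0 : 0 ≤ ‖e‖ := norm_nonneg e
  have he1 : ‖e‖ ≤ 1 := by nlinarith
  have h01 : (0 : ℝ) ≤ 1 := zero_le_one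
  -- extension of velocities to the line, the corresponding positions and accelerations
  let ext : C(Icc (0 : ℝ) 1, E) → ℝ → E := fun v => IccExtend h01 v
  have hext : ∀ v, Continuous (ext v) := fun v => v.continuous.Icc_extend'
  have hextn : ∀ v s, ‖ext v s‖ ≤ ‖v‖ := fun v s => v.norm_coe_le_norm _
  have hextd : ∀ v w s, ‖ext v s - ext w s‖ ≤ ‖v - w‖ := fun v w s =>
    (v - w).norm_coe_le_norm (projIcc 0 1 h01 s)
  let pos : C(Icc (0 : ℝ) 1, E) → ℝ → E := fun v t => p + ∫ s in (0 : ℝ)..t, ext v s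
  have hposd : ∀ v t, HasDerivAt (pos v) (ext v t) t := fun v t =>
    ((hext v).integral_hasStrictDerivAt 0 t).hasDerivAt.const_add p
  have hposn : ∀ v, ∀ t ∈ Icc (0 : ℝ) 1, ‖pos v t - p‖ ≤ ‖v‖ := by
    intro v t ht
    have h := norm_integral_le_of_norm_le_const (a := 0) (b := t) (f := ext v) (C := ‖v‖)
      fun s _ => hextn v s
    simp only [pos, add_sub_cancel_left]
    rw [sub_zero, abs_of_nonneg ht.1] at h
    nlinarith [norm_nonneg v, ht.2]
  have hposdiff : ∀ v w, ∀ t ∈ Icc (0 : ℝ) 1, ‖pos v t - pos w t‖ ≤ ‖v - w‖ := by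
    intro v w t ht
    have h := norm_integral_le_of_norm_le_const (a := 0) (b := t)
      (f := fun s => ext v s - ext w s) (C := ‖v - w‖) fun s _ => hextd v w s
    simp only [pos, add_sub_add_left_eq_sub]
    rw [integral_sub ((hext v).intervalIntegrable _ _) ((hext w).intervalIntegrable _ _),
      sub_zero, abs_of_nonneg ht.1] at h
    nlinarith [norm_nonneg (v - w), ht.2]
  let S : Set C(Icc (0 : ℝ) 1, E) := Metric.closedBall 0 (2 * ‖e‖)
  have hS : ∀ v ∈ S, ‖v‖ ≤ 2 * ‖e‖ := fun v hv => by simpa [S] using hv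
  have hposb : ∀ v ∈ S, ∀ t ∈ Icc (0 : ℝ) 1, pos v t ∈ Metric.ball p R := by
    intro v hv t ht
    rw [mem_ball_iff_norm]
    exact ((hposn v t ht).trans (hS v hv)).trans_lt heR
  have hΓc : ContinuousOn Γ (Metric.ball p R) := by
    have : LipschitzOnWith (Real.toNNReal B) Γ (Metric.ball p R) := by
      refine LipschitzOnWith.of_dist_le_mul fun x hx y hy => ?_
      rw [dist_eq_norm, dist_eq_norm, Real.coe_toNNReal _ (by linarith)]
      exact hΓL x hx y hy
    exact this.continuousOn
  let acc : C(Icc (0 : ℝ) 1, E) → ℝ → E := fun v t =>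
    -Γ (pos v (projIcc 0 1 h01 t)) (ext v t) (ext v t)
  have hacc : ∀ v ∈ S, Continuous (acc v) := by
    intro v hv
    have h1 : Continuous (fun t : ℝ => pos v (projIcc 0 1 h01 t)) :=
      (continuous_iff_continuousAt.2 fun t => (hposd v t).continuousAt).comp
        (continuous_subtype_val.comp continuous_projIcc)
    have h2 : Continuous (fun t : ℝ => Γ (pos v (projIcc 0 1 h01 t))) :=
      hΓc.comp_continuous h1 fun t => hposb v hv _ (projIcc 0 1 h01 t).2
    exact ((h2.clm_apply (hext v)).clm_apply (hext v)).neg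
  have haccn : ∀ v ∈ S, ∀ t, ‖acc v t‖ ≤ 4 * B * ‖e‖ ^ 2 := by
    intro v hv t
    have h1 := hΓ _ (hposb v hv _ (projIcc 0 1 h01 t).2)
    have h2 := (hextn v t).trans (hS v hv)
    calc ‖acc v t‖ ≤ ‖Γ (pos v (projIcc 0 1 h01 t))‖ * ‖ext v t‖ * ‖ext v t‖ := by
          simp only [acc, norm_neg]; exact ContinuousLinearMap.le_opNorm₂ _ _ _
      _ ≤ B * (2 * ‖e‖) * (2 * ‖e‖) := by gcongr
      _ = _ := by ring
  have haccd : ∀ v ∈ S, ∀ w ∈ S, ∀ t, ‖acc v t - acc w t‖ ≤ 8 * B * ‖e‖ * ‖v - w‖ := by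
    intro v hv w hw t
    set t' := projIcc 0 1 h01 t
    have h1 := hΓ _ (hposb w hw _ t'.2)
    have h2 := (hextn v t).trans (hS v hv)
    have h2' := (hextn w t).trans (hS w hw)
    have h3 := hextd v w t
    have h4 : ‖Γ (pos v t') - Γ (pos w t')‖ ≤ B * ‖v - w‖ :=
      (hΓL _ (hposb v hv _ t'.2) _ (hposb w hw _ t'.2)).trans
        (by gcongr; exact hposdiff v w _ t'.2)
    have e1 : acc v t - acc w t = -((Γ (pos v t') - Γ (pos w t')) (ext v t) (ext v t) +
        Γ (pos w t') (ext v t - ext w t) (ext v t) +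
        Γ (pos w t') (ext w t) (ext v t - ext w t)) := by
      simp only [acc, map_sub, sub_apply, t']
      abel
    have hn := norm_nonneg (v - w)
    rw [e1, norm_neg]
    refine (norm_add₃_le).trans ?_
    have k1 : ‖(Γ (pos v t') - Γ (pos w t')) (ext v t) (ext v t)‖ ≤
        B * ‖v - w‖ * (2 * ‖e‖) * (2 * ‖e‖) :=
      (ContinuousLinearMap.le_opNorm₂ _ _ _).trans (by gcongr)
    have k2 : ‖Γ (pos w t') (ext v t - ext w t) (ext v t)‖ ≤ B * ‖v - w‖ * (2 * ‖e‖) :=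
      (ContinuousLinearMap.le_opNorm₂ _ _ _).trans (by gcongr)
    have k3 : ‖Γ (pos w t') (ext w t) (ext v t - ext w t)‖ ≤ B * (2 * ‖e‖) * ‖v - w‖ :=
      (ContinuousLinearMap.le_opNorm₂ _ _ _).trans (by gcongr)
    have k4 : B * ‖v - w‖ * (2 * ‖e‖) * (2 * ‖e‖) ≤ 4 * (B * ‖v - w‖ * ‖e‖) := by
      have : 0 ≤ B * ‖v - w‖ * ‖e‖ := by positivity
      nlinarith
    linarith
  let I1 : C(Icc (0 : ℝ) 1, E) → ℝ → E := fun v t => ∫ s in (0 : ℝ)..t, acc v s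
  have hI1d : ∀ v ∈ S, ∀ t, HasDerivAt (I1 v) (acc v t) t := fun v hv t =>
    ((hacc v hv).integral_hasStrictDerivAt 0 t).hasDerivAt
  have hI1c : ∀ v ∈ S, Continuous (I1 v) := fun v hv =>
    continuous_iff_continuousAt.2 fun t => (hI1d v hv t).continuousAt
  have hI1n : ∀ v ∈ S, ∀ t ∈ Icc (0 : ℝ) 1, ‖I1 v t‖ ≤ 4 * B * ‖e‖ ^ 2 := by
    intro v hv t ht
    have h := norm_integral_le_of_norm_le_const (a := 0) (b := t) (f := acc v)
      fun s _ => haccn v hv s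
    rw [sub_zero, abs_of_nonneg ht.1] at h
    have : 0 ≤ 4 * B * ‖e‖ ^ 2 := by positivity
    exact h.trans (by nlinarith [ht.2])
  have hI1diff : ∀ v ∈ S, ∀ w ∈ S, ∀ t ∈ Icc (0 : ℝ) 1,
      ‖I1 v t - I1 w t‖ ≤ 8 * B * ‖e‖ * ‖v - w‖ := by
    intro v hv w hw t ht
    have h := norm_integral_le_of_norm_le_const (a := 0) (b := t)
      (f := fun s => acc v s - acc w s) fun s _ => haccd v hv w hw s
    rw [integral_sub ((hacc v hv).intervalIntegrable _ _) ((hacc w hw).intervalIntegrable _ _),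
      sub_zero, abs_of_nonneg ht.1] at h
    have : 0 ≤ 8 * B * ‖e‖ * ‖v - w‖ := by positivity
    exact h.trans (by nlinarith [ht.2])
  -- the velocity with acceleration `acc v` and mean `e` is `e - m v + I1 v`
  let m : C(Icc (0 : ℝ) 1, E) → E := fun v => ∫ t in (0 : ℝ)..1, I1 v t
  have hm : ∀ v ∈ S, ‖m v‖ ≤ 4 * B * ‖e‖ ^ 2 := by
    intro v hv
    have h := norm_integral_le_of_norm_le_const (a := 0) (b := 1) (f := I1 v)
      (C := 4 * B * ‖e‖ ^ 2) fun s hs => hI1n v hv s (by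
        rw [uIoc_of_le h01] at hs; exact ⟨hs.1.le, hs.2⟩)
    simpa using h
  have hmd : ∀ v ∈ S, ∀ w ∈ S, ‖m v - m w‖ ≤ 8 * B * ‖e‖ * ‖v - w‖ := by
    intro v hv w hw
    have h := norm_integral_le_of_norm_le_const (a := 0) (b := 1)
      (f := fun s => I1 v s - I1 w s) (C := 8 * B * ‖e‖ * ‖v - w‖) fun s hs =>
        hI1diff v hv w hw s (by rw [uIoc_of_le h01] at hs; exact ⟨hs.1.le, hs.2⟩)
    rw [integral_sub ((hI1c v hv).intervalIntegrable _ _)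
      ((hI1c w hw).intervalIntegrable _ _)] at h
    simpa using h
  classical
  let T : C(Icc (0 : ℝ) 1, E) → C(Icc (0 : ℝ) 1, E) := fun v =>
    if hv : v ∈ S then ⟨fun t => e - m v + I1 v t,
      (continuous_const.add ((hI1c v hv).comp continuous_subtype_val))⟩ else v
  have hT : ∀ v ∈ S, ∀ t, T v t = e - m v + I1 v t := by
    intro v hv t
    simp only [T, dif_pos hv]
    rfl
  have hTS : MapsTo T S S := by
    intro v hv
    rw [mem_closedBall_zero_iff, ContinuousMap.norm_le _ (by positivity)]
    intro t
    rw [hT v hv]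
    calc ‖e - m v + I1 v t‖ ≤ ‖e‖ + ‖m v‖ + ‖I1 v t‖ :=
          (norm_add_le _ _).trans (by gcongr; exact norm_sub_le _ _)
      _ ≤ ‖e‖ + 4 * B * ‖e‖ ^ 2 + 4 * B * ‖e‖ ^ 2 := by
          gcongr
          · exact hm v hv
          · exact hI1n v hv t t.2
      _ ≤ 2 * ‖e‖ := by nlinarith
  have hcontr : ContractingWith (1 / 2) (hTS.restrict T S S) := by
    refine ⟨by rw [← NNReal.coe_lt_coe]; norm_num, LipschitzWith.of_dist_le_mul ?_⟩
    rintro ⟨v, hv⟩ ⟨w, hw⟩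
    simp only [Subtype.dist_eq, MapsTo.val_restrict_apply]
    rw [dist_eq_norm, dist_eq_norm, ContinuousMap.norm_le _ (by positivity)]
    intro t
    rw [ContinuousMap.sub_apply, hT v hv, hT w hw]
    have e1 : e - m v + I1 v t - (e - m w + I1 w t) = (I1 v t - I1 w t) - (m v - m w) := by abel
    rw [e1]
    refine (norm_sub_le _ _).trans ((add_le_add (hI1diff v hv w hw t t.2) (hmd v hv w hw)).trans ?_)
    have : 0 ≤ ‖v - w‖ := norm_nonneg _
    norm_num
    nlinarith
  obtain ⟨v, hvS, hfix, -⟩ := hcontr.exists_fixedPoint' (x := 0)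
    (Metric.isClosed_closedBall.isComplete) hTS (by simp [S]) (edist_ne_top _ _)
  have hv : ∀ t : Icc (0 : ℝ) 1, v t = e - m v + I1 v t := fun t => by
    conv_lhs => rw [← hfix.eq]
    exact hT v hvS t
  have hextv : ∀ t ∈ Icc (0 : ℝ) 1, ext v t = e - m v + I1 v t := fun t ht => by
    simp only [ext, IccExtend_of_mem h01 _ ht]
    exact hv ⟨t, ht⟩
  have hc1 : pos v 1 = p + e := by
    have : ∫ s in (0 : ℝ)..1, ext v s = ∫ s in (0 : ℝ)..1, (e - m v + I1 v s) :=
      integral_congr fun s hs => hextv s (by rwa [uIcc_of_le h01] at hs)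
    simp only [pos]
    rw [this, integral_add intervalIntegrable_const ((hI1c v hvS).intervalIntegrable _ _)]
    simp [m]
  refine ⟨pos v, ext v, by simp [pos], hc1, fun t ht => ⟨(hposd v t).hasDerivWithinAt, ?_,
    (hextn v t).trans (hS v hvS), (hposn v t ht).trans (hS v hvS)⟩⟩
  have h1 : HasDerivWithinAt (fun t => e - m v + I1 v t) (acc v t) (Icc 0 1) t :=
    ((hI1d v hvS t).const_add (e - m v)).hasDerivWithinAt
  have h2 : acc v t = -Γ (pos v t) (ext v t) (ext v t) := by
    simp only [acc, projIcc_of_mem h01 ht]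
  rw [← h2]
  exact h1.congr hextv (hextv t ht)

/-- Along a geodesic the speed is constant. -/
theorem geodesic_speed_const {g : E → E →L[ℝ] E →L[ℝ] ℝ} {Γ : E → E →L[ℝ] E →L[ℝ] E}
    {c v : ℝ → E} (hsymm : ∀ q u w, g q u w = g q w u)
    (hg : ∀ t ∈ Icc (0 : ℝ) 1, DifferentiableAt ℝ g (c t))
    (hΓ : ∀ t ∈ Icc (0 : ℝ) 1, ∀ u w, g (c t) (Γ (c t) u u) w = christoffelForm g (c t) u u w)
    (hc : ∀ t ∈ Icc (0 : ℝ) 1, HasDerivWithinAt c (v t) (Icc 0 1) t)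
    (hv : ∀ t ∈ Icc (0 : ℝ) 1, HasDerivWithinAt v (-Γ (c t) (v t) (v t)) (Icc 0 1) t) :
    ∀ t ∈ Icc (0 : ℝ) 1, g (c t) (v t) (v t) = g (c 0) (v 0) (v 0) := by
  have hd : ∀ t ∈ Icc (0 : ℝ) 1,
      HasDerivWithinAt (fun t => g (c t) (v t) (v t)) 0 (Icc 0 1) t := by
    intro t ht
    have h := (((hg t ht).hasFDerivAt.comp_hasDerivWithinAt t (hc t ht)).clm_apply
      (hv t ht)).clm_apply (hv t ht)
    convert! h using 1
    simp only [add_apply, map_neg, neg_apply, Function.comp_apply]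
    rw [hsymm _ (v t) (Γ (c t) (v t) (v t)), hΓ t ht, christoffelForm_apply]
    ring
  have := constant_of_has_deriv_right_zero (a := 0) (b := 1)
    (fun t ht => (hd t ht).continuousWithinAt) fun t ht =>
      (hd t (Ico_subset_Icc_self ht)).mono_of_mem_nhdsWithin (Icc_mem_nhdsGE_of_mem ht)
  exact this

set_option maxHeartbeats 1600000 in
open intervalIntegral in
/-- Short geodesics minimize length. The curve `b` is compared with the geodesic `c` after the
geodesic has been reparametrized by `S`, proportionally (up to `κ`) to the length of `b`. The
linear term of the difference of the energies is a total derivative, because `c` is a geodesic,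
and the quadratic term is nonnegative, because `c` is short. -/
theorem geodesic_speed_le_length {g : E → E →L[ℝ] E →L[ℝ] ℝ} {Γ : E → E →L[ℝ] E →L[ℝ] E}
    {p : E} {R K V : ℝ} (hK : 1 ≤ K) (hV : 0 ≤ V) (hVK : 6 * K ^ 4 * V ^ 2 ≤ 1)
    (hsymm : ∀ q u w, g q u w = g q w u)
    (hg : ∀ q ∈ Metric.ball p R, DifferentiableAt ℝ g q)
    (hgK : ∀ q ∈ Metric.ball p R, ‖fderiv ℝ g q‖ ≤ K)
    (hgL : ∀ q ∈ Metric.ball p R, ∀ q' ∈ Metric.ball p R,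
      ‖fderiv ℝ g q - fderiv ℝ g q'‖ ≤ K * ‖q - q'‖)
    (hpos : ∀ q ∈ Metric.ball p R, ∀ w, K⁻¹ * ‖w‖ ^ 2 ≤ g q w w)
    {c v : ℝ → E}
    (hΓ : ∀ t ∈ Icc (0 : ℝ) 1, ∀ u w, g (c t) (Γ (c t) u u) w = christoffelForm g (c t) u u w)
    (hc : ∀ t ∈ Icc (0 : ℝ) 1, HasDerivWithinAt c (v t) (Icc 0 1) t)
    (hv : ∀ t ∈ Icc (0 : ℝ) 1, HasDerivWithinAt v (-Γ (c t) (v t) (v t)) (Icc 0 1) t)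
    (hcR : ∀ t ∈ Icc (0 : ℝ) 1, c t ∈ Metric.ball p R)
    (hvV : ∀ t ∈ Icc (0 : ℝ) 1, ‖v t‖ ≤ V)
    {b b' : ℝ → E} (hb : ∀ t ∈ Icc (0 : ℝ) 1, HasDerivWithinAt b (b' t) (Icc 0 1) t)
    (hb' : ContinuousOn b' (Icc 0 1)) (hbR : ∀ t ∈ Icc (0 : ℝ) 1, b t ∈ Metric.ball p R)
    (hb0 : b 0 = c 0) (hb1 : b 1 = c 1) :
    √(g (c 0) (v 0) (v 0)) ≤ ∫ t in (0 : ℝ)..1, √(g (b t) (b' t) (b' t)) := by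
  have h01 : (0 : ℝ) ≤ 1 := zero_le_one
  set l := g (c 0) (v 0) (v 0) with hl
  have hspeed : ∀ t ∈ Icc (0 : ℝ) 1, g (c t) (v t) (v t) = l :=
    geodesic_speed_const hsymm (fun t ht => hg _ (hcR t ht)) hΓ hc hv
  have hgpos : ∀ q ∈ Metric.ball p R, ∀ w, 0 ≤ g q w w := fun q hq w =>
    le_trans (by positivity) (hpos q hq w)
  have hgLip : ∀ q ∈ Metric.ball p R, ∀ q' ∈ Metric.ball p R, ‖g q - g q'‖ ≤ K * ‖q - q'‖ :=
    fun q hq q' hq' => (convex_ball p R).norm_image_sub_le_of_norm_fderiv_le hg hgK hq' hq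
  have hgTay : ∀ q ∈ Metric.ball p R, ∀ q' ∈ Metric.ball p R,
      ‖g q - g q' - fderiv ℝ g q' (q - q')‖ ≤ K * ‖q - q'‖ * ‖q - q'‖ := by
    intro q hq q' hq'
    have hseg : segment ℝ q' q ⊆ Metric.ball p R := (convex_ball p R).segment_subset hq' hq
    refine (convex_segment q' q).norm_image_sub_le_of_norm_hasFDerivWithin_le'
      (fun x hx => (hg x (hseg hx)).hasFDerivAt.hasFDerivWithinAt) (fun x hx => ?_)
      (left_mem_segment ℝ q' q) (right_mem_segment ℝ q' q)
    refine (hgL x (hseg hx) q' hq').trans ?_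
    gcongr
    rw [← dist_eq_norm, ← dist_eq_norm, dist_comm x, dist_comm q]
    have := (mem_segment_iff_wbtw.1 hx).dist_add_dist
    linarith [dist_nonneg (x := x) (y := q)]
  have hbc : ContinuousOn b (Icc 0 1) := fun t ht => (hb t ht).continuousWithinAt
  have hφc : ContinuousOn (fun t => √(g (b t) (b' t) (b' t))) (Icc 0 1) := by
    have h1 : ContinuousOn (fun t => g (b t)) (Icc 0 1) := fun t ht =>
      (hg _ (hbR t ht)).continuousAt.comp_continuousWithinAt (hbc t ht)
    exact ((h1.clm_apply hb').clm_apply hb').sqrt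
  set φ : ℝ → ℝ := fun t => √(g (b t) (b' t) (b' t)) with hφ
  have hφsq : ∀ t ∈ Icc (0 : ℝ) 1, φ t ^ 2 = g (b t) (b' t) (b' t) := fun t ht =>
    Real.sq_sqrt (hgpos _ (hbR t ht) _)
  have hφ0 : ∀ t, 0 ≤ φ t := fun t => Real.sqrt_nonneg _
  set φe : ℝ → ℝ := IccExtend h01 ((Icc 0 1).domRestrict φ) with hφe
  have hφec : Continuous φe := hφc.domRestrict.Icc_extend'
  have hφeq : ∀ t ∈ Icc (0 : ℝ) 1, φe t = φ t := fun t ht => IccExtend_of_mem h01 _ ht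
  have hφe0 : ∀ t, 0 ≤ φe t := fun t => hφ0 _
  set L := ∫ t in (0 : ℝ)..1, φ t with hL
  have hLe : ∫ t in (0 : ℝ)..1, φe t = L :=
    integral_congr fun s hs => hφeq s (by rwa [uIcc_of_le h01] at hs)
  have hL0 : 0 ≤ L := integral_nonneg h01 fun t _ => hφ0 t
  -- the positive `κ` keeps the reparametrization strictly increasing where `b` is at rest
  suffices H : ∀ κ > 0, l ≤ L * (L + κ) by
    have h1 : l ≤ L * L := by
      refine le_of_forall_pos_le_add fun ι hι => ?_
      have := H (ι / (L + 1)) (by positivity)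
      have h2 : L * (ι / (L + 1)) ≤ ι := by
        rw [mul_div_assoc', div_le_iff₀ (by positivity)]
        nlinarith
      nlinarith
    exact Real.sqrt_le_iff.2 ⟨hL0, by nlinarith⟩
  intro κ hκ
  have hLκ : 0 < L + κ := by linarith
  set σ : ℝ → ℝ := fun s => (φe s + κ) / (L + κ) with hσ
  have hσc : Continuous σ := (hφec.add continuous_const).div_const _
  have hσ0 : ∀ s, 0 < σ s := fun s => div_pos (by linarith [hφe0 s]) hLκ
  set S : ℝ → ℝ := fun s => ∫ x in (0 : ℝ)..s, σ x with hS
  have hSd : ∀ s, HasDerivAt S (σ s) s := fun s => (hσc.integral_hasStrictDerivAt 0 s).hasDerivAt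
  have hS0 : S 0 = 0 := integral_same
  have hS1 : S 1 = 1 := by
    simp only [hS, hσ, integral_div]
    rw [integral_add (hφec.intervalIntegrable _ _) intervalIntegrable_const, hLe]
    simp [hLκ.ne']
  have hSmono : Monotone S := monotone_of_deriv_nonneg (fun s => (hSd s).differentiableAt)
    fun s => by rw [(hSd s).deriv]; exact (hσ0 s).le
  have hSI : MapsTo S (Icc 0 1) (Icc 0 1) := fun s hs =>
    ⟨by rw [← hS0]; exact hSmono hs.1, by rw [← hS1]; exact hSmono hs.2⟩
  -- the reparametrized geodesic and the difference of the two curves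
  have hCd : ∀ s ∈ Icc (0 : ℝ) 1,
      HasDerivWithinAt (fun s => c (S s)) (σ s • v (S s)) (Icc 0 1) s := fun s hs =>
    (hc _ (hSI hs)).scomp s (hSd s).hasDerivWithinAt hSI
  have hWd : ∀ s ∈ Icc (0 : ℝ) 1,
      HasDerivWithinAt (fun s => v (S s)) (σ s • -Γ (c (S s)) (v (S s)) (v (S s))) (Icc 0 1) s :=
    fun s hs => (hv _ (hSI hs)).scomp s (hSd s).hasDerivWithinAt hSI
  set h : ℝ → E := fun s => b s - c (S s) with hh
  set h' : ℝ → E := fun s => b' s - σ s • v (S s) with hh'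
  have hhd : ∀ s ∈ Icc (0 : ℝ) 1, HasDerivWithinAt h (h' s) (Icc 0 1) s := fun s hs =>
    (hb s hs).sub (hCd s hs)
  have hh0 : h 0 = 0 := by simp [hh, hS0, hb0]
  have hh1 : h 1 = 0 := by simp [hh, hS1, hb1]
  have hh'c : ContinuousOn h' (Icc 0 1) :=
    hb'.sub (hσc.continuousOn.smul fun s hs => (hWd s hs).continuousWithinAt)
  set he : ℝ → E := IccExtend h01 ((Icc 0 1).domRestrict h') with hhe
  have hhec : Continuous he := hh'c.domRestrict.Icc_extend'
  have hheq : ∀ t ∈ Icc (0 : ℝ) 1, he t = h' t := fun t ht => IccExtend_of_mem h01 _ ht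
  set ρ : ℝ → ℝ := fun s => ‖he s‖ ^ 2 / σ s with hρ
  have hρc : Continuous ρ := (hhec.norm.pow 2).div hσc fun s => (hσ0 s).ne'
  have hρ0 : ∀ s, 0 ≤ ρ s := fun s => div_nonneg (by positivity) (hσ0 s).le
  set q : ℝ → ℝ := fun s => ∫ x in (0 : ℝ)..s, ρ x with hq
  have hqd : ∀ s, HasDerivAt q (ρ s) s := fun s => (hρc.integral_hasStrictDerivAt 0 s).hasDerivAt
  have hq0 : q 0 = 0 := integral_same
  have hqmono : Monotone q := monotone_of_deriv_nonneg (fun s => (hqd s).differentiableAt)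
    fun s => by rw [(hqd s).deriv]; exact hρ0 s
  set Q := q 1 with hQ
  have hQ0 : 0 ≤ Q := by rw [hQ, ← hq0]; exact hqmono h01
  -- the Poincaré inequality for `h`
  have hpoinc : ∀ s ∈ Icc (0 : ℝ) 1, ‖h s‖ ^ 2 ≤ Q := by
    intro s hs
    refine le_of_forall_pos_le_add fun ι hι => ?_
    set y := √(Q + ι) with hy
    have hy0 : 0 < y := Real.sqrt_pos.2 (by linarith)
    have hy2 : y ^ 2 = Q + ι := Real.sq_sqrt (by linarith)
    have key := image_norm_le_of_norm_deriv_right_le_deriv_boundary (a := 0) (b := 1) (f := h)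
      (f' := h') (B := fun s => (q s / y + y * S s) / 2)
      (B' := fun s => (ρ s / y + y * σ s) / 2)
      (fun t ht => (hhd t ht).continuousWithinAt)
      (fun t ht => (hhd t (Ico_subset_Icc_self ht)).mono_of_mem_nhdsWithin
        (Icc_mem_nhdsGE_of_mem ht)) (by simp [hh0, hq0, hS0])
      (fun t => (((hqd t).div_const y).add ((hSd t).const_mul y)).div_const 2)
      (fun t ht => by
        have ht' := Ico_subset_Icc_self ht
        have h1 : ρ t = ‖h' t‖ ^ 2 / σ t := by simp only [hρ, hheq t ht']
        rw [h1, le_div_iff₀ two_pos, div_div, div_add' _ _ _ (by positivity [hσ0 t]),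
          le_div_iff₀ (mul_pos (hσ0 t) hy0)]
        nlinarith [sq_nonneg (‖h' t‖ - y * σ t)]) hs
    have h2 : q s ≤ Q := hqmono hs.2
    have h3 : S s ≤ 1 := (hSI hs).2
    have h4 : ‖h s‖ ≤ y := by
      refine key.trans ?_
      have : q s / y ≤ y := by rw [div_le_iff₀ hy0]; nlinarith
      nlinarith
    nlinarith [norm_nonneg (h s)]
  -- the first variation is a total derivative
  set P : ℝ → ℝ := fun s => g (c (S s)) (v (S s)) (h s) with hP
  have hPd : ∀ s ∈ Icc (0 : ℝ) 1, HasDerivWithinAt P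
      (σ s * (fderiv ℝ g (c (S s)) (h s) (v (S s)) (v (S s)) / 2) +
        g (c (S s)) (v (S s)) (h' s)) (Icc 0 1) s := by
    intro s hs
    have h1 := (((hg _ (hcR _ (hSI hs))).hasFDerivAt.comp_hasDerivWithinAt s (hCd s hs)).clm_apply
      (hWd s hs)).clm_apply (hhd s hs)
    convert! h1 using 1
    simp only [add_apply, map_neg, neg_apply, map_smul, smul_apply, smul_eq_mul, smul_neg,
      Function.comp_apply]
    rw [hΓ _ (hSI hs), christoffelForm_apply]
    ring
  -- the value of `G` is `0` at `0`, and its monotonicity gives the claim at `1`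
  set G : ℝ → ℝ := fun s => (L + κ) * (∫ x in (0 : ℝ)..s, φe x) - l * S s - 2 * P s -
    q s / (2 * K) + 3 * K ^ 3 * V ^ 2 * Q * S s with hG
  have hGd : ∀ s ∈ Icc (0 : ℝ) 1, HasDerivWithinAt G ((L + κ) * φe s - l * σ s -
      2 * (σ s * (fderiv ℝ g (c (S s)) (h s) (v (S s)) (v (S s)) / 2) +
        g (c (S s)) (v (S s)) (h' s)) - ρ s / (2 * K) + 3 * K ^ 3 * V ^ 2 * Q * σ s)
      (Icc 0 1) s := fun s hs =>
    (((((hφec.integral_hasStrictDerivAt 0 s).hasDerivAt.hasDerivWithinAt.const_mul _).sub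
      ((hSd s).hasDerivWithinAt.const_mul _)).sub ((hPd s hs).const_mul _)).sub
      ((hqd s).hasDerivWithinAt.div_const _)).add ((hSd s).hasDerivWithinAt.const_mul _)
  have hGmono : MonotoneOn G (Icc 0 1) := by
    refine monotoneOn_of_hasDerivWithinAt_nonneg (convex_Icc 0 1)
      (fun s hs => (hGd s hs).continuousWithinAt)
      (fun s hs => (hGd s (interior_subset hs)).mono interior_subset) fun s hs => ?_
    replace hs := interior_subset hs
    have hsC := hcR _ (hSI hs)
    have hsb := hbR s hs
    set C := c (S s) with hC
    set W := v (S s) with hW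
    have hWV : ‖W‖ ≤ V := hvV _ (hSI hs)
    have hσs := hσ0 s
    have e1 : b' s = σ s • W + h' s := by simp [hh', hW]
    have e2 : b s - C = h s := rfl
    have e3 : φe s ^ 2 = g (b s) (b' s) (b' s) := by rw [hφeq s hs, hφsq s hs]
    have e4 : g C W W = l := hspeed _ (hSI hs)
    have e5 : ρ s = ‖h' s‖ ^ 2 / σ s := by simp only [hρ, hheq s hs]
    have e6 : φe s ^ 2 / σ s ≤ (L + κ) * φe s := by
      rw [div_le_iff₀ hσs]
      have : (L + κ) * σ s = φe s + κ := by simp only [hσ]; field_simp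
      nlinarith [hφe0 s]
    have b1 : ‖(g (b s) - g C) W (h' s)‖ ≤ K * ‖h s‖ * V * ‖h' s‖ := by
      refine (ContinuousLinearMap.le_opNorm₂ _ _ _).trans ?_
      gcongr
      exact hgLip _ hsb _ hsC
    have b2 : ‖(g (b s) - g C - fderiv ℝ g C (h s)) W W‖ ≤ K * ‖h s‖ * ‖h s‖ * V * V := by
      refine (ContinuousLinearMap.le_opNorm₂ _ _ _).trans ?_
      gcongr
      exact hgTay _ hsb _ hsC
    have b3 := hpos _ hsb (h' s)
    have e7 : φe s ^ 2 / σ s = g (b s) (h' s) (h' s) / σ s + 2 * g (b s) W (h' s) +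
        σ s * g (b s) W W := by
      rw [e3, e1]
      simp only [map_add, map_smul, add_apply, smul_apply, smul_eq_mul]
      rw [hsymm (b s) (h' s) W]
      field_simp
      ring
    simp only [sub_apply, Real.norm_eq_abs] at b1 b2
    have hp := hpoinc s hs
    set a := ‖h' s‖
    set x := ‖h s‖
    have ha : 0 ≤ a := norm_nonneg _
    have hx : 0 ≤ x := norm_nonneg _
    have b4 : K⁻¹ * (a ^ 2 / σ s) ≤ g (b s) (h' s) (h' s) / σ s := by
      rw [← mul_div_assoc]
      gcongr
    have hK0 : 0 < K := by linarith
    -- Young's inequality for the cross term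
    have b5 : 2 * (K * x * V * a) ≤ a ^ 2 / σ s / (2 * K) + 2 * K ^ 3 * V ^ 2 * x ^ 2 * σ s := by
      rw [div_div, div_add' _ _ _ (by positivity), le_div_iff₀ (by positivity)]
      nlinarith [sq_nonneg (a - 2 * K ^ 2 * V * x * σ s)]
    have b6 : K * x * x * V * V ≤ K ^ 3 * V ^ 2 * x ^ 2 := by
      have : K ≤ K ^ 3 := le_self_pow₀ hK (by norm_num)
      have h2 : 0 ≤ V ^ 2 * x ^ 2 := by positivity
      nlinarith
    have b7 : 3 * K ^ 3 * V ^ 2 * x ^ 2 * σ s ≤ 3 * K ^ 3 * V ^ 2 * Q * σ s := by gcongr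
    have b8 : K⁻¹ * (a ^ 2 / σ s) = a ^ 2 / σ s / (2 * K) + a ^ 2 / σ s / (2 * K) := by
      field_simp
      ring
    have b9 := neg_le_of_abs_le b1
    have b10 := neg_le_of_abs_le b2
    have b11 : -(K ^ 3 * V ^ 2 * x ^ 2) * σ s ≤
        (g (b s) W W - g C W W - fderiv ℝ g C (h s) W W) * σ s := by
      gcongr
      linarith
    rw [e5, ← e4]
    nlinarith
  have hfin := hGmono ⟨le_rfl, h01⟩ ⟨h01, le_rfl⟩ h01
  have hK0 : 0 < K := by linarith
  simp only [hG, hS0, hS1, hP, hh0, hh1, hq0, integral_same, hLe, map_zero] at hfin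
  have hQ' : 3 * K ^ 3 * V ^ 2 * Q ≤ Q / (2 * K) := by
    rw [le_div_iff₀ (by positivity)]
    nlinarith
  simp only [mul_zero, zero_div, sub_zero, add_zero, mul_one] at hfin
  linarith

end Geodesic

section LinearODE

variable {E : Type*} [NormedAddCommGroup E] [NormedSpace ℝ E]

/-- A linear equation with small coefficients has solutions on `[0, 1]`, which vary little. -/
theorem exists_linearODE [CompleteSpace E] {A : ℝ → E →L[ℝ] E} {κ : ℝ}
    (hA : ContinuousOn A (Icc 0 1)) (hκ : ∀ t ∈ Icc (0 : ℝ) 1, ‖A t‖ ≤ κ) (hκ2 : κ ≤ 1 / 2)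
    (y : E) :
    ∃ Y : ℝ → E, Y 0 = y ∧ ∀ t ∈ Icc (0 : ℝ) 1,
      HasDerivWithinAt Y (-A t (Y t)) (Icc 0 1) t ∧ ‖Y t - y‖ ≤ 2 * κ * ‖y‖ := by
  have hκ0 : 0 ≤ κ := (norm_nonneg _).trans (hκ 0 ⟨le_rfl, zero_le_one⟩)
  let κ' : NNReal := ⟨κ, hκ0⟩
  -- Picard iteration takes place in the ball of radius `‖y‖` about `y`
  have hball : ∀ x ∈ Metric.closedBall y ‖y‖₊, ‖x‖ ≤ 2 * ‖y‖ := by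
    intro x hx
    have h1 : ‖x - y‖ ≤ ‖y‖ := by simpa [dist_eq_norm] using hx
    have h2 := norm_add_le (x - y) y
    rw [sub_add_cancel] at h2
    linarith
  have hPL : IsPicardLindelof (fun t x => -A t x) (tmin := 0) (tmax := 1)
      ⟨0, le_rfl, zero_le_one⟩ y ‖y‖₊ 0 (κ' * (2 * ‖y‖₊)) κ' := by
    refine ⟨fun t ht => ?_, fun x _ => (hA.clm_apply continuousOn_const).neg, fun t ht x hx => ?_,
      ?_⟩
    · refine LipschitzOnWith.of_dist_le_mul fun x _ z _ => ?_
      rw [dist_eq_norm, dist_eq_norm, neg_sub_neg, ← map_sub, ← neg_sub, map_neg, norm_neg]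
      exact ((A t).le_opNorm _).trans (by gcongr; exact hκ t ht)
    · rw [norm_neg]
      exact ((A t).le_opNorm _).trans (mul_le_mul (hκ t ht) (hball x hx) (norm_nonneg _) hκ0)
    · have : κ * (2 * ‖y‖) ≤ ‖y‖ := by nlinarith [norm_nonneg y]
      change κ * (2 * ‖y‖) * max ((1 : ℝ) - 0) (0 - 0) ≤ ‖y‖ - 0
      simpa using this
  obtain ⟨Y, hY0, hY⟩ := hPL.exists_eq_forall_mem_Icc_hasDerivWithinAt₀
  replace hY0 : Y 0 = y := hY0
  have hYc : ContinuousOn Y (Icc 0 1) := fun t ht => (hY t ht).continuousWithinAt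
  obtain ⟨s, hs, hsmax⟩ := isCompact_Icc.exists_isMaxOn ⟨(0 : ℝ), le_rfl, zero_le_one⟩ hYc.norm
  have hgrow : ∀ t ∈ Icc (0 : ℝ) 1, ‖Y t - y‖ ≤ κ * ‖Y s‖ := by
    intro t ht
    have h := norm_image_sub_le_of_norm_deriv_le_segment' (C := κ * ‖Y s‖) hY (fun x hx => by
      rw [norm_neg]
      exact ((A x).le_opNorm _).trans (mul_le_mul (hκ x (Ico_subset_Icc_self hx))
        (hsmax (Ico_subset_Icc_self hx)) (norm_nonneg _) hκ0)) t ht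
    rw [hY0, sub_zero] at h
    have : 0 ≤ κ * ‖Y s‖ := by positivity
    nlinarith [ht.2]
  have hs2 : ‖Y s‖ ≤ 2 * ‖y‖ := by
    have h1 := hgrow s hs
    have h2 := norm_add_le (Y s - y) y
    rw [sub_add_cancel] at h2
    nlinarith [norm_nonneg (Y s)]
  exact ⟨Y, hY0, fun t ht => ⟨hY t ht, (hgrow t ht).trans (by nlinarith)⟩⟩

end LinearODE

/-! ### Uniform bounds in charts -/

section Bounds

/-- Near a compact set, a `C²` function and its derivative are bounded and the derivative is
Lipschitz. A single large number serves as the bound, as the Lipschitz constant and as the inverse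
of the radius. -/
theorem eventually_bounds {E F : Type*} [NormedAddCommGroup E] [NormedSpace ℝ E]
    [FiniteDimensional ℝ E] [NormedAddCommGroup F] [NormedSpace ℝ F] {f : E → F} {O K : Set E}
    (hO : IsOpen O) (hK : IsCompact K) (hKO : K ⊆ O) (hf : ContDiffOn ℝ 2 f O) :
    ∀ᶠ B : ℝ in atTop, ∀ y ∈ K, Metric.ball y B⁻¹ ⊆ O ∧
      (∀ p ∈ Metric.ball y B⁻¹, ‖f p‖ ≤ B ∧ ‖fderiv ℝ f p‖ ≤ B) ∧
      ∀ p ∈ Metric.ball y B⁻¹, ∀ p' ∈ Metric.ball y B⁻¹,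
        ‖fderiv ℝ f p - fderiv ℝ f p'‖ ≤ B * ‖p - p'‖ := by
  obtain ⟨δ, hδ, hsub⟩ := hK.exists_cthickening_subset_open hO hKO
  have hcomp : IsCompact (Metric.cthickening δ K) := hK.cthickening
  have hf1 : ContDiffOn ℝ 1 (fderiv ℝ f) O := hf.fderiv_of_isOpen hO (by norm_num)
  have hf2 : ContDiffOn ℝ 0 (fderiv ℝ (fderiv ℝ f)) O := hf1.fderiv_of_isOpen hO (by norm_num)
  obtain ⟨C0, hC0⟩ := hcomp.exists_bound_of_continuousOn (hf.continuousOn.mono hsub)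
  obtain ⟨C1, hC1⟩ := hcomp.exists_bound_of_continuousOn (hf1.continuousOn.mono hsub)
  obtain ⟨C2, hC2⟩ := hcomp.exists_bound_of_continuousOn (hf2.continuousOn.mono hsub)
  filter_upwards [eventually_ge_atTop C0, eventually_ge_atTop C1, eventually_ge_atTop C2,
    eventually_ge_atTop δ⁻¹, eventually_gt_atTop 0] with B h0 h1 h2 hB hBpos y hy
  have hball : Metric.ball y B⁻¹ ⊆ Metric.cthickening δ K := by
    refine (Metric.ball_subset_ball (inv_le_of_inv_le₀ hδ hB)).trans ?_
    exact (Metric.ball_subset_thickening hy δ).trans (Metric.thickening_subset_cthickening δ K)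
  refine ⟨hball.trans hsub, fun p hp => ⟨(hC0 p (hball hp)).trans h0, (hC1 p (hball hp)).trans h1⟩,
    fun p hp p' hp' => ?_⟩
  refine (convex_ball y B⁻¹).norm_image_sub_le_of_norm_fderiv_le (fun x hx => ?_)
    (fun x hx => (hC2 x (hball hx)).trans h2) hp' hp
  exact (hf1.differentiableOn one_ne_zero).differentiableAt (hO.mem_nhds (hsub (hball hx)))

/-- Near a compact set, a continuous field of positive definite forms is uniformly comparable to the
norm. -/
theorem eventually_form_bounds {E : Type*} [NormedAddCommGroup E] [NormedSpace ℝ E]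
    [FiniteDimensional ℝ E] {g : E → E →L[ℝ] E →L[ℝ] ℝ} {O K : Set E}
    (hO : IsOpen O) (hK : IsCompact K) (hKO : K ⊆ O) (hg : ContinuousOn g O)
    (hpos : ∀ p ∈ O, ∀ v, v ≠ 0 → 0 < g p v v) :
    ∀ᶠ B : ℝ in atTop, ∀ y ∈ K, ∀ p ∈ Metric.ball y B⁻¹, ∀ v,
      B⁻¹ * ‖v‖ ^ 2 ≤ g p v v ∧ g p v v ≤ B * ‖v‖ ^ 2 := by
  obtain ⟨δ, hδ, hsub⟩ := hK.exists_cthickening_subset_open hO hKO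
  have hcomp : IsCompact (Metric.cthickening δ K) := hK.cthickening
  obtain ⟨C0, hC0⟩ := hcomp.exists_bound_of_continuousOn (hg.mono hsub)
  have hcomp2 : IsCompact (Metric.cthickening δ K ×ˢ Metric.sphere (0 : E) 1) :=
    hcomp.prod (isCompact_sphere 0 1)
  have hc2 : ContinuousOn (fun x : E × E => (g x.1 x.2 x.2)⁻¹)
      (Metric.cthickening δ K ×ˢ Metric.sphere (0 : E) 1) := by
    refine ContinuousOn.inv₀ ?_ fun x hx => (hpos _ (hsub hx.1) _ ?_).ne'
    · exact (((hg.mono hsub).comp continuousOn_fst fun x hx => hx.1).clm_apply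
        continuousOn_snd).clm_apply continuousOn_snd
    · exact ne_zero_of_mem_unit_sphere (⟨x.2, hx.2⟩ : Metric.sphere (0 : E) 1)
  obtain ⟨C1, hC1⟩ := hcomp2.exists_bound_of_continuousOn hc2
  filter_upwards [eventually_ge_atTop C0, eventually_ge_atTop C1,
    eventually_ge_atTop δ⁻¹, eventually_gt_atTop 0] with B h0 h1 hB hBpos y hy p hp v
  have hball : Metric.ball y B⁻¹ ⊆ Metric.cthickening δ K := by
    refine (Metric.ball_subset_ball (inv_le_of_inv_le₀ hδ hB)).trans ?_
    exact (Metric.ball_subset_thickening hy δ).trans (Metric.thickening_subset_cthickening δ K)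
  constructor
  · rcases eq_or_ne v 0 with rfl | hv
    · simp
    have hv' : 0 < ‖v‖ := norm_pos_iff.2 hv
    have hu : ‖v‖⁻¹ • v ∈ Metric.sphere (0 : E) 1 := by
      simp [norm_smul, hv'.ne']
    have h2 := (hC1 (p, ‖v‖⁻¹ • v) ⟨hball hp, hu⟩).trans h1
    have h3 : 0 < g p (‖v‖⁻¹ • v) (‖v‖⁻¹ • v) :=
      hpos p (hsub (hball hp)) _ (smul_ne_zero (inv_ne_zero hv'.ne') hv)
    have h4 : g p v v = ‖v‖ ^ 2 * g p (‖v‖⁻¹ • v) (‖v‖⁻¹ • v) := by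
      simp only [map_smul, smul_apply, smul_eq_mul]
      field_simp
    rw [Real.norm_of_nonneg (inv_nonneg.2 h3.le)] at h2
    rw [h4, mul_comm]
    gcongr
    exact inv_le_of_inv_le₀ h3 h2
  · have h2 := (g p).le_opNorm₂ v v
    have h3 := (hC0 p (hball hp)).trans h0
    calc g p v v ≤ ‖g p v v‖ := le_abs_self _
      _ ≤ ‖g p‖ * ‖v‖ * ‖v‖ := h2
      _ ≤ B * ‖v‖ * ‖v‖ := by gcongr
      _ = _ := by ring

end Bounds

section ChartBounds

variable {M : Type*} [EMetricSpace M] [ChartedSpace Plane M] [IsManifold (𝓡 2) ∞ M]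
  [RiemannianBundle (fun x : M => TangentSpace (𝓡 2) x)]

/-- In the preferred chart at `z`, the metric and its Christoffel symbols are controlled by `B` on
the ball of radius `B⁻¹` about the coordinates of `y`. -/
structure GoodChart (B : ℝ) (z y : M) : Prop where
  one_le : 1 ≤ B
  mem_source : y ∈ (chartAt Plane z).source
  ball_subset : Metric.ball (extChartAt (𝓡 2) z y) B⁻¹ ⊆ (extChartAt (𝓡 2) z).target
  lower : ∀ p ∈ Metric.ball (extChartAt (𝓡 2) z y) B⁻¹, ∀ v, B⁻¹ * ‖v‖ ^ 2 ≤ gram z p v v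
  upper : ∀ p ∈ Metric.ball (extChartAt (𝓡 2) z y) B⁻¹, ∀ v, gram z p v v ≤ B * ‖v‖ ^ 2
  norm_fderiv : ∀ p ∈ Metric.ball (extChartAt (𝓡 2) z y) B⁻¹, ‖fderiv ℝ (gram z) p‖ ≤ B
  fderiv_lipschitz : ∀ p ∈ Metric.ball (extChartAt (𝓡 2) z y) B⁻¹,
    ∀ p' ∈ Metric.ball (extChartAt (𝓡 2) z y) B⁻¹,
      ‖fderiv ℝ (gram z) p - fderiv ℝ (gram z) p'‖ ≤ B * ‖p - p'‖
  norm_spray : ∀ p ∈ Metric.ball (extChartAt (𝓡 2) z y) B⁻¹, ‖spray (gram z) p‖ ≤ B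
  spray_lipschitz : ∀ p ∈ Metric.ball (extChartAt (𝓡 2) z y) B⁻¹,
    ∀ p' ∈ Metric.ball (extChartAt (𝓡 2) z y) B⁻¹,
      ‖spray (gram z) p - spray (gram z) p'‖ ≤ B * ‖p - p'‖

theorem isCompact_coord_core (𝒜 : FiniteAtlas M) {z : M} (hz : z ∈ 𝒜.centers) :
    IsCompact (extChartAt (𝓡 2) z '' 𝒜.core z) :=
  (𝒜.isCompact_core z hz).image_of_continuousOn
    ((continuousOn_extChartAt z).mono (by simpa using 𝒜.core_subset z hz))

theorem coord_core_subset (𝒜 : FiniteAtlas M) {z : M} (hz : z ∈ 𝒜.centers) :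
    extChartAt (𝓡 2) z '' 𝒜.core z ⊆ (extChartAt (𝓡 2) z).target := by
  rintro _ ⟨y, hy, rfl⟩
  exact coord_mem_target (𝒜.core_subset z hz hy)

variable [IsContMDiffRiemannianBundle (𝓡 2) ∞ Plane (fun x : M => TangentSpace (𝓡 2) x)]

/-- The cores of the atlas are compact, so one constant works at all their points. -/
theorem eventually_goodChart (𝒜 : FiniteAtlas M) :
    ∀ᶠ B : ℝ in atTop, ∀ z ∈ 𝒜.centers, ∀ y ∈ 𝒜.core z, GoodChart B z y := by
  rw [Finset.eventually_all]
  intro z hz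
  have hpos : ∀ p ∈ (extChartAt (𝓡 2) z).target, ∀ v, v ≠ 0 → 0 < gram z p v v :=
    fun p hp v hv => gram_pos hp hv
  have hle : (2 : ℕ∞ω) ≤ (∞ : ℕ∞ω) := ENat.LEInfty.out
  filter_upwards [eventually_ge_atTop 1,
    eventually_bounds (isOpen_target z) (isCompact_coord_core 𝒜 hz) (coord_core_subset 𝒜 hz)
      ((contDiffOn_gram z).of_le hle),
    eventually_bounds (isOpen_target z) (isCompact_coord_core 𝒜 hz) (coord_core_subset 𝒜 hz)
      ((contDiffOn_spray (isOpen_target z) (contDiffOn_gram z) hpos).of_le hle),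
    eventually_form_bounds (isOpen_target z) (isCompact_coord_core 𝒜 hz)
      (coord_core_subset 𝒜 hz) (contDiffOn_gram z).continuousOn hpos] with B h1 hg hs hf y hy
  have hy' := mem_image_of_mem (extChartAt (𝓡 2) z) hy
  refine ⟨h1, 𝒜.core_subset z hz hy, (hg _ hy').1, fun p hp v => (hf _ hy' p hp v).1,
    fun p hp v => (hf _ hy' p hp v).2,
    fun p hp => ((hg _ hy').2.1 p hp).2,
    (hg _ hy').2.2, fun p hp => ((hs _ hy').2.1 p hp).1, fun p hp p' hp' => ?_⟩
  refine (convex_ball _ B⁻¹).norm_image_sub_le_of_norm_fderiv_le (fun x hx => ?_)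
    (fun x hx => ((hs _ hy').2.1 x hx).2) hp' hp
  exact ((contDiffOn_spray (isOpen_target z) (contDiffOn_gram z) hpos).differentiableOn
    (by simp)).differentiableAt ((isOpen_target z).mem_nhds ((hg _ hy').1 hx))

end ChartBounds

/-! ### Distances in charts -/

section Continuity

/-- The continuity method on an interval. -/
theorem Icc_subset_of_continuity {T : ℝ} {S : Set ℝ} (hS : IsClosed (S ∩ Icc 0 T))
    (h0 : (0 : ℝ) ∈ S) (hstep : ∀ t ∈ Ico 0 T, Icc 0 t ⊆ S → S ∈ 𝓝[>] t) : Icc 0 T ⊆ S := by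
  rcases lt_or_ge T 0 with hT | hT
  · rw [Icc_eq_empty (not_le.2 hT)]
    exact empty_subset S
  let S' : Set ℝ := {t | Icc 0 t ⊆ S}
  have key : Icc 0 T ⊆ S' := by
    refine IsClosed.Icc_subset_of_forall_mem_nhdsWithin ?_ ?_ ?_
    · refine isClosed_of_closure_subset fun t ht => ?_
      have htI : t ∈ Icc 0 T := isClosed_Icc.closure_subset_iff.2 inter_subset_right ht
      have hlt : ∀ x, 0 ≤ x → x < t → x ∈ S := by
        intro x hx0 hxt
        obtain ⟨y, hy, hyS⟩ := mem_closure_iff_nhds.1 ht (Ioi x) (Ioi_mem_nhds hxt)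
        exact hyS.1 ⟨hx0, (mem_Ioi.1 hy).le⟩
      refine ⟨fun x hx => ?_, htI⟩
      rcases hx.2.lt_or_eq with h | rfl
      · exact hlt x hx.1 h
      rcases hx.1.lt_or_eq with h | rfl
      · refine (hS.closure_subset_iff.2 Subset.rfl (?_ : x ∈ closure (S ∩ Icc 0 T))).1
        rw [mem_closure_iff_nhds]
        intro U hU
        have h1 : ∀ᶠ y in 𝓝[<] x, y ∈ U ∧ 0 < y ∧ y < x := by
          filter_upwards [nhdsWithin_le_nhds hU, nhdsWithin_le_nhds (Ioi_mem_nhds h),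
            self_mem_nhdsWithin] with y h1 h2 h3 using ⟨h1, h2, h3⟩
        obtain ⟨y, hyU, hy0, hyx⟩ := h1.exists
        exact ⟨y, hyU, hlt y hy0.le hyx, hy0.le, hyx.le.trans htI.2⟩
      · exact h0
    · intro x hx
      rwa [le_antisymm hx.2 hx.1]
    · rintro t ⟨htS, ht⟩
      have h1 := hstep t ht htS
      obtain ⟨u, hu, hsub⟩ := mem_nhdsGT_iff_exists_Ioo_subset.1 h1
      filter_upwards [Ioo_mem_nhdsGT hu] with y hy x hx
      rcases le_or_gt x t with h | h
      · exact htS ⟨hx.1, h⟩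
      · exact hsub ⟨h, hx.2.trans_lt hy.2⟩
  exact fun t ht => key ht ⟨ht.1, le_rfl⟩

end Continuity

section Distance

variable {M : Type*} [EMetricSpace M] [ChartedSpace Plane M] [IsManifold (𝓡 2) ∞ M]
  [RiemannianBundle (fun x : M => TangentSpace (𝓡 2) x)]

theorem GoodChart.pos {B : ℝ} {z y : M} (h : GoodChart B z y) : 0 < B := zero_lt_one.trans_le h.one_le

theorem GoodChart.inv_pos {B : ℝ} {z y : M} (h : GoodChart B z y) : 0 < B⁻¹ := _root_.inv_pos.2 h.pos

theorem GoodChart.norm_ofChart_le {B : ℝ} {z y : M} (h : GoodChart B z y) {p : Plane}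
    (hp : p ∈ Metric.ball (extChartAt (𝓡 2) z y) B⁻¹) (v : Plane) :
    ‖ofChart z p v‖ ≤ B * ‖v‖ := by
  have h1 := h.upper p hp v
  rw [← norm_sq_ofChart] at h1
  have h2 := h.one_le
  refine abs_le_of_sq_le_sq' (a := ‖ofChart z p v‖) (h1.trans ?_) (by positivity [h.pos]) |>.2
  rw [mul_pow]
  gcongr
  exact le_self_pow₀ h2 two_ne_zero

theorem GoodChart.norm_le_ofChart {B : ℝ} {z y : M} (h : GoodChart B z y) {p : Plane}
    (hp : p ∈ Metric.ball (extChartAt (𝓡 2) z y) B⁻¹) (v : Plane) :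
    ‖v‖ ≤ B * ‖ofChart z p v‖ := by
  have h1 := h.lower p hp v
  rw [← norm_sq_ofChart, inv_mul_le_iff₀ h.pos] at h1
  have h2 := h.one_le
  refine abs_le_of_sq_le_sq' (a := ‖v‖) (h1.trans ?_) (by positivity [h.pos]) |>.2
  rw [mul_pow]
  gcongr
  exact le_self_pow₀ h2 two_ne_zero

theorem GoodChart.norm_le_toChart {B : ℝ} {z y : M} (h : GoodChart B z y) {y' : M}
    (hy : y' ∈ (chartAt Plane z).source)
    (hp : extChartAt (𝓡 2) z y' ∈ Metric.ball (extChartAt (𝓡 2) z y) B⁻¹)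
    (v : TangentSpace (𝓡 2) y') :
    ‖v‖ ≤ B * ‖toChart z y' v‖ := by
  obtain ⟨p, hpt, rfl⟩ := exists_coord hy
  rw [coord_symm hpt] at hp
  conv_lhs => rw [← ofChart_toChart hpt v]
  exact h.norm_ofChart_le hp _

theorem GoodChart.norm_toChart_le {B : ℝ} {z y : M} (h : GoodChart B z y) {y' : M}
    (hy : y' ∈ (chartAt Plane z).source)
    (hp : extChartAt (𝓡 2) z y' ∈ Metric.ball (extChartAt (𝓡 2) z y) B⁻¹)
    (v : TangentSpace (𝓡 2) y') :
    ‖toChart z y' v‖ ≤ B * ‖v‖ := by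
  obtain ⟨p, hpt, rfl⟩ := exists_coord hy
  rw [coord_symm hpt] at hp
  conv_rhs => rw [← ofChart_toChart hpt v]
  exact h.norm_le_ofChart hp _

theorem pathELength_le_of_speed_le {c : ℝ → M} {a b κ : ℝ} (hab : a ≤ b)
    (h : ∀ t ∈ Icc a b, ‖velocityWithin c (Icc a b) t‖ ≤ κ) :
    pathELength (𝓡 2) c a b ≤ ENNReal.ofReal (κ * (b - a)) := by
  have hκ : 0 ≤ κ := (norm_nonneg _).trans (h a ⟨le_rfl, hab⟩)
  rw [pathELength_eq_lintegral_mfderivWithin_Icc]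
  calc ∫⁻ t in Icc a b, ‖mfderivWithin 𝓘(ℝ, ℝ) (𝓡 2) c (Icc a b) t 1‖ₑ
      ≤ ∫⁻ t in Icc a b, ENNReal.ofReal κ := by
        refine MeasureTheory.setLIntegral_mono' measurableSet_Icc fun t ht => ?_
        rw [← ofReal_norm]
        exact ENNReal.ofReal_le_ofReal (h t ht)
    _ = ENNReal.ofReal (κ * (b - a)) := by
        rw [MeasureTheory.setLIntegral_const, Real.volume_Icc, ENNReal.ofReal_mul hκ]

theorem edist_le_of_speed_le [IsRiemannianManifold (𝓡 2) M] {c : ℝ → M} {a b κ : ℝ} (hab : a ≤ b)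
    (hc : ContMDiffOn 𝓘(ℝ, ℝ) (𝓡 2) 1 c (Icc a b))
    (h : ∀ t ∈ Icc a b, ‖velocityWithin c (Icc a b) t‖ ≤ κ) :
    edist (c a) (c b) ≤ ENNReal.ofReal (κ * (b - a)) := by
  rw [IsRiemannianManifold.out (I := 𝓡 2) (c a) (c b)]
  exact (riemannianEDist_le_pathELength hc rfl rfl hab).trans (pathELength_le_of_speed_le hab h)

theorem GoodChart.edist_symm_le [IsRiemannianManifold (𝓡 2) M] {B : ℝ} {z y : M}
    (h : GoodChart B z y) {p p' : Plane} (hp : p ∈ Metric.ball (extChartAt (𝓡 2) z y) B⁻¹)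
    (hp' : p' ∈ Metric.ball (extChartAt (𝓡 2) z y) B⁻¹) :
    edist ((extChartAt (𝓡 2) z).symm p) ((extChartAt (𝓡 2) z).symm p') ≤
      ENNReal.ofReal (B * ‖p' - p‖) := by
  let u : ℝ → Plane := fun t => p + t • (p' - p)
  have hu : ∀ t ∈ Icc (0 : ℝ) 1, u t ∈ Metric.ball (extChartAt (𝓡 2) z y) B⁻¹ := fun t ht =>
    (convex_ball _ _).add_smul_sub_mem hp hp' ht
  have hud : ∀ t, HasDerivAt u (p' - p) t := fun t => by
    exact (((hasDerivAt_id t).smul_const (p' - p)).const_add p).congr_deriv (one_smul _ _)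
  have huc : ContMDiffOn 𝓘(ℝ, ℝ) (𝓡 2) 1 (fun t => (extChartAt (𝓡 2) z).symm (u t)) (Icc 0 1) := by
    have h1 : ContMDiffOn 𝓘(ℝ, Plane) (𝓡 2) 1 (extChartAt (𝓡 2) z).symm
      (extChartAt (𝓡 2) z).target := contMDiffOn_extChartAt_symm z
    have h2 : ContMDiff 𝓘(ℝ, ℝ) 𝓘(ℝ, Plane) 1 u :=
      (contDiff_const.add (contDiff_id.smul contDiff_const)).contMDiff
    exact h1.comp h2.contMDiffOn fun t ht => h.ball_subset (hu t ht)
  have key := edist_le_of_speed_le (κ := B * ‖p' - p‖) zero_le_one huc fun t ht => by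
    rw [velocityWithin_symm_comp (hud t).hasDerivWithinAt
      (uniqueDiffOn_Icc zero_lt_one t ht) (h.ball_subset (hu t ht))]
    exact h.norm_ofChart_le (hu t ht) _
  simpa [u] using key

/-- Linear functionals of the coordinates, with norm at most `κ` for the Riemannian metric, vary
by at most `κ` times the length along paths. -/
theorem abs_functional_le_pathELength {z : M} {η : ℝ → M} {T κ : ℝ} (hT : 0 ≤ T)
    (hη : ContMDiffOn 𝓘(ℝ, ℝ) (𝓡 2) 1 η (Icc 0 T))
    (hs : ∀ t ∈ Icc 0 T, η t ∈ (chartAt Plane z).source) (l : Plane →L[ℝ] ℝ) (hκ : 0 ≤ κ)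
    (hl : ∀ t ∈ Icc 0 T, ∀ v : TangentSpace (𝓡 2) (η t), |l (toChart z (η t) v)| ≤ κ * ‖v‖) :
    ENNReal.ofReal |l (extChartAt (𝓡 2) z (η T)) - l (extChartAt (𝓡 2) z (η 0))| ≤
      ENNReal.ofReal κ * pathELength (𝓡 2) η 0 T := by
  rcases hT.eq_or_lt with rfl | hT
  · simp
  let F : ℝ → ℝ := fun t => l (extChartAt (𝓡 2) z (η t))
  have hFd : ∀ t ∈ Icc 0 T, HasDerivWithinAt F (l (toChart z (η t) (velocityWithin η (Icc 0 T) t)))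
      (Icc 0 T) t := fun t ht =>
    l.hasFDerivAt.comp_hasDerivWithinAt t (hasDerivWithinAt_coord
      ((hη t ht).mdifferentiableWithinAt one_ne_zero) (uniqueDiffOn_Icc hT t ht) (hs t ht))
  have hF : ContMDiffOn 𝓘(ℝ, ℝ) 𝓘(ℝ, ℝ) 1 F (Icc 0 T) := by
    have h1 : ContMDiffOn (𝓡 2) 𝓘(ℝ, Plane) 1 (extChartAt (𝓡 2) z) (chartAt Plane z).source :=
      contMDiffOn_extChartAt
    exact l.contDiff.contMDiff.comp_contMDiffOn (h1.comp hη hs)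
  have h1 := (riemannianEDist_le_pathELength hF rfl rfl hT.le)
  rw [← IsRiemannianManifold.out (I := 𝓘(ℝ, ℝ)) (F 0) (F T)] at h1
  rw [abs_sub_comm, ← Real.dist_eq, ← edist_dist]
  refine h1.trans ?_
  rw [pathELength_eq_lintegral_mfderivWithin_Icc, pathELength_eq_lintegral_mfderivWithin_Icc,
    ← MeasureTheory.lintegral_const_mul' _ _ ENNReal.ofReal_ne_top]
  refine MeasureTheory.setLIntegral_mono' measurableSet_Icc fun t ht => ?_
  have h2 : mfderivWithin 𝓘(ℝ, ℝ) 𝓘(ℝ, ℝ) F (Icc 0 T) t 1 =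
      l (toChart z (η t) (velocityWithin η (Icc 0 T) t)) := by
    rw [mfderivWithin_eq_fderivWithin]
    exact (hFd t ht).derivWithin (uniqueDiffOn_Icc hT t ht)
  have h3 : ‖mfderivWithin 𝓘(ℝ, ℝ) 𝓘(ℝ, ℝ) F (Icc 0 T) t 1‖ₑ =
      ENNReal.ofReal |l (toChart z (η t) (velocityWithin η (Icc 0 T) t))| := by
    rw [← Real.norm_eq_abs, ofReal_norm, ← h2]
    exact enorm_tangentSpace_vectorSpace
  rw [h3, ← ofReal_norm, ← ENNReal.ofReal_mul hκ]
  exact ENNReal.ofReal_le_ofReal (hl t ht _)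

/-- A short path starting at `y` stays in the chart. -/
theorem GoodChart.path_mem {B : ℝ} {z y : M} (h : GoodChart B z y) {η : ℝ → M} {T r : ℝ}
    (hη : ContMDiffOn 𝓘(ℝ, ℝ) (𝓡 2) 1 η (Icc 0 T)) (h0 : η 0 = y)
    (hlen : pathELength (𝓡 2) η 0 T < ENNReal.ofReal r) (hr : B * r < B⁻¹) :
    ∀ t ∈ Icc 0 T, η t ∈ (chartAt Plane z).source ∧
      ‖extChartAt (𝓡 2) z (η t) - extChartAt (𝓡 2) z y‖ < B * r := by
  have hB := h.pos
  have hr0 : 0 < r := by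
    by_contra hneg
    rw [ENNReal.ofReal_of_nonpos (not_lt.1 hneg)] at hlen
    exact not_lt_bot hlen
  set q := extChartAt (𝓡 2) z y with hq
  let C : Set M := (extChartAt (𝓡 2) z).symm '' Metric.closedBall q (B * r)
  have hCt : Metric.closedBall q (B * r) ⊆ (extChartAt (𝓡 2) z).target :=
    (Metric.closedBall_subset_ball hr).trans h.ball_subset
  have hC : IsClosed C := ((isCompact_closedBall q (B * r)).image_of_continuousOn
    ((continuousOn_extChartAt_symm z).mono hCt)).isClosed
  have hCmem : ∀ y' ∈ C, y' ∈ (chartAt Plane z).source ∧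
      ‖extChartAt (𝓡 2) z y' - q‖ ≤ B * r := by
    rintro _ ⟨p, hp, rfl⟩
    refine ⟨symm_mem_source (hCt hp), ?_⟩
    rw [coord_symm (hCt hp)]
    simpa [dist_eq_norm] using hp
  have hηc : ContinuousOn η (Icc 0 T) := hη.continuousOn
  -- as long as the path is in the chart, it does not reach the boundary of the ball
  have himp : ∀ t ∈ Icc 0 T, Icc 0 t ⊆ η ⁻¹' C →
      ‖extChartAt (𝓡 2) z (η t) - q‖ < B * r := by
    intro t ht hsub
    obtain ⟨l, hl1, hl2⟩ := exists_dual_vector'' ℝ (extChartAt (𝓡 2) z (η t) - q)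
    have key := abs_functional_le_pathELength (z := z) (κ := B) ht.1
      (hη.mono (Icc_subset_Icc_right ht.2)) (fun s hs => (hCmem _ (hsub hs)).1) l hB.le
      (fun s hs v => by
        refine (l.le_opNorm _).trans ?_
        have h2 := h.norm_toChart_le (hCmem _ (hsub hs)).1
          (mem_ball_iff_norm.2 ((hCmem _ (hsub hs)).2.trans_lt hr)) v
        calc ‖l‖ * ‖toChart z (η s) v‖ ≤ 1 * (B * ‖v‖) := by gcongr
          _ = B * ‖v‖ := one_mul _)
    rw [h0, ← map_sub] at key
    have hl3 : |l (extChartAt (𝓡 2) z (η t) - q)| = ‖extChartAt (𝓡 2) z (η t) - q‖ := by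
      rw [hl2]; simp
    rw [← hq, hl3] at key
    have h3 : pathELength (𝓡 2) η 0 t < ENNReal.ofReal r :=
      (pathELength_mono le_rfl ht.2).trans_lt hlen
    have h4 : ENNReal.ofReal B * pathELength (𝓡 2) η 0 t < ENNReal.ofReal (B * r) := by
      rw [ENNReal.ofReal_mul hB.le]
      exact (ENNReal.mul_lt_mul_iff_right (by simpa using hB) ENNReal.ofReal_ne_top).2 h3
    exact (ENNReal.ofReal_lt_ofReal_iff (by positivity)).1 (key.trans_lt h4)
  have hmain : Icc 0 T ⊆ η ⁻¹' C := by
    refine Icc_subset_of_continuity ?_ ?_ ?_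
    · rw [inter_comm]
      exact hηc.preimage_isClosed_of_isClosed isClosed_Icc hC
    · refine ⟨q, Metric.mem_closedBall_self (by positivity), ?_⟩
      rw [hq, symm_coord h.mem_source, h0]
    · intro t ht hsub
      have h1 := himp t ⟨ht.1, ht.2.le⟩ hsub
      have h2 := (hCmem _ (hsub ⟨ht.1, le_rfl⟩)).1
      have h3 : ContinuousWithinAt η (Ioi t) t :=
        (hηc t ⟨ht.1, ht.2.le⟩).mono_of_mem_nhdsWithin
          (mem_of_superset (Ioo_mem_nhdsGT ht.2) fun s hs => ⟨ht.1.trans hs.1.le, hs.2.le⟩)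
      have h4 : ∀ᶠ y' in 𝓝 (η t), y' ∈ (chartAt Plane z).source ∧
          ‖extChartAt (𝓡 2) z y' - q‖ < B * r := by
        have h6 : ∀ᶠ y' in 𝓝 (η t), y' ∈ (chartAt Plane z).source :=
          (chartAt Plane z).open_source.mem_nhds h2
        refine h6.and ?_
        have h5 : ContinuousAt (fun y' => ‖extChartAt (𝓡 2) z y' - q‖) (η t) :=
          ((continuousAt_extChartAt' (by simpa using h2)).sub continuousAt_const).norm
        exact h5.eventually_lt continuousAt_const h1
      filter_upwards [h3.eventually h4] with s hs
      exact ⟨_, by simpa [dist_eq_norm] using hs.2.le, symm_coord hs.1⟩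
  exact fun t ht => ⟨(hCmem _ (hmain ht)).1,
    himp t ht fun s hs => hmain ⟨hs.1, hs.2.trans ht.2⟩⟩

end Distance

/-! ### Covariant derivatives in charts -/

section CovariantDerivative

variable {M : Type*} [EMetricSpace M] [ChartedSpace Plane M] [IsManifold (𝓡 2) ∞ M]

theorem contMDiffOn_ofChart_curve {z : M} {c Y : ℝ → Plane} {S : Set ℝ} (hc : ContDiffOn ℝ 1 c S)
    (hY : ContDiffOn ℝ 1 Y S) (hS : ∀ t ∈ S, c t ∈ (extChartAt (𝓡 2) z).target) :
    ContMDiffOn 𝓘(ℝ, ℝ) (𝓡 2).tangent 1 (fun t : ℝ =>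
      (⟨(extChartAt (𝓡 2) z).symm (c t), ofChart z (c t) (Y t)⟩ : TangentBundle (𝓡 2) M)) S := by
  have h1 := (contMDiffOn_extChartAt_symm (I := 𝓡 2) (n := ∞) z).contMDiffOn_tangentMapWithin
    (m := 1) (by rw [one_add_one_eq_two]; exact ENat.LEInfty.out) (isOpen_target z).uniqueMDiffOn
  have h2 : ContMDiffOn 𝓘(ℝ, ℝ) 𝓘(ℝ, Plane).tangent 1 (fun t : ℝ =>
      (⟨c t, Y t⟩ : TangentBundle 𝓘(ℝ, Plane) Plane)) S := by
    intro t ht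
    apply Bundle.contMDiffWithinAt_totalSpace.2
    refine ⟨(hc t ht).contMDiffWithinAt, ?_⟩
    convert! (hY t ht).contMDiffWithinAt with y
    simp [trivializationAt_model_space_apply]
  refine (h1.comp h2 fun t ht => hS t ht).congr fun t ht => ?_
  simp only [tangentMapWithin, Function.comp]
  rw [mfderivWithin_of_isOpen (isOpen_target z) (hS t ht)]
  rfl

theorem ofChart_surjective {z y : M} (hy : y ∈ (chartAt Plane z).source) (w : Plane) :
    ∃ v : TangentSpace (𝓡 2) y, toChart z y v = w := by
  obtain ⟨p, hp, rfl⟩ := exists_coord hy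
  exact ⟨_, toChart_ofChart hp w⟩

theorem toChart_eq_fderiv {z z' y : M} (hy : y ∈ (chartAt Plane z).source)
    (hy' : y ∈ (chartAt Plane z').source) (v : TangentSpace (𝓡 2) y) :
    toChart z' y v = fderiv ℝ (chartMap id z z') (extChartAt (𝓡 2) z y) (toChart z y v) := by
  have h := toChart_mfderiv (g := id) (z := z) (z' := z') mdifferentiableAt_id hy hy' v
  rw [mfderiv_id] at h
  exact h

variable [RiemannianBundle (fun x : M => TangentSpace (𝓡 2) x)]
  [IsContMDiffRiemannianBundle (𝓡 2) ∞ Plane (fun x : M => TangentSpace (𝓡 2) x)]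

theorem differentiableAt_gram {z : M} {p : Plane} (hp : p ∈ (extChartAt (𝓡 2) z).target) :
    DifferentiableAt ℝ (gram z) p :=
  ((contDiffOn_gram z).differentiableOn (by simp)).differentiableAt ((isOpen_target z).mem_nhds hp)

theorem christoffel_eq {z : M} {p : Plane} (hp : p ∈ (extChartAt (𝓡 2) z).target) (u v w : Plane) :
    christoffel z p u v w = christoffelForm (gram z) p u v w := by
  have h : ∀ u v w : Plane, fderiv ℝ (fun q => chartMetric z q v w) p u =
      fderiv ℝ (gram z) p u v w := by
    intro u v w
    have e1 : HasFDerivAt (fun q => gram z q v w)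
      (((ContinuousLinearMap.apply ℝ ℝ w).comp
        ((ContinuousLinearMap.apply ℝ (Plane →L[ℝ] ℝ) v).comp (fderiv ℝ (gram z) p)))) p :=
      ((ContinuousLinearMap.apply ℝ ℝ w).comp
        (ContinuousLinearMap.apply ℝ (Plane →L[ℝ] ℝ) v)).hasFDerivAt.comp p
          (differentiableAt_gram hp).hasFDerivAt
    exact congrArg (fun l : Plane →L[ℝ] ℝ => l u) e1.fderiv
  rw [christoffel, christoffelForm_apply, h, h, h]

/-- The covariant derivative of a vector field along a curve, computed in any chart. -/
theorem covDeriv_eq {z : M} {c : ℝ → M} {Y : ∀ t, TangentSpace (𝓡 2) (c t)} {t : ℝ}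
    {dc dY : Plane} (hsrc : ∀ᶠ s in 𝓝 t, c s ∈ (chartAt Plane z).source)
    (hc : HasDerivAt (fun s => extChartAt (𝓡 2) z (c s)) dc t)
    (hY : HasDerivAt (fun s => toChart z (c s) (Y s)) dY t) (u : TangentSpace (𝓡 2) (c t)) :
    covDeriv c Y t (toChart (c t) (c t) u) =
      gram z (extChartAt (𝓡 2) z (c t)) dY (toChart z (c t) u) +
        christoffelForm (gram z) (extChartAt (𝓡 2) z (c t)) dc (toChart z (c t) (Y t))
          (toChart z (c t) u) := by
  revert u
  set z' := c t with hz'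
  intro u
  have hz : z' ∈ (chartAt Plane z).source := hsrc.self_of_nhds
  have hzz : z' ∈ (chartAt Plane z').source := mem_chart_source Plane z'
  set p := extChartAt (𝓡 2) z z' with hp
  have hpt : p ∈ (extChartAt (𝓡 2) z).target := coord_mem_target hz
  let τ := chartMap id z z'
  have hτp : τ p = extChartAt (𝓡 2) z' z' := by
    change extChartAt (𝓡 2) z' ((extChartAt (𝓡 2) z).symm (extChartAt (𝓡 2) z z')) = _
    rw [symm_coord hz]
  have hdom : p ∈ chartDomain id z z' := by
    refine ⟨hpt, ?_⟩
    change (extChartAt (𝓡 2) z).symm (extChartAt (𝓡 2) z z') ∈ _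
    rw [symm_coord hz]
    exact hzz
  have hopen := isOpen_chartDomain (continuous_id (X := M)) z z'
  have hτ : ContDiffAt ℝ 2 τ p := ((contDiffOn_chartMap (ENat.LEInfty.out : (2 : ℕ∞ω) ≤ (∞ : ℕ∞ω))
    contMDiff_id z z').contDiffAt (hopen.mem_nhds hdom))
  have hnear : ∀ᶠ s in 𝓝 t, c s ∈ (chartAt Plane z).source ∧ c s ∈ (chartAt Plane z').source := by
    have h1 : ∀ᶠ s in 𝓝 t, extChartAt (𝓡 2) z (c s) ∈ chartDomain id z z' :=
      hc.continuousAt.eventually_mem (hopen.mem_nhds hdom)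
    filter_upwards [hsrc, h1] with s h1 h2
    have h3 : id ((extChartAt (𝓡 2) z).symm (extChartAt (𝓡 2) z (c s))) ∈ _ := h2.2
    rw [symm_coord h1] at h3
    exact ⟨h1, h3⟩
  have hgram : ∀ᶠ q in 𝓝 p, ∀ v w, gram z q v w =
      gram z' (τ q) (fderiv ℝ τ q v) (fderiv ℝ τ q w) := by
    filter_upwards [hopen.mem_nhds hdom] with q hq v w
    have hq1 := symm_mem_source hq.1
    have hq2 : (extChartAt (𝓡 2) z).symm q ∈ (chartAt Plane z').source := hq.2
    have h1 := inner_eq_gram hq2 (ofChart z q v) (ofChart z q w)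
    rw [toChart_eq_fderiv hq1 hq2, toChart_eq_fderiv hq1 hq2, toChart_ofChart hq.1,
      toChart_ofChart hq.1, coord_symm hq.1] at h1
    exact h1
  -- the covariant derivative is defined in the chart at `c t`; the change of charts leads to the
  -- chart at `z`
  have key := covariant_transform (g := gram z') (g' := gram z) (τ := τ) (p' := p) (t := t)
    (c' := fun s => extChartAt (𝓡 2) z (c s)) (Y' := fun s => toChart z (c s) (Y s))
    (gram_comm z') hτ (by rw [hτp]; exact differentiableAt_gram (coord_mem_target hzz)) hgram
    (differentiableAt_gram hpt) rfl hc hY (toChart z z' u)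
  have e1 : (fun s => fderiv ℝ τ (extChartAt (𝓡 2) z (c s)) (toChart z (c s) (Y s))) =ᶠ[𝓝 t]
      coordField z' c Y := by
    filter_upwards [hnear] with s hs
    exact (toChart_eq_fderiv hs.1 hs.2 _).symm
  have e2 : (fun s => τ (extChartAt (𝓡 2) z (c s))) =ᶠ[𝓝 t]
      fun s => extChartAt (𝓡 2) z' (c s) := by
    filter_upwards [hsrc] with s hs
    change extChartAt (𝓡 2) z' ((extChartAt (𝓡 2) z).symm (extChartAt (𝓡 2) z (c s))) = _
    rw [symm_coord hs]
  rw [e1.deriv_eq, e2.deriv_eq, hτp, ← toChart_eq_fderiv hz hzz] at key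
  have e3 : fderiv ℝ τ p (toChart z (c t) (Y t)) = coordField z' c Y t :=
    (toChart_eq_fderiv hz hzz (Y t)).symm
  rw [e3] at key
  rw [← key]
  change chartMetric z' _ _ _ + christoffel z' _ _ _ _ = _
  rw [christoffel_eq (coord_mem_target hzz)]
  rfl

end CovariantDerivative

/-! ### Minimizing geodesics and parallel transport -/

section Geodesics

variable {M : Type*} [EMetricSpace M] [ChartedSpace Plane M] [IsManifold (𝓡 2) ∞ M]
  [RiemannianBundle (fun x : M => TangentSpace (𝓡 2) x)] [IsRiemannianManifold (𝓡 2) M]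

theorem GoodChart.mem_of_edist_lt {B : ℝ} {z y y' : M} (h : GoodChart B z y) {r : ℝ}
    (hy : edist y y' < ENNReal.ofReal r) (hr : B * r < B⁻¹) :
    y' ∈ (chartAt Plane z).source ∧ ‖extChartAt (𝓡 2) z y' - extChartAt (𝓡 2) z y‖ < B * r := by
  rw [IsRiemannianManifold.out (I := 𝓡 2) y y'] at hy
  obtain ⟨η, h0, h1, hη, hlen⟩ := exists_lt_of_riemannianEDist_lt hy
  have := h.path_mem hη h0 hlen hr 1 ⟨zero_le_one, le_rfl⟩
  rwa [h1] at this

variable [IsContMDiffRiemannianBundle (𝓡 2) ∞ Plane (fun x : M => TangentSpace (𝓡 2) x)]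

/-- A nearby point is joined to `y` by a minimizing geodesic, along which vectors can be parallel
transported, and parallel transport moves the coordinates of vectors very little. -/
theorem GoodChart.exists_mem_transportCone {B : ℝ} {z y y' : M} (h : GoodChart B z y) {r : ℝ}
    (hy : edist y y' < ENNReal.ofReal r) (hr : 64 * B ^ 3 * r ≤ 1)
    {𝒞 : Set (TangentSpace (𝓡 2) y)} {v : TangentSpace (𝓡 2) y} (hv : v ∈ 𝒞) :
    ∃ w ∈ transportCone y 𝒞 y', ‖toChart z y' w - toChart z y v‖ ≤
      4 * B ^ 2 * r * ‖toChart z y v‖ := by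
  have hB := h.pos
  have hB1 := h.one_le
  have hr0 : 0 < r := by
    by_contra hneg
    rw [ENNReal.ofReal_of_nonpos (not_lt.1 hneg)] at hy
    exact not_lt_bot hy
  have hr1 : 64 * (B * r) ≤ 1 := by
    refine le_trans ?_ hr
    have : B ^ 1 ≤ B ^ 3 := pow_le_pow_right₀ hB1 (by norm_num)
    nlinarith
  have hr2 : 64 * (B * (B * r)) ≤ 1 := by
    refine le_trans ?_ hr
    have : B ^ 2 ≤ B ^ 3 := pow_le_pow_right₀ hB1 (by norm_num)
    nlinarith
  have hBr : B * r < B⁻¹ := by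
    rw [lt_inv_comm₀ (by positivity) hB, ← one_div, lt_div_iff₀ (by positivity)]
    nlinarith
  obtain ⟨hsrc, hdist⟩ := h.mem_of_edist_lt hy hBr
  set p := extChartAt (𝓡 2) z y with hp
  set e := extChartAt (𝓡 2) z y' - p with he
  have hball := h.ball_subset
  have hpos : ∀ q ∈ Metric.ball p B⁻¹, ∀ v, v ≠ 0 → 0 < gram z q v v := fun q hq v hv =>
    gram_pos (hball hq) hv
  have heR : 2 * ‖e‖ < B⁻¹ := by
    have h1 : 2 * ‖e‖ * B < 1 := by nlinarith
    rwa [← one_div, lt_div_iff₀ hB]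
  obtain ⟨c, v', hc0, hc1, hcv⟩ := exists_geodesic (Γ := spray (gram z)) (p := p) (e := e)
    (R := B⁻¹) hB1 h.norm_spray h.spray_lipschitz heR (by nlinarith [norm_nonneg e])
  have hcd := fun t ht => (hcv t ht).1
  have hvd := fun t ht => (hcv t ht).2.1
  have hvV : ∀ t ∈ Icc (0 : ℝ) 1, ‖v' t‖ ≤ 2 * ‖e‖ := fun t ht => (hcv t ht).2.2.1
  have hcR : ∀ t ∈ Icc (0 : ℝ) 1, c t ∈ Metric.ball p B⁻¹ := fun t ht =>
    mem_ball_iff_norm.2 ((hcv t ht).2.2.2.trans_lt heR)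
  have hct : ∀ t ∈ Icc (0 : ℝ) 1, c t ∈ (extChartAt (𝓡 2) z).target := fun t ht =>
    hball (hcR t ht)
  have hΓ : ∀ t ∈ Icc (0 : ℝ) 1, ∀ u w, gram z (c t) (spray (gram z) (c t) u u) w =
      christoffelForm (gram z) (c t) u u w := fun t ht u w => apply_spray (hpos _ (hcR t ht)) _ _ _
  have hgd : ∀ q ∈ Metric.ball p B⁻¹, DifferentiableAt ℝ (gram z) q := fun q hq =>
    differentiableAt_gram (hball hq)
  have hspray : ContDiffOn ℝ ∞ (spray (gram z)) (Metric.ball p B⁻¹) :=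
    contDiffOn_spray Metric.isOpen_ball ((contDiffOn_gram z).mono hball) hpos
  -- smoothness of the geodesic
  have hcs : ContDiffOn ℝ ∞ c (Icc 0 1) := by
    have hF : ContDiffOn ℝ ((⊤ : ℕ∞) : ℕ∞ω) (Function.uncurry fun (_ : ℝ) (x : Plane × Plane) =>
        (x.2, -spray (gram z) x.1 x.2 x.2)) (Icc (0 : ℝ) 1 ×ˢ (Metric.ball p B⁻¹ ×ˢ univ)) := by
      have h1 : ContDiffOn ℝ ∞ (fun x : ℝ × Plane × Plane => spray (gram z) x.2.1)
          (Icc (0 : ℝ) 1 ×ˢ (Metric.ball p B⁻¹ ×ˢ univ)) :=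
        hspray.comp contDiff_snd.fst.contDiffOn fun x hx => hx.2.1
      exact contDiff_snd.snd.contDiffOn.prodMk
        ((h1.clm_apply contDiff_snd.snd.contDiffOn).clm_apply contDiff_snd.snd.contDiffOn).neg
    have := ODE.contDiffOn_enat_Icc_of_hasDerivWithinAt hF
      (α := fun t => (c t, v' t)) (fun t ht => (hcd t ht).prodMk (hvd t ht))
      (fun t ht => ⟨hcR t ht, mem_univ _⟩)
    exact contDiff_fst.comp_contDiffOn this
  let cM : ℝ → M := fun t => (extChartAt (𝓡 2) z).symm (c t)
  have hcM : ContMDiffOn 𝓘(ℝ, ℝ) (𝓡 2) ∞ cM (Icc 0 1) :=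
    (contMDiffOn_extChartAt_symm z).comp hcs.contMDiffOn fun t ht => hct t ht
  have hcM0 : cM 0 = y := by
    change (extChartAt (𝓡 2) z).symm (c 0) = y
    rw [hc0, hp, symm_coord h.mem_source]
  have hcM1 : cM 1 = y' := by
    change (extChartAt (𝓡 2) z).symm (c 1) = y'
    rw [hc1, he, add_sub_cancel, symm_coord hsrc]
  -- the speed is constant, and equal to the distance
  set l := √(gram z (c 0) (v' 0) (v' 0)) with hl
  have hspeed : ∀ t ∈ Icc (0 : ℝ) 1, ‖ofChart z (c t) (v' t)‖ = l := fun t ht => by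
    rw [hl, ← geodesic_speed_const (gram_comm z) (fun t ht => hgd _ (hcR t ht)) hΓ hcd hvd t ht,
      ← norm_sq_ofChart, Real.sqrt_sq (norm_nonneg _)]
  have hle : ∀ s ∈ Icc (0 : ℝ) 1, ∀ t ∈ Icc (0 : ℝ) 1, s ≤ t →
      edist (cM s) (cM t) ≤ ENNReal.ofReal (l * (t - s)) := by
    intro s hs t ht hst
    rcases hst.eq_or_lt with rfl | hst'
    · simp
    have hsub : Icc s t ⊆ Icc 0 1 := Icc_subset_Icc hs.1 ht.2
    refine edist_le_of_speed_le hst ((hcM.mono hsub).of_le (by simp)) fun τ hτ => ?_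
    rw [velocityWithin_symm_comp ((hcd τ (hsub hτ)).mono hsub) (uniqueDiffOn_Icc hst' τ hτ)
      (hct τ (hsub hτ)), hspeed τ (hsub hτ)]
  have hl0 : 0 ≤ l := Real.sqrt_nonneg _
  -- short paths from `y` to the other point stay in the chart, where geodesics minimize length
  have hlow : ENNReal.ofReal l ≤ edist y y' := by
    refine le_of_forall_gt fun L hL => ?_
    have hL' : edist y y' < min L (ENNReal.ofReal r) := lt_min hL hy
    rw [IsRiemannianManifold.out (I := 𝓡 2) y y'] at hL'
    obtain ⟨η, h0, h1, hη, hlen⟩ := exists_lt_of_riemannianEDist_lt hL'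
    refine lt_of_le_of_lt ?_ (hlen.trans_le (min_le_left _ _))
    have hmem := h.path_mem hη h0 (hlen.trans_le (min_le_right _ _)) hBr
    have hηd : ∀ t ∈ Icc (0 : ℝ) 1, HasDerivWithinAt (fun t => extChartAt (𝓡 2) z (η t))
        (toChart z (η t) (velocityWithin η (Icc 0 1) t)) (Icc 0 1) t := fun t ht =>
      hasDerivWithinAt_coord ((hη t ht).mdifferentiableWithinAt one_ne_zero)
        (uniqueDiffOn_Icc zero_lt_one t ht) (hmem t ht).1
    have hηc : ContDiffOn ℝ 1 (fun t => extChartAt (𝓡 2) z (η t)) (Icc 0 1) := by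
      rw [← contMDiffOn_iff_contDiffOn]
      exact (contMDiffOn_extChartAt (I := 𝓡 2) (x := z) (n := 1)).comp hη
        fun t ht => (hmem t ht).1
    have hη' : ContinuousOn (fun t => toChart z (η t) (velocityWithin η (Icc 0 1) t))
        (Icc 0 1) :=
      (hηc.continuousOn_derivWithin (uniqueDiffOn_Icc zero_lt_one) le_rfl).congr fun t ht =>
        ((hηd t ht).derivWithin (uniqueDiffOn_Icc zero_lt_one t ht)).symm
    have hηR : ∀ t ∈ Icc (0 : ℝ) 1, extChartAt (𝓡 2) z (η t) ∈ Metric.ball p B⁻¹ := fun t ht =>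
      mem_ball_iff_norm.2 ((hmem t ht).2.trans hBr)
    have key := geodesic_speed_le_length hB1 (V := 2 * ‖e‖) (by positivity) (by
        have h1 : B ^ 2 * (2 * ‖e‖) ≤ 1 / 32 := by nlinarith [pow_pos hB 2]
        have h2 : 0 ≤ B ^ 2 * (2 * ‖e‖) := by positivity
        calc 6 * B ^ 4 * (2 * ‖e‖) ^ 2 = 6 * (B ^ 2 * (2 * ‖e‖)) ^ 2 := by ring
          _ ≤ 6 * (1 / 32) ^ 2 := by gcongr
          _ ≤ 1 := by norm_num) (gram_comm z)
      hgd h.norm_fderiv h.fderiv_lipschitz h.lower hΓ hcd hvd hcR hvV hηd hη' hηR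
      (by rw [h0, hc0]) (by rw [h1, hc1, he, add_sub_cancel])
    rw [← hl] at key
    have hint : ∀ t ∈ Icc (0 : ℝ) 1, √(gram z (extChartAt (𝓡 2) z (η t))
        (toChart z (η t) (velocityWithin η (Icc 0 1) t))
        (toChart z (η t) (velocityWithin η (Icc 0 1) t))) = ‖velocityWithin η (Icc 0 1) t‖ :=
      fun t ht => by
        rw [← norm_sq_eq_gram (hmem t ht).1, Real.sqrt_sq (norm_nonneg _)]
    have hcont : ContinuousOn (fun t => √(gram z (extChartAt (𝓡 2) z (η t))
        (toChart z (η t) (velocityWithin η (Icc 0 1) t))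
        (toChart z (η t) (velocityWithin η (Icc 0 1) t)))) (Icc 0 1) :=
      (((((contDiffOn_gram z).continuousOn.comp hηc.continuousOn
        fun t ht => hball (hηR t ht)).clm_apply hη').clm_apply hη')).sqrt
    rw [pathELength_eq_lintegral_mfderivWithin_Icc]
    refine (ENNReal.ofReal_le_ofReal key).trans (le_of_eq ?_)
    rw [intervalIntegral.integral_of_le zero_le_one, ← MeasureTheory.integral_Icc_eq_integral_Ioc,
      MeasureTheory.ofReal_integral_eq_lintegral_ofReal hcont.integrableOn_Icc
        (MeasureTheory.ae_of_all _ fun t => Real.sqrt_nonneg _)]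
    refine MeasureTheory.setLIntegral_congr_fun measurableSet_Icc fun t ht => ?_
    rw [hint t ht, ofReal_norm]
    rfl
  have hyy : edist y y' = ENNReal.ofReal l := by
    refine le_antisymm ?_ hlow
    have := hle 0 ⟨le_rfl, zero_le_one⟩ 1 ⟨zero_le_one, le_rfl⟩ zero_le_one
    rwa [hcM0, hcM1, sub_zero, mul_one] at this
  -- the upper bounds for three successive arcs add up to the distance, so all of them are sharp
  have hmin0 : ∀ s ∈ Icc (0 : ℝ) 1, ∀ t ∈ Icc (0 : ℝ) 1, s ≤ t →
      edist (cM s) (cM t) = ENNReal.ofReal (l * (t - s)) := by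
    intro s hs t ht hst
    refine le_antisymm (hle s hs t ht hst) ?_
    have e1 := hle 0 ⟨le_rfl, zero_le_one⟩ s hs hs.1
    have e2 := hle t ht 1 ⟨zero_le_one, le_rfl⟩ ht.2
    rw [hcM0] at e1
    rw [hcM1] at e2
    have e3 : ENNReal.ofReal l ≤ ENNReal.ofReal (l * (s - 0)) +
        (edist (cM s) (cM t) + ENNReal.ofReal (l * (1 - t))) := by
      rw [← hyy]
      refine (edist_triangle y (cM s) y').trans (add_le_add e1 ?_)
      exact (edist_triangle (cM s) (cM t) y').trans (add_le_add le_rfl e2)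
    have hfin : edist (cM s) (cM t) ≠ ⊤ :=
      ((hle s hs t ht hst).trans_lt ENNReal.ofReal_lt_top).ne
    rw [← ENNReal.ofReal_toReal hfin] at e3 ⊢
    have hs0 : 0 ≤ l * (s - 0) := mul_nonneg hl0 (by linarith [hs.1])
    have ht0 : 0 ≤ l * (1 - t) := mul_nonneg hl0 (by linarith [ht.2])
    rw [← ENNReal.ofReal_add ENNReal.toReal_nonneg ht0,
      ← ENNReal.ofReal_add hs0 (add_nonneg ENNReal.toReal_nonneg ht0),
      ENNReal.ofReal_le_ofReal_iff (by positivity)] at e3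
    refine ENNReal.ofReal_le_ofReal ?_
    linarith
  have hmin : IsMinGeodesic y y' cM := by
    refine ⟨hcM, hcM0, hcM1, fun s hs t ht => ?_⟩
    rw [hyy, ← ENNReal.ofReal_mul (abs_nonneg _)]
    rcases le_total s t with hst | hst
    · rw [hmin0 s hs t ht hst, abs_sub_comm, abs_of_nonneg (by linarith), mul_comm]
    · rw [edist_comm, hmin0 t ht s hs hst, abs_of_nonneg (by linarith), mul_comm]
  -- parallel transport
  have hvc : ContinuousOn v' (Icc 0 1) := fun t ht => (hvd t ht).continuousWithinAt
  have hAc : ContinuousOn (fun t => spray (gram z) (c t) (v' t)) (Icc 0 1) :=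
    (hspray.continuousOn.comp hcs.continuousOn fun t ht => hcR t ht).clm_apply hvc
  obtain ⟨Y, hY0, hY⟩ := exists_linearODE (A := fun t => spray (gram z) (c t) (v' t))
    (κ := B * (2 * ‖e‖)) hAc (fun t ht => ((spray (gram z) (c t)).le_opNorm _).trans
      (mul_le_mul (h.norm_spray _ (hcR t ht)) (hvV t ht) (norm_nonneg _) hB.le))
    (by nlinarith [norm_nonneg e]) (toChart z y v)
  have hYc : ContinuousOn Y (Icc 0 1) := fun t ht => (hY t ht).1.continuousWithinAt
  have hYs : ContDiffOn ℝ 1 Y (Icc 0 1) := by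
    rw [show (1 : ℕ∞ω) = 0 + 1 from rfl, contDiffOn_succ_iff_derivWithin
      (uniqueDiffOn_Icc zero_lt_one)]
    refine ⟨fun t ht => (hY t ht).1.differentiableWithinAt, by simp, ?_⟩
    rw [contDiffOn_zero]
    refine ContinuousOn.congr (f := fun t => -spray (gram z) (c t) (v' t) (Y t))
      (hAc.clm_apply hYc).neg fun t ht => ?_
    exact (hY t ht).1.derivWithin (uniqueDiffOn_Icc zero_lt_one t ht)
  let YM : ∀ t, TangentSpace (𝓡 2) (cM t) := fun t => ofChart z (c t) (Y t)
  have hpar : IsParallel cM YM := by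
    refine ⟨contMDiffOn_ofChart_curve (hcs.of_le (by simp)) hYs hct, fun t ht w => ?_⟩
    have htI : t ∈ Icc (0 : ℝ) 1 := Ioo_subset_Icc_self ht
    have hnear : ∀ᶠ s in 𝓝 t, s ∈ Icc (0 : ℝ) 1 := Icc_mem_nhds ht.1 ht.2
    have e1 : ∀ᶠ s in 𝓝 t, cM s ∈ (chartAt Plane z).source := by
      filter_upwards [hnear] with s hs using symm_mem_source (hct s hs)
    have e2 : HasDerivAt (fun s => extChartAt (𝓡 2) z (cM s)) (v' t) t := by
      refine ((hcd t htI).hasDerivAt (Icc_mem_nhds ht.1 ht.2)).congr_of_eventuallyEq ?_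
      filter_upwards [hnear] with s hs using coord_symm (hct s hs)
    have e3 : HasDerivAt (fun s => toChart z (cM s) (YM s))
        (-spray (gram z) (c t) (v' t) (Y t)) t := by
      refine ((hY t htI).1.hasDerivAt (Icc_mem_nhds ht.1 ht.2)).congr_of_eventuallyEq ?_
      filter_upwards [hnear] with s hs using toChart_ofChart (hct s hs) _
    obtain ⟨u, rfl⟩ := ofChart_surjective (mem_chart_source Plane (cM t)) w
    rw [covDeriv_eq e1 e2 e3]
    have e4 : extChartAt (𝓡 2) z (cM t) = c t := coord_symm (hct t htI)
    have e5 : toChart z (cM t) (YM t) = Y t := toChart_ofChart (hct t htI) _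
    rw [e4, e5, map_neg, neg_apply, apply_spray (hpos _ (hcR t htI)), neg_add_cancel]
  have h01 : (1 : ℝ) ∈ Icc (0 : ℝ) 1 := ⟨zero_le_one, le_rfl⟩
  have hY1 := (hY 1 h01).2
  have hYM0 : (⟨cM 0, YM 0⟩ : TangentBundle (𝓡 2) M) = ⟨y, v⟩ := by
    have e5 : toChart z (cM 0) (YM 0) = toChart z y v :=
      (toChart_ofChart (hct 0 ⟨le_rfl, zero_le_one⟩) _).trans hY0
    revert e5
    generalize YM 0 = w
    revert w
    rw [hcM0]
    exact fun w hw => by rw [toChart_injective h.mem_source hw]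
  have hYM1 : ∃ w : TangentSpace (𝓡 2) y', (⟨cM 1, YM 1⟩ : TangentBundle (𝓡 2) M) = ⟨y', w⟩ ∧
      toChart z y' w = Y 1 := by
    have e5 : toChart z (cM 1) (YM 1) = Y 1 := toChart_ofChart (hct 1 h01) _
    revert e5
    generalize YM 1 = w
    revert w
    rw [hcM1]
    exact fun w hw => ⟨w, rfl, hw⟩
  obtain ⟨w, hw1, hw2⟩ := hYM1
  refine ⟨w, ⟨cM, YM, hmin, hpar, ⟨v, hv, hYM0⟩, hw1⟩, ?_⟩
  rw [hw2]
  refine hY1.trans (mul_le_mul_of_nonneg_right ?_ (norm_nonneg _))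
  nlinarith

end Geodesics

/-! ### Recursive estimates for coordinates in a hyperbolic splitting -/

section Scalar

variable {X Z R α : ℕ → ℝ} {n : ℕ} {m A : ℝ}

/-- Coordinates `X` (contracted) and `Z` (expanded), normalized so that the unperturbed dynamics is
the identity, are perturbed with summable relative errors `α`, in the norm `|X| / R + |Z|` with
increasing weights `R`. If `Z` dominates at time `0`, then it does not decrease much. -/
theorem expanding_coordinate_bound (hR : ∀ k ≤ n, 0 < R k) (hmono : ∀ k < n, R k ≤ R (k + 1))
    (hα : ∀ k, 0 ≤ α k) (hA : ∑ k ∈ Finset.range n, α k ≤ A)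
    (hX : ∀ k < n, |X (k + 1) - X k| ≤ α k * (|X k| + R k * |Z k|))
    (hZ : ∀ k < n, |Z (k + 1) - Z k| ≤ α k * (|X k| / R k + |Z k|))
    (hm : 0 ≤ m) (h0 : |X 0| ≤ m * (R 0 * |Z 0|)) (hAm : 4 * (A * (1 + m)) ≤ 1) :
    |Z 0| ≤ 2 * |Z n| := by
  have hsum0 : ∀ k, 0 ≤ ∑ i ∈ Finset.range k, α i := fun k => Finset.sum_nonneg fun i _ => hα i
  have hsumA : ∀ k ≤ n, ∑ i ∈ Finset.range k, α i ≤ A := fun k hk =>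
    (Finset.sum_le_sum_of_subset_of_nonneg (Finset.range_subset_range.2 hk)
      fun i _ _ => hα i).trans hA
  have hA0 : 0 ≤ A := (hsum0 n).trans hA
  have hA4 : 4 * A ≤ 1 := by nlinarith
  set S : ℝ := |X 0| / R 0 + |Z 0| with hS
  have hR0 := hR 0 (Nat.zero_le n)
  have hS0 : 0 ≤ S := by positivity
  have hSm : S ≤ (1 + m) * |Z 0| := by
    have : |X 0| / R 0 ≤ m * |Z 0| := by
      rw [div_le_iff₀ hR0]
      linarith
    linarith
  -- forward induction: since the weights increase, the norm `|X| / R + |Z|` grows only by the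
  -- errors
  have key : ∀ k ≤ n, |X k| / R k + |Z k| ≤ (1 + 4 * ∑ i ∈ Finset.range k, α i) * S ∧
      |Z 0| - 2 * (∑ i ∈ Finset.range k, α i) * S ≤ |Z k| := by
    intro k
    induction k with
    | zero => intro _; simp [hS]
    | succ k ih =>
      intro hk
      have hk' : k < n := hk
      obtain ⟨ih1, ih2⟩ := ih hk'.le
      have hRk := hR k hk'.le
      have hRk' := hR (k + 1) hk
      have hs := hsum0 k
      have hsA := hsumA k hk'.le
      have hαk := hα k
      have e1 : |X (k + 1)| / R (k + 1) ≤ |X k| / R k + α k * (|X k| / R k + |Z k|) := by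
        have h1 : |X (k + 1)| ≤ |X k| + α k * (|X k| + R k * |Z k|) := by
          have := abs_sub_abs_le_abs_sub (X (k + 1)) (X k)
          linarith [hX k hk']
        calc |X (k + 1)| / R (k + 1) ≤ |X (k + 1)| / R k := by
              gcongr
              exact hmono k hk'
          _ ≤ (|X k| + α k * (|X k| + R k * |Z k|)) / R k := by gcongr
          _ = _ := by field_simp
      have e2 : |Z (k + 1)| ≤ |Z k| + α k * (|X k| / R k + |Z k|) := by
        have := abs_sub_abs_le_abs_sub (Z (k + 1)) (Z k)
        linarith [hZ k hk']
      have e3 : |Z k| - α k * (|X k| / R k + |Z k|) ≤ |Z (k + 1)| := by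
        have := abs_sub_abs_le_abs_sub (Z k) (Z (k + 1))
        rw [abs_sub_comm] at this
        linarith [hZ k hk']
      rw [Finset.sum_range_succ]
      set s := ∑ i ∈ Finset.range k, α i
      have hαS : 0 ≤ α k * S := mul_nonneg hαk hS0
      have e4 : α k * (|X k| / R k + |Z k|) ≤ α k * (2 * S) := by
        refine mul_le_mul_of_nonneg_left (ih1.trans ?_) hαk
        nlinarith
      constructor
      · nlinarith
      · nlinarith
  have h1 := (key n le_rfl).2
  have h2 : (∑ i ∈ Finset.range n, α i) * S ≤ A * ((1 + m) * |Z 0|) :=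
    mul_le_mul hA hSm hS0 hA0
  have h3 := abs_nonneg (Z 0)
  nlinarith

/-- With the same perturbations, if `X` dominates at time `n`, then the norm `|X| + R |Z|` is
controlled at all times by `X 0`, and `Z 0` is small with respect to `X 0`. -/
theorem contracting_coordinate_bound (hR : ∀ k ≤ n, 0 < R k) (hmono : ∀ k < n, R k ≤ R (k + 1))
    (hα : ∀ k, 0 ≤ α k) (hA : ∑ k ∈ Finset.range n, α k ≤ A)
    (hX : ∀ k < n, |X (k + 1) - X k| ≤ α k * (|X k| + R k * |Z k|))
    (hZ : ∀ k < n, |Z (k + 1) - Z k| ≤ α k * (|X k| / R k + |Z k|))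
    (hm : 0 ≤ m) (hn : R n * |Z n| ≤ m * |X n|) (hAm : 8 * (A * (1 + m)) ≤ 1) :
    (∀ k ≤ n, |X k| + R k * |Z k| ≤ 4 * (1 + m) * |X 0|) ∧
      |Z 0| ≤ (2 * m / R n + 4 * A * (1 + m) / R 0) * |X 0| := by
  have hsub : ∀ k, ∑ i ∈ Finset.Ico k n, α i ≤ A := fun k =>
    (Finset.sum_le_sum_of_subset_of_nonneg (fun i hi => Finset.mem_range.2 (Finset.mem_Ico.1 hi).2)
      fun i _ _ => hα i).trans hA
  have hsum0 : ∀ k, 0 ≤ ∑ i ∈ Finset.Ico k n, α i := fun k => Finset.sum_nonneg fun i _ => hα i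
  have hA0 : 0 ≤ A := (hsum0 0).trans (hsub 0)
  have hA8 : 8 * A ≤ 1 := by nlinarith
  have hR0 := hR 0 (Nat.zero_le n)
  have hRmono : ∀ k ≤ n, R 0 ≤ R k := by
    intro k
    induction k with
    | zero => intro _; exact le_rfl
    | succ k ih => intro hk; exact (ih (Nat.le_of_succ_le hk)).trans (hmono k hk)
  set S : ℝ := |X n| + R n * |Z n| with hS
  have hS0 : 0 ≤ S := add_nonneg (abs_nonneg _) (mul_nonneg (hR n le_rfl).le (abs_nonneg _))
  have hSm : S ≤ (1 + m) * |X n| := by linarith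
  -- backward induction: since the weights increase, the norm `|X| + R |Z|` grows only by the
  -- errors as time decreases
  have key : ∀ j, ∀ k, k + j = n →
      |X k| + R k * |Z k| ≤ (1 + 8 * ∑ i ∈ Finset.Ico k n, α i) * S ∧
      |X n| - 2 * (∑ i ∈ Finset.Ico k n, α i) * S ≤ |X k| ∧
      |Z k| ≤ |Z n| + 2 * (∑ i ∈ Finset.Ico k n, α i) * S / R 0 := by
    intro j
    induction j with
    | zero =>
      rintro k rfl
      simp [hS]
    | succ j ih =>
      intro k hk
      have hk' : k < n := by omega
      obtain ⟨ih1, ih2, ih3⟩ := ih (k + 1) (by omega)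
      rw [Finset.sum_eq_sum_Ico_succ_bot hk']
      have hRk := hR k hk'.le
      have hαk := hα k
      have hs := hsum0 (k + 1)
      have hsA := hsub k
      rw [Finset.sum_eq_sum_Ico_succ_bot hk'] at hsA
      set s := ∑ i ∈ Finset.Ico (k + 1) n, α i
      set P := |X k| + R k * |Z k| with hP
      have hP0 : 0 ≤ P := by positivity
      have e1 : |X k| ≤ |X (k + 1)| + α k * P := by
        have := abs_sub_abs_le_abs_sub (X k) (X (k + 1))
        rw [abs_sub_comm] at this
        linarith [hX k hk']
      have e1' : |X (k + 1)| ≤ |X k| + α k * P := by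
        have := abs_sub_abs_le_abs_sub (X (k + 1)) (X k)
        linarith [hX k hk']
      have e2 : |Z k| ≤ |Z (k + 1)| + α k * (P / R k) := by
        have := abs_sub_abs_le_abs_sub (Z k) (Z (k + 1))
        rw [abs_sub_comm] at this
        have h2 : P / R k = |X k| / R k + |Z k| := by rw [hP]; field_simp
        rw [h2]
        linarith [hZ k hk']
      have e3 : R k * |Z k| ≤ R (k + 1) * |Z (k + 1)| + α k * P := by
        have h1 := mul_le_mul_of_nonneg_left e2 hRk.le
        have h2 : R k * (|Z (k + 1)| + α k * (P / R k)) = R k * |Z (k + 1)| + α k * P := by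
          field_simp
        have h3 : R k * |Z (k + 1)| ≤ R (k + 1) * |Z (k + 1)| := by
          gcongr
          exact hmono k hk'
        linarith
      have hαS : 0 ≤ α k * S := mul_nonneg hαk hS0
      have e4 : (1 - 2 * α k) * P ≤ |X (k + 1)| + R (k + 1) * |Z (k + 1)| := by linarith
      have e5 : P ≤ (1 + 8 * (α k + s)) * S := by
        have h1 : P ≤ (1 + 4 * α k) * ((1 - 2 * α k) * P) := by
          have : 0 ≤ α k * P := mul_nonneg hαk hP0
          nlinarith
        have h2 : (1 + 4 * α k) * ((1 - 2 * α k) * P) ≤ (1 + 4 * α k) * ((1 + 8 * s) * S) :=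
          mul_le_mul_of_nonneg_left (e4.trans ih1) (by linarith)
        nlinarith
      have e6 : P ≤ 2 * S := e5.trans (by nlinarith)
      have e7 : α k * P ≤ α k * (2 * S) := mul_le_mul_of_nonneg_left e6 hαk
      refine ⟨e5, by nlinarith, ?_⟩
      have e8 : α k * (P / R k) ≤ α k * (2 * S / R 0) := by
        refine mul_le_mul_of_nonneg_left ?_ hαk
        exact div_le_div₀ (by positivity) e6 hR0 (hRmono k hk'.le)
      have e9 : 2 * (α k + s) * S / R 0 = 2 * s * S / R 0 + α k * (2 * S / R 0) := by ring
      linarith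
  have hXn := abs_nonneg (X n)
  have hT : ∀ k ≤ n, (∑ i ∈ Finset.Ico k n, α i) * S ≤ A * ((1 + m) * |X n|) := fun k hk =>
    mul_le_mul (hsub k) hSm hS0 hA0
  have h0 := key n 0 (Nat.zero_add n)
  have hX0 : |X n| ≤ 2 * |X 0| := by
    have := hT 0 (Nat.zero_le n)
    nlinarith [h0.2.1]
  constructor
  · intro k hk
    have h1 := (key (n - k) k (by omega)).1
    have h2 : |X k| + R k * |Z k| ≤ 2 * S := by
      refine h1.trans ?_
      nlinarith [hsub k]
    nlinarith
  · have h1 := h0.2.2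
    have hRn := hR n le_rfl
    have h2 : |Z n| ≤ m / R n * |X n| := by
      rw [div_mul_eq_mul_div, le_div_iff₀ hRn]
      linarith
    have h3 : 2 * (∑ i ∈ Finset.Ico 0 n, α i) * S / R 0 ≤ 2 * (A * ((1 + m) * (2 * |X 0|))) / R 0 := by
      have := hT 0 (Nat.zero_le n)
      have h4 : A * ((1 + m) * |X n|) ≤ A * ((1 + m) * (2 * |X 0|)) := by gcongr
      exact div_le_div_of_nonneg_right (by linarith) hR0.le
    have h5 : m / R n * |X n| ≤ m / R n * (2 * |X 0|) := by gcongr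
    calc |Z 0| ≤ m / R n * (2 * |X 0|) + 2 * (A * ((1 + m) * (2 * |X 0|))) / R 0 := by linarith
      _ = _ := by ring

end Scalar

/-! ### Perturbed hyperbolic sequences of linear maps of the plane -/

section Wedge

/-- The determinant of a pair of vectors of the plane. -/
def wedge : Plane →L[ℝ] Plane →L[ℝ] ℝ :=
  (EuclideanSpace.proj (0 : Fin 2) : Plane →L[ℝ] ℝ).smulRight
      (EuclideanSpace.proj (1 : Fin 2) : Plane →L[ℝ] ℝ) -
    (EuclideanSpace.proj (1 : Fin 2) : Plane →L[ℝ] ℝ).smulRight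
      (EuclideanSpace.proj (0 : Fin 2) : Plane →L[ℝ] ℝ)

theorem wedge_apply (u v : Plane) : wedge u v = u 0 * v 1 - u 1 * v 0 := by
  simp [wedge]

theorem wedge_self (u : Plane) : wedge u u = 0 := by
  rw [wedge_apply]
  ring

theorem wedge_swap (u v : Plane) : wedge u v = -wedge v u := by
  rw [wedge_apply, wedge_apply]
  ring

theorem abs_wedge_le (u v : Plane) : |wedge u v| ≤ ‖u‖ * ‖v‖ := by
  refine abs_le_of_sq_le_sq ?_ (by positivity)
  rw [mul_pow, EuclideanSpace.norm_sq_eq, EuclideanSpace.norm_sq_eq, wedge_apply]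
  simp only [Fin.sum_univ_two, Real.norm_eq_abs, sq_abs]
  nlinarith [sq_nonneg (u 0 * v 0 + u 1 * v 1)]

theorem wedge_smul_eq (e e' w : Plane) : wedge e e' • w = wedge w e' • e + wedge e w • e' := by
  ext i
  simp only [PiLp.add_apply, PiLp.smul_apply, smul_eq_mul, wedge_apply]
  fin_cases i <;> simp <;> ring

/-- The first coordinate in the basis `e, e'`. -/
def coordS (e e' w : Plane) : ℝ := wedge w e' / wedge e e'

/-- The second coordinate in the basis `e, e'`. -/
def coordU (e e' w : Plane) : ℝ := wedge e w / wedge e e'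

theorem coordS_smul_add {e e' : Plane} (h : wedge e e' ≠ 0) (w : Plane) :
    coordS e e' w • e + coordU e e' w • e' = w := by
  have h1 := wedge_smul_eq e e' w
  rw [coordS, coordU, div_eq_inv_mul, div_eq_inv_mul, mul_smul, mul_smul, ← smul_add, ← h1,
    smul_smul, inv_mul_cancel₀ h, one_smul]

theorem norm_le_coord {e e' : Plane} (h : wedge e e' ≠ 0) (w : Plane) :
    ‖w‖ ≤ |coordS e e' w| * ‖e‖ + |coordU e e' w| * ‖e'‖ := by
  conv_lhs => rw [← coordS_smul_add h w]
  refine (norm_add_le _ _).trans ?_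
  rw [norm_smul, norm_smul, Real.norm_eq_abs, Real.norm_eq_abs]

theorem coordS_comb {e e' : Plane} (h : wedge e e' ≠ 0) (a b : ℝ) :
    coordS e e' (a • e + b • e') = a := by
  simp [coordS, wedge_self, h]

theorem coordU_comb {e e' : Plane} (h : wedge e e' ≠ 0) (a b : ℝ) :
    coordU e e' (a • e + b • e') = b := by
  simp [coordU, wedge_self, h]

theorem coordS_sub (e e' w w' : Plane) :
    coordS e e' (w - w') = coordS e e' w - coordS e e' w' := by
  simp [coordS, sub_div]

theorem coordU_sub (e e' w w' : Plane) :
    coordU e e' (w - w') = coordU e e' w - coordU e e' w' := by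
  simp [coordU, sub_div]

theorem abs_coordS_le {e e' : Plane} {a : ℝ} (ha : 0 < a) (he : e ≠ 0) (he' : e' ≠ 0)
    (h : ‖e‖ * ‖e'‖ ≤ a * |wedge e e'|) (w : Plane) : |coordS e e' w| ≤ a * ‖w‖ / ‖e‖ := by
  have h1 : 0 < ‖e‖ := norm_pos_iff.2 he
  have h2 : 0 < ‖e'‖ := norm_pos_iff.2 he'
  have h3 : 0 < |wedge e e'| := by
    by_contra hneg
    nlinarith [mul_pos h1 h2]
  rw [coordS, abs_div, div_le_div_iff₀ h3 h1]
  calc |wedge w e'| * ‖e‖ ≤ ‖w‖ * ‖e'‖ * ‖e‖ := by gcongr; exact abs_wedge_le _ _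
    _ = ‖w‖ * (‖e‖ * ‖e'‖) := by ring
    _ ≤ ‖w‖ * (a * |wedge e e'|) := by gcongr
    _ = _ := by ring

theorem abs_coordU_le {e e' : Plane} {a : ℝ} (ha : 0 < a) (he : e ≠ 0) (he' : e' ≠ 0)
    (h : ‖e‖ * ‖e'‖ ≤ a * |wedge e e'|) (w : Plane) : |coordU e e' w| ≤ a * ‖w‖ / ‖e'‖ := by
  have h1 : 0 < ‖e‖ := norm_pos_iff.2 he
  have h2 : 0 < ‖e'‖ := norm_pos_iff.2 he'
  have h3 : 0 < |wedge e e'| := by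
    by_contra hneg
    nlinarith [mul_pos h1 h2]
  rw [coordU, abs_div, div_le_div_iff₀ h3 h2]
  calc |wedge e w| * ‖e'‖ ≤ ‖e‖ * ‖w‖ * ‖e'‖ := by gcongr; exact abs_wedge_le _ _
    _ = ‖w‖ * (‖e‖ * ‖e'‖) := by ring
    _ ≤ ‖w‖ * (a * |wedge e e'|) := by gcongr
    _ = _ := by ring

end Wedge

section Hyperbolic

/-- A tempered splitting for a sequence of `n` linear maps of the plane: the images `es`, `eu` of
two vectors are contracted and expanded, and their angle does not decay too fast. -/
structure HypSeq (L lam ε : ℝ) (n : ℕ) (es eu : ℕ → Plane) (A : ℕ → Plane →L[ℝ] Plane) : Prop where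
  one_le : 1 ≤ L
  lam_pos : 0 < lam
  eps_nonneg : 0 ≤ ε
  eps_le : 100 * ε ≤ lam
  es_ne : ∀ k ≤ n, es k ≠ 0
  eu_ne : ∀ k ≤ n, eu k ≠ 0
  map_es : ∀ k < n, A k (es k) = es (k + 1)
  map_eu : ∀ k < n, A k (eu k) = eu (k + 1)
  es_le : ∀ k < n, ‖es k‖ ≤ L * ‖es (k + 1)‖
  eu_le : ∀ k < n, ‖eu k‖ ≤ L * ‖eu (k + 1)‖
  es_zero_le : ‖es 0‖ ≤ L
  le_es_zero : 1 ≤ L * ‖es 0‖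
  eu_zero_le : ‖eu 0‖ ≤ L
  le_eu_zero : 1 ≤ L * ‖eu 0‖
  expand : ∀ k j : ℕ, k + j ≤ n →
    Real.exp (lam * j) * Real.exp (-ε * k) * ‖eu k‖ ≤ L * ‖eu (k + j)‖
  contract : ∀ k j : ℕ, k + j ≤ n →
    ‖es (k + j)‖ ≤ L * Real.exp (-lam * j) * Real.exp (ε * k) * ‖es k‖
  angle : ∀ k ≤ n, ‖es k‖ * ‖eu k‖ ≤ L * Real.exp (ε * k) * |wedge (es k) (eu k)|

namespace HypSeq

variable {L lam ε : ℝ} {n : ℕ} {es eu : ℕ → Plane} {A : ℕ → Plane →L[ℝ] Plane}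

theorem L_pos (h : HypSeq L lam ε n es eu A) : 0 < L := zero_lt_one.trans_le h.one_le

theorem es_pos (h : HypSeq L lam ε n es eu A) {k : ℕ} (hk : k ≤ n) : 0 < ‖es k‖ :=
  norm_pos_iff.2 (h.es_ne k hk)

theorem eu_pos (h : HypSeq L lam ε n es eu A) {k : ℕ} (hk : k ≤ n) : 0 < ‖eu k‖ :=
  norm_pos_iff.2 (h.eu_ne k hk)

theorem wedge_ne (h : HypSeq L lam ε n es eu A) {k : ℕ} (hk : k ≤ n) :
    wedge (es k) (eu k) ≠ 0 := by
  intro h0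
  have := h.angle k hk
  rw [h0, abs_zero, mul_zero] at this
  exact absurd this (not_le.2 (mul_pos (h.es_pos hk) (h.eu_pos hk)))

theorem ratio_le (h : HypSeq L lam ε n es eu A) {k j : ℕ} (hkj : k + j ≤ n) :
    ‖eu k‖ / ‖es k‖ ≤ L ^ 2 * Real.exp (2 * ε * k - 2 * lam * j) *
      (‖eu (k + j)‖ / ‖es (k + j)‖) := by
  have hk : k ≤ n := by omega
  have hL := h.L_pos
  have h1 := h.expand k j hkj
  have h2 := h.contract k j hkj
  have hs := h.es_pos hk
  have hs' := h.es_pos hkj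
  have e1 : ‖eu k‖ ≤ L * Real.exp (ε * k - lam * j) * ‖eu (k + j)‖ := by
    have e2 : Real.exp (ε * k - lam * j) * (Real.exp (lam * j) * Real.exp (-ε * k)) = 1 := by
      rw [← Real.exp_add, ← Real.exp_add, ← Real.exp_zero]
      congr 1
      ring
    calc ‖eu k‖ = Real.exp (ε * k - lam * j) *
          (Real.exp (lam * j) * Real.exp (-ε * k) * ‖eu k‖) := by
          rw [← mul_assoc, e2, one_mul]
      _ ≤ Real.exp (ε * k - lam * j) * (L * ‖eu (k + j)‖) := by gcongr
      _ = _ := by ring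
  have e3 : ‖es (k + j)‖ ≤ L * Real.exp (ε * k - lam * j) * ‖es k‖ := by
    refine h2.trans (le_of_eq ?_)
    rw [mul_assoc L, ← Real.exp_add]
    ring_nf
  rw [← mul_div_assoc, div_le_div_iff₀ hs hs']
  calc ‖eu k‖ * ‖es (k + j)‖ ≤ (L * Real.exp (ε * k - lam * j) * ‖eu (k + j)‖) *
        (L * Real.exp (ε * k - lam * j) * ‖es k‖) := by gcongr
    _ = L ^ 2 * (Real.exp (ε * k - lam * j) * Real.exp (ε * k - lam * j)) * ‖eu (k + j)‖ *
        ‖es k‖ := by ring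
    _ = _ := by
      rw [← Real.exp_add]
      ring_nf

/-- A monotone replacement for the ratios `‖eu k‖ / ‖es k‖`: the supremum of the earlier ratios,
discounted by `exp (-5 ε k)`. It is comparable to the ratios up to factors `exp (5 ε k)`. -/
def weight (ε : ℝ) (es eu : ℕ → Plane) : ℕ →o ℝ :=
  partialSups fun i : ℕ => Real.exp (-5 * ε * i) * (‖eu i‖ / ‖es i‖)

theorem ratio_le_weight (k : ℕ) :
    ‖eu k‖ / ‖es k‖ ≤ Real.exp (5 * ε * k) * weight ε es eu k := by
  have h1 : Real.exp (-5 * ε * k) * (‖eu k‖ / ‖es k‖) ≤ weight ε es eu k :=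
    le_partialSups (fun i : ℕ => Real.exp (-5 * ε * i) * (‖eu i‖ / ‖es i‖)) k
  calc ‖eu k‖ / ‖es k‖ = Real.exp (5 * ε * k) *
        (Real.exp (-5 * ε * k) * (‖eu k‖ / ‖es k‖)) := by
        rw [← mul_assoc, ← Real.exp_add]
        ring_nf
        simp
    _ ≤ _ := by gcongr

theorem weight_zero : weight ε es eu 0 = ‖eu 0‖ / ‖es 0‖ := by
  simp [weight]

theorem weight_le (h : HypSeq L lam ε n es eu A) {k : ℕ} (hk : k ≤ n) :
    weight ε es eu k ≤ L ^ 2 * (‖eu k‖ / ‖es k‖) := by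
  refine partialSups_le _ _ _ fun i hi => ?_
  obtain ⟨j, rfl⟩ := Nat.exists_eq_add_of_le hi
  have hpos : 0 ≤ ‖eu (i + j)‖ / ‖es (i + j)‖ := by positivity
  have hL := h.L_pos
  have h1 := h.lam_pos
  have h2 := h.eps_nonneg
  calc Real.exp (-5 * ε * i) * (‖eu i‖ / ‖es i‖)
      ≤ Real.exp (-5 * ε * i) * (L ^ 2 * Real.exp (2 * ε * i - 2 * lam * j) *
      (‖eu (i + j)‖ / ‖es (i + j)‖)) := by
        gcongr
        exact h.ratio_le hk
    _ = L ^ 2 * Real.exp (-5 * ε * i + (2 * ε * i - 2 * lam * j)) *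
        (‖eu (i + j)‖ / ‖es (i + j)‖) := by
        rw [Real.exp_add]; ring
    _ ≤ L ^ 2 * 1 * (‖eu (i + j)‖ / ‖es (i + j)‖) := by
        gcongr
        rw [Real.exp_le_one_iff]
        have e1 : 0 ≤ ε * i := by positivity
        have e2 : 0 ≤ lam * j := by positivity
        linarith
    _ = _ := by rw [mul_one]

theorem weight_pos (h : HypSeq L lam ε n es eu A) {k : ℕ} (hk : k ≤ n) :
    0 < weight ε es eu k := by
  have h1 := ratio_le_weight (ε := ε) (es := es) (eu := eu) k
  have h2 : 0 < ‖eu k‖ / ‖es k‖ := div_pos (h.eu_pos hk) (h.es_pos hk)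
  have h3 := Real.exp_pos (5 * ε * k)
  by_contra hneg
  nlinarith

theorem inv_weight_zero_le (h : HypSeq L lam ε n es eu A) :
    1 ≤ L ^ 2 * weight ε es eu 0 := by
  have hs := h.es_pos (Nat.zero_le n)
  rw [weight_zero, ← mul_div_assoc, le_div_iff₀ hs, one_mul]
  have := h.es_zero_le
  have h2 := h.le_eu_zero
  have hL := h.L_pos
  nlinarith

theorem inv_weight_le (h : HypSeq L lam ε n es eu A) :
    1 ≤ L ^ 4 * Real.exp (-lam * n) * weight ε es eu n := by
  have hL := h.L_pos
  have h1 := h.inv_weight_zero_le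
  have h2 := h.ratio_le (k := 0) (j := n) (by omega)
  rw [zero_add, ← weight_zero (ε := ε)] at h2
  have h3 := ratio_le_weight (ε := ε) (es := es) (eu := eu) n
  have hw := (h.weight_pos (le_refl n)).le
  calc 1 ≤ L ^ 2 * weight ε es eu 0 := h1
    _ ≤ L ^ 2 * (L ^ 2 * Real.exp (2 * ε * (0 : ℕ) - 2 * lam * n) *
        (Real.exp (5 * ε * n) * weight ε es eu n)) := by
        gcongr
        exact h2.trans (by gcongr)
    _ = L ^ 4 * Real.exp (2 * ε * (0 : ℕ) - 2 * lam * n + 5 * ε * n) * weight ε es eu n := by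
        rw [Real.exp_add]; ring
    _ ≤ L ^ 4 * Real.exp (-lam * n) * weight ε es eu n := by
        gcongr
        have e1 : 5 * ε * n ≤ lam * n := by
          gcongr
          linarith [h.eps_le, h.eps_nonneg]
        push_cast
        linarith

variable {w : ℕ → Plane} {β : ℝ}

/-- The relative error made at time `k` by a pseudo-orbit, in adapted coordinates. -/
def relErr (L lam ε β : ℝ) (k : ℕ) : ℝ :=
  L ^ 4 * Real.exp (ε * (k + 1) + 5 * ε * k) * (β * Real.exp (-lam * k / 2))

/-- The constant in the bound of the sum of the relative errors. -/
def errConst (L lam : ℝ) : ℝ := L ^ 4 * Real.exp lam * (1 - Real.exp (-lam / 4))⁻¹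

theorem errConst_nonneg (hL : 0 < L) (hlam : 0 < lam) : 0 ≤ errConst L lam := by
  have h1 : Real.exp (-lam / 4) < 1 := by
    rw [Real.exp_lt_one_iff]
    linarith
  have : 0 ≤ (1 - Real.exp (-lam / 4))⁻¹ := inv_nonneg.2 (by linarith)
  rw [errConst]
  positivity

/-- The relative errors are summable, uniformly in the length of the sequence, because `ε` is small
with respect to `lam`. -/
theorem sum_relErr_le (h : HypSeq L lam ε n es eu A) (hβ : 0 ≤ β) (m : ℕ) :
    ∑ k ∈ Finset.range m, relErr L lam ε β k ≤ β * errConst L lam := by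
  have hL := h.L_pos
  have h1 := h.lam_pos
  have hq : Real.exp (-lam / 4) < 1 := by
    rw [Real.exp_lt_one_iff]
    linarith
  have hle : ∀ k ∈ Finset.range m, relErr L lam ε β k ≤
      β * (L ^ 4 * Real.exp lam) * Real.exp (-lam / 4) ^ k := by
    intro k _
    have e1 : Real.exp (-lam / 4) ^ k = Real.exp (k * (-lam / 4)) := (Real.exp_nat_mul _ k).symm
    rw [e1]
    calc relErr L lam ε β k = β * L ^ 4 *
          Real.exp ((ε * (k + 1) + 5 * ε * k) + (-lam * k / 2)) := by
          rw [relErr, Real.exp_add (ε * (k + 1) + 5 * ε * k)]; ring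
      _ ≤ β * L ^ 4 * Real.exp (lam + k * (-lam / 4)) := by
          refine mul_le_mul_of_nonneg_left (Real.exp_le_exp.2 ?_) (by positivity)
          have e2 : (k : ℝ) * (100 * ε) ≤ k * lam := by
            gcongr
            exact h.eps_le
          have := h.eps_le
          have := h.eps_nonneg
          have e3 : 0 ≤ (k : ℝ) * ε := by positivity
          nlinarith
      _ = _ := by rw [Real.exp_add]; ring
  refine (Finset.sum_le_sum hle).trans ?_
  have hgeom : ∑ k ∈ Finset.range m, Real.exp (-lam / 4) ^ k ≤ (1 - Real.exp (-lam / 4))⁻¹ := by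
    rw [← tsum_geometric_of_lt_one (Real.exp_nonneg _) hq]
    exact (summable_geometric_of_lt_one (Real.exp_nonneg _) hq).sum_le_tsum _
      fun i _ => by positivity
  rw [← Finset.mul_sum, errConst, mul_assoc β]
  gcongr

/-- The linear maps leave the coordinates unchanged, so their increments come from the errors of the
pseudo-orbit, which are exponentially small and dominate the subexponential angles. -/
theorem abs_coordS_succ_sub_le (h : HypSeq L lam ε n es eu A) (hβ : 0 ≤ β)
    (hw : ∀ k < n, ‖w (k + 1) - A k (w k)‖ ≤ β * Real.exp (-lam * k / 2) * ‖w k‖) {k : ℕ}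
    (hk : k < n) :
    |coordS (es (k + 1)) (eu (k + 1)) (w (k + 1)) - coordS (es k) (eu k) (w k)| ≤
        relErr L lam ε β k * (|coordS (es k) (eu k) (w k)| +
          weight ε es eu k * |coordU (es k) (eu k) (w k)|) ∧
      |coordU (es (k + 1)) (eu (k + 1)) (w (k + 1)) - coordU (es k) (eu k) (w k)| ≤
        relErr L lam ε β k * (|coordS (es k) (eu k) (w k)| / weight ε es eu k +
          |coordU (es k) (eu k) (w k)|) := by
  have hL := h.L_pos
  have hL1 := h.one_le
  have hε := h.eps_nonneg
  have hne := h.wedge_ne hk.le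
  have hne' := h.wedge_ne (Nat.succ_le_of_lt hk)
  have hs := h.es_pos hk.le
  have hu := h.eu_pos hk.le
  have hs' := h.es_pos (Nat.succ_le_of_lt hk)
  have hu' := h.eu_pos (Nat.succ_le_of_lt hk)
  have hw0 := h.weight_pos hk.le
  set X := coordS (es k) (eu k) (w k) with hX
  set Z := coordU (es k) (eu k) (w k) with hZ
  set W := weight ε es eu k with hW
  have hlin : A k (w k) = X • es (k + 1) + Z • eu (k + 1) := by
    conv_lhs => rw [← coordS_smul_add hne (w k)]
    rw [map_add, map_smul, map_smul, h.map_es k hk, h.map_eu k hk]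
  set d := w (k + 1) - A k (w k) with hd
  have hXd : coordS (es (k + 1)) (eu (k + 1)) (w (k + 1)) - X =
      coordS (es (k + 1)) (eu (k + 1)) d := by
    rw [hd, coordS_sub, hlin, coordS_comb hne']
  have hZd : coordU (es (k + 1)) (eu (k + 1)) (w (k + 1)) - Z =
      coordU (es (k + 1)) (eu (k + 1)) d := by
    rw [hd, coordU_sub, hlin, coordU_comb hne']
  have hdn : ‖d‖ ≤ β * Real.exp (-lam * k / 2) * (|X| * ‖es k‖ + |Z| * ‖eu k‖) :=
    (hw k hk).trans (by gcongr; exact norm_le_coord hne _)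
  have ha : 0 < L * Real.exp (ε * (k + 1 : ℕ)) := by positivity
  have hS := abs_coordS_le ha (h.es_ne _ hk) (h.eu_ne _ hk) (h.angle _ hk) d
  have hU := abs_coordU_le ha (h.es_ne _ hk) (h.eu_ne _ hk) (h.angle _ hk) d
  set a := L * Real.exp (ε * (k + 1 : ℕ)) with hadef
  set b := β * Real.exp (-lam * k / 2) with hb
  have hb0 : 0 ≤ b := by positivity
  have hrel : relErr L lam ε β k = L ^ 3 * a * Real.exp (5 * ε * k) * b := by
    rw [relErr, hadef, Real.exp_add]
    push_cast
    ring
  have hr1 : ‖eu k‖ / ‖es k‖ ≤ Real.exp (5 * ε * k) * W := ratio_le_weight k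
  have hr2 : ‖es k‖ / ‖eu k‖ ≤ L ^ 2 * W⁻¹ := by
    have h1 := h.weight_le hk.le
    rw [← hW, ← mul_div_assoc, le_div_iff₀ hs] at h1
    rw [← div_eq_mul_inv, div_le_div_iff₀ hu hw0]
    linarith
  have hexp : 1 ≤ Real.exp (5 * ε * k) := Real.one_le_exp (by positivity)
  have hL13 : L ≤ L ^ 3 := le_self_pow₀ hL1 (by norm_num)
  rw [hXd, hZd, hrel]
  constructor
  · calc |coordS (es (k + 1)) (eu (k + 1)) d| ≤ a * ‖d‖ / ‖es (k + 1)‖ := hS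
      _ ≤ a * (b * (|X| * ‖es k‖ + |Z| * ‖eu k‖)) / (‖es k‖ / L) := by
          gcongr
          rw [div_le_iff₀ hL]
          linarith [h.es_le k hk]
      _ = L * a * b * (|X| + ‖eu k‖ / ‖es k‖ * |Z|) := by field_simp
      _ ≤ L * a * b * (|X| + Real.exp (5 * ε * k) * W * |Z|) := by gcongr
      _ ≤ L ^ 3 * a * b * (Real.exp (5 * ε * k) * |X| + Real.exp (5 * ε * k) * W * |Z|) := by
          gcongr
          exact le_mul_of_one_le_left (abs_nonneg _) hexp
      _ = _ := by ring
  · calc |coordU (es (k + 1)) (eu (k + 1)) d| ≤ a * ‖d‖ / ‖eu (k + 1)‖ := hU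
      _ ≤ a * (b * (|X| * ‖es k‖ + |Z| * ‖eu k‖)) / (‖eu k‖ / L) := by
          gcongr
          rw [div_le_iff₀ hL]
          linarith [h.eu_le k hk]
      _ = L * a * b * (‖es k‖ / ‖eu k‖ * |X| + |Z|) := by field_simp
      _ ≤ L * a * b * (L ^ 2 * W⁻¹ * |X| + L ^ 2 * |Z|) := by
          gcongr
          exact le_mul_of_one_le_left (abs_nonneg _) (one_le_pow₀ hL1)
      _ = L ^ 3 * a * b * (|X| / W + |Z|) * 1 := by ring
      _ ≤ L ^ 3 * a * b * (|X| / W + |Z|) * Real.exp (5 * ε * k) := by gcongr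
      _ = _ := by ring

theorem relErr_nonneg (h : HypSeq L lam ε n es eu A) (hβ : 0 ≤ β) (k : ℕ) :
    0 ≤ relErr L lam ε β k := by
  have hL := h.L_pos
  rw [relErr]
  positivity

/-- The expanding coordinate of a pseudo-orbit that starts away from the contracting direction
does not decrease much. -/
theorem expanding_bound (h : HypSeq L lam ε n es eu A) (hβ : 0 ≤ β)
    (hw : ∀ k < n, ‖w (k + 1) - A k (w k)‖ ≤ β * Real.exp (-lam * k / 2) * ‖w k‖)
    {m : ℕ} (hm : m ≤ n) {a : ℝ} (ha : 0 ≤ a)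
    (h0 : |coordS (es 0) (eu 0) (w 0)| ≤ a * |coordU (es 0) (eu 0) (w 0)|)
    (hβa : 4 * (β * errConst L lam * (1 + a * L ^ 2)) ≤ 1) :
    |coordU (es 0) (eu 0) (w 0)| ≤ 2 * L * Real.exp (ε * m) * ‖w m‖ / ‖eu m‖ := by
  have hL := h.L_pos
  have key := expanding_coordinate_bound (n := m)
    (X := fun k => coordS (es k) (eu k) (w k)) (Z := fun k => coordU (es k) (eu k) (w k))
    (R := weight ε es eu) (α := relErr L lam ε β) (m := a * L ^ 2)
    (fun k hk => h.weight_pos (hk.trans hm))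
    (fun k _ => (weight ε es eu).monotone (Nat.le_succ k)) (h.relErr_nonneg hβ)
    (h.sum_relErr_le hβ m) (fun k hk => (h.abs_coordS_succ_sub_le hβ hw (hk.trans_le hm)).1)
    (fun k hk => (h.abs_coordS_succ_sub_le hβ hw (hk.trans_le hm)).2) (by positivity) (by
      refine h0.trans ?_
      have h1 := mul_le_mul_of_nonneg_right h.inv_weight_zero_le
        (mul_nonneg ha (abs_nonneg (coordU (es 0) (eu 0) (w 0))))
      linarith) hβa
  have h2 := abs_coordU_le (by positivity) (h.es_ne m hm) (h.eu_ne m hm) (h.angle m hm) (w m)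
  calc _ ≤ 2 * |coordU (es m) (eu m) (w m)| := key
    _ ≤ 2 * (L * Real.exp (ε * m) * ‖w m‖ / ‖eu m‖) := by gcongr
    _ = _ := by ring

/-- A pseudo-orbit that ends away from the expanding direction is contracted, and starts near the
contracting direction. -/
theorem contracting_bound (h : HypSeq L lam ε n es eu A) (hβ : 0 ≤ β)
    (hw : ∀ k < n, ‖w (k + 1) - A k (w k)‖ ≤ β * Real.exp (-lam * k / 2) * ‖w k‖)
    {c : ℝ} (hc : 0 < c) (hn : c * (‖w n‖ * ‖eu n‖) ≤ |wedge (w n) (eu n)|)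
    (hβc : 8 * (β * errConst L lam * (1 + L ^ 2 / c)) ≤ 1) :
    (∀ k ≤ n, ‖w k‖ ≤
        4 * (1 + L ^ 2 / c) * Real.exp (5 * ε * k) * ‖es k‖ * |coordS (es 0) (eu 0) (w 0)|) ∧
      |coordU (es 0) (eu 0) (w 0)| ≤
        (2 * (L ^ 2 / c) * L ^ 4 * Real.exp (-lam * n) +
          4 * (β * errConst L lam) * (1 + L ^ 2 / c) * L ^ 2) *
          |coordS (es 0) (eu 0) (w 0)| := by
  have hL := h.L_pos
  have hsn := h.es_pos (le_refl n)
  have hun := h.eu_pos (le_refl n)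
  -- at time `n` the first coordinate dominates the second
  have hcone : weight ε es eu n * |coordU (es n) (eu n) (w n)| ≤
      L ^ 2 / c * |coordS (es n) (eu n) (w n)| := by
    have h1 : |coordU (es n) (eu n) (w n)| * (‖eu n‖ / ‖es n‖) ≤
        |coordS (es n) (eu n) (w n)| / c := by
      have h3 : 0 < |wedge (es n) (eu n)| := abs_pos.2 (h.wedge_ne le_rfl)
      rw [coordU, coordS, abs_div, abs_div, div_mul_div_comm, div_div, div_le_div_iff₀
        (by positivity) (by positivity)]
      calc |wedge (es n) (w n)| * ‖eu n‖ * (|wedge (es n) (eu n)| * c)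
          ≤ ‖es n‖ * ‖w n‖ * ‖eu n‖ * (|wedge (es n) (eu n)| * c) := by
            gcongr
            exact abs_wedge_le _ _
        _ = c * (‖w n‖ * ‖eu n‖) * (|wedge (es n) (eu n)| * ‖es n‖) := by ring
        _ ≤ _ := by gcongr
    calc weight ε es eu n * |coordU (es n) (eu n) (w n)|
        ≤ L ^ 2 * (‖eu n‖ / ‖es n‖) * |coordU (es n) (eu n) (w n)| := by
          gcongr
          exact h.weight_le le_rfl
      _ = L ^ 2 * (|coordU (es n) (eu n) (w n)| * (‖eu n‖ / ‖es n‖)) := by ring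
      _ ≤ L ^ 2 * (|coordS (es n) (eu n) (w n)| / c) := by gcongr
      _ = _ := by ring
  obtain ⟨key1, key2⟩ := contracting_coordinate_bound (n := n)
    (X := fun k => coordS (es k) (eu k) (w k)) (Z := fun k => coordU (es k) (eu k) (w k))
    (R := weight ε es eu) (α := relErr L lam ε β) (m := L ^ 2 / c)
    (fun k hk => h.weight_pos hk)
    (fun k _ => (weight ε es eu).monotone (Nat.le_succ k)) (h.relErr_nonneg hβ)
    (h.sum_relErr_le hβ n) (fun k hk => (h.abs_coordS_succ_sub_le hβ hw hk).1)
    (fun k hk => (h.abs_coordS_succ_sub_le hβ hw hk).2) (by positivity) hcone hβc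
  have hE := errConst_nonneg hL h.lam_pos
  constructor
  · intro k hk
    have hs := h.es_pos hk
    have h1 := norm_le_coord (h.wedge_ne hk) (w k)
    have h2 := ratio_le_weight (ε := ε) (es := es) (eu := eu) k
    rw [div_le_iff₀ hs] at h2
    have hexp : 1 ≤ Real.exp (5 * ε * k) := Real.one_le_exp (by have := h.eps_nonneg; positivity)
    calc ‖w k‖ ≤ |coordS (es k) (eu k) (w k)| * ‖es k‖ +
          |coordU (es k) (eu k) (w k)| * ‖eu k‖ := h1
      _ ≤ Real.exp (5 * ε * k) * |coordS (es k) (eu k) (w k)| * ‖es k‖ +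
          |coordU (es k) (eu k) (w k)| * (Real.exp (5 * ε * k) * weight ε es eu k * ‖es k‖) := by
          gcongr
          exact le_mul_of_one_le_left (abs_nonneg _) hexp
      _ = Real.exp (5 * ε * k) * ‖es k‖ * (|coordS (es k) (eu k) (w k)| +
          weight ε es eu k * |coordU (es k) (eu k) (w k)|) := by ring
      _ ≤ Real.exp (5 * ε * k) * ‖es k‖ *
          (4 * (1 + L ^ 2 / c) * |coordS (es 0) (eu 0) (w 0)|) := by
          gcongr
          exact key1 k hk
      _ = _ := by ring
  · refine key2.trans ?_
    have e1 : 2 * (L ^ 2 / c) / weight ε es eu n ≤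
        2 * (L ^ 2 / c) * L ^ 4 * Real.exp (-lam * n) := by
      rw [div_le_iff₀ (h.weight_pos le_rfl)]
      calc 2 * (L ^ 2 / c) = 2 * (L ^ 2 / c) * 1 := by ring
        _ ≤ 2 * (L ^ 2 / c) * (L ^ 4 * Real.exp (-lam * n) * weight ε es eu n) := by
          gcongr
          exact h.inv_weight_le
        _ = _ := by ring
    have e2 : 4 * (β * errConst L lam) * (1 + L ^ 2 / c) / weight ε es eu 0 ≤
        4 * (β * errConst L lam) * (1 + L ^ 2 / c) * L ^ 2 := by
      rw [div_le_iff₀ (h.weight_pos (Nat.zero_le n)), mul_assoc _ (L ^ 2)]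
      exact le_mul_of_one_le_right (by positivity) h.inv_weight_zero_le
    gcongr

end HypSeq

end Hyperbolic

/-! ### Uniform bounds for the dynamics in charts -/

section Uniform

variable {M : Type*} [EMetricSpace M] [ChartedSpace Plane M] [IsManifold (𝓡 2) ∞ M]

/-- The map `g`, in the preferred charts at `z` and `z'`, has a derivative which is bounded by `B`
and `B`-Lipschitz on the ball of radius `B⁻¹` about the coordinates of `y`. -/
structure ChartMapBound (B : ℝ) (g : M → M) (z z' y : M) : Prop where
  ball_subset : Metric.ball (extChartAt (𝓡 2) z y) B⁻¹ ⊆ chartDomain g z z'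
  norm_fderiv : ∀ p ∈ Metric.ball (extChartAt (𝓡 2) z y) B⁻¹,
    ‖fderiv ℝ (chartMap g z z') p‖ ≤ B
  fderiv_lipschitz : ∀ p ∈ Metric.ball (extChartAt (𝓡 2) z y) B⁻¹,
    ∀ p' ∈ Metric.ball (extChartAt (𝓡 2) z y) B⁻¹,
      ‖fderiv ℝ (chartMap g z z') p - fderiv ℝ (chartMap g z z') p'‖ ≤ B * ‖p - p'‖

theorem eventually_chartMapBound {g : M → M} (hg : ContMDiff (𝓡 2) (𝓡 2) 2 g) {z z' : M}
    {K : Set M} (hK : IsCompact K) (hz : K ⊆ (chartAt Plane z).source)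
    (hz' : ∀ y ∈ K, g y ∈ (chartAt Plane z').source) :
    ∀ᶠ B : ℝ in atTop, ∀ y ∈ K, ChartMapBound B g z z' y := by
  have h1 : IsCompact (extChartAt (𝓡 2) z '' K) :=
    hK.image_of_continuousOn ((continuousOn_extChartAt z).mono (by simpa using hz))
  have h2 : extChartAt (𝓡 2) z '' K ⊆ chartDomain g z z' := by
    rintro _ ⟨y, hy, rfl⟩
    refine ⟨coord_mem_target (hz hy), ?_⟩
    rw [symm_coord (hz hy)]
    exact hz' y hy
  filter_upwards [eventually_bounds (isOpen_chartDomain hg.continuous z z') h1 h2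
    (contDiffOn_chartMap (ENat.LEInfty.out : (2 : ℕ∞ω) ≤ (∞ : ℕ∞ω)) hg z z')] with B hB y hy
  have h3 := hB _ (mem_image_of_mem _ hy)
  exact ⟨h3.1, fun p hp => (h3.2.1 p hp).2, h3.2.2⟩

variable [RiemannianBundle (fun x : M => TangentSpace (𝓡 2) x)]

/-- All the bounds, uniform over the manifold, on the charts, the metric, the area and the
dynamics. The changes of charts are controlled at the points of small balls about the cores, since
a point close to one core may lie in another one. -/
structure UniformBounds (ρ : M → ℝ) {m : ℕ} (f : Fin m → M ≃ₘ^2⟮𝓡 2, 𝓡 2⟯ M)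
    (𝒜 : FiniteAtlas M) (B : ℝ) : Prop where
  one_le : 1 ≤ B
  good : ∀ z ∈ 𝒜.centers, ∀ y ∈ 𝒜.core z, GoodChart B z y
  density_le : ∀ y, ρ y ≤ B
  le_density : ∀ y, 1 ≤ B * ρ y
  map : ∀ i, ∀ z ∈ 𝒜.centers, ∀ z' ∈ 𝒜.centers, ∀ y ∈ 𝒜.core z, f i y ∈ 𝒜.core z' →
    ChartMapBound B (f i) z z' y
  inv : ∀ i, ∀ z ∈ 𝒜.centers, ∀ z' ∈ 𝒜.centers, ∀ y ∈ 𝒜.core z, (f i).symm y ∈ 𝒜.core z' →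
    ChartMapBound B (f i).symm z z' y
  trans : ∀ z ∈ 𝒜.centers, ∀ z' ∈ 𝒜.centers, ∀ y ∈ 𝒜.core z,
    ∀ p ∈ Metric.ball (extChartAt (𝓡 2) z y) B⁻¹, (extChartAt (𝓡 2) z).symm p ∈ 𝒜.core z' →
      ChartMapBound B id z z' ((extChartAt (𝓡 2) z).symm p) ∧
        ChartMapBound B id z' z ((extChartAt (𝓡 2) z).symm p)

/-- By compactness, the bounds hold with any large constant. -/
theorem eventually_uniformBounds [CompactSpace M]
    [IsContMDiffRiemannianBundle (𝓡 2) ∞ Plane (fun x : M => TangentSpace (𝓡 2) x)]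
    {ρ : M → ℝ} (hρ : Continuous ρ) (hρpos : ∀ x, 0 < ρ x)
    {m : ℕ} (f : Fin m → M ≃ₘ^2⟮𝓡 2, 𝓡 2⟯ M) (𝒜 : FiniteAtlas M) :
    ∀ᶠ B : ℝ in atTop, UniformBounds ρ f 𝒜 B := by
  have hclosed : ∀ z ∈ 𝒜.centers, IsClosed (𝒜.core z) := fun z hz =>
    (𝒜.isCompact_core z hz).isClosed
  -- bounds for the density
  have hρ1 : ∀ᶠ B : ℝ in atTop, ∀ y, ρ y ≤ B := by
    obtain ⟨b, hb⟩ := isCompact_univ.exists_bound_of_continuousOn hρ.continuousOn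
    filter_upwards [eventually_ge_atTop b] with B hB y
    exact (le_abs_self _).trans ((hb y (mem_univ y)).trans hB)
  have hρ2 : ∀ᶠ B : ℝ in atTop, ∀ y, 1 ≤ B * ρ y := by
    obtain ⟨b, hb⟩ := isCompact_univ.exists_bound_of_continuousOn
      (hρ.inv₀ fun y => (hρpos y).ne').continuousOn
    filter_upwards [eventually_ge_atTop b] with B hB y
    have h1 := ((le_abs_self _).trans (hb y (mem_univ y))).trans hB
    rwa [Pi.inv_apply, inv_le_iff_one_le_mul₀ (hρpos y)] at h1
  -- bounds for the maps
  have hmap : ∀ g : M ≃ₘ^2⟮𝓡 2, 𝓡 2⟯ M, ∀ᶠ B : ℝ in atTop, ∀ z ∈ 𝒜.centers, ∀ z' ∈ 𝒜.centers,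
      ∀ y ∈ 𝒜.core z, g y ∈ 𝒜.core z' → ChartMapBound B g z z' y := by
    intro g
    rw [Finset.eventually_all]
    intro z hz
    rw [Finset.eventually_all]
    intro z' hz'
    have hK : IsCompact (𝒜.core z ∩ g ⁻¹' 𝒜.core z') :=
      (𝒜.isCompact_core z hz).inter_right ((hclosed z' hz').preimage g.contMDiff.continuous)
    filter_upwards [eventually_chartMapBound g.contMDiff (z := z) (z' := z') hK
      (inter_subset_left.trans (𝒜.core_subset z hz))
      (fun y hy => 𝒜.core_subset z' hz' hy.2)] with B hB y hy hy'
    exact hB y ⟨hy, hy'⟩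
  -- bounds for the changes of charts
  have htrans : ∀ᶠ B : ℝ in atTop, ∀ z ∈ 𝒜.centers, ∀ z' ∈ 𝒜.centers, ∀ y ∈ 𝒜.core z,
      ∀ p ∈ Metric.ball (extChartAt (𝓡 2) z y) B⁻¹, (extChartAt (𝓡 2) z).symm p ∈ 𝒜.core z' →
      ChartMapBound B id z z' ((extChartAt (𝓡 2) z).symm p) ∧
        ChartMapBound B id z' z ((extChartAt (𝓡 2) z).symm p) := by
    rw [Finset.eventually_all]
    intro z hz
    rw [Finset.eventually_all]
    intro z' hz'
    obtain ⟨δ, hδ, hsub⟩ := (isCompact_coord_core 𝒜 hz).exists_cthickening_subset_open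
      (isOpen_target z) (coord_core_subset 𝒜 hz)
    have hQ : IsCompact ((extChartAt (𝓡 2) z).symm ''
        Metric.cthickening δ (extChartAt (𝓡 2) z '' 𝒜.core z)) :=
      (isCompact_coord_core 𝒜 hz).cthickening.image_of_continuousOn
        ((continuousOn_extChartAt_symm z).mono hsub)
    set Q := (extChartAt (𝓡 2) z).symm ''
        Metric.cthickening δ (extChartAt (𝓡 2) z '' 𝒜.core z)
    have hQz : Q ⊆ (chartAt Plane z).source := by
      rintro _ ⟨p, hp, rfl⟩
      exact symm_mem_source (hsub hp)
    have hK : IsCompact (Q ∩ 𝒜.core z') := hQ.inter_right (hclosed z' hz')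
    have hKz : Q ∩ 𝒜.core z' ⊆ (chartAt Plane z).source := inter_subset_left.trans hQz
    have hKz' : Q ∩ 𝒜.core z' ⊆ (chartAt Plane z').source :=
      inter_subset_right.trans (𝒜.core_subset z' hz')
    filter_upwards [eventually_chartMapBound contMDiff_id (z := z) (z' := z') hK hKz
        (fun y hy => hKz' hy),
      eventually_chartMapBound contMDiff_id (z := z') (z' := z) hK hKz' (fun y hy => hKz hy),
      eventually_ge_atTop δ⁻¹] with B h1 h2 h3 y hy p hp hp'
    have hmem : (extChartAt (𝓡 2) z).symm p ∈ Q ∩ 𝒜.core z' := by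
      refine ⟨mem_image_of_mem _ ?_, hp'⟩
      refine Metric.thickening_subset_cthickening δ _ ?_
      exact Metric.ball_subset_thickening (mem_image_of_mem _ hy) δ
        (Metric.ball_subset_ball (inv_le_of_inv_le₀ hδ h3) hp)
    exact ⟨h1 _ hmem, h2 _ hmem⟩
  filter_upwards [eventually_ge_atTop 1, eventually_goodChart 𝒜, hρ1, hρ2, htrans,
    eventually_all.2 fun i => hmap (f i), eventually_all.2 fun i => hmap (f i).symm] with
    B h1 h2 h3 h4 h5 h6 h7
  exact ⟨h1, h2, h3, h4, h6, h7, h5⟩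

end Uniform

/-! ### Areas and angles in charts -/

section Area

/-- The Gram determinant of a symmetric form on the plane is a multiple `D` of the square of the
determinant, and bounds for the form give bounds for `D`. -/
theorem form_det {b : Plane →L[ℝ] Plane →L[ℝ] ℝ} (hb : ∀ u v, b u v = b v u) :
    ∃ D : ℝ, (∀ u v, b u u * b v v - b u v ^ 2 = D * wedge u v ^ 2) ∧
      ∀ B : ℝ, 0 < B → (∀ v, B⁻¹ * ‖v‖ ^ 2 ≤ b v v) → (∀ v, b v v ≤ B * ‖v‖ ^ 2) →
        (B⁻¹) ^ 2 ≤ D ∧ D ≤ B ^ 2 := by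
  let e : Fin 2 → Plane := fun i => EuclideanSpace.single i (1 : ℝ)
  have hdec : ∀ u : Plane, u = u 0 • e 0 + u 1 • e 1 := by
    intro u
    ext i
    fin_cases i <;> simp [e]
  have hexp : ∀ u v : Plane, b u v = u 0 * v 0 * b (e 0) (e 0) +
      (u 0 * v 1 + u 1 * v 0) * b (e 0) (e 1) + u 1 * v 1 * b (e 1) (e 1) := by
    intro u v
    conv_lhs => rw [hdec u, hdec v]
    simp only [map_add, map_smul, add_apply, smul_apply, smul_eq_mul]
    rw [hb (e 1) (e 0)]
    ring
  set a := b (e 0) (e 0) with ha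
  set c := b (e 1) (e 1) with hc
  set d := b (e 0) (e 1) with hd
  refine ⟨a * c - d ^ 2, fun u v => ?_, fun B hB hlow hupp => ?_⟩
  · rw [hexp u u, hexp v v, hexp u v, wedge_apply]
    ring
  have hnorm : ∀ i, ‖e i‖ = 1 := fun i => by simp [e]
  have ha1 : B⁻¹ ≤ a := by
    have := hlow (e 0)
    rwa [hnorm, one_pow, mul_one] at this
  have ha2 : a ≤ B := by
    have := hupp (e 0)
    rwa [hnorm, one_pow, mul_one] at this
  have hc2 : c ≤ B := by
    have := hupp (e 1)
    rwa [hnorm, one_pow, mul_one] at this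
  have hBi : 0 < B⁻¹ := inv_pos.2 hB
  have ha0 : 0 < a := hBi.trans_le ha1
  constructor
  · let v : Plane := (-d) • e 0 + a • e 1
    have hv0 : v 0 = -d := by simp [v, e]
    have hv1 : v 1 = a := by simp [v, e]
    have h1 := hlow v
    rw [hexp v v, hv0, hv1, EuclideanSpace.norm_sq_eq] at h1
    simp only [Fin.sum_univ_two, Real.norm_eq_abs, sq_abs, hv0, hv1] at h1
    have h2 : B⁻¹ * a ^ 2 ≤ a * (a * c - d ^ 2) := by
      have : 0 ≤ B⁻¹ * (-d) ^ 2 := by positivity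
      nlinarith
    have h3 : B⁻¹ * a ≤ a * c - d ^ 2 := by
      refine le_of_mul_le_mul_left ?_ ha0
      linarith
    nlinarith
  · have : 0 ≤ d ^ 2 := sq_nonneg d
    have : a * c ≤ a * B := mul_le_mul_of_nonneg_left hc2 ha0.le
    nlinarith

section Angle

variable {V : Type*} [NormedAddCommGroup V] [InnerProductSpace ℝ V]

theorem sin_lineAngle_mul (u v : V) :
    Real.sin (lineAngle u v) * (‖u‖ * ‖v‖) = parallelogramArea u v := by
  have h1 : Real.sin (lineAngle u v) = Real.sin (InnerProductGeometry.angle u v) := by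
    rw [lineAngle]
    rcases min_choice (InnerProductGeometry.angle u v)
      (Real.pi - InnerProductGeometry.angle u v) with h | h
    · rw [h]
    · rw [h, Real.sin_pi_sub]
  rw [h1, InnerProductGeometry.sin_angle_mul_norm_mul_norm, parallelogramArea,
    real_inner_self_eq_norm_sq, real_inner_self_eq_norm_sq, sq (inner ℝ u v)]

theorem lineAngle_nonneg (u v : V) : 0 ≤ lineAngle u v :=
  le_min (InnerProductGeometry.angle_nonneg _ _)
    (sub_nonneg.2 (InnerProductGeometry.angle_le_pi _ _))

theorem lineAngle_le (u v : V) : lineAngle u v ≤ Real.pi / 2 := by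
  rw [lineAngle]
  rcases le_total (InnerProductGeometry.angle u v) (Real.pi / 2) with h | h
  · exact (min_le_left _ _).trans h
  · exact (min_le_right _ _).trans (by linarith)

theorem lineAngle_mul_le (u v : V) :
    lineAngle u v * (‖u‖ * ‖v‖) ≤ 2 * parallelogramArea u v := by
  have h1 := Real.mul_le_sin (lineAngle_nonneg u v) (lineAngle_le u v)
  have h2 : lineAngle u v ≤ 2 * Real.sin (lineAngle u v) := by
    have h3 : 1 / 2 ≤ 2 / Real.pi := by
      rw [div_le_div_iff₀ two_pos Real.pi_pos]
      linarith [Real.pi_le_four]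
    have := mul_le_mul_of_nonneg_right h3 (lineAngle_nonneg u v)
    linarith
  rw [← sin_lineAngle_mul, ← mul_assoc 2]
  exact mul_le_mul_of_nonneg_right h2 (by positivity)

/-- The cosine of the angle with a fixed vector changes by at most the angle between the lines. -/
theorem abs_inner_le_of_lineAngle {u v : V} (hu : u ≠ 0) (hv : v ≠ 0) (w : V) :
    |inner ℝ v w| * ‖u‖ ≤ |inner ℝ u w| * ‖v‖ + lineAngle u v * (‖u‖ * ‖v‖ * ‖w‖) := by
  have hu' : 0 < ‖u‖ := norm_pos_iff.2 hu
  have hv' : 0 < ‖v‖ := norm_pos_iff.2 hv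
  have main : ∀ u : V, u ≠ 0 → |inner ℝ v w| * ‖u‖ ≤ |inner ℝ u w| * ‖v‖ +
      InnerProductGeometry.angle u v * (‖u‖ * ‖v‖ * ‖w‖) := by
    intro u hu
    have hu' : 0 < ‖u‖ := norm_pos_iff.2 hu
    have hangle := InnerProductGeometry.angle_nonneg u v
    set d := ‖u‖ • v - ‖v‖ • u with hd
    have hnd : ‖d‖ ≤ InnerProductGeometry.angle u v * (‖u‖ * ‖v‖) := by
      refine abs_le_of_sq_le_sq' ?_ (by positivity) |>.2
      have h1 : ‖d‖ ^ 2 = 2 * (‖u‖ * ‖v‖) ^ 2 *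
          (1 - Real.cos (InnerProductGeometry.angle u v)) := by
        have h2 := InnerProductGeometry.cos_angle_mul_norm_mul_norm u v
        rw [hd, norm_sub_sq_real, norm_smul, norm_smul, inner_smul_left, inner_smul_right,
          real_inner_comm, ← h2]
        simp
        ring
      have h3 := Real.one_sub_sq_div_two_le_cos (x := InnerProductGeometry.angle u v)
      rw [h1, mul_pow]
      have h4 : 0 ≤ (‖u‖ * ‖v‖) ^ 2 := by positivity
      nlinarith
    have h5 : inner ℝ d w = ‖u‖ * inner ℝ v w - ‖v‖ * inner ℝ u w := by
      rw [hd, inner_sub_left, real_inner_smul_left, real_inner_smul_left]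
    have h6 : |inner ℝ d w| ≤ InnerProductGeometry.angle u v * (‖u‖ * ‖v‖) * ‖w‖ :=
      (abs_real_inner_le_norm d w).trans (by gcongr)
    have h7 : |inner ℝ v w| * ‖u‖ - |inner ℝ u w| * ‖v‖ ≤ |inner ℝ d w| := by
      rw [h5]
      have := abs_sub_abs_le_abs_sub (‖u‖ * inner ℝ v w) (‖v‖ * inner ℝ u w)
      rw [abs_mul, abs_mul, abs_norm, abs_norm] at this
      linarith
    linarith
  rcases min_choice (InnerProductGeometry.angle u v)
      (Real.pi - InnerProductGeometry.angle u v) with h | h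
  · rw [lineAngle, h]
    exact main u hu
  · rw [lineAngle, h]
    have := main (-u) (neg_ne_zero.2 hu)
    rwa [InnerProductGeometry.angle_neg_left, norm_neg, inner_neg_left, abs_neg] at this

theorem parallelogramArea_sq (u v : V) :
    parallelogramArea u v ^ 2 = ‖u‖ ^ 2 * ‖v‖ ^ 2 - inner ℝ u v ^ 2 := by
  rw [parallelogramArea, Real.sq_sqrt]
  have h1 := abs_real_inner_le_norm u v
  have h2 := sq_le_sq' (by linarith [abs_nonneg (inner ℝ u v), neg_le_of_abs_le h1]) (le_of_abs_le h1)
  rw [mul_pow] at h2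
  linarith

theorem parallelogramArea_nonneg (u v : V) : 0 ≤ parallelogramArea u v := Real.sqrt_nonneg _

theorem parallelogramArea_le (u v : V) : parallelogramArea u v ≤ ‖u‖ * ‖v‖ := by
  refine abs_le_of_sq_le_sq' ?_ (by positivity) |>.2
  rw [parallelogramArea_sq, mul_pow]
  linarith [sq_nonneg (inner ℝ u v : ℝ)]

end Angle

variable {M : Type*} [EMetricSpace M] [ChartedSpace Plane M] [IsManifold (𝓡 2) ∞ M]
  [RiemannianBundle (fun x : M => TangentSpace (𝓡 2) x)]

/-- The Riemannian area of a parallelogram is comparable to its area in the chart. -/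
theorem GoodChart.area_bounds {B : ℝ} {z y : M} (h : GoodChart B z y) {y' : M}
    (hy : y' ∈ (chartAt Plane z).source)
    (hp : extChartAt (𝓡 2) z y' ∈ Metric.ball (extChartAt (𝓡 2) z y) B⁻¹)
    (u v : TangentSpace (𝓡 2) y') :
    |wedge (toChart z y' u) (toChart z y' v)| ≤ B * parallelogramArea u v ∧
      parallelogramArea u v ≤ B * |wedge (toChart z y' u) (toChart z y' v)| := by
  have hB := h.pos
  obtain ⟨D, hD, hD'⟩ := form_det (gram_comm z (extChartAt (𝓡 2) z y'))
  obtain ⟨h1, h2⟩ := hD' B hB (h.lower _ hp) (h.upper _ hp)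
  have h3 : parallelogramArea u v ^ 2 = D * wedge (toChart z y' u) (toChart z y' v) ^ 2 := by
    rw [parallelogramArea_sq, norm_sq_eq_gram hy, norm_sq_eq_gram hy, inner_eq_gram hy, hD]
  have h4 := parallelogramArea_nonneg u v
  set W := wedge (toChart z y' u) (toChart z y' v)
  have hW : 0 ≤ W ^ 2 := sq_nonneg W
  constructor
  · refine abs_le_of_sq_le_sq ?_ (by positivity)
    rw [mul_pow, h3]
    have h5 : 1 ≤ B ^ 2 * D := by
      have := mul_le_mul_of_nonneg_left h1 (sq_nonneg B)
      rwa [← mul_pow, mul_inv_cancel₀ hB.ne', one_pow] at this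
    nlinarith
  · refine abs_le_of_sq_le_sq' ?_ (by positivity) |>.2
    rw [mul_pow, h3, sq_abs]
    gcongr

end Area

/-! ### Orbits in charts -/

section Orbits

variable {M : Type*} [EMetricSpace M] [ChartedSpace Plane M] [IsManifold (𝓡 2) ∞ M]
variable {m : ℕ} {f : Fin m → M ≃ₘ^2⟮𝓡 2, 𝓡 2⟯ M} {wd : ℕ → Fin m}

theorem contMDiff_wordMap (n : ℕ) : ContMDiff (𝓡 2) (𝓡 2) 2 (wordMap f wd n) := by
  induction n with
  | zero => exact contMDiff_id
  | succ n ih => exact (f (wd n)).contMDiff.comp ih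

theorem mdifferentiableAt_wordMap (n : ℕ) (y : M) :
    MDifferentiableAt (𝓡 2) (𝓡 2) (wordMap f wd n) y :=
  (contMDiff_wordMap n).mdifferentiableAt two_ne_zero

theorem wordDeriv_zero (y : M) (v : TangentSpace (𝓡 2) y) : wordDeriv f wd 0 y v = v := by
  have : wordDeriv f wd 0 y = mfderiv (𝓡 2) (𝓡 2) id y := rfl
  rw [this, mfderiv_id]
  rfl

theorem wordDeriv_succ (n : ℕ) (y : M) (v : TangentSpace (𝓡 2) y) :
    wordDeriv f wd (n + 1) y v =
      mfderiv (𝓡 2) (𝓡 2) (f (wd n)) (wordMap f wd n y) (wordDeriv f wd n y v) := by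
  have h : wordDeriv f wd (n + 1) y = mfderiv (𝓡 2) (𝓡 2) (f (wd n) ∘ wordMap f wd n) y := rfl
  rw [h, mfderiv_comp y ((f (wd n)).contMDiff.mdifferentiableAt two_ne_zero)
    (mdifferentiableAt_wordMap n y)]
  rfl

/-- The coordinates of the orbit of `y`, in the preferred charts at the points `z k`. -/
def orbitPt (f : Fin m → M ≃ₘ^2⟮𝓡 2, 𝓡 2⟯ M) (wd : ℕ → Fin m) (z : ℕ → M) (y : M) (k : ℕ) :
    Plane :=
  extChartAt (𝓡 2) (z k) (wordMap f wd k y)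

/-- The coordinates of the images of a tangent vector at `y`. -/
def orbitVec (f : Fin m → M ≃ₘ^2⟮𝓡 2, 𝓡 2⟯ M) (wd : ℕ → Fin m) (z : ℕ → M) (y : M)
    (v : TangentSpace (𝓡 2) y) (k : ℕ) : Plane :=
  toChart (z k) (wordMap f wd k y) (wordDeriv f wd k y v)

/-- The map applied at time `k`, in charts. -/
def stepMap (f : Fin m → M ≃ₘ^2⟮𝓡 2, 𝓡 2⟯ M) (wd : ℕ → Fin m) (z : ℕ → M) (k : ℕ) :
    Plane → Plane :=
  chartMap (f (wd k)) (z k) (z (k + 1))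

/-- The differential of the map applied at time `k`, along the orbit of `x` and in charts. -/
def orbitMap (f : Fin m → M ≃ₘ^2⟮𝓡 2, 𝓡 2⟯ M) (wd : ℕ → Fin m) (z : ℕ → M) (x : M) (k : ℕ) :
    Plane →L[ℝ] Plane :=
  fderiv ℝ (stepMap f wd z k) (orbitPt f wd z x k)

theorem orbitPt_succ {z : ℕ → M} {y : M} {k : ℕ}
    (hy : wordMap f wd k y ∈ (chartAt Plane (z k)).source) :
    orbitPt f wd z y (k + 1) = stepMap f wd z k (orbitPt f wd z y k) := by
  rw [stepMap, chartMap, orbitPt, orbitPt, symm_coord hy]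
  rfl

theorem orbitVec_succ {z : ℕ → M} {y : M} {k : ℕ}
    (hy : wordMap f wd k y ∈ (chartAt Plane (z k)).source)
    (hy' : wordMap f wd (k + 1) y ∈ (chartAt Plane (z (k + 1))).source)
    (v : TangentSpace (𝓡 2) y) :
    orbitVec f wd z y v (k + 1) =
      fderiv ℝ (stepMap f wd z k) (orbitPt f wd z y k) (orbitVec f wd z y v k) := by
  rw [orbitVec, wordDeriv_succ]
  exact toChart_mfderiv ((f (wd k)).contMDiff.mdifferentiableAt two_ne_zero) hy hy' _

theorem orbitVec_zero (z : ℕ → M) (y : M) (v : TangentSpace (𝓡 2) y) :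
    orbitVec f wd z y v 0 = toChart (z 0) y v :=
  congrArg (toChart (z 0) y) (wordDeriv_zero y v)

/-- The points `z k` are centers of charts whose cores contain the orbit of `x`. -/
def IsItinerary (f : Fin m → M ≃ₘ^2⟮𝓡 2, 𝓡 2⟯ M) (wd : ℕ → Fin m) (𝒜 : FiniteAtlas M) (x : M)
    (z : ℕ → M) : Prop :=
  ∀ k, z k ∈ 𝒜.centers ∧ wordMap f wd k x ∈ 𝒜.core (z k)

theorem exists_itinerary (f : Fin m → M ≃ₘ^2⟮𝓡 2, 𝓡 2⟯ M) (wd : ℕ → Fin m) (𝒜 : FiniteAtlas M)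
    (x : M) : ∃ z, IsItinerary f wd 𝒜 x z := by
  choose z hz hz' using 𝒜.cover
  exact ⟨fun k => z (wordMap f wd k x), fun k => ⟨hz _, hz' _⟩⟩

/-- The first `n` points of the orbit of `y` are very close to those of the orbit of `x`, more and
more so. -/
def InTube (f : Fin m → M ≃ₘ^2⟮𝓡 2, 𝓡 2⟯ M) (wd : ℕ → Fin m) (x : M) (β lam : ℝ) (n : ℕ)
    (y : M) : Prop :=
  ∀ k ≤ n, edist (wordMap f wd k x) (wordMap f wd k y) ≤
    ENNReal.ofReal (β * Real.exp (-lam * k / 2))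

variable [RiemannianBundle (fun x : M => TangentSpace (𝓡 2) x)] {ρ : M → ℝ} {𝒜 : FiniteAtlas M}
  {B : ℝ} {x : M} {z : ℕ → M}

theorem UniformBounds.pos (h : UniformBounds ρ f 𝒜 B) : 0 < B := zero_lt_one.trans_le h.one_le

theorem UniformBounds.goodChart (h : UniformBounds ρ f 𝒜 B) (hz : IsItinerary f wd 𝒜 x z) (k : ℕ) :
    GoodChart B (z k) (wordMap f wd k x) :=
  h.good _ (hz k).1 _ (hz k).2

theorem UniformBounds.stepMap_bound (h : UniformBounds ρ f 𝒜 B) (hz : IsItinerary f wd 𝒜 x z)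
    (k : ℕ) : ChartMapBound B (f (wd k)) (z k) (z (k + 1)) (wordMap f wd k x) :=
  h.map _ _ (hz k).1 _ (hz (k + 1)).1 _ (hz k).2 (hz (k + 1)).2

theorem UniformBounds.differentiableAt_stepMap (h : UniformBounds ρ f 𝒜 B)
    (hz : IsItinerary f wd 𝒜 x z) {k : ℕ} {p : Plane}
    (hp : p ∈ Metric.ball (orbitPt f wd z x k) B⁻¹) : DifferentiableAt ℝ (stepMap f wd z k) p :=
  ((contDiffOn_chartMap (ENat.LEInfty.out : (2 : ℕ∞ω) ≤ (∞ : ℕ∞ω)) (f (wd k)).contMDiff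
    _ _).contDiffAt ((isOpen_chartDomain (f (wd k)).contMDiff.continuous _ _).mem_nhds
      ((h.stepMap_bound hz k).ball_subset hp))).differentiableAt two_ne_zero

theorem UniformBounds.orbitMap_sub_le (h : UniformBounds ρ f 𝒜 B)
    (hz : IsItinerary f wd 𝒜 x z) {k : ℕ} {p : Plane}
    (hp : p ∈ Metric.ball (orbitPt f wd z x k) B⁻¹) :
    ‖fderiv ℝ (stepMap f wd z k) p - orbitMap f wd z x k‖ ≤
      B * ‖p - orbitPt f wd z x k‖ :=
  (h.stepMap_bound hz k).fderiv_lipschitz p hp _ (Metric.mem_ball_self (_root_.inv_pos.2 h.pos))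

/-- The inverse of `f` has a bounded derivative, so the differential of `f` cannot contract much. -/
theorem UniformBounds.norm_le_orbitMap (h : UniformBounds ρ f 𝒜 B)
    (hz : IsItinerary f wd 𝒜 x z) (k : ℕ) (v : Plane) :
    ‖v‖ ≤ B * ‖orbitMap f wd z x k v‖ := by
  have hs := (h.goodChart hz k).mem_source
  have hs' := (h.goodChart hz (k + 1)).mem_source
  have hg : wordMap f wd (k + 1) x = f (wd k) (wordMap f wd k x) := rfl
  have hinv : (f (wd k)).symm (wordMap f wd (k + 1) x) = wordMap f wd k x := by
    rw [hg]
    exact (f (wd k)).symm_apply_apply _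
  have hb := h.inv (wd k) _ (hz (k + 1)).1 _ (hz k).1 _ (hz (k + 1)).2 (by
    rw [hinv]; exact (hz k).2)
  obtain ⟨u, rfl⟩ := ofChart_surjective hs v
  have h1 := toChart_mfderiv (g := f (wd k)) (z := z k) (z' := z (k + 1))
    ((f (wd k)).contMDiff.mdifferentiableAt two_ne_zero) hs hs' u
  have h2 := toChart_mfderiv (g := (f (wd k)).symm) (z := z (k + 1)) (z' := z k)
    ((f (wd k)).symm.contMDiff.mdifferentiableAt two_ne_zero) hs' (by rw [hinv]; exact hs)
    (mfderiv (𝓡 2) (𝓡 2) (f (wd k)) (wordMap f wd k x) u)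
  have h3 : toChart (z k) ((f (wd k)).symm (wordMap f wd (k + 1) x))
      (mfderiv (𝓡 2) (𝓡 2) (f (wd k)).symm (wordMap f wd (k + 1) x)
        (mfderiv (𝓡 2) (𝓡 2) (f (wd k)) (wordMap f wd k x) u)) =
      toChart (z k) (wordMap f wd k x) u := by
    have h4 := mfderiv_comp (wordMap f wd k x)
      ((f (wd k)).symm.contMDiff.mdifferentiableAt (x := f (wd k) (wordMap f wd k x)) two_ne_zero)
      ((f (wd k)).contMDiff.mdifferentiableAt (x := wordMap f wd k x) two_ne_zero)
    have h5 : (f (wd k)).symm ∘ f (wd k) = (id : M → M) :=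
      funext fun y => (f (wd k)).symm_apply_apply y
    have h6 : ∀ (g : M → M) (_ : g = id) (w : TangentSpace (𝓡 2) (wordMap f wd k x)),
        toChart (z k) (g (wordMap f wd k x)) (mfderiv (𝓡 2) (𝓡 2) g (wordMap f wd k x) w) =
          toChart (z k) (wordMap f wd k x) w := by
      rintro g rfl w
      rw [mfderiv_id]
      rfl
    have h7 := h6 _ h5 u
    rw [h4] at h7
    exact h7
  rw [h3] at h2
  have h8 : orbitMap f wd z x k (toChart (z k) (wordMap f wd k x) u) =
      toChart (z (k + 1)) (f (wd k) (wordMap f wd k x))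
        (mfderiv (𝓡 2) (𝓡 2) (f (wd k)) (wordMap f wd k x) u) := h1.symm
  rw [h8]
  conv_lhs => rw [h2]
  exact (ContinuousLinearMap.le_opNorm _ _).trans
    (mul_le_mul_of_nonneg_right (hb.norm_fderiv _ (Metric.mem_ball_self (_root_.inv_pos.2 h.pos)))
      (norm_nonneg _))

theorem orbitVec_succ_self (h : UniformBounds ρ f 𝒜 B) (hz : IsItinerary f wd 𝒜 x z) (k : ℕ)
    (v : TangentSpace (𝓡 2) x) :
    orbitVec f wd z x v (k + 1) = orbitMap f wd z x k (orbitVec f wd z x v k) :=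
  orbitVec_succ (h.goodChart hz k).mem_source (h.goodChart hz (k + 1)).mem_source v

theorem orbitVec_ne_zero (h : UniformBounds ρ f 𝒜 B) (hz : IsItinerary f wd 𝒜 x z)
    {v : TangentSpace (𝓡 2) x} (hv : v ≠ 0) (k : ℕ) : orbitVec f wd z x v k ≠ 0 := by
  induction k with
  | zero =>
    intro h0
    rw [orbitVec, wordDeriv_zero] at h0
    exact hv (toChart_injective (h.goodChart hz 0).mem_source (h0.trans (map_zero _).symm))
  | succ k ih =>
    intro h0
    rw [orbitVec_succ_self h hz] at h0
    have := h.norm_le_orbitMap hz k (orbitVec f wd z x v k)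
    rw [h0, norm_zero, mul_zero] at this
    exact ih (norm_le_zero_iff.1 this)

theorem norm_orbitVec_le (h : UniformBounds ρ f 𝒜 B) (hz : IsItinerary f wd 𝒜 x z)
    (v : TangentSpace (𝓡 2) x) (k : ℕ) : ‖orbitVec f wd z x v k‖ ≤ B * ‖wordDeriv f wd k x v‖ :=
  (h.goodChart hz k).norm_toChart_le (h.goodChart hz k).mem_source
    (Metric.mem_ball_self (_root_.inv_pos.2 h.pos)) _

theorem norm_wordDeriv_zero (y : M) (v : TangentSpace (𝓡 2) y) :
    ‖wordDeriv f wd 0 y v‖ = ‖v‖ :=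
  congrArg (fun w : TangentSpace (𝓡 2) y => ‖w‖) (wordDeriv_zero y v)

theorem le_norm_orbitVec (h : UniformBounds ρ f 𝒜 B) (hz : IsItinerary f wd 𝒜 x z)
    (v : TangentSpace (𝓡 2) x) (k : ℕ) : ‖wordDeriv f wd k x v‖ ≤ B * ‖orbitVec f wd z x v k‖ :=
  (h.goodChart hz k).norm_le_toChart (h.goodChart hz k).mem_source
    (Metric.mem_ball_self (_root_.inv_pos.2 h.pos)) _

/-- A tempered splitting gives a tempered splitting in charts. -/
theorem hypSeq_of_tempered (h : UniformBounds ρ f 𝒜 B) (hz : IsItinerary f wd 𝒜 x z)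
    {C lam ε : ℝ} {n : ℕ} (hC : 0 ≤ C) (hlam : 0 < lam) (hε : 0 ≤ ε) (hε' : 100 * ε ≤ lam)
    {es eu : TangentSpace (𝓡 2) x} (hes : ‖es‖ = 1) (heu : ‖eu‖ = 1)
    (hexp : ∀ k j : ℕ, k + j ≤ n →
      Real.exp (-C) * Real.exp (lam * j) * Real.exp (-ε * k) * ‖wordDeriv f wd k x eu‖ ≤
        ‖wordDeriv f wd (k + j) x eu‖)
    (hcon : ∀ k j : ℕ, k + j ≤ n →
      ‖wordDeriv f wd (k + j) x es‖ ≤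
        Real.exp C * Real.exp (-lam * j) * Real.exp (ε * k) * ‖wordDeriv f wd k x es‖)
    (hang : ∀ k : ℕ, k ≤ n →
      Real.exp (-C) * Real.exp (-ε * k) ≤
        lineAngle (wordDeriv f wd k x es) (wordDeriv f wd k x eu)) :
    HypSeq (2 * B ^ 3 * Real.exp C) lam ε n (orbitVec f wd z x es) (orbitVec f wd z x eu)
      (orbitMap f wd z x) := by
  have hB := h.pos
  have hB1 := h.one_le
  have hexpC : 1 ≤ Real.exp C := Real.one_le_exp hC
  have hCC : Real.exp C * Real.exp (-C) = 1 := by rw [← Real.exp_add]; simp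
  have hBL : B ≤ 2 * B ^ 3 * Real.exp C := by
    have h1 : B ≤ B ^ 3 := le_self_pow₀ hB1 (by norm_num)
    have h2 : B ^ 3 * 1 ≤ B ^ 3 * Real.exp C := by gcongr
    nlinarith [pow_pos hB 3]
  have hB2L : B ^ 2 * Real.exp C ≤ 2 * B ^ 3 * Real.exp C := by
    have h1 : B ^ 2 ≤ B ^ 3 := pow_le_pow_right₀ hB1 (by norm_num)
    gcongr
    nlinarith [pow_pos hB 3]
  have hes0 : es ≠ 0 := fun h0 => by simp [h0] at hes
  have heu0 : eu ≠ 0 := fun h0 => by simp [h0] at heu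
  have hzero : ∀ v : TangentSpace (𝓡 2) x, ‖v‖ = 1 → ‖orbitVec f wd z x v 0‖ ≤ B ∧
      1 ≤ B * ‖orbitVec f wd z x v 0‖ := by
    intro v hv
    have h1 := norm_orbitVec_le h hz v 0
    have h2 := le_norm_orbitVec h hz v 0
    rw [norm_wordDeriv_zero, hv] at h1 h2
    exact ⟨by linarith, h2⟩
  refine
    { one_le := hB1.trans hBL
      lam_pos := hlam
      eps_nonneg := hε
      eps_le := hε'
      es_ne := fun k _ => orbitVec_ne_zero h hz hes0 k
      eu_ne := fun k _ => orbitVec_ne_zero h hz heu0 k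
      map_es := fun k _ => (orbitVec_succ_self h hz k es).symm
      map_eu := fun k _ => (orbitVec_succ_self h hz k eu).symm
      es_le := fun k _ => ?_
      eu_le := fun k _ => ?_
      es_zero_le := (hzero es hes).1.trans hBL
      le_es_zero := (hzero es hes).2.trans (by gcongr)
      eu_zero_le := (hzero eu heu).1.trans hBL
      le_eu_zero := (hzero eu heu).2.trans (by gcongr)
      expand := fun k j hkj => ?_
      contract := fun k j hkj => ?_
      angle := fun k hk => ?_ }
  · rw [orbitVec_succ_self h hz]
    exact (h.norm_le_orbitMap hz k _).trans (by gcongr)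
  · rw [orbitVec_succ_self h hz]
    exact (h.norm_le_orbitMap hz k _).trans (by gcongr)
  · calc Real.exp (lam * j) * Real.exp (-ε * k) * ‖orbitVec f wd z x eu k‖
        ≤ Real.exp (lam * j) * Real.exp (-ε * k) * (B * ‖wordDeriv f wd k x eu‖) := by
          gcongr
          exact norm_orbitVec_le h hz eu k
      _ = B * Real.exp C * (Real.exp (-C) * Real.exp (lam * j) * Real.exp (-ε * k) *
          ‖wordDeriv f wd k x eu‖) := by
          linear_combination -B * Real.exp (lam * j) * Real.exp (-ε * k) *
            ‖wordDeriv f wd k x eu‖ * hCC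
      _ ≤ B * Real.exp C * (B * ‖orbitVec f wd z x eu (k + j)‖) := by
          exact mul_le_mul_of_nonneg_left
            ((hexp k j hkj).trans (le_norm_orbitVec h hz eu (k + j))) (by positivity)
      _ = B ^ 2 * Real.exp C * ‖orbitVec f wd z x eu (k + j)‖ := by ring
      _ ≤ _ := by gcongr
  · calc ‖orbitVec f wd z x es (k + j)‖ ≤ B * ‖wordDeriv f wd (k + j) x es‖ :=
          norm_orbitVec_le h hz es (k + j)
      _ ≤ B * (Real.exp C * Real.exp (-lam * j) * Real.exp (ε * k) *
          (B * ‖orbitVec f wd z x es k‖)) := by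
          gcongr
          refine (hcon k j hkj).trans ?_
          gcongr
          exact le_norm_orbitVec h hz es k
      _ = (B ^ 2 * Real.exp C) * Real.exp (-lam * j) * Real.exp (ε * k) *
          ‖orbitVec f wd z x es k‖ := by ring
      _ ≤ _ := by gcongr
  · have h1 := hang k hk
    have h2 := lineAngle_mul_le (wordDeriv f wd k x es) (wordDeriv f wd k x eu)
    have h3 := ((h.goodChart hz k).area_bounds (h.goodChart hz k).mem_source
      (Metric.mem_ball_self (_root_.inv_pos.2 h.pos)) (wordDeriv f wd k x es)
      (wordDeriv f wd k x eu)).2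
    have hee : Real.exp (ε * k) * Real.exp (-ε * k) = 1 := by rw [← Real.exp_add]; simp
    set s := ‖wordDeriv f wd k x es‖ with hs
    set u := ‖wordDeriv f wd k x eu‖ with hu
    have h4 : Real.exp (-C) * Real.exp (-ε * k) * (s * u) ≤ 2 * (B *
        |wedge (orbitVec f wd z x es k) (orbitVec f wd z x eu k)|) := by
      refine (mul_le_mul_of_nonneg_right h1 (by positivity)).trans (h2.trans ?_)
      gcongr
      exact h3
    calc ‖orbitVec f wd z x es k‖ * ‖orbitVec f wd z x eu k‖ ≤ (B * s) * (B * u) := by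
          gcongr
          · exact norm_orbitVec_le h hz es k
          · exact norm_orbitVec_le h hz eu k
      _ = B ^ 2 * Real.exp C * Real.exp (ε * k) *
          (Real.exp (-C) * Real.exp (-ε * k) * (s * u)) := by
          linear_combination -B ^ 2 * s * u * hCC - B ^ 2 * s * u * Real.exp C * Real.exp (-C) * hee
      _ ≤ B ^ 2 * Real.exp C * Real.exp (ε * k) * (2 * (B *
        |wedge (orbitVec f wd z x es k) (orbitVec f wd z x eu k)|)) := by gcongr
      _ = _ := by ring

end Orbits

/-! ### Tempered splittings along an orbit -/

section MostContracted

variable {V W : Type*} [NormedAddCommGroup V] [InnerProductSpace ℝ V]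
  [NormedAddCommGroup W] [InnerProductSpace ℝ W] {A : V →L[ℝ] W} {S : Submodule ℝ V}

theorem IsMostContracted.exists_ne_zero (h : IsMostContracted A S) : ∃ v ∈ S, v ≠ 0 := by
  have : Nontrivial S := Module.nontrivial_of_finrank_pos (R := ℝ) (by rw [h.1]; exact one_pos)
  obtain ⟨⟨v, hv⟩, hne⟩ := exists_ne (0 : S)
  exact ⟨v, hv, fun h0 => hne (Subtype.ext h0)⟩

theorem IsMostContracted.norm_mul_le (h : IsMostContracted A S) {v : V} (hv : v ∈ S) (w : V) :
    ‖A v‖ * ‖w‖ ≤ ‖A w‖ * ‖v‖ := by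
  rcases eq_or_ne v 0 with rfl | hv0
  · simp
  by_cases hw : w ∈ S
  · obtain ⟨c, rfl⟩ : ∃ c : ℝ, c • v = w := by
      have := (finrank_eq_one_iff_of_nonzero' (⟨v, hv⟩ : S) (by simpa using hv0)).1 h.1 ⟨w, hw⟩
      obtain ⟨c, hc⟩ := this
      exact ⟨c, congrArg Subtype.val hc⟩
    rw [map_smul, norm_smul, norm_smul]
    exact le_of_eq (by ring)
  · exact (h.2 v hv hv0 w hw).le

/-- The map `A` maps vectors orthogonal to the most contracted direction to vectors orthogonal to
its image. -/
theorem IsMostContracted.inner_map (h : IsMostContracted A S) {v : V} (hv : v ∈ S) (w : V) :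
    inner ℝ (A v) (A w) * ‖v‖ ^ 2 = inner ℝ v w * ‖A v‖ ^ 2 := by
  -- the derivative of `t ↦ ‖A (v + t w)‖² ‖v‖² - ‖A v‖² ‖v + t w‖²` vanishes at its minimum
  have key : ∀ t : ℝ, 0 ≤ 2 * (inner ℝ (A v) (A w) * ‖v‖ ^ 2 - inner ℝ v w * ‖A v‖ ^ 2) * t +
      (‖A w‖ ^ 2 * ‖v‖ ^ 2 - ‖A v‖ ^ 2 * ‖w‖ ^ 2) * t ^ 2 := by
    intro t
    have h1 := h.norm_mul_le hv (v + t • w)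
    have h2 : (‖A v‖ * ‖v + t • w‖) ^ 2 ≤ (‖A (v + t • w)‖ * ‖v‖) ^ 2 := by gcongr
    rw [mul_pow, mul_pow, map_add, map_smul, norm_add_sq_real, norm_add_sq_real, inner_smul_right,
      inner_smul_right, norm_smul, norm_smul, mul_pow, mul_pow, Real.norm_eq_abs, sq_abs] at h2
    linarith
  have h1 : discrim (‖A w‖ ^ 2 * ‖v‖ ^ 2 - ‖A v‖ ^ 2 * ‖w‖ ^ 2)
      (2 * (inner ℝ (A v) (A w) * ‖v‖ ^ 2 - inner ℝ v w * ‖A v‖ ^ 2)) 0 ≤ 0 :=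
    discrim_le_zero fun t => by linarith [key t]
  rw [discrim] at h1
  have h2 : (inner ℝ (A v) (A w) * ‖v‖ ^ 2 - inner ℝ v w * ‖A v‖ ^ 2) ^ 2 ≤ 0 := by linarith
  have h3 := pow_eq_zero_iff two_ne_zero |>.1 (le_antisymm h2 (sq_nonneg _))
  linarith

end MostContracted

theorem HypSeq.mono {L lam ε : ℝ} {n n' : ℕ} {es eu : ℕ → Plane} {A : ℕ → Plane →L[ℝ] Plane}
    (h : HypSeq L lam ε n' es eu A) (hn : n ≤ n') : HypSeq L lam ε n es eu A where
  one_le := h.one_le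
  lam_pos := h.lam_pos
  eps_nonneg := h.eps_nonneg
  eps_le := h.eps_le
  es_ne k hk := h.es_ne k (hk.trans hn)
  eu_ne k hk := h.eu_ne k (hk.trans hn)
  map_es k hk := h.map_es k (hk.trans_le hn)
  map_eu k hk := h.map_eu k (hk.trans_le hn)
  es_le k hk := h.es_le k (hk.trans_le hn)
  eu_le k hk := h.eu_le k (hk.trans_le hn)
  es_zero_le := h.es_zero_le
  le_es_zero := h.le_es_zero
  eu_zero_le := h.eu_zero_le
  le_eu_zero := h.le_eu_zero
  expand k j hk := h.expand k j (hk.trans hn)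
  contract k j hk := h.contract k j (hk.trans hn)
  angle k hk := h.angle k (hk.trans hn)

theorem HypSeq.es_bound {L lam ε : ℝ} {n : ℕ} {es eu : ℕ → Plane} {A : ℕ → Plane →L[ℝ] Plane}
    (h : HypSeq L lam ε n es eu A) {k : ℕ} (hk : k ≤ n) : ‖es k‖ ≤ L ^ 2 * Real.exp (-lam * k) := by
  have h1 := h.contract 0 k (by omega)
  have hL := h.L_pos
  simp only [zero_add, Nat.cast_zero, mul_zero, Real.exp_zero, mul_one] at h1
  calc ‖es k‖ ≤ L * Real.exp (-lam * k) * ‖es 0‖ := h1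
    _ ≤ L * Real.exp (-lam * k) * L := by gcongr; exact h.es_zero_le
    _ = _ := by ring

theorem HypSeq.eu_bound {L lam ε : ℝ} {n : ℕ} {es eu : ℕ → Plane} {A : ℕ → Plane →L[ℝ] Plane}
    (h : HypSeq L lam ε n es eu A) {k : ℕ} (hk : k ≤ n) : Real.exp (lam * k) ≤ L ^ 2 * ‖eu k‖ := by
  have h1 := h.expand 0 k (by omega)
  have hL := h.L_pos
  simp only [zero_add, Nat.cast_zero, mul_zero, Real.exp_zero, mul_one] at h1
  calc Real.exp (lam * k) = Real.exp (lam * k) * 1 := (mul_one _).symm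
    _ ≤ Real.exp (lam * k) * (L * ‖eu 0‖) := by gcongr; exact h.le_eu_zero
    _ = L * (Real.exp (lam * k) * ‖eu 0‖) := by ring
    _ ≤ L * (L * ‖eu k‖) := by gcongr
    _ = _ := by ring

section Splitting

variable {M : Type*} [EMetricSpace M] [ChartedSpace Plane M] [IsManifold (𝓡 2) ∞ M]
variable {m : ℕ} {f : Fin m → M ≃ₘ^2⟮𝓡 2, 𝓡 2⟯ M} {wd : ℕ → Fin m}
  [RiemannianBundle (fun x : M => TangentSpace (𝓡 2) x)] {ρ : M → ℝ} {𝒜 : FiniteAtlas M}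
  {B : ℝ} {x : M} {z : ℕ → M}

/-- The unit vectors `es`, `eu` at `x` define, in charts, a tempered splitting along the orbit. -/
structure IsSplitting (f : Fin m → M ≃ₘ^2⟮𝓡 2, 𝓡 2⟯ M) (wd : ℕ → Fin m) (z : ℕ → M) (x : M)
    (L lam ε : ℝ) (n : ℕ) (es eu : TangentSpace (𝓡 2) x) : Prop where
  norm_es : ‖es‖ = 1
  norm_eu : ‖eu‖ = 1
  hyp : HypSeq L lam ε n (orbitVec f wd z x es) (orbitVec f wd z x eu) (orbitMap f wd z x)

variable {L lam ε : ℝ} {n : ℕ} {es eu : TangentSpace (𝓡 2) x}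

theorem IsSplitting.mono {n' : ℕ} (h : IsSplitting f wd z x L lam ε n' es eu) (hn : n ≤ n') :
    IsSplitting f wd z x L lam ε n es eu :=
  ⟨h.norm_es, h.norm_eu, h.hyp.mono hn⟩

theorem wordMap_preservesArea (hf : ∀ i, PreservesArea ρ (f i)) (n : ℕ) :
    PreservesArea ρ (wordMap f wd n) := by
  induction n with
  | zero =>
    intro y u v
    have h1 : ∀ w : TangentSpace (𝓡 2) y, mfderiv (𝓡 2) (𝓡 2) (wordMap f wd 0) y w = w :=
      wordDeriv_zero y
    have h2 := congrArg₂ (fun a b : TangentSpace (𝓡 2) y => ρ y * parallelogramArea a b)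
      (h1 u) (h1 v)
    exact h2
  | succ n ih =>
    intro y u v
    have h1 : ∀ w : TangentSpace (𝓡 2) y, mfderiv (𝓡 2) (𝓡 2) (wordMap f wd (n + 1)) y w =
        mfderiv (𝓡 2) (𝓡 2) (f (wd n)) (wordMap f wd n y) (wordDeriv f wd n y w) :=
      wordDeriv_succ n y
    rw [h1, h1]
    exact (hf (wd n) _ _ _).trans (ih y u v)

/-- Preservation of the area: the product of contraction and expansion is at most subexponential,
because the angle of the splitting is at least so. -/
theorem IsSplitting.norm_mul_norm_le (hs : IsSplitting f wd z x L lam ε n es eu)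
    (h : UniformBounds ρ f 𝒜 B) (hz : IsItinerary f wd 𝒜 x z)
    (hf : ∀ i, PreservesArea ρ (f i)) :
    ‖orbitVec f wd z x es n‖ * ‖orbitVec f wd z x eu n‖ ≤ L * B ^ 3 * Real.exp (ε * n) := by
  have hB := h.pos
  have hL := hs.hyp.L_pos
  have h1 := hs.hyp.angle n le_rfl
  have h2 := ((h.goodChart hz n).area_bounds (h.goodChart hz n).mem_source
      (Metric.mem_ball_self (_root_.inv_pos.2 h.pos)) (wordDeriv f wd n x es)
      (wordDeriv f wd n x eu)).1
  have h3 : ρ (wordMap f wd n x) * parallelogramArea (wordDeriv f wd n x es)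
      (wordDeriv f wd n x eu) = ρ x * parallelogramArea es eu :=
    wordMap_preservesArea hf n x es eu
  have h4 : parallelogramArea es eu ≤ 1 := by
    have := parallelogramArea_le es eu
    rwa [hs.norm_es, hs.norm_eu, one_mul] at this
  have h5 := parallelogramArea_nonneg (wordDeriv f wd n x es) (wordDeriv f wd n x eu)
  have h5' := parallelogramArea_nonneg es eu
  have h6 := h.le_density (wordMap f wd n x)
  have h7 := h.density_le x
  have h8 : parallelogramArea (wordDeriv f wd n x es) (wordDeriv f wd n x eu) ≤ B ^ 2 := by
    calc parallelogramArea (wordDeriv f wd n x es) (wordDeriv f wd n x eu)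
        = 1 * parallelogramArea (wordDeriv f wd n x es) (wordDeriv f wd n x eu) := (one_mul _).symm
      _ ≤ B * ρ (wordMap f wd n x) *
          parallelogramArea (wordDeriv f wd n x es) (wordDeriv f wd n x eu) := by gcongr
      _ = B * (ρ x * parallelogramArea es eu) := by rw [mul_assoc, h3]
      _ ≤ B * (B * 1) := by gcongr
      _ = B ^ 2 := by ring
  calc _ ≤ L * Real.exp (ε * n) * |wedge (orbitVec f wd z x es n) (orbitVec f wd z x eu n)| := h1
    _ ≤ L * Real.exp (ε * n) * (B * B ^ 2) := by
      gcongr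
      exact h2.trans (by gcongr)
    _ = _ := by ring

theorem orbitVec_comb (a b : ℝ) (u v : TangentSpace (𝓡 2) x) (k : ℕ) :
    orbitVec f wd z x (a • u + b • v) k =
      a • orbitVec f wd z x u k + b • orbitVec f wd z x v k := by
  simp [orbitVec]

theorem IsSplitting.angle_zero (hs : IsSplitting f wd z x L lam ε n es eu) :
    ‖orbitVec f wd z x es 0‖ * ‖orbitVec f wd z x eu 0‖ ≤
      L * |wedge (orbitVec f wd z x es 0) (orbitVec f wd z x eu 0)| := by
  have := hs.hyp.angle 0 (Nat.zero_le n)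
  simpa using this

/-- The coordinates of a vector in the basis `es`, `eu`, which can be computed in the chart. -/
theorem IsSplitting.exists_comb (hs : IsSplitting f wd z x L lam ε n es eu)
    (h : UniformBounds ρ f 𝒜 B) (hz : IsItinerary f wd 𝒜 x z) (v : TangentSpace (𝓡 2) x) :
    ∃ a b : ℝ, v = a • es + b • eu ∧
      coordS (orbitVec f wd z x es 0) (orbitVec f wd z x eu 0) (toChart (z 0) x v) = a ∧
      coordU (orbitVec f wd z x es 0) (orbitVec f wd z x eu 0) (toChart (z 0) x v) = b ∧
      |a| ≤ L ^ 2 * ‖toChart (z 0) x v‖ ∧ |b| ≤ L ^ 2 * ‖toChart (z 0) x v‖ := by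
  have hL := hs.hyp.L_pos
  have hne := hs.hyp.wedge_ne (Nat.zero_le n)
  refine ⟨_, _, ?_, rfl, rfl, ?_, ?_⟩
  · refine toChart_injective (h.goodChart hz 0).mem_source ?_
    change toChart (z 0) x v = toChart (z 0) x _
    rw [map_add, map_smul, map_smul, ← orbitVec_zero (f := f) (wd := wd) z x es,
      ← orbitVec_zero (f := f) (wd := wd) z x eu]
    exact (coordS_smul_add hne _).symm
  · refine (abs_coordS_le hL (hs.hyp.es_ne 0 (Nat.zero_le n)) (hs.hyp.eu_ne 0 (Nat.zero_le n))
      hs.angle_zero _).trans ?_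
    rw [div_le_iff₀ (hs.hyp.es_pos (Nat.zero_le n))]
    have h1 := mul_le_mul_of_nonneg_left hs.hyp.le_es_zero
      (mul_nonneg hL.le (norm_nonneg (toChart (z 0) x v)))
    linarith
  · refine (abs_coordU_le hL (hs.hyp.es_ne 0 (Nat.zero_le n)) (hs.hyp.eu_ne 0 (Nat.zero_le n))
      hs.angle_zero _).trans ?_
    rw [div_le_iff₀ (hs.hyp.eu_pos (Nat.zero_le n))]
    have h1 := mul_le_mul_of_nonneg_left hs.hyp.le_eu_zero
      (mul_nonneg hL.le (norm_nonneg (toChart (z 0) x v)))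
    linarith

theorem IsSplitting.norm_wordDeriv_le (hs : IsSplitting f wd z x L lam ε n es eu)
    (h : UniformBounds ρ f 𝒜 B) (hz : IsItinerary f wd 𝒜 x z) :
    ‖wordDeriv f wd n x‖ ≤ 2 * B ^ 2 * L ^ 6 * ‖orbitVec f wd z x eu n‖ := by
  have hB := h.pos
  have hL := hs.hyp.L_pos
  have hL1 := hs.hyp.one_le
  have hlam := hs.hyp.lam_pos
  refine ContinuousLinearMap.opNorm_le_bound _ (by positivity) fun v => ?_
  obtain ⟨a, b, hv, -, -, ha, hb⟩ := hs.exists_comb h hz v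
  have h1 : ‖orbitVec f wd z x es n‖ ≤ L ^ 4 * ‖orbitVec f wd z x eu n‖ := by
    have e1 := hs.hyp.es_bound (le_refl n)
    have e2 := hs.hyp.eu_bound (le_refl n)
    have e3 : Real.exp (-lam * n) ≤ 1 := by
      rw [Real.exp_le_one_iff]
      have : 0 ≤ lam * n := by positivity
      linarith
    have e4 : 1 ≤ Real.exp (lam * n) := Real.one_le_exp (by positivity)
    calc ‖orbitVec f wd z x es n‖ ≤ L ^ 2 * Real.exp (-lam * n) := e1
      _ ≤ L ^ 2 * (L ^ 2 * ‖orbitVec f wd z x eu n‖) := by gcongr; linarith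
      _ = _ := by ring
  have h2 := le_norm_orbitVec h hz v n
  have h3 : ‖toChart (z 0) x v‖ ≤ B * ‖v‖ := by
    have := norm_orbitVec_le h hz v 0
    rwa [orbitVec_zero, norm_wordDeriv_zero] at this
  have h4 : ‖orbitVec f wd z x v n‖ ≤ |a| * ‖orbitVec f wd z x es n‖ +
      |b| * ‖orbitVec f wd z x eu n‖ := by
    rw [hv, orbitVec_comb]
    refine (norm_add_le _ _).trans ?_
    rw [norm_smul, norm_smul, Real.norm_eq_abs, Real.norm_eq_abs]
  have hL4 : 1 ≤ L ^ 4 := one_le_pow₀ hL1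
  calc ‖wordDeriv f wd n x v‖ ≤ B * ‖orbitVec f wd z x v n‖ := h2
    _ ≤ B * ((L ^ 2 * (B * ‖v‖)) * (L ^ 4 * ‖orbitVec f wd z x eu n‖) +
        (L ^ 2 * (B * ‖v‖)) * (L ^ 4 * ‖orbitVec f wd z x eu n‖)) := by
        gcongr
        refine h4.trans ?_
        gcongr
        · exact ha.trans (by gcongr)
        · exact hb.trans (by gcongr)
        · exact le_mul_of_one_le_left (norm_nonneg _) hL4
    _ = _ := by ring

theorem IsSplitting.exp_le_norm_wordDeriv (hs : IsSplitting f wd z x L lam ε n es eu)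
    (h : UniformBounds ρ f 𝒜 B) (hz : IsItinerary f wd 𝒜 x z) :
    Real.exp (lam * n) ≤ B * L ^ 2 * ‖wordDeriv f wd n x‖ := by
  have hB := h.pos
  have hL := hs.hyp.L_pos
  have h1 := hs.hyp.eu_bound (le_refl n)
  have h2 := norm_orbitVec_le h hz eu n
  have h3 := (wordDeriv f wd n x).le_opNorm eu
  rw [hs.norm_eu, mul_one] at h3
  calc _ ≤ L ^ 2 * ‖orbitVec f wd z x eu n‖ := h1
    _ ≤ L ^ 2 * (B * ‖wordDeriv f wd n x‖) := by gcongr; exact h2.trans (by gcongr)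
    _ = _ := by ring

/-- In particular the scale `exp (-1.99 log ‖D‖)` tends to `0`, uniformly. -/
theorem IsSplitting.radius_le (hs : IsSplitting f wd z x L lam ε n es eu)
    (h : UniformBounds ρ f 𝒜 B) (hz : IsItinerary f wd 𝒜 x z) :
    Real.exp (-1.99 * Real.log ‖wordDeriv f wd n x‖) ≤ (B * L ^ 2) ^ 2 * Real.exp (-lam * n) := by
  have hB := h.pos
  have hL := hs.hyp.L_pos
  have h1 := hs.exp_le_norm_wordDeriv h hz
  have hlam := hs.hyp.lam_pos
  have hD : 0 < ‖wordDeriv f wd n x‖ := by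
    have := (Real.exp_pos (lam * n)).trans_le h1
    exact (pos_iff_pos_of_mul_pos this).1 (by positivity)
  have hBL : 1 ≤ B * L ^ 2 := one_le_mul_of_one_le_of_one_le h.one_le (one_le_pow₀ hs.hyp.one_le)
  have h2 : lam * n ≤ Real.log (B * L ^ 2) + Real.log ‖wordDeriv f wd n x‖ := by
    rw [← Real.log_mul (by positivity) hD.ne']
    exact (Real.le_log_iff_exp_le (by positivity)).2 h1
  have h3 : 0 ≤ Real.log (B * L ^ 2) := Real.log_nonneg hBL
  have h4 : (B * L ^ 2) ^ 2 = Real.exp (2 * Real.log (B * L ^ 2)) := by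
    rw [two_mul, Real.exp_add, Real.exp_log (by positivity), sq]
  rw [h4, ← Real.exp_add]
  refine Real.exp_le_exp.2 ?_
  have h5 : 0 ≤ lam * n := by positivity
  linarith

/-- The ratio of contraction and expansion is much smaller than the scale
`exp (-1.99 log ‖D‖)`. -/
theorem IsSplitting.ratio_le_radius (hs : IsSplitting f wd z x L lam ε n es eu)
    (h : UniformBounds ρ f 𝒜 B) (hz : IsItinerary f wd 𝒜 x z)
    (hf : ∀ i, PreservesArea ρ (f i)) (hε : 1000 * ε ≤ lam) :
    ‖orbitVec f wd z x es n‖ / ‖orbitVec f wd z x eu n‖ * Real.exp (6 * ε * n) ≤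
      4 * B ^ 8 * L ^ 15 * Real.exp (-(3 / 1000) * lam * n) *
        Real.exp (-1.99 * Real.log ‖wordDeriv f wd n x‖) := by
  have hB := h.pos
  have hL := hs.hyp.L_pos
  have hlam := hs.hyp.lam_pos
  have hε0 := hs.hyp.eps_nonneg
  have h1 := hs.exp_le_norm_wordDeriv h hz
  have hD : 0 < ‖wordDeriv f wd n x‖ := by
    have := (Real.exp_pos (lam * n)).trans_le h1
    exact (pos_iff_pos_of_mul_pos this).1 (by positivity)
  have hBL : 1 ≤ B * L ^ 2 := one_le_mul_of_one_le_of_one_le h.one_le (one_le_pow₀ hs.hyp.one_le)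
  have h2 : lam * n ≤ Real.log (B * L ^ 2) + Real.log ‖wordDeriv f wd n x‖ := by
    rw [← Real.log_mul (by positivity) hD.ne']
    exact (Real.le_log_iff_exp_le (by positivity)).2 h1
  have h3 : 0 ≤ Real.log (B * L ^ 2) := Real.log_nonneg hBL
  have hu := hs.hyp.eu_pos (le_refl n)
  have h4 := hs.norm_mul_norm_le h hz hf
  have h5 := hs.norm_wordDeriv_le h hz
  set D := ‖wordDeriv f wd n x‖ with hDdef
  set s := ‖orbitVec f wd z x es n‖
  set u := ‖orbitVec f wd z x eu n‖
  -- the product `s u` is almost bounded, and `u` is comparable to `D`, so the ratio is almost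
  -- `D⁻²`
  have h6 : s / u ≤ L * B ^ 3 * Real.exp (ε * n) * ((2 * B ^ 2 * L ^ 6) ^ 2 / D ^ 2) := by
    rw [div_le_iff₀ hu]
    have e1 : D ^ 2 ≤ (2 * B ^ 2 * L ^ 6) ^ 2 * u ^ 2 := by
      rw [← mul_pow]
      gcongr
    have e2 : s * D ^ 2 ≤ L * B ^ 3 * Real.exp (ε * n) * (2 * B ^ 2 * L ^ 6) ^ 2 * u := by
      calc s * D ^ 2 ≤ s * ((2 * B ^ 2 * L ^ 6) ^ 2 * u ^ 2) := by gcongr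
        _ = (s * u) * (2 * B ^ 2 * L ^ 6) ^ 2 * u := by ring
        _ ≤ L * B ^ 3 * Real.exp (ε * n) * (2 * B ^ 2 * L ^ 6) ^ 2 * u := by gcongr
    rw [mul_div_assoc', div_mul_eq_mul_div, le_div_iff₀ (by positivity)]
    linarith
  -- the difference of the exponents `2` and `1.99` leaves a factor `exp (-lam n / 100)`, which
  -- absorbs the subexponential factors
  have h7 : 1 / D ^ 2 ≤ B * L ^ 2 * Real.exp (-(lam * n) / 100) *
      Real.exp (-1.99 * Real.log D) := by
    have e1 : 1 / D ^ 2 = Real.exp (-2 * Real.log D) := by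
      rw [neg_mul, Real.exp_neg, two_mul, Real.exp_add, Real.exp_log hD, one_div, sq]
    have e2 : B * L ^ 2 = Real.exp (Real.log (B * L ^ 2)) := (Real.exp_log (by positivity)).symm
    rw [e1, e2, ← Real.exp_add, ← Real.exp_add]
    refine Real.exp_le_exp.2 ?_
    linarith
  calc s / u * Real.exp (6 * ε * n)
      ≤ L * B ^ 3 * Real.exp (ε * n) * ((2 * B ^ 2 * L ^ 6) ^ 2 / D ^ 2) *
        Real.exp (6 * ε * n) := by gcongr
    _ = 4 * B ^ 7 * L ^ 13 * (Real.exp (ε * n) * Real.exp (6 * ε * n)) * (1 / D ^ 2) := by ring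
    _ ≤ 4 * B ^ 7 * L ^ 13 * (Real.exp (ε * n) * Real.exp (6 * ε * n)) *
        (B * L ^ 2 * Real.exp (-(lam * n) / 100) * Real.exp (-1.99 * Real.log D)) := by gcongr
    _ = 4 * B ^ 8 * L ^ 15 * (Real.exp (ε * n) * Real.exp (6 * ε * n) *
        Real.exp (-(lam * n) / 100)) * Real.exp (-1.99 * Real.log D) := by ring
    _ ≤ _ := by
      gcongr
      rw [← Real.exp_add, ← Real.exp_add]
      refine Real.exp_le_exp.2 ?_
      have : 1000 * ε * n ≤ lam * n := by gcongr
      linarith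

/-- The most contracted direction is close to the contracted vector of a splitting. -/
theorem IsSplitting.coordU_mostContracted_le (hs : IsSplitting f wd z x L lam ε n es eu)
    (h : UniformBounds ρ f 𝒜 B) (hz : IsItinerary f wd 𝒜 x z)
    {S : Submodule ℝ (TangentSpace (𝓡 2) x)} (hS : IsMostContracted (wordDeriv f wd n x) S)
    {v : TangentSpace (𝓡 2) x} (hv : v ∈ S) :
    |coordU (orbitVec f wd z x es 0) (orbitVec f wd z x eu 0) (toChart (z 0) x v)| ≤
      B ^ 3 * L ^ 5 * Real.exp (-lam * n) * ‖toChart (z 0) x v‖ := by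
  have hB := h.pos
  have hL := hs.hyp.L_pos
  have hlam := hs.hyp.lam_pos
  have hne := hs.hyp.wedge_ne (le_refl n)
  obtain ⟨a, b, hab, -, hb, -, -⟩ := hs.exists_comb h hz v
  rw [hb]
  -- the coordinates are the same at times `0` and `n`; at time `n` the image of `v` is at most as
  -- long as that of `es`
  have h1 : coordU (orbitVec f wd z x es n) (orbitVec f wd z x eu n) (orbitVec f wd z x v n) =
      b := by
    rw [hab, orbitVec_comb, coordU_comb hne]
  have h2 := abs_coordU_le (a := L * Real.exp (ε * n)) (by positivity) (hs.hyp.es_ne n le_rfl)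
    (hs.hyp.eu_ne n le_rfl) (hs.hyp.angle n le_rfl) (orbitVec f wd z x v n)
  rw [h1] at h2
  have h3 := norm_orbitVec_le h hz v n
  have h4 := hS.norm_mul_le hv es
  rw [hs.norm_es, mul_one] at h4
  have h5 := le_norm_orbitVec h hz es n
  have h6 : ‖v‖ ≤ B * ‖toChart (z 0) x v‖ := by
    have := le_norm_orbitVec h hz v 0
    rwa [orbitVec_zero, norm_wordDeriv_zero] at this
  have h7 := hs.hyp.es_bound (le_refl n)
  have h8 := hs.hyp.eu_bound (le_refl n)
  have hu := hs.hyp.eu_pos (le_refl n)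
  have h9 : ‖orbitVec f wd z x v n‖ ≤
      B * ((B * (L ^ 2 * Real.exp (-lam * n))) * (B * ‖toChart (z 0) x v‖)) := by
    refine h3.trans ?_
    gcongr
    refine h4.trans ?_
    gcongr
    exact h5.trans (by gcongr)
  refine h2.trans ?_
  rw [div_le_iff₀ hu]
  calc L * Real.exp (ε * n) * ‖orbitVec f wd z x v n‖
      ≤ L * Real.exp (ε * n) *
        (B * ((B * (L ^ 2 * Real.exp (-lam * n))) * (B * ‖toChart (z 0) x v‖))) := by gcongr
    _ = B ^ 3 * L ^ 3 * Real.exp (-lam * n) * ‖toChart (z 0) x v‖ * Real.exp (ε * n) := by ring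
    _ ≤ B ^ 3 * L ^ 3 * Real.exp (-lam * n) * ‖toChart (z 0) x v‖ * (L ^ 2 *
        ‖orbitVec f wd z x eu n‖) := by
        gcongr
        refine le_trans (Real.exp_le_exp.2 ?_) h8
        gcongr
        linarith [hs.hyp.eps_le, hs.hyp.eps_nonneg]
    _ = _ := by ring

/-- A line close to the image of the most contracted direction is far from the expanded vector. -/
theorem IsSplitting.wedge_ge_of_lineAngle (hs : IsSplitting f wd z x L lam ε n es eu)
    (h : UniformBounds ρ f 𝒜 B) (hz : IsItinerary f wd 𝒜 x z)
    {S : Submodule ℝ (TangentSpace (𝓡 2) x)} (hS : IsMostContracted (wordDeriv f wd n x) S)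
    {v : TangentSpace (𝓡 2) x} (hv : v ∈ S) (hv0 : v ≠ 0)
    {w : TangentSpace (𝓡 2) (wordMap f wd n x)} (hw0 : w ≠ 0)
    (hvw : lineAngle (wordDeriv f wd n x v) w ≤ 1 / 4)
    (hn : 4 * B ^ 2 * L ^ 4 * Real.exp (-lam * n) ≤ 1) :
    ‖toChart (z n) (wordMap f wd n x) w‖ * ‖orbitVec f wd z x eu n‖ ≤
      2 * B ^ 3 * |wedge (toChart (z n) (wordMap f wd n x) w) (orbitVec f wd z x eu n)| := by
  have hB := h.pos
  have hL := hs.hyp.L_pos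
  have hlam := hs.hyp.lam_pos
  have hg := h.goodChart hz n
  have hself := Metric.mem_ball_self (x := extChartAt (𝓡 2) (z n) (wordMap f wd n x))
    (_root_.inv_pos.2 h.pos)
  set A := wordDeriv f wd n x with hA
  have hAv : A v ≠ 0 := by
    intro h0
    apply orbitVec_ne_zero h hz hv0 n
    rw [orbitVec, ← hA, h0, map_zero]
  have hAv' : 0 < ‖A v‖ := norm_pos_iff.2 hAv
  have hv' : 0 < ‖v‖ := norm_pos_iff.2 hv0
  -- the singular directions have orthogonal images, so the images of `v` and `eu` are almost
  -- orthogonal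
  have h1 : |inner ℝ (A v) (A eu)| ≤ ‖A v‖ * ‖A es‖ := by
    have e1 := hS.inner_map hv eu
    have e2 := hS.norm_mul_le hv es
    have e3 := abs_real_inner_le_norm v eu
    rw [hs.norm_es, mul_one] at e2
    rw [hs.norm_eu, mul_one] at e3
    have e4 : |inner ℝ (A v) (A eu)| * ‖v‖ ^ 2 = |inner ℝ v eu| * ‖A v‖ ^ 2 := by
      have := congrArg abs e1
      rwa [abs_mul, abs_mul, abs_of_nonneg (sq_nonneg ‖v‖), abs_of_nonneg (sq_nonneg ‖A v‖)] at this
    refine le_of_mul_le_mul_right ?_ (pow_pos hv' 2)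
    rw [e4]
    calc |inner ℝ v eu| * ‖A v‖ ^ 2 ≤ ‖v‖ * ‖A v‖ ^ 2 := by gcongr
      _ = ‖A v‖ * ‖v‖ * ‖A v‖ := by ring
      _ ≤ ‖A v‖ * ‖v‖ * (‖A es‖ * ‖v‖) := by gcongr
      _ = _ := by ring
  have h2 : 4 * ‖A es‖ ≤ ‖A eu‖ := by
    have e1 := le_norm_orbitVec h hz es n
    have e2 := norm_orbitVec_le h hz eu n
    have e3 := hs.hyp.es_bound (le_refl n)
    have e4 := hs.hyp.eu_bound (le_refl n)
    have e5 : 1 ≤ Real.exp (lam * n) := Real.one_le_exp (by positivity)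
    have e6 : 1 ≤ L ^ 2 * (B * ‖A eu‖) := e5.trans (e4.trans (by gcongr))
    calc 4 * ‖A es‖ ≤ 4 * (B * (L ^ 2 * Real.exp (-lam * n))) * 1 := by
          rw [mul_one]
          gcongr
          exact e1.trans (by gcongr)
      _ ≤ 4 * (B * (L ^ 2 * Real.exp (-lam * n))) * (L ^ 2 * (B * ‖A eu‖)) := by gcongr
      _ = 4 * B ^ 2 * L ^ 4 * Real.exp (-lam * n) * ‖A eu‖ := by ring
      _ ≤ 1 * ‖A eu‖ := by gcongr
      _ = _ := one_mul _
  have h3 := abs_inner_le_of_lineAngle hAv hw0 (A eu)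
  have h4 : |inner ℝ w (A eu)| ≤ ‖w‖ * ‖A eu‖ / 2 := by
    refine le_of_mul_le_mul_right ?_ hAv'
    calc |inner ℝ w (A eu)| * ‖A v‖ ≤ |inner ℝ (A v) (A eu)| * ‖w‖ +
          lineAngle (A v) w * (‖A v‖ * ‖w‖ * ‖A eu‖) := h3
      _ ≤ ‖A v‖ * (‖A eu‖ / 4) * ‖w‖ + 1 / 4 * (‖A v‖ * ‖w‖ * ‖A eu‖) := by
          gcongr
          refine h1.trans ?_
          gcongr
          linarith
      _ = _ := by ring
  -- hence the angle of `w` and `A eu` is far from `0`, and they span a large area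
  have h5 : ‖w‖ * ‖A eu‖ ≤ 2 * parallelogramArea w (A eu) := by
    refine abs_le_of_sq_le_sq' ?_ (mul_nonneg two_pos.le (parallelogramArea_nonneg _ _)) |>.2
    rw [mul_pow 2, parallelogramArea_sq]
    have e1 : inner ℝ w (A eu) ^ 2 ≤ (‖w‖ * ‖A eu‖ / 2) ^ 2 :=
      sq_le_sq' (by linarith [neg_le_of_abs_le h4]) (le_of_abs_le h4)
    nlinarith [sq_nonneg (‖w‖ * ‖A eu‖)]
  have h6 := (hg.area_bounds hg.mem_source hself w (A eu)).2
  have h7 := hg.norm_toChart_le hg.mem_source hself w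
  have h8 := norm_orbitVec_le h hz eu n
  calc ‖toChart (z n) (wordMap f wd n x) w‖ * ‖orbitVec f wd z x eu n‖
      ≤ (B * ‖w‖) * (B * ‖A eu‖) := by gcongr
    _ = B ^ 2 * (‖w‖ * ‖A eu‖) := by ring
    _ ≤ B ^ 2 * (2 * (B *
        |wedge (toChart (z n) (wordMap f wd n x) w) (orbitVec f wd z x eu n)|)) := by
      refine mul_le_mul_of_nonneg_left (h5.trans ?_) (by positivity)
      exact mul_le_mul_of_nonneg_left h6 two_pos.le
    _ = _ := by ring

end Splitting

/-! ### Orbits in a tube -/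

section Tube

variable {M : Type*} [EMetricSpace M] [ChartedSpace Plane M] [IsManifold (𝓡 2) ∞ M]
variable {m : ℕ} {f : Fin m → M ≃ₘ^2⟮𝓡 2, 𝓡 2⟯ M} {wd : ℕ → Fin m}
  [RiemannianBundle (fun x : M => TangentSpace (𝓡 2) x)] {ρ : M → ℝ} {𝒜 : FiniteAtlas M}
  {B : ℝ} {x y y' : M} {z : ℕ → M} {β lam : ℝ} {n : ℕ}

theorem InTube.mono {n' : ℕ} (h : InTube f wd x β lam n' y) (hn : n ≤ n') :
    InTube f wd x β lam n y :=
  fun k hk => h k (hk.trans hn)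

theorem InTube.mono_width {β' : ℝ} (h : InTube f wd x β lam n y) (hβ : β ≤ β') :
    InTube f wd x β' lam n y :=
  fun k hk => (h k hk).trans (ENNReal.ofReal_le_ofReal (by gcongr))

theorem inTube_self : InTube f wd x β lam n x := fun k _ => by simp

/-- The orbits of points of the tube can be followed in the charts. -/
theorem InTube.chart [IsRiemannianManifold (𝓡 2) M] (h : InTube f wd x β lam n y)
    (hB : UniformBounds ρ f 𝒜 B) (hz : IsItinerary f wd 𝒜 x z) (hβ : 0 < β)
    (hβ' : 2 * B ^ 2 * β < 1) (hlam : 0 ≤ lam) {k : ℕ} (hk : k ≤ n) :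
    wordMap f wd k y ∈ (chartAt Plane (z k)).source ∧
      ‖orbitPt f wd z y k - orbitPt f wd z x k‖ ≤ 2 * B * β * Real.exp (-lam * k / 2) ∧
      orbitPt f wd z y k ∈ Metric.ball (orbitPt f wd z x k) B⁻¹ := by
  have hBp := hB.pos
  have he : Real.exp (-lam * k / 2) ≤ 1 := by
    rw [Real.exp_le_one_iff]
    have : 0 ≤ lam * k := by positivity
    linarith
  have he0 := Real.exp_pos (-lam * k / 2)
  have h1 : B * (2 * β * Real.exp (-lam * k / 2)) < B⁻¹ := by
    rw [← one_div, lt_div_iff₀ hBp]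
    have : 2 * B ^ 2 * β * Real.exp (-lam * k / 2) ≤ 2 * B ^ 2 * β := by
      exact mul_le_of_le_one_right (by positivity) he
    nlinarith
  have h2 := (hB.goodChart hz k).mem_of_edist_lt (y' := wordMap f wd k y)
    (r := 2 * β * Real.exp (-lam * k / 2)) ((h k hk).trans_lt (by
      refine (ENNReal.ofReal_lt_ofReal_iff (by positivity)).2 ?_
      have : 0 < β * Real.exp (-lam * k / 2) := by positivity
      linarith)) h1
  refine ⟨h2.1, ?_, mem_ball_iff_norm.2 (h2.2.trans h1)⟩
  have h3 := h2.2.le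
  calc _ ≤ B * (2 * β * Real.exp (-lam * k / 2)) := h3
    _ = _ := by ring

variable [IsRiemannianManifold (𝓡 2) M]

/-- Seen along the orbit of `x`, the images of a vector tangent at a point of the tube are a
pseudo-orbit of the differentials. -/
theorem InTube.orbitVec_pseudo (h : InTube f wd x β lam n y)
    (hB : UniformBounds ρ f 𝒜 B) (hz : IsItinerary f wd 𝒜 x z) (hβ : 0 < β)
    (hβ' : 2 * B ^ 2 * β < 1) (hlam : 0 ≤ lam) (v : TangentSpace (𝓡 2) y) {k : ℕ} (hk : k < n) :
    ‖orbitVec f wd z y v (k + 1) - orbitMap f wd z x k (orbitVec f wd z y v k)‖ ≤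
      2 * B ^ 2 * β * Real.exp (-lam * k / 2) * ‖orbitVec f wd z y v k‖ := by
  have hBp := hB.pos
  obtain ⟨h1, h2, h3⟩ := h.chart hB hz hβ hβ' hlam hk.le
  rw [orbitVec_succ h1 (h.chart hB hz hβ hβ' hlam (Nat.succ_le_of_lt hk)).1,
    ← sub_apply]
  refine (ContinuousLinearMap.le_opNorm _ _).trans ?_
  gcongr
  calc _ ≤ B * ‖orbitPt f wd z y k - orbitPt f wd z x k‖ := hB.orbitMap_sub_le hz h3
    _ ≤ B * (2 * B * β * Real.exp (-lam * k / 2)) := by gcongr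
    _ = _ := by ring

/-- The differences of two orbits in the tube are a pseudo-orbit of the differentials along the
orbit of `x`. -/
theorem InTube.orbitPt_pseudo (h : InTube f wd x β lam n y) (h' : InTube f wd x β lam n y')
    (hB : UniformBounds ρ f 𝒜 B) (hz : IsItinerary f wd 𝒜 x z) (hβ : 0 < β)
    (hβ' : 2 * B ^ 2 * β < 1) (hlam : 0 ≤ lam) {k : ℕ} (hk : k < n) :
    ‖(orbitPt f wd z y (k + 1) - orbitPt f wd z y' (k + 1)) -
        orbitMap f wd z x k (orbitPt f wd z y k - orbitPt f wd z y' k)‖ ≤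
      2 * B ^ 2 * β * Real.exp (-lam * k / 2) * ‖orbitPt f wd z y k - orbitPt f wd z y' k‖ := by
  have hBp := hB.pos
  obtain ⟨h1, h2, h3⟩ := h.chart hB hz hβ hβ' hlam hk.le
  obtain ⟨h1', h2', h3'⟩ := h'.chart hB hz hβ hβ' hlam hk.le
  rw [orbitPt_succ h1, orbitPt_succ h1']
  set q := orbitPt f wd z x k
  set r := 2 * B * β * Real.exp (-lam * k / 2) with hr
  have hsub : Metric.closedBall q r ⊆ Metric.ball q B⁻¹ := by
    refine Metric.closedBall_subset_ball ?_
    rw [← one_div, lt_div_iff₀ hBp]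
    have he : Real.exp (-lam * k / 2) ≤ 1 := by
      rw [Real.exp_le_one_iff]
      have : 0 ≤ lam * k := by positivity
      linarith
    have : 2 * B ^ 2 * β * Real.exp (-lam * k / 2) ≤ 2 * B ^ 2 * β :=
      mul_le_of_le_one_right (by positivity) he
    rw [hr]
    nlinarith
  have key := (convex_closedBall q r).norm_image_sub_le_of_norm_fderiv_le'
    (f := stepMap f wd z k) (φ := orbitMap f wd z x k) (C := B * r)
    (fun p hp => hB.differentiableAt_stepMap hz (hsub hp))
    (fun p hp => (hB.orbitMap_sub_le hz (hsub hp)).trans (by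
      gcongr
      exact mem_closedBall_iff_norm.1 hp))
    (mem_closedBall_iff_norm.2 h2') (mem_closedBall_iff_norm.2 h2)
  refine key.trans (le_of_eq ?_)
  rw [hr]
  ring

end Tube

/-! ### Line fields in charts -/

section LineFields

variable {M : Type*} [EMetricSpace M] [ChartedSpace Plane M] [IsManifold (𝓡 2) ∞ M]

theorem mem_dir_iff (V : LineField M) {z y : M} (hy : y ∈ (chartAt Plane z).source) (w : Plane) :
    ofChart z (extChartAt (𝓡 2) z y) w ∈ V.dir ((extChartAt (𝓡 2) z).symm (extChartAt (𝓡 2) z y)) ↔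
      ∃ u ∈ V.dir y, toChart z y u = w := by
  obtain ⟨p, hp, rfl⟩ := exists_coord hy
  rw [coord_symm hp]
  constructor
  · intro h
    exact ⟨_, h, toChart_ofChart hp w⟩
  · rintro ⟨u, hu, rfl⟩
    rwa [ofChart_toChart hp]

theorem exists_smul_eq_of_mem_dir {V : LineField M} {y : M} (hy : y ∈ V.domain)
    {u u' : TangentSpace (𝓡 2) y} (hu : u ∈ V.dir y) (hu0 : u ≠ 0) (hu' : u' ∈ V.dir y) :
    ∃ c : ℝ, u' = c • u := by
  obtain ⟨c, hc⟩ := (finrank_eq_one_iff_of_nonzero' (⟨u, hu⟩ : V.dir y)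
    (by simpa using hu0)).1 (V.finrank_dir y hy) ⟨u', hu'⟩
  exact ⟨c, (congrArg Subtype.val hc).symm⟩

theorem LineField.exists_ne_zero (V : LineField M) {y : M} (hy : y ∈ V.domain) :
    ∃ u ∈ V.dir y, u ≠ 0 := by
  have : Nontrivial (V.dir y) :=
    Module.nontrivial_of_finrank_pos (R := ℝ) (by rw [V.finrank_dir y hy]; exact one_pos)
  obtain ⟨⟨v, hv⟩, hne⟩ := exists_ne (0 : V.dir y)
  exact ⟨v, hv, fun h0 => hne (Subtype.ext h0)⟩

variable [RiemannianBundle (fun x : M => TangentSpace (𝓡 2) x)]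
  {m : ℕ} {f : Fin m → M ≃ₘ^2⟮𝓡 2, 𝓡 2⟯ M} {ρ : M → ℝ} {𝒜 : FiniteAtlas M} {B : ℝ}

/-- A line field with bounded `C²` norm is spanned, in any chart of the atlas, by a vector field
with controlled derivative. -/
theorem LineField.C2NormLE.exists_lift {V : LineField M} {b : ℝ} (hV : V.C2NormLE 𝒜 b)
    (hB : UniformBounds ρ f 𝒜 B) {z y : M} (hz : z ∈ 𝒜.centers) (hy : y ∈ 𝒜.core z) {p : Plane}
    (hp : p ∈ Metric.ball (extChartAt (𝓡 2) z y) B⁻¹)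
    (hpV : (extChartAt (𝓡 2) z).symm p ∈ V.domain) :
    ∃ φ : Plane → Plane, ContDiffAt ℝ 1 φ p ∧ ‖fderiv ℝ φ p‖ ≤ B ^ 2 * (1 + b) ∧
      1 ≤ B * ‖φ p‖ ∧ ∀ᶠ q in 𝓝 p, ∃ u ∈ V.dir ((extChartAt (𝓡 2) z).symm q),
        toChart z ((extChartAt (𝓡 2) z).symm q) u = φ q := by
  have hBp := hB.pos
  have hBi := inv_pos.2 hB.pos
  have hpt : p ∈ (extChartAt (𝓡 2) z).target := (hB.good z hz y hy).ball_subset hp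
  set y₁ := (extChartAt (𝓡 2) z).symm p with hy₁
  have hs := symm_mem_source hpt
  obtain ⟨z', hz', hcore⟩ := 𝒜.cover y₁
  have hs' := 𝒜.core_subset z' hz' hcore
  obtain ⟨hb1, hb2⟩ := hB.trans z hz z' hz' y hy p hp hcore
  obtain ⟨φ₀, hφ₀, hspan, hnorm⟩ := hV z' hz' y₁ ⟨hcore, hpV⟩
  set p' := extChartAt (𝓡 2) z' y₁ with hp'
  have hp1 : extChartAt (𝓡 2) z y₁ = p := coord_symm hpt
  let τ := chartMap id z z'
  let θ := chartMap id z' z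
  have hτp : τ p = p' := rfl
  have hself' := Metric.mem_ball_self (x := p') hBi
  have hdom : p ∈ chartDomain id z z' := hb1.ball_subset (by
    rw [hp1]; exact Metric.mem_ball_self hBi)
  have hdom' : p' ∈ chartDomain id z' z := hb2.ball_subset hself'
  have hopen := isOpen_chartDomain (continuous_id (X := M)) z z'
  have hopen' := isOpen_chartDomain (continuous_id (X := M)) z' z
  have hτ : ContDiffAt ℝ 2 τ p := ((contDiffOn_chartMap (ENat.LEInfty.out : (2 : ℕ∞ω) ≤ (∞ : ℕ∞ω))
    contMDiff_id z z').contDiffAt (hopen.mem_nhds hdom))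
  have hθ : ContDiffAt ℝ 2 θ p' := ((contDiffOn_chartMap (ENat.LEInfty.out : (2 : ℕ∞ω) ≤ (∞ : ℕ∞ω))
    contMDiff_id z' z).contDiffAt (hopen'.mem_nhds hdom'))
  have hτ1 : ContDiffAt ℝ 1 τ p := hτ.of_le one_le_two
  have hDθ : ContDiffAt ℝ 1 (fderiv ℝ θ) p' := hθ.fderiv_right (m := 1) le_rfl
  let φ : Plane → Plane := fun q => fderiv ℝ θ (τ q) (φ₀ (τ q))
  have hφ : ContDiffAt ℝ 1 φ p :=
    (hDθ.comp p hτ1).clm_apply ((hφ₀.of_le one_le_two).comp p hτ1)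
  have hτd := (hτ1.differentiableAt one_ne_zero).hasFDerivAt
  have hDθd := (hDθ.differentiableAt one_ne_zero).hasFDerivAt
  have hφ₀d := (hφ₀.differentiableAt two_ne_zero).hasFDerivAt
  have hunit : ‖φ₀ p'‖ = 1 := hspan.self_of_nhds.1
  have hτn : ‖fderiv ℝ τ p‖ ≤ B := hb1.norm_fderiv p (by
    rw [hp1]; exact Metric.mem_ball_self hBi)
  have hθn : ‖fderiv ℝ θ p'‖ ≤ B := hb2.norm_fderiv p' hself'
  have hφ₀n : ‖fderiv ℝ φ₀ p'‖ ≤ b := by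
    have := hnorm 1 le_rfl one_le_two
    rwa [norm_iteratedFDeriv_one] at this
  have hθ2 : ‖fderiv ℝ (fderiv ℝ θ) p'‖ ≤ B := by
    refine hDθd.le_of_lip' hBp.le ?_
    filter_upwards [Metric.ball_mem_nhds p' hBi] with q hq
    exact hb2.fderiv_lipschitz q hq p' hself'
  refine ⟨φ, hφ, ?_, ?_, ?_⟩
  · have hd : HasFDerivAt φ _ p := (hDθd.comp p hτd).clm_apply (hφ₀d.comp p hτd)
    rw [hd.fderiv]
    refine ContinuousLinearMap.opNorm_le_bound _ ?_ fun w => ?_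
    · have := (norm_nonneg _).trans hφ₀n
      positivity
    · simp only [add_apply, ContinuousLinearMap.comp_apply, ContinuousLinearMap.flip_apply]
      have hw : ‖fderiv ℝ τ p w‖ ≤ B * ‖w‖ := ContinuousLinearMap.le_of_opNorm_le _ hτn w
      have e1 : ‖fderiv ℝ θ p' (fderiv ℝ φ₀ p' (fderiv ℝ τ p w))‖ ≤ B * (b * (B * ‖w‖)) := by
        refine (ContinuousLinearMap.le_of_opNorm_le _ hθn _).trans ?_
        gcongr
        refine (ContinuousLinearMap.le_of_opNorm_le _ hφ₀n _).trans ?_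
        have := (norm_nonneg _).trans hφ₀n
        gcongr
      have e2 : ‖fderiv ℝ (fderiv ℝ θ) p' (fderiv ℝ τ p w) (φ₀ p')‖ ≤ B * (B * ‖w‖) * 1 := by
        rw [← hunit]
        refine (ContinuousLinearMap.le_opNorm _ _).trans ?_
        gcongr
        refine (ContinuousLinearMap.le_of_opNorm_le _ hθ2 _).trans ?_
        gcongr
      refine (norm_add_le _ _).trans ((add_le_add e1 e2).trans (le_of_eq ?_))
      ring
  · obtain ⟨u, hu⟩ := ofChart_surjective hs' (φ₀ p')
    have e1 := toChart_eq_fderiv hs hs' u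
    have e2 := toChart_eq_fderiv hs' hs u
    rw [hp1] at e1
    have e3 : φ p = toChart z y₁ u := by
      rw [e2, hu]
      rfl
    rw [e3, ← hunit, ← hu, e1]
    exact ContinuousLinearMap.le_of_opNorm_le _ hτn _
  · have h1 : ∀ᶠ q in 𝓝 p, τ q ∈ {q' | ‖φ₀ q'‖ = 1 ∧ mfderiv 𝓘(ℝ, Plane) (𝓡 2)
        (extChartAt (𝓡 2) z').symm q' (φ₀ q') ∈ V.dir ((extChartAt (𝓡 2) z').symm q')} :=
      hτ.continuousAt.eventually hspan
    filter_upwards [h1, hopen.mem_nhds hdom] with q hq hqd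
    have hqs := symm_mem_source hqd.1
    have hqs' : (extChartAt (𝓡 2) z).symm q ∈ (chartAt Plane z').source := hqd.2
    obtain ⟨u, hu, hu'⟩ := (mem_dir_iff V hqs' (φ₀ (τ q))).1 hq.2
    refine ⟨u, hu, ?_⟩
    rw [toChart_eq_fderiv hqs' hqs, hu']
    rfl

/-- The square of the sine of the angle of a line field with a fixed vector, times the square of
the norm of this vector, in a chart. All nonzero vectors of a line give the same value, and the
supremum avoids a choice among them. -/
def lineSlope (V : LineField M) (z : M) (e q : Plane) : ℝ :=
  sSup ((fun u => wedge (toChart z ((extChartAt (𝓡 2) z).symm q) u) e ^ 2 /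
    ‖toChart z ((extChartAt (𝓡 2) z).symm q) u‖ ^ 2) ''
      {u ∈ (V.dir ((extChartAt (𝓡 2) z).symm q) : Set _) | u ≠ 0})

theorem lineSlope_eq {V : LineField M} {z : M} {e q : Plane}
    (hqV : (extChartAt (𝓡 2) z).symm q ∈ V.domain)
    {u : TangentSpace (𝓡 2) ((extChartAt (𝓡 2) z).symm q)}
    (hu : u ∈ V.dir ((extChartAt (𝓡 2) z).symm q)) (hu0 : u ≠ 0) :
    lineSlope V z e q = wedge (toChart z ((extChartAt (𝓡 2) z).symm q) u) e ^ 2 /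
      ‖toChart z ((extChartAt (𝓡 2) z).symm q) u‖ ^ 2 := by
  suffices key : (fun u => wedge (toChart z ((extChartAt (𝓡 2) z).symm q) u) e ^ 2 /
      ‖toChart z ((extChartAt (𝓡 2) z).symm q) u‖ ^ 2) ''
      {u ∈ (V.dir ((extChartAt (𝓡 2) z).symm q) : Set _) | u ≠ 0} =
      {wedge (toChart z ((extChartAt (𝓡 2) z).symm q) u) e ^ 2 /
        ‖toChart z ((extChartAt (𝓡 2) z).symm q) u‖ ^ 2} by
    rw [lineSlope, key, csSup_singleton]
  ext r
  constructor
  · rintro ⟨u', ⟨hu', hu'0⟩, rfl⟩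
    obtain ⟨c, rfl⟩ := exists_smul_eq_of_mem_dir hqV hu hu0 hu'
    have hc : c ≠ 0 := fun h0 => hu'0 (by rw [h0, zero_smul])
    simp only [map_smul, smul_apply, smul_eq_mul, norm_smul, mem_singleton_iff, mul_pow,
      Real.norm_eq_abs, sq_abs]
    rw [mul_div_mul_left _ _ (pow_ne_zero 2 hc)]
  · rintro rfl
    exact ⟨u, ⟨hu, hu0⟩, rfl⟩

/-- Line fields with bounded `C²` norm have Lipschitz slopes. The slope does not depend on the
orientation of the line, so it can be compared along a segment although the line field is only
locally spanned by the vector fields of `exists_lift`. -/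
theorem LineField.C2NormLE.lineSlope_sub_le {V : LineField M} {b : ℝ} (hV : V.C2NormLE 𝒜 b)
    (hB : UniformBounds ρ f 𝒜 B) {z y : M} (hz : z ∈ 𝒜.centers) (hy : y ∈ 𝒜.core z) (e : Plane)
    {S : Set Plane} (hS : Convex ℝ S) (hSB : S ⊆ Metric.ball (extChartAt (𝓡 2) z y) B⁻¹)
    (hSV : ∀ p ∈ S, (extChartAt (𝓡 2) z).symm p ∈ V.domain) {p p' : Plane} (hp : p ∈ S)
    (hp' : p' ∈ S) :
    |lineSlope V z e p' - lineSlope V z e p| ≤ 4 * ‖e‖ ^ 2 * B ^ 3 * (1 + b) * ‖p' - p‖ := by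
  have hBp := hB.pos
  have hmain : ∀ q ∈ S, ∃ l : Plane →L[ℝ] ℝ, HasFDerivAt (lineSlope V z e) l q ∧
      ‖l‖ ≤ 4 * ‖e‖ ^ 2 * B ^ 3 * (1 + b) := by
    intro q hq
    obtain ⟨φ, hφ, hφn, hφ0, hspan⟩ := hV.exists_lift hB hz hy (hSB hq) (hSV q hq)
    have hφq : 0 < ‖φ q‖ := by
      by_contra hneg
      nlinarith [norm_nonneg (φ q)]
    have hqt := (hB.good z hz y hy).ball_subset (hSB hq)
    have hopen : ∀ᶠ q' in 𝓝 q, (extChartAt (𝓡 2) z).symm q' ∈ V.domain :=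
      ((continuousOn_extChartAt_symm z).continuousAt ((isOpen_target z).mem_nhds hqt)).eventually
        (V.isOpen_domain.mem_nhds (hSV q hq))
    have hne : ∀ᶠ q' in 𝓝 q, φ q' ≠ 0 :=
      hφ.continuousAt.eventually_ne (norm_pos_iff.1 hφq)
    have heq : lineSlope V z e =ᶠ[𝓝 q] fun q' => wedge (φ q') e ^ 2 / ‖φ q'‖ ^ 2 := by
      filter_upwards [hspan, hopen, hne] with q' hq' hV' hne'
      obtain ⟨u, hu, hu'⟩ := hq'
      rw [← hu']
      refine lineSlope_eq hV' hu fun h0 => hne' ?_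
      rw [← hu', h0, map_zero]
    have hφd := (hφ.differentiableAt one_ne_zero).hasFDerivAt
    set D := fderiv ℝ φ q
    have h1 : HasFDerivAt (fun q' => wedge (φ q') e) ((wedge.flip e).comp D) q :=
      (wedge.flip e).hasFDerivAt.comp q hφd
    have h2 : HasFDerivAt (fun q' => ‖φ q'‖ ^ 2) (2 • (innerSL ℝ (φ q)).comp D) q :=
      hφd.norm_sq
    have hsq : ‖φ q‖ ^ 2 ≠ 0 := (pow_pos hφq 2).ne'
    have h3 := (h1.pow 2).mul ((hasDerivAt_inv hsq).comp_hasFDerivAt q h2)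
    refine ⟨_, h3.congr_of_eventuallyEq heq, ?_⟩
    refine ContinuousLinearMap.opNorm_le_bound _ ?_ fun w => ?_
    · have := (norm_nonneg _).trans hφn
      have : 0 ≤ 1 + b := by
        by_contra hneg
        nlinarith [pow_pos hBp 2]
      positivity
    · have hw : ‖D w‖ ≤ B ^ 2 * (1 + b) * ‖w‖ := ContinuousLinearMap.le_of_opNorm_le _ hφn w
      have e1 := abs_wedge_le (φ q) e
      have e2 := abs_wedge_le (D w) e
      have e3 := abs_real_inner_le_norm (φ q) (D w)
      set N := ‖φ q‖ with hN
      have e4 : |wedge (φ q) e ^ 2 * ((-((N ^ 2) ^ 2)⁻¹) * (2 * inner ℝ (φ q) (D w))) +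
          (N ^ 2)⁻¹ * (2 * wedge (φ q) e * wedge (D w) e)| ≤ 4 * ‖e‖ ^ 2 * (N⁻¹ * ‖D w‖) := by
        refine (abs_add_le _ _).trans ?_
        rw [abs_mul, abs_mul, abs_mul, abs_mul, abs_mul, abs_mul, abs_pow, abs_neg, abs_inv,
          abs_inv, abs_of_nonneg (sq_nonneg N), abs_of_nonneg (sq_nonneg (N ^ 2)), abs_two]
        calc _ ≤ (N * ‖e‖) ^ 2 * (((N ^ 2) ^ 2)⁻¹ * (2 * (N * ‖D w‖))) +
              (N ^ 2)⁻¹ * (2 * (N * ‖e‖) * (‖D w‖ * ‖e‖)) := by gcongr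
          _ = _ := by field_simp; ring
      have e5 : N⁻¹ ≤ B := by
        rw [inv_le_iff_one_le_mul₀ hφq]
        exact hφ0
      have hb0 : 0 ≤ N⁻¹ * ‖D w‖ := by positivity
      have e6 : N⁻¹ * ‖D w‖ ≤ B * (B ^ 2 * (1 + b) * ‖w‖) := by gcongr
      calc _ = |wedge (φ q) e ^ 2 * ((-((N ^ 2) ^ 2)⁻¹) * (2 * inner ℝ (φ q) (D w))) +
          (N ^ 2)⁻¹ * (2 * wedge (φ q) e * wedge (D w) e)| := by
            rw [← Real.norm_eq_abs]
            congr 1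
            simp [hN]
        _ ≤ 4 * ‖e‖ ^ 2 * (N⁻¹ * ‖D w‖) := e4
        _ ≤ 4 * ‖e‖ ^ 2 * (B * (B ^ 2 * (1 + b) * ‖w‖)) := by gcongr
        _ = _ := by ring
  choose! l hl hln using hmain
  exact hS.norm_image_sub_le_of_norm_hasFDerivWithin_le
    (fun q hq => (hl q hq).hasFDerivWithinAt) hln hp hp'

end LineFields

/-! ### Leaves of the pulled back line field -/

section Leaves

variable {M : Type*} [EMetricSpace M] [ChartedSpace Plane M] [IsManifold (𝓡 2) ∞ M]
variable {m : ℕ} {f : Fin m → M ≃ₘ^2⟮𝓡 2, 𝓡 2⟯ M} {wd : ℕ → Fin m}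
  [RiemannianBundle (fun x : M => TangentSpace (𝓡 2) x)] {ρ : M → ℝ} {𝒜 : FiniteAtlas M}
  {B : ℝ} {x : M} {z : ℕ → M} {L lam ε β : ℝ} {n : ℕ} {es eu : TangentSpace (𝓡 2) x}
  {V : LineField M}

theorem lineSlope_coord {z y : M} {e : Plane} (hy : y ∈ (chartAt Plane z).source)
    (hyV : y ∈ V.domain) {u : TangentSpace (𝓡 2) y} (hu : u ∈ V.dir y) (hu0 : u ≠ 0) :
    lineSlope V z e (extChartAt (𝓡 2) z y) =
      wedge (toChart z y u) e ^ 2 / ‖toChart z y u‖ ^ 2 := by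
  obtain ⟨p, hp, rfl⟩ := exists_coord hy
  rw [coord_symm hp]
  exact lineSlope_eq hyV hu hu0

/-- On the ball of radius `r` about `x_n`, in the chart at `z n`, the line field `V` is defined and
its angle with the image of `eu` is bounded below. -/
structure IsConeField (f : Fin m → M ≃ₘ^2⟮𝓡 2, 𝓡 2⟯ M) (wd : ℕ → Fin m) (z : ℕ → M) (x : M)
    (eu : TangentSpace (𝓡 2) x) (B r : ℝ) (n : ℕ) (V : LineField M) : Prop where
  mem_domain : ∀ y ∈ (chartAt Plane (z n)).source,
    extChartAt (𝓡 2) (z n) y ∈ Metric.closedBall (orbitPt f wd z x n) r → y ∈ V.domain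
  cone : ∀ y ∈ (chartAt Plane (z n)).source,
    extChartAt (𝓡 2) (z n) y ∈ Metric.closedBall (orbitPt f wd z x n) r → ∀ u ∈ V.dir y,
      ‖toChart (z n) y u‖ * ‖orbitVec f wd z x eu n‖ ≤
        4 * B ^ 3 * |wedge (toChart (z n) y u) (orbitVec f wd z x eu n)|

variable [IsRiemannianManifold (𝓡 2) M]

/-- A smoothed image distribution is close, at `x_n`, to the image of the most contracted direction,
which is almost orthogonal to the image of `eu`; and it cannot turn much on a ball whose radius
times the `C²` norm is small. -/
theorem isConeField_of_smoothedImage (hs : IsSplitting f wd z x L lam ε n es eu)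
    (hB : UniformBounds ρ f 𝒜 B) (hz : IsItinerary f wd 𝒜 x z) {ν₁ ν₂ η D₁ D₂ D₃ r : ℝ} {K : Set M}
    (hV : IsSmoothedImage f wd 𝒜 ν₁ ν₂ η D₁ D₂ D₃ n K V) (hxK : x ∈ K)
    {S : Submodule ℝ (TangentSpace (𝓡 2) x)} (hS : IsMostContracted (wordDeriv f wd n x) S)
    (hn1 : 4 * B ^ 2 * L ^ 4 * Real.exp (-lam * n) ≤ 1)
    (hn2 : D₃ * Real.exp (-(η * ν₂ * n)) ≤ 1 / 4) (hr0 : 0 ≤ r) (hr : B * r < 1)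
    (hn3 : B * r ≤ D₁ * Real.exp (-(η * ν₁ * n))) (hD₂ : 0 ≤ D₂)
    (hn4 : 4 * B ^ 3 * (1 + D₂ * Real.exp (η * ν₁ * n)) * r * (16 * B ^ 6) ≤ 3) :
    IsConeField f wd z x eu B r n V := by
  have hBp := hB.pos
  have hg := hB.goodChart hz n
  have hsub : Metric.closedBall (orbitPt f wd z x n) r ⊆
      Metric.ball (orbitPt f wd z x n) B⁻¹ := by
    refine Metric.closedBall_subset_ball ?_
    rw [← one_div, lt_div_iff₀ hBp]
    linarith
  have hself : orbitPt f wd z x n ∈ Metric.ball (orbitPt f wd z x n) B⁻¹ :=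
    Metric.mem_ball_self (inv_pos.2 hBp)
  have hdom : ∀ p ∈ Metric.closedBall (orbitPt f wd z x n) r,
      (extChartAt (𝓡 2) (z n)).symm p ∈ V.domain := by
    intro p hp
    refine hV.mem_domain x hxK _ ?_
    have h1 := hg.edist_symm_le hself (hsub hp)
    have h2 : (extChartAt (𝓡 2) (z n)).symm (orbitPt f wd z x n) = wordMap f wd n x :=
      symm_coord hg.mem_source
    rw [h2] at h1
    refine h1.trans (ENNReal.ofReal_le_ofReal (le_trans ?_ hn3))
    gcongr
    exact mem_closedBall_iff_norm.1 hp
  have hdom' : ∀ y ∈ (chartAt Plane (z n)).source,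
      extChartAt (𝓡 2) (z n) y ∈ Metric.closedBall (orbitPt f wd z x n) r → y ∈ V.domain := by
    intro y hy hyr
    have := hdom _ hyr
    rwa [symm_coord hy] at this
  refine ⟨hdom', fun y hy hyr u hu => ?_⟩
  rcases eq_or_ne u 0 with rfl | hu0
  · simp
  set e := orbitVec f wd z x eu n with he
  have hxball : extChartAt (𝓡 2) (z n) (wordMap f wd n x) ∈
      Metric.closedBall (orbitPt f wd z x n) r := Metric.mem_closedBall_self hr0
  have hxV := hdom' _ hg.mem_source hxball
  obtain ⟨u₀, hu₀, hu₀0⟩ := V.exists_ne_zero hxV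
  obtain ⟨v, hv, hv0⟩ := hS.exists_ne_zero
  have h1 := hs.wedge_ge_of_lineAngle hB hz hS hv hv0 hu₀0
    ((hV.angle_lt x hxK S hS v hv hv0 u₀ hu₀ hu₀0).le.trans hn2) hn1
  have h2 := lineSlope_coord (e := e) hg.mem_source hxV hu₀ hu₀0
  have h3 := lineSlope_coord (e := e) hy (hdom' y hy hyr) hu hu0
  have h4 := hV.c2Norm_le.lineSlope_sub_le hB (hz n).1 (hz n).2 e
    (convex_closedBall (orbitPt f wd z x n) r) hsub hdom hxball hyr
  rw [h2, h3] at h4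
  set w₀ := toChart (z n) (wordMap f wd n x) u₀
  set w := toChart (z n) y u
  have hw₀ : 0 < ‖w₀‖ := norm_pos_iff.2 fun h0 => hu₀0
    (toChart_injective hg.mem_source (h0.trans (map_zero _).symm))
  have hw : 0 < ‖w‖ := norm_pos_iff.2 fun h0 => hu0
    (toChart_injective hy (h0.trans (map_zero _).symm))
  have h5 : ‖e‖ ^ 2 ≤ 4 * B ^ 6 * (wedge w₀ e ^ 2 / ‖w₀‖ ^ 2) := by
    rw [← mul_div_assoc, le_div_iff₀ (by positivity)]
    have := pow_le_pow_left₀ (by positivity) h1 2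
    rw [mul_pow, mul_pow, sq_abs] at this
    nlinarith
  have h6 : wedge w₀ e ^ 2 / ‖w₀‖ ^ 2 - wedge w e ^ 2 / ‖w‖ ^ 2 ≤
      4 * ‖e‖ ^ 2 * B ^ 3 * (1 + D₂ * Real.exp (η * ν₁ * n)) * r := by
    have h7 := (neg_le_of_abs_le h4)
    have h8 : 4 * ‖e‖ ^ 2 * B ^ 3 * (1 + D₂ * Real.exp (η * ν₁ * n)) *
        ‖extChartAt (𝓡 2) (z n) y - extChartAt (𝓡 2) (z n) (wordMap f wd n x)‖ ≤
        4 * ‖e‖ ^ 2 * B ^ 3 * (1 + D₂ * Real.exp (η * ν₁ * n)) * r := by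
      gcongr
      exact mem_closedBall_iff_norm.1 hyr
    linarith
  have h9 : ‖e‖ ^ 2 ≤ 16 * B ^ 6 * (wedge w e ^ 2 / ‖w‖ ^ 2) := by
    have e1 := mul_le_mul_of_nonneg_left h6 (by positivity : 0 ≤ 16 * B ^ 6)
    have e2 := mul_le_mul_of_nonneg_left hn4 (sq_nonneg ‖e‖)
    nlinarith
  rw [← mul_div_assoc, le_div_iff₀ (by positivity)] at h9
  refine abs_le_of_sq_le_sq' ?_ (by positivity) |>.2
  rw [mul_pow, mul_pow, sq_abs]
  nlinarith

/-- All that is needed to control the leaves, of time `n`, of the pullback of the line field `V`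
near `x`: uniform bounds for the dynamics, a tempered splitting along the orbit of `x`, a width `β`
of the tube, and a line field `V` far from the expanding direction at time `n`. -/
structure IsAdapted (ρ : M → ℝ) (f : Fin m → M ≃ₘ^2⟮𝓡 2, 𝓡 2⟯ M) (𝒜 : FiniteAtlas M)
    (wd : ℕ → Fin m) (z : ℕ → M) (x : M) (B L lam ε β : ℝ) (n : ℕ)
    (es eu : TangentSpace (𝓡 2) x) (V : LineField M) : Prop where
  bounds : UniformBounds ρ f 𝒜 B
  itinerary : IsItinerary f wd 𝒜 x z
  splitting : IsSplitting f wd z x L lam ε n es eu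
  width_pos : 0 < β
  width_lt : 2 * B ^ 2 * β < 1
  width_small : 8 * (2 * B ^ 2 * β * HypSeq.errConst L lam * (1 + 4 * B ^ 3 * L ^ 2)) ≤ 1
  cone : IsConeField f wd z x eu B (2 * B * β * Real.exp (-lam * n / 2)) n V
  c2 : ∃ b, V.C2NormLE 𝒜 b

/-- The contraction constant along leaves: tangent vectors of leaves are contracted like `es`, up to
this constant and subexponential factors. -/
def leafConst (B L : ℝ) : ℝ := 4 * (1 + 4 * B ^ 3 * L ^ 2)

/-- A bound for the slope of the leaves with respect to the contracting direction. It is small when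
`n` is large and the tube is narrow. -/
def leafSlope (B L lam β : ℝ) (n : ℕ) : ℝ :=
  8 * B ^ 3 * L ^ 6 * Real.exp (-lam * n) +
    8 * B ^ 2 * β * HypSeq.errConst L lam * (1 + 4 * B ^ 3 * L ^ 2) * L ^ 2

/-- Vectors at points of the tube that are mapped to `V` at time `n` are contracted like `es`, and
almost parallel to it. -/
theorem IsAdapted.tangent_bound (h : IsAdapted ρ f 𝒜 wd z x B L lam ε β n es eu V) {y : M}
    (hy : InTube f wd x β lam n y) {v : TangentSpace (𝓡 2) y}
    (hv : wordDeriv f wd n y v ∈ V.dir (wordMap f wd n y)) :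
    (∀ k ≤ n, ‖orbitVec f wd z y v k‖ ≤ leafConst B L * Real.exp (5 * ε * k) *
        ‖orbitVec f wd z x es k‖ *
        |coordS (orbitVec f wd z x es 0) (orbitVec f wd z x eu 0) (toChart (z 0) y v)|) ∧
      |coordU (orbitVec f wd z x es 0) (orbitVec f wd z x eu 0) (toChart (z 0) y v)| ≤
        leafSlope B L lam β n *
        |coordS (orbitVec f wd z x es 0) (orbitVec f wd z x eu 0) (toChart (z 0) y v)| := by
  have hBp := h.bounds.pos
  have hyp := h.splitting.hyp
  obtain ⟨h1, h2, h3⟩ := hy.chart h.bounds h.itinerary h.width_pos h.width_lt hyp.lam_pos.le le_rfl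
  have h4 := h.cone.cone _ h1 (mem_closedBall_iff_norm.2 h2) _ hv
  have hc : L ^ 2 / (4 * B ^ 3)⁻¹ = 4 * B ^ 3 * L ^ 2 := by
    rw [div_inv_eq_mul]; ring
  have hβ0 := h.width_pos
  obtain ⟨key1, key2⟩ := hyp.contracting_bound (β := 2 * B ^ 2 * β) (w := orbitVec f wd z y v)
    (c := (4 * B ^ 3)⁻¹) (by positivity)
    (fun k hk => hy.orbitVec_pseudo h.bounds h.itinerary h.width_pos h.width_lt hyp.lam_pos.le v hk)
    (by positivity) (by
      rw [inv_mul_le_iff₀ (by positivity)]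
      exact h4) (by rw [hc]; exact h.width_small)
  rw [orbitVec_zero z y v] at key1 key2
  rw [hc] at key1 key2
  refine ⟨fun k hk => (key1 k hk).trans (le_of_eq (by rw [leafConst])),
    key2.trans (le_of_eq ?_)⟩
  rw [leafSlope]
  ring

/-- A unit speed curve starting at `x` that is mapped by the time `n` map to a curve tangent
to `V`. -/
structure IsLeafCurve (f : Fin m → M ≃ₘ^2⟮𝓡 2, 𝓡 2⟯ M) (wd : ℕ → Fin m) (n : ℕ)
    (V : LineField M) (x : M) (T : ℝ) (σ : ℝ → M) : Prop where
  pos : 0 < T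
  contMDiffOn : ContMDiffOn 𝓘(ℝ, ℝ) (𝓡 2) 1 σ (Icc 0 T)
  zero : σ 0 = x
  norm_velocity : ∀ s ∈ Icc 0 T, ‖velocityWithin σ (Icc 0 T) s‖ = 1
  mem_dir : ∀ s ∈ Icc 0 T,
    wordDeriv f wd n (σ s) (velocityWithin σ (Icc 0 T) s) ∈ V.dir (wordMap f wd n (σ s))

theorem hasDerivWithinAt_orbitPt {σ : ℝ → M} {S : Set ℝ} {s : ℝ} {k : ℕ}
    (hσ : MDifferentiableWithinAt 𝓘(ℝ, ℝ) (𝓡 2) σ S s) (hS : UniqueDiffWithinAt ℝ S s)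
    (hs : wordMap f wd k (σ s) ∈ (chartAt Plane (z k)).source) :
    HasDerivWithinAt (fun s => orbitPt f wd z (σ s) k)
      (orbitVec f wd z (σ s) (velocityWithin σ S s) k) S s := by
  have h1 : MDifferentiableWithinAt 𝓘(ℝ, ℝ) (𝓡 2) (wordMap f wd k ∘ σ) S s :=
    (mdifferentiableAt_wordMap k (σ s)).comp_mdifferentiableWithinAt s hσ
  have h2 := hasDerivWithinAt_coord (z := z k) h1 hS hs
  have h3 : velocityWithin (wordMap f wd k ∘ σ) S s =
      wordDeriv f wd k (σ s) (velocityWithin σ S s) := by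
    have := mfderiv_comp_mfderivWithin s (mdifferentiableAt_wordMap (f := f) (wd := wd) k (σ s)) hσ
      hS.uniqueMDiffWithinAt
    exact congrArg (fun A : ℝ →L[ℝ] TangentSpace (𝓡 2) (wordMap f wd k (σ s)) => A (1 : ℝ)) this
  rw [h3] at h2
  exact h2

/-- Leaves in the tube are contracted like `es`. -/
theorem IsAdapted.leaf_contraction (h : IsAdapted ρ f 𝒜 wd z x B L lam ε β n es eu V) {T t : ℝ}
    {σ : ℝ → M} (hσ : IsLeafCurve f wd n V x T σ) (ht : t ∈ Icc 0 T)
    (htube : ∀ s ∈ Icc 0 t, InTube f wd x β lam n (σ s)) :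
    ∀ k ≤ n, ‖orbitPt f wd z (σ t) k - orbitPt f wd z x k‖ ≤
      leafConst B L * (L ^ 2 * B) * Real.exp (5 * ε * k) * ‖orbitVec f wd z x es k‖ * t := by
  intro k hk
  have hBp := h.bounds.pos
  have hyp := h.splitting.hyp
  have hL := hyp.L_pos
  have hsub : Icc 0 t ⊆ Icc 0 T := Icc_subset_Icc_right ht.2
  have hlc : 0 ≤ leafConst B L := by rw [leafConst]; positivity
  have key := norm_image_sub_le_of_norm_deriv_le_segment'
    (f := fun s => orbitPt f wd z (σ s) k) (a := 0) (b := t)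
    (f' := fun s => orbitVec f wd z (σ s) (velocityWithin σ (Icc 0 T) s) k)
    (C := leafConst B L * (L ^ 2 * B) * Real.exp (5 * ε * k) * ‖orbitVec f wd z x es k‖)
    (fun s hs => (hasDerivWithinAt_orbitPt ((hσ.contMDiffOn s (hsub hs)).mdifferentiableWithinAt
      one_ne_zero) (uniqueDiffOn_Icc hσ.pos s (hsub hs))
      ((htube s hs).chart h.bounds h.itinerary h.width_pos h.width_lt hyp.lam_pos.le hk).1).mono
        hsub) (fun s hs => ?_) t ⟨ht.1, le_rfl⟩
  · rw [hσ.zero, sub_zero] at key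
    exact key
  · have hsI : s ∈ Icc 0 t := ⟨hs.1, hs.2.le⟩
    have h1 := (h.tangent_bound (htube s hsI) (hσ.mem_dir s (hsub hsI))).1 k hk
    have h2 := (htube s hsI).chart h.bounds h.itinerary h.width_pos h.width_lt hyp.lam_pos.le
      (Nat.zero_le n)
    have h3 := (h.bounds.goodChart h.itinerary 0).norm_toChart_le h2.1 h2.2.2
      (velocityWithin σ (Icc 0 T) s)
    have h3' : ‖toChart (z 0) (σ s) (velocityWithin σ (Icc 0 T) s)‖ ≤ B := by
      have h4 := hσ.norm_velocity s (hsub hsI)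
      calc _ ≤ B * ‖velocityWithin σ (Icc 0 T) s‖ := h3
        _ = B := by rw [h4, mul_one]
    have h5 := abs_coordS_le hL (hyp.es_ne 0 (Nat.zero_le n)) (hyp.eu_ne 0 (Nat.zero_le n))
      h.splitting.angle_zero (toChart (z 0) (σ s) (velocityWithin σ (Icc 0 T) s))
    have h6 : |coordS (orbitVec f wd z x es 0) (orbitVec f wd z x eu 0)
        (toChart (z 0) (σ s) (velocityWithin σ (Icc 0 T) s))| ≤ L ^ 2 * B := by
      refine h5.trans ?_
      rw [div_le_iff₀ (hyp.es_pos (Nat.zero_le n))]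
      have e1 := mul_le_mul_of_nonneg_left hyp.le_es_zero (by positivity : 0 ≤ L * B)
      have e2 : L * ‖toChart (z 0) (σ s) (velocityWithin σ (Icc 0 T) s)‖ ≤ L * B := by gcongr
      linarith
    calc _ ≤ leafConst B L * Real.exp (5 * ε * k) * ‖orbitVec f wd z x es k‖ * (L ^ 2 * B) :=
          h1.trans (by gcongr)
      _ = _ := by ring

/-- The contraction improves the tube: as long as a leaf stays in the tube of width `β`, its point
at arclength `t` is in the tube of width proportional to `t`. -/
theorem IsAdapted.inTube_of_leaf (h : IsAdapted ρ f 𝒜 wd z x B L lam ε β n es eu V) {T t : ℝ}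
    {σ : ℝ → M} (hσ : IsLeafCurve f wd n V x T σ) (ht : t ∈ Icc 0 T)
    (htube : ∀ s ∈ Icc 0 t, InTube f wd x β lam n (σ s)) :
    InTube f wd x (leafConst B L * L ^ 4 * B ^ 2 * t) lam n (σ t) := by
  intro k hk
  have hBp := h.bounds.pos
  have hyp := h.splitting.hyp
  have hL := hyp.L_pos
  have hlc : 0 ≤ leafConst B L := by rw [leafConst]; positivity
  have h1 := h.leaf_contraction hσ ht htube k hk
  have h2 := (htube t ⟨ht.1, le_rfl⟩).chart h.bounds h.itinerary h.width_pos h.width_lt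
    hyp.lam_pos.le hk
  have hg := h.bounds.goodChart h.itinerary k
  have h3 := hg.edist_symm_le (Metric.mem_ball_self (inv_pos.2 hBp)) h2.2.2
  have e1 : (extChartAt (𝓡 2) (z k)).symm (orbitPt f wd z (σ t) k) = wordMap f wd k (σ t) :=
    symm_coord h2.1
  rw [symm_coord hg.mem_source, e1] at h3
  refine h3.trans (ENNReal.ofReal_le_ofReal ?_)
  have h4 := hyp.es_bound hk
  calc B * ‖orbitPt f wd z (σ t) k - orbitPt f wd z x k‖
      ≤ B * (leafConst B L * (L ^ 2 * B) * Real.exp (5 * ε * k) *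
        (L ^ 2 * Real.exp (-lam * k)) * t) := by
        have := ht.1
        gcongr
        exact h1.trans (by gcongr)
    _ = leafConst B L * L ^ 4 * B ^ 2 * t * (Real.exp (5 * ε * k) * Real.exp (-lam * k)) := by ring
    _ ≤ _ := by
      have := ht.1
      gcongr
      rw [← Real.exp_add]
      refine Real.exp_le_exp.2 ?_
      have : 100 * ε * k ≤ lam * k := by gcongr; exact hyp.eps_le
      have : 0 ≤ lam * k := by have := hyp.lam_pos; positivity
      linarith

theorem isClosed_inTube : IsClosed {y | InTube f wd x β lam n y} := by
  have : {y | InTube f wd x β lam n y} = ⋂ k, ⋂ (_ : k ≤ n), {y | edist (wordMap f wd k x)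
      (wordMap f wd k y) ≤ ENNReal.ofReal (β * Real.exp (-lam * k / 2))} := by
    ext y
    simp [InTube]
  rw [this]
  refine isClosed_iInter fun k => isClosed_iInter fun _ => ?_
  exact isClosed_le (continuous_const.edist (contMDiff_wordMap k).continuous) continuous_const

theorem InTube.eventually {β' : ℝ} {y : M} (h : InTube f wd x β lam n y) (hβ : β < β')
    (hβ0 : 0 < β') : ∀ᶠ y' in 𝓝 y, InTube f wd x β' lam n y' := by
  have h1 : ∀ k ∈ Finset.range (n + 1), ∀ᶠ y' in 𝓝 y, edist (wordMap f wd k x) (wordMap f wd k y') <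
      ENNReal.ofReal (β' * Real.exp (-lam * k / 2)) := by
    intro k hk
    have hc : Continuous fun y' => edist (wordMap f wd k x) (wordMap f wd k y') :=
      continuous_const.edist (contMDiff_wordMap k).continuous
    refine hc.continuousAt.eventually_lt continuousAt_const
      ((h k (Nat.lt_succ_iff.1 (Finset.mem_range.1 hk))).trans_lt ?_)
    refine (ENNReal.ofReal_lt_ofReal_iff (by positivity)).2 ?_
    gcongr
  filter_upwards [(Finset.eventually_all _).2 h1] with y' hy' k hk
  exact (hy' k (Finset.mem_range.2 (Nat.lt_succ_of_le hk))).le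

/-- Short leaves stay in the tube: the improvement of `inTube_of_leaf` prevents them from reaching
its boundary. -/
theorem IsAdapted.leaf_inTube (h : IsAdapted ρ f 𝒜 wd z x B L lam ε β n es eu V) {T : ℝ}
    {σ : ℝ → M} (hσ : IsLeafCurve f wd n V x T σ)
    (hT : 2 * (leafConst B L * L ^ 4 * B ^ 2 * T) ≤ β) :
    ∀ s ∈ Icc 0 T, InTube f wd x β lam n (σ s) := by
  have hlc : 0 ≤ leafConst B L * L ^ 4 * B ^ 2 := by
    have := h.bounds.pos
    rw [leafConst]; positivity
  have hβ := h.width_pos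
  refine Icc_subset_of_continuity (S := {s | InTube f wd x β lam n (σ s)}) ?_ ?_ ?_
  · rw [inter_comm]
    exact hσ.contMDiffOn.continuousOn.preimage_isClosed_of_isClosed isClosed_Icc isClosed_inTube
  · change InTube f wd x β lam n (σ 0)
    rw [hσ.zero]
    exact inTube_self
  · intro t ht hsub
    have htI : t ∈ Icc 0 T := ⟨ht.1, ht.2.le⟩
    have h1 := h.inTube_of_leaf hσ htI fun s hs => hsub hs
    have h2 : leafConst B L * L ^ 4 * B ^ 2 * t ≤ leafConst B L * L ^ 4 * B ^ 2 * T := by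
      gcongr
      exact ht.2.le
    have h3 := (h1.mono_width (β' := β / 2) (by linarith)).eventually (β' := β) (by linarith) hβ
    have h4 : ContinuousWithinAt σ (Ioi t) t :=
      (hσ.contMDiffOn.continuousOn t htI).mono_of_mem_nhdsWithin
        (mem_of_superset (Ioo_mem_nhdsGT ht.2) fun s hs => ⟨ht.1.trans hs.1.le, hs.2.le⟩)
    exact h4.eventually h3

end Leaves

/-! ### Integral curves of vector fields on open sets -/

/-- A `C¹` vector field on an open set has, for all times, a curve that is an integral curve as
long as it stays in a given compact subset. -/
theorem exists_curve_of_compact {E : Type*} [NormedAddCommGroup E] [NormedSpace ℝ E]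
    [FiniteDimensional ℝ E] {U Q : Set E} (hU : IsOpen U) (hQ : IsCompact Q) (hQU : Q ⊆ U)
    {X : E → E} (hX : ∀ p ∈ U, ContDiffAt ℝ 1 X p) (p₀ : E) {T : ℝ} (hT : 0 ≤ T) :
    ∃ σ : ℝ → E, σ 0 = p₀ ∧ ContDiffOn ℝ 1 σ (Icc 0 T) ∧
      ∀ t ∈ Icc 0 T, σ t ∈ Q → HasDerivWithinAt σ (X (σ t)) (Icc 0 T) t := by
  -- the field is cut off outside a neighbourhood of the compact set, and then complete
  obtain ⟨K', hK', hQK', hK'U⟩ := exists_compact_between hQ hU hQU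
  obtain ⟨χ, hχ1, hχ0, -⟩ := exists_contMDiffMap_one_nhds_of_subset_interior (n := 1) 𝓘(ℝ, E)
    hQ.isClosed hQK'
  have hχ : ContDiff ℝ 1 χ := χ.contMDiff.contDiff
  set Y : E → E := fun p => χ p • X p with hY
  have hYsupp : HasCompactSupport Y :=
    HasCompactSupport.intro hK' fun p hp => by simp [hY, hχ0 p hp]
  have hYdiff : ContDiff ℝ 1 Y := by
    rw [contDiff_iff_contDiffAt]
    intro p
    by_cases hp : p ∈ U
    · exact hχ.contDiffAt.smul (hX p hp)
    · have : Y =ᶠ[𝓝 p] fun _ => 0 := by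
        filter_upwards [hK'.isClosed.isOpen_compl.mem_nhds fun h => hp (hK'U h)] with q hq
        simp [hY, hχ0 q hq]
      exact contDiffAt_const.congr_of_eventuallyEq this
  obtain ⟨K, hK⟩ := ContDiff.lipschitzWith_of_hasCompactSupport hYsupp hYdiff one_ne_zero
  obtain ⟨C, hC⟩ := hYsupp.exists_bound_of_continuous hYdiff.continuous
  have hC0 : 0 ≤ C := (norm_nonneg _).trans (hC 0)
  have hPL : IsPicardLindelof (fun _ p => Y p) (tmin := 0) (tmax := T)
      ⟨0, le_rfl, hT⟩ p₀ (⟨C, hC0⟩ * ⟨T, hT⟩) 0 ⟨C, hC0⟩ K := by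
    refine ⟨fun t _ => hK.lipschitzOnWith, fun p _ => continuousOn_const, fun t _ p _ => hC p, ?_⟩
    rw [max_eq_left (by simpa using hT)]
    change C * (T - 0) ≤ C * T - 0
    simp
  obtain ⟨σ, h0, hσ⟩ := hPL.exists_eq_forall_mem_Icc_hasDerivWithinAt₀
  have hσc : ContinuousOn σ (Icc 0 T) := fun t ht => (hσ t ht).continuousWithinAt
  refine ⟨σ, h0, ?_, fun t ht hQt => ?_⟩
  · rcases hT.eq_or_lt with rfl | hT'
    · rw [Icc_self]
      intro t ht
      rw [mem_singleton_iff.1 ht]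
      exact contDiffWithinAt_singleton
    · rw [show (1 : ℕ∞ω) = 0 + 1 from rfl, contDiffOn_succ_iff_derivWithin (uniqueDiffOn_Icc hT')]
      refine ⟨fun t ht => (hσ t ht).differentiableWithinAt, by simp, ?_⟩
      rw [contDiffOn_zero]
      refine (hYdiff.continuous.comp_continuousOn hσc).congr fun t ht => ?_
      exact (hσ t ht).derivWithin (uniqueDiffOn_Icc hT' t ht)
  · have h1 : χ (σ t) = 1 := hχ1.self_of_nhdsSet _ hQt
    have := hσ t ht
    simpa [hY, h1] using this

section LeafExistence

variable {M : Type*} [EMetricSpace M] [ChartedSpace Plane M] [IsManifold (𝓡 2) ∞ M]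
variable {m : ℕ} {f : Fin m → M ≃ₘ^2⟮𝓡 2, 𝓡 2⟯ M} {wd : ℕ → Fin m}

theorem wordDeriv_injective (n : ℕ) (y : M) : Function.Injective (wordDeriv f wd n y) := by
  induction n with
  | zero =>
    intro u v h
    rwa [wordDeriv_zero, wordDeriv_zero] at h
  | succ n ih =>
    intro u v h
    rw [wordDeriv_succ, wordDeriv_succ] at h
    exact ih (((f (wd n)).mfderivToContinuousLinearEquiv two_ne_zero _).injective h)

variable [RiemannianBundle (fun x : M => TangentSpace (𝓡 2) x)] {ρ : M → ℝ} {𝒜 : FiniteAtlas M}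
  {B : ℝ} {x : M} {z : ℕ → M} {L lam ε β : ℝ} {n : ℕ} {es eu : TangentSpace (𝓡 2) x}
  {V : LineField M} [IsRiemannianManifold (𝓡 2) M]

/-- `u` is a unit vector mapped into `V` by the time `n` differential, and its component along `e`
in the basis `e, e'` of the chart at `z` has the sign of `s`. -/
structure IsLeafVector (f : Fin m → M ≃ₘ^2⟮𝓡 2, 𝓡 2⟯ M) (wd : ℕ → Fin m) (n : ℕ)
    (V : LineField M) (z : M) (e e' : Plane) (s : ℝ) (y : M) (u : TangentSpace (𝓡 2) y) :
    Prop where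
  norm_eq : ‖u‖ = 1
  mem_dir : wordDeriv f wd n y u ∈ V.dir (wordMap f wd n y)
  pos : 0 < s * coordS e e' (toChart z y u)

theorem coordS_smul (e e' w : Plane) (c : ℝ) : coordS e e' (c • w) = c * coordS e e' w := by
  rw [coordS, coordS, map_smul, smul_apply, smul_eq_mul, mul_div_assoc]

/-- A vector mapped to `V` is almost parallel to `es`, so it is determined by its component along
`es`. -/
theorem IsAdapted.eq_zero_of_coordS_eq_zero (h : IsAdapted ρ f 𝒜 wd z x B L lam ε β n es eu V)
    {y : M} (hy : InTube f wd x β lam n y) {u : TangentSpace (𝓡 2) y}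
    (hu : wordDeriv f wd n y u ∈ V.dir (wordMap f wd n y))
    (h0 : coordS (orbitVec f wd z x es 0) (orbitVec f wd z x eu 0) (toChart (z 0) y u) = 0) :
    u = 0 := by
  have h1 := (h.tangent_bound hy hu).2
  rw [h0, abs_zero, mul_zero] at h1
  have h2 := coordS_smul_add (h.splitting.hyp.wedge_ne (Nat.zero_le n)) (toChart (z 0) y u)
  rw [h0, abs_nonpos_iff.1 h1, zero_smul, zero_smul, add_zero] at h2
  exact toChart_injective (hy.chart h.bounds h.itinerary h.width_pos h.width_lt
    h.splitting.hyp.lam_pos.le (Nat.zero_le n)).1 (h2.symm.trans (map_zero _).symm)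

theorem IsAdapted.leafVector_unique (h : IsAdapted ρ f 𝒜 wd z x B L lam ε β n es eu V)
    {y : M} (hy : InTube f wd x β lam n y) {s : ℝ} {u u' : TangentSpace (𝓡 2) y}
    (hu : IsLeafVector f wd n V (z 0) (orbitVec f wd z x es 0) (orbitVec f wd z x eu 0) s y u)
    (hu' : IsLeafVector f wd n V (z 0) (orbitVec f wd z x es 0) (orbitVec f wd z x eu 0) s y u') :
    u = u' := by
  set e := orbitVec f wd z x es 0
  set e' := orbitVec f wd z x eu 0
  set a := coordS e e' (toChart (z 0) y u) with ha
  set a' := coordS e e' (toChart (z 0) y u') with ha'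
  have h1 : a' • u - a • u' = 0 := by
    refine h.eq_zero_of_coordS_eq_zero hy ?_ ?_
    · rw [map_sub, map_smul, map_smul]
      exact Submodule.sub_mem _ (Submodule.smul_mem _ _ hu.mem_dir)
        (Submodule.smul_mem _ _ hu'.mem_dir)
    · rw [map_sub, map_smul, map_smul, coordS_sub, coordS_smul, coordS_smul]
      change a' * a - a * a' = 0
      ring
  have h2 : a' • u = a • u' := sub_eq_zero.1 h1
  have h3 : |a'| = |a| := by
    have := congrArg norm h2
    rwa [norm_smul, norm_smul, hu.norm_eq, hu'.norm_eq, mul_one, mul_one] at this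
  have h4 : 0 < s * a := hu.pos
  have h5 : 0 < s * a' := hu'.pos
  have h6 : a' = a := by
    rcases abs_eq_abs.1 h3 with h | h
    · exact h
    · rw [h] at h5
      linarith
  have h7 : a ≠ 0 := fun h0 => by rw [h0, mul_zero] at h4; exact h4.ne rfl
  rw [h6] at h2
  exact smul_right_injective _ h7 h2

variable [IsContMDiffRiemannianBundle (𝓡 2) ∞ Plane (fun x : M => TangentSpace (𝓡 2) x)]

/-- The unit vectors mapped to `V` form, near every point of the tube, a `C¹` field: it is obtained
from a field that spans `V` by the inverse of the differential of the time `n` map, which is `C¹`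
since the map is `C²`. The sign of the component along `es` singles out one of the two orientations,
so that the local fields agree. -/
theorem IsAdapted.exists_local_leafVector (h : IsAdapted ρ f 𝒜 wd z x B L lam ε β n es eu V)
    {y : M} (hy : InTube f wd x β lam n y) {s : ℝ} (hs : s ≠ 0) :
    ∃ φ : Plane → Plane, ContDiffAt ℝ 1 φ (extChartAt (𝓡 2) (z 0) y) ∧
      ∀ᶠ q in 𝓝 (extChartAt (𝓡 2) (z 0) y), ∃ u : TangentSpace (𝓡 2) ((extChartAt (𝓡 2) (z 0)).symm q),
        toChart (z 0) _ u = φ q ∧ IsLeafVector f wd n V (z 0) (orbitVec f wd z x es 0)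
          (orbitVec f wd z x eu 0) s ((extChartAt (𝓡 2) (z 0)).symm q) u := by
  set e := orbitVec f wd z x es 0 with he
  set e' := orbitVec f wd z x eu 0 with he'
  have hlam := h.splitting.hyp.lam_pos.le
  obtain ⟨hy0, -, -⟩ := hy.chart h.bounds h.itinerary h.width_pos h.width_lt hlam (Nat.zero_le n)
  obtain ⟨hyn, hyn2, hyn3⟩ := hy.chart h.bounds h.itinerary h.width_pos h.width_lt hlam le_rfl
  change y ∈ _ at hy0
  obtain ⟨b, hb⟩ := h.c2
  have hyV : wordMap f wd n y ∈ V.domain :=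
    h.cone.mem_domain _ hyn (mem_closedBall_iff_norm.2 hyn2)
  obtain ⟨φ₀, hφ₀, -, hφ₀1, hφ₀V⟩ := hb.exists_lift h.bounds (h.itinerary n).1 (h.itinerary n).2
    hyn3 (by rw [orbitPt, symm_coord hyn]; exact hyV)
  obtain ⟨p, hp, rfl⟩ := exists_coord hy0
  rw [coord_symm hp]
  set Φ := chartMap (wordMap f wd n) (z 0) (z n) with hΦ
  have hΦp : Φ p = orbitPt f wd z ((extChartAt (𝓡 2) (z 0)).symm p) n := rfl
  have hopen := isOpen_chartDomain (contMDiff_wordMap (f := f) (wd := wd) n).continuous (z 0) (z n)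
  have hpD : p ∈ chartDomain (wordMap f wd n) (z 0) (z n) := ⟨hp, hyn⟩
  have hΦd : ContDiffAt ℝ 2 Φ p :=
    (contDiffOn_chartMap (ENat.LEInfty.out : (2 : ℕ∞ω) ≤ (∞ : ℕ∞ω))
      (contMDiff_wordMap n) (z 0) (z n)).contDiffAt (hopen.mem_nhds hpD)
  have hchain : ∀ q ∈ chartDomain (wordMap f wd n) (z 0) (z n), ∀ v,
      toChart (z n) _ (wordDeriv f wd n ((extChartAt (𝓡 2) (z 0)).symm q) (ofChart (z 0) q v)) =
        fderiv ℝ Φ q v := by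
    intro q hq v
    have e1 := toChart_mfderiv (z := z 0) (z' := z n)
      (mdifferentiableAt_wordMap (f := f) (wd := wd) n ((extChartAt (𝓡 2) (z 0)).symm q))
      (symm_mem_source hq.1) hq.2 (ofChart (z 0) q v)
    rwa [toChart_ofChart hq.1, coord_symm hq.1] at e1
  have hinj : ∀ q ∈ chartDomain (wordMap f wd n) (z 0) (z n),
      Function.Injective (fderiv ℝ Φ q) := by
    intro q hq v w hvw
    rw [← hchain q hq, ← hchain q hq] at hvw
    exact ofChart_injective hq.1 (wordDeriv_injective n _ (toChart_injective hq.2 hvw))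
  have hequiv : ∀ q ∈ chartDomain (wordMap f wd n) (z 0) (z n),
      ∃ E : Plane ≃L[ℝ] Plane, (E : Plane →L[ℝ] Plane) = fderiv ℝ Φ q := fun q hq =>
    ⟨ContinuousLinearEquiv.ofBijective (fderiv ℝ Φ q) (LinearMap.ker_eq_bot.2 (hinj q hq))
      (LinearMap.range_eq_top.2 (LinearMap.injective_iff_surjective.1 (hinj q hq))), by
        ext; rfl⟩
  have hinv : ∀ q ∈ chartDomain (wordMap f wd n) (z 0) (z n), ∀ w,
      fderiv ℝ Φ q ((fderiv ℝ Φ q).inverse w) = w := by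
    intro q hq w
    obtain ⟨E, hE⟩ := hequiv q hq
    rw [← hE, ContinuousLinearMap.inverse_equiv]
    exact E.apply_symm_apply w
  set φ₁ : Plane → Plane := fun q => (fderiv ℝ Φ q).inverse (φ₀ (Φ q)) with hφ₁
  have hφ₁d : ContDiffAt ℝ 1 φ₁ p := by
    obtain ⟨E, hE⟩ := hequiv p hpD
    have h1 : ContDiffAt ℝ 1 (fderiv ℝ Φ) p := hΦd.fderiv_right (by rw [one_add_one_eq_two])
    have h2 : ContDiffAt ℝ 1 (fun q => (fderiv ℝ Φ q).inverse) p := by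
      have h3 := contDiffAt_map_inverse (𝕜 := ℝ) (n := 1) E
      rw [hE] at h3
      exact h3.comp p h1
    refine h2.clm_apply (ContDiffAt.comp p ?_ (hΦd.of_le one_le_two))
    rw [hΦp]
    exact hφ₀
  have hφ₁V : ∀ᶠ q in 𝓝 p,
      wordDeriv f wd n ((extChartAt (𝓡 2) (z 0)).symm q) (ofChart (z 0) q (φ₁ q)) ∈
        V.dir (wordMap f wd n ((extChartAt (𝓡 2) (z 0)).symm q)) := by
    have h1 : ∀ᶠ q in 𝓝 p, ∃ u ∈ V.dir ((extChartAt (𝓡 2) (z n)).symm (Φ q)),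
        toChart (z n) ((extChartAt (𝓡 2) (z n)).symm (Φ q)) u = φ₀ (Φ q) := by
      rw [← hΦp] at hφ₀V
      exact hΦd.continuousAt.eventually hφ₀V
    filter_upwards [h1, hopen.mem_nhds hpD] with q hq hqD
    have h2 : (extChartAt (𝓡 2) (z n)).symm (Φ q) =
        wordMap f wd n ((extChartAt (𝓡 2) (z 0)).symm q) := symm_coord hqD.2
    rw [h2] at hq
    obtain ⟨u, hu, hu'⟩ := hq
    have h3 := hchain q hqD (φ₁ q)
    rw [hφ₁, hinv q hqD, ← hu'] at h3
    rw [toChart_injective hqD.2 h3]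
    exact hu
  have hφ₁0 : φ₁ p ≠ 0 := by
    intro h0
    have h1 := hinv p hpD (φ₀ (Φ p))
    change fderiv ℝ Φ p (φ₁ p) = _ at h1
    rw [h0, map_zero, hΦp] at h1
    rw [← h1, norm_zero, mul_zero] at hφ₀1
    linarith
  have hcS : coordS e e' (φ₁ p) ≠ 0 := by
    intro h0
    have h1 := h.eq_zero_of_coordS_eq_zero hy hφ₁V.self_of_nhds
      (by rw [toChart_ofChart hp]; exact h0)
    exact hφ₁0 (ofChart_injective hp (h1.trans (map_zero _).symm))
  -- the sign for which the first coordinate has the sign of `s`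
  obtain ⟨τ, hτ, hτs⟩ : ∃ τ : ℝ, |τ| = 1 ∧ 0 < τ * (s * coordS e e' (φ₁ p)) := by
    rcases lt_or_gt_of_ne (mul_ne_zero hs hcS) with h1 | h1
    · exact ⟨-1, by simp, by linarith⟩
    · exact ⟨1, by simp, by linarith⟩
  have hgram : ContDiffAt ℝ 1 (fun q => gram (z 0) q (φ₁ q) (φ₁ q)) p :=
    ((((contDiffOn_gram (z 0)).contDiffAt ((isOpen_target (z 0)).mem_nhds hp)).of_le
      (by simp)).clm_apply hφ₁d).clm_apply hφ₁d
  have hgpos : 0 < gram (z 0) p (φ₁ p) (φ₁ p) := gram_pos hp hφ₁0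
  have hsqrt : ContDiffAt ℝ 1 (fun q => Real.sqrt (gram (z 0) q (φ₁ q) (φ₁ q))) p :=
    hgram.sqrt hgpos.ne'
  refine ⟨fun q => (τ / Real.sqrt (gram (z 0) q (φ₁ q) (φ₁ q))) • φ₁ q,
    (contDiffAt_const.div hsqrt (Real.sqrt_pos.2 hgpos).ne').smul hφ₁d, ?_⟩
  have hcont : ContinuousAt (fun q => τ * (s * coordS e e' (φ₁ q))) p := by
    refine continuousAt_const.mul (continuousAt_const.mul ?_)
    simp only [coordS]
    refine ContinuousAt.div_const ?_ _
    exact ((wedge.flip e').continuous.continuousAt).comp hφ₁d.continuousAt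
  filter_upwards [hφ₁V, hopen.mem_nhds hpD, hgram.continuousAt.eventually_const_lt hgpos,
    hcont.eventually_const_lt hτs] with q hqV hqD hqg hqs
  have hsq := Real.sqrt_pos.2 hqg
  refine ⟨ofChart (z 0) q ((τ / Real.sqrt (gram (z 0) q (φ₁ q) (φ₁ q))) • φ₁ q),
    toChart_ofChart hqD.1 _, ?_, ?_, ?_⟩
  · rw [map_smul, norm_smul, norm_div, Real.norm_eq_abs, hτ, Real.norm_eq_abs, abs_of_pos hsq]
    have h1 : ‖ofChart (z 0) q (φ₁ q)‖ = Real.sqrt (gram (z 0) q (φ₁ q) (φ₁ q)) := by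
      rw [← norm_sq_ofChart, Real.sqrt_sq (norm_nonneg _)]
    rw [h1, one_div, inv_mul_cancel₀ hsq.ne']
  · rw [map_smul, map_smul]
    exact Submodule.smul_mem _ _ hqV
  · rw [toChart_ofChart hqD.1, coordS_smul]
    have : s * (τ / Real.sqrt (gram (z 0) q (φ₁ q) (φ₁ q)) * coordS e e' (φ₁ q)) =
      τ * (s * coordS e e' (φ₁ q)) / Real.sqrt (gram (z 0) q (φ₁ q) (φ₁ q)) := by ring
    rw [this]
    exact div_pos hqs hsq

theorem isCompact_coord_tube [CompactSpace M] {β' : ℝ}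
    (hsub : ∀ y, InTube f wd x β' lam n y → y ∈ (chartAt Plane (z 0)).source) :
    IsCompact {q ∈ (extChartAt (𝓡 2) (z 0)).target |
      InTube f wd x β' lam n ((extChartAt (𝓡 2) (z 0)).symm q)} := by
  have h1 : IsCompact {y | InTube f wd x β' lam n y} := isClosed_inTube.isCompact
  have h2 := h1.image_of_continuousOn ((continuousOn_extChartAt (I := 𝓡 2) (z 0)).mono
    (by rw [extChartAt_source]; exact hsub))
  suffices e : {q ∈ (extChartAt (𝓡 2) (z 0)).target |
      InTube f wd x β' lam n ((extChartAt (𝓡 2) (z 0)).symm q)} =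
      extChartAt (𝓡 2) (z 0) '' {y | InTube f wd x β' lam n y} by
    rw [e]
    exact h2
  ext q
  constructor
  · rintro ⟨hq, hq'⟩
    exact ⟨_, hq', coord_symm hq⟩
  · rintro ⟨y, hy, rfl⟩
    refine ⟨coord_mem_target (hsub y hy), ?_⟩
    rw [symm_coord (hsub y hy)]
    exact hy

/-- On both sides of `x` there is a leaf curve of definite length, and it stays in the tube. -/
theorem IsAdapted.exists_leafCurve [CompactSpace M]
    (h : IsAdapted ρ f 𝒜 wd z x B L lam ε β n es eu V) {s : ℝ} (hs : s ≠ 0) {T : ℝ} (hT : 0 < T)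
    (hTβ : 4 * (leafConst B L * L ^ 4 * B ^ 2 * T) ≤ β) :
    ∃ σ : ℝ → M, IsLeafCurve f wd n V x T σ ∧ ∀ t ∈ Icc 0 T,
      0 < s * coordS (orbitVec f wd z x es 0) (orbitVec f wd z x eu 0)
        (toChart (z 0) (σ t) (velocityWithin σ (Icc 0 T) t)) := by
  set e := orbitVec f wd z x es 0 with he
  set e' := orbitVec f wd z x eu 0 with he'
  have hβ := h.width_pos
  have hlam := h.splitting.hyp.lam_pos.le
  have hsrc : ∀ y, InTube f wd x β lam n y → y ∈ (chartAt Plane (z 0)).source := fun y hy =>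
    (hy.chart h.bounds h.itinerary h.width_pos h.width_lt hlam (Nat.zero_le n)).1
  have hx0 : x ∈ (chartAt Plane (z 0)).source := hsrc x inTube_self
  let U₀ : Set Plane := {q | q ∈ (extChartAt (𝓡 2) (z 0)).target ∧
    InTube f wd x β lam n ((extChartAt (𝓡 2) (z 0)).symm q)}
  let Q : Set Plane := {q | q ∈ (extChartAt (𝓡 2) (z 0)).target ∧
    InTube f wd x (β / 2) lam n ((extChartAt (𝓡 2) (z 0)).symm q)}
  have hQ : IsCompact Q := isCompact_coord_tube fun y hy => hsrc y (hy.mono_width (by linarith))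
  have hsymm : ∀ q ∈ (extChartAt (𝓡 2) (z 0)).target,
      ContinuousAt (extChartAt (𝓡 2) (z 0)).symm q := fun q hq =>
    (continuousOn_extChartAt_symm (z 0)).continuousAt ((isOpen_target (z 0)).mem_nhds hq)
  have hQU : Q ⊆ interior U₀ := by
    intro q hq
    rw [mem_interior_iff_mem_nhds]
    filter_upwards [(isOpen_target (z 0)).mem_nhds hq.1,
      (hsymm q hq.1).eventually (hq.2.eventually (β' := β) (by linarith) hβ)] with q' h1 h2
    exact ⟨h1, h2⟩
  -- the leaf vector is unique, so the choice does not matter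
  let X : Plane → Plane := fun q => toChart (z 0) _ (Classical.epsilon fun u =>
    IsLeafVector f wd n V (z 0) e e' s ((extChartAt (𝓡 2) (z 0)).symm q) u)
  have hX : ∀ q ∈ U₀, ∀ u, IsLeafVector f wd n V (z 0) e e' s ((extChartAt (𝓡 2) (z 0)).symm q) u →
      X q = toChart (z 0) _ u := by
    intro q hq u hu
    exact congrArg _ (h.leafVector_unique hq.2 (Classical.epsilon_spec ⟨u, hu⟩) hu)
  have hXU : ∀ q ∈ interior U₀, ContDiffAt ℝ 1 X q := by
    intro q hq
    have hq0 := interior_subset hq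
    obtain ⟨φ, hφ, hφX⟩ := h.exists_local_leafVector hq0.2 hs
    rw [coord_symm hq0.1] at hφ hφX
    refine hφ.congr_of_eventuallyEq ?_
    filter_upwards [hφX, isOpen_interior.mem_nhds hq] with q' h1 h2
    obtain ⟨u, hu, hu'⟩ := h1
    rw [hX q' (interior_subset h2) u hu', hu]
  have hXvec : ∀ q ∈ Q, IsLeafVector f wd n V (z 0) e e' s ((extChartAt (𝓡 2) (z 0)).symm q)
      (ofChart (z 0) q (X q)) := by
    intro q hq
    have hq0 := interior_subset (hQU hq)
    obtain ⟨φ, hφ, hφX⟩ := h.exists_local_leafVector hq0.2 hs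
    rw [coord_symm hq0.1] at hφ hφX
    obtain ⟨u, hu, hu'⟩ := hφX.self_of_nhds
    rw [hX q hq0 u hu', ofChart_toChart hq0.1]
    exact hu'
  obtain ⟨c, hc0, hcd, hc⟩ := exists_curve_of_compact isOpen_interior hQ hQU hXU
    (extChartAt (𝓡 2) (z 0) x) hT.le
  -- the curve is a leaf curve as long as it stays in the tube
  have hleaf : ∀ t ∈ Ioc 0 T, (∀ r ∈ Icc 0 t, c r ∈ Q) →
      IsLeafCurve f wd n V x t (fun r => (extChartAt (𝓡 2) (z 0)).symm (c r)) ∧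
      ∀ r ∈ Icc 0 t, velocityWithin (fun r => (extChartAt (𝓡 2) (z 0)).symm (c r)) (Icc 0 t) r =
        ofChart (z 0) (c r) (X (c r)) := by
    intro t ht htQ
    have hsub : Icc 0 t ⊆ Icc 0 T := Icc_subset_Icc_right ht.2
    have hvel : ∀ r ∈ Icc 0 t,
        velocityWithin (fun r => (extChartAt (𝓡 2) (z 0)).symm (c r)) (Icc 0 t) r =
          ofChart (z 0) (c r) (X (c r)) := fun r hr =>
      velocityWithin_symm_comp ((hc r (hsub hr) (htQ r hr)).mono hsub)
        (uniqueDiffOn_Icc ht.1 r hr) (htQ r hr).1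
    refine ⟨⟨ht.1, ?_, ?_, fun r hr => ?_, fun r hr => ?_⟩, hvel⟩
    · have h1 : ContMDiffOn 𝓘(ℝ, Plane) (𝓡 2) 1 (extChartAt (𝓡 2) (z 0)).symm
          (extChartAt (𝓡 2) (z 0)).target :=
        (contMDiffOn_extChartAt_symm (n := ∞) (z 0)).of_le (by simp)
      exact h1.comp (hcd.mono hsub).contMDiffOn fun r hr => (htQ r hr).1
    · rw [hc0, symm_coord hx0]
    · rw [hvel r hr]
      exact (hXvec (c r) (htQ r hr)).norm_eq
    · rw [hvel r hr]
      exact (hXvec (c r) (htQ r hr)).mem_dir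
  have hc0Q : c 0 ∈ Q := by
    refine ⟨?_, ?_⟩
    · rw [hc0]
      exact coord_mem_target hx0
    · rw [hc0, symm_coord hx0]
      exact inTube_self
  have hlc : 0 ≤ leafConst B L * L ^ 4 * B ^ 2 := by
    have := h.bounds.pos
    rw [leafConst]; positivity
  -- the tube of width `β / 2` is never left, because the curve is in the one of width `β / 4`
  have hstay : Icc 0 T ⊆ {t | c t ∈ Q} := by
    refine Icc_subset_of_continuity ?_ hc0Q ?_
    · rw [inter_comm]
      exact hcd.continuousOn.preimage_isClosed_of_isClosed isClosed_Icc hQ.isClosed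
    · intro t ht hsub
      have htQ : ∀ r ∈ Icc 0 t, c r ∈ Q := fun r hr => hsub hr
      have hct : c t ∈ Q := htQ t ⟨ht.1, le_rfl⟩
      have h1 : InTube f wd x (β / 4) lam n ((extChartAt (𝓡 2) (z 0)).symm (c t)) := by
        rcases ht.1.eq_or_lt with h0 | h0
        · rw [← h0, hc0, symm_coord hx0]
          exact inTube_self
        · refine (h.inTube_of_leaf (hleaf t ⟨h0, ht.2.le⟩ htQ).1 ⟨ht.1, le_rfl⟩
            fun r hr => (htQ r hr).2.mono_width (by linarith)).mono_width ?_
          have : leafConst B L * L ^ 4 * B ^ 2 * t ≤ leafConst B L * L ^ 4 * B ^ 2 * T := by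
            gcongr
            exact ht.2.le
          linarith
      have h2 : ContinuousWithinAt c (Ioi t) t :=
        (hcd.continuousOn t ⟨ht.1, ht.2.le⟩).mono_of_mem_nhdsWithin
          (mem_of_superset (Ioo_mem_nhdsGT ht.2) fun s hs => ⟨ht.1.trans hs.1.le, hs.2.le⟩)
      have h3 : Q ∈ 𝓝 (c t) := by
        filter_upwards [(isOpen_target (z 0)).mem_nhds hct.1,
          (hsymm _ hct.1).eventually (h1.eventually (β' := β / 2) (by linarith) (by linarith))]
          with q' h1 h2 using ⟨h1, h2⟩
      exact h2.eventually h3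
  obtain ⟨h1, h2⟩ := hleaf T ⟨hT, le_rfl⟩ hstay
  refine ⟨_, h1, fun t ht => ?_⟩
  rw [h2 t ht]
  exact (hXvec _ (hstay ht)).pos

end LeafExistence

/-! ### Leaves are graphs -/

theorem monotoneOn_of_hasDerivWithinAt_nonneg {g g' : ℝ → ℝ} {T : ℝ}
    (hg : ∀ t ∈ Icc 0 T, HasDerivWithinAt g (g' t) (Icc 0 T) t) (hg' : ∀ t ∈ Icc 0 T, 0 ≤ g' t) :
    MonotoneOn g (Icc 0 T) := by
  refine monotoneOn_of_deriv_nonneg (convex_Icc 0 T) (fun t ht => (hg t ht).continuousWithinAt)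
    (fun t ht => ?_) fun t ht => ?_
  · exact (hg t (interior_subset ht)).differentiableWithinAt.mono interior_subset
  · rw [((hg t (interior_subset ht)).hasDerivAt (mem_interior_iff_mem_nhds.1 ht)).deriv]
    exact hg' t (interior_subset ht)

section Graph

variable {M : Type*} [EMetricSpace M] [ChartedSpace Plane M] [IsManifold (𝓡 2) ∞ M]
variable {m : ℕ} {f : Fin m → M ≃ₘ^2⟮𝓡 2, 𝓡 2⟯ M} {wd : ℕ → Fin m}
variable [RiemannianBundle (fun x : M => TangentSpace (𝓡 2) x)] {ρ : M → ℝ} {𝒜 : FiniteAtlas M}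
  {B : ℝ} {x : M} {z : ℕ → M} {L lam ε β : ℝ} {n : ℕ} {es eu : TangentSpace (𝓡 2) x}
  {V : LineField M}

/-- The inner product with `v ∈ T_x M`, in the chart at `z`. -/
def tangentForm (z x : M) (v : TangentSpace (𝓡 2) x) : Plane →L[ℝ] ℝ :=
  gram z (extChartAt (𝓡 2) z x) (toChart z x v)

theorem tangentForm_toChart {z x : M} (hx : x ∈ (chartAt Plane z).source)
    (v u : TangentSpace (𝓡 2) x) : tangentForm z x v (toChart z x u) = inner ℝ v u :=
  (inner_eq_gram hx v u).symm

theorem coordU_eq (e e' w : Plane) : coordU e e' w = ((wedge e e')⁻¹ • wedge e) w := by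
  rw [coordU, smul_apply, smul_eq_mul, div_eq_inv_mul]

variable [IsContMDiffRiemannianBundle (𝓡 2) ∞ Plane (fun x : M => TangentSpace (𝓡 2) x)]

theorem GoodChart.gram_sub_le {B : ℝ} {z y : M} (h : GoodChart B z y) {p p' : Plane}
    (hp : p ∈ Metric.ball (extChartAt (𝓡 2) z y) B⁻¹)
    (hp' : p' ∈ Metric.ball (extChartAt (𝓡 2) z y) B⁻¹) :
    ‖gram z p' - gram z p‖ ≤ B * ‖p' - p‖ :=
  (convex_ball _ _).norm_image_sub_le_of_norm_fderiv_le
    (fun _ hq => differentiableAt_gram (h.ball_subset hq)) h.norm_fderiv hp hp'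

/-- Tangent vectors at nearby points with the same coordinates have almost the same norm. -/
theorem GoodChart.abs_norm_sq_sub_le {B : ℝ} {z y : M} (h : GoodChart B z y) {y' : M} {r : ℝ}
    (hy : y' ∈ (chartAt Plane z).source)
    (hp : extChartAt (𝓡 2) z y' ∈ Metric.ball (extChartAt (𝓡 2) z y) B⁻¹)
    (hr : ‖extChartAt (𝓡 2) z y' - extChartAt (𝓡 2) z y‖ ≤ r) {u : TangentSpace (𝓡 2) y}
    {v : TangentSpace (𝓡 2) y'} (huv : toChart z y u = toChart z y' v) :
    |‖v‖ ^ 2 - ‖u‖ ^ 2| ≤ B ^ 3 * r * ‖v‖ ^ 2 := by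
  have hB := h.pos
  have hself := Metric.mem_ball_self (x := extChartAt (𝓡 2) z y) h.inv_pos
  have h1 := h.gram_sub_le hself hp
  rw [norm_sq_eq_gram hy, norm_sq_eq_gram h.mem_source, huv, ← sub_apply, ← sub_apply,
    ← norm_sq_eq_gram hy]
  have h2 := h.norm_toChart_le hy hp v
  have hr0 : 0 ≤ r := (norm_nonneg _).trans hr
  calc _ ≤ ‖gram z (extChartAt (𝓡 2) z y') - gram z (extChartAt (𝓡 2) z y)‖ *
        ‖toChart z y' v‖ * ‖toChart z y' v‖ := by
        rw [← Real.norm_eq_abs]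
        exact ContinuousLinearMap.le_opNorm₂ _ _ _
    _ ≤ (B * r) * (B * ‖v‖) * (B * ‖v‖) := by
        gcongr
        exact h1.trans (by gcongr)
    _ = _ := by ring

variable [IsRiemannianManifold (𝓡 2) M]

/-- The coordinate `tangentForm` along `es` differs from `coordS` by the other coordinate, because
the basis `es`, `eu` consists of unit vectors but need not be orthogonal. -/
theorem IsSplitting.tangentForm_bounds (hs : IsSplitting f wd z x L lam ε n es eu)
    (hz : x ∈ (chartAt Plane (z 0)).source) (u : TangentSpace (𝓡 2) x) :
    |tangentForm (z 0) x es (toChart (z 0) x u)| ≤ ‖u‖ ∧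
      |tangentForm (z 0) x es (toChart (z 0) x u) -
        coordS (orbitVec f wd z x es 0) (orbitVec f wd z x eu 0) (toChart (z 0) x u)| ≤
          |coordU (orbitVec f wd z x es 0) (orbitVec f wd z x eu 0) (toChart (z 0) x u)| ∧
      ‖u‖ ≤ |coordS (orbitVec f wd z x es 0) (orbitVec f wd z x eu 0) (toChart (z 0) x u)| +
          |coordU (orbitVec f wd z x es 0) (orbitVec f wd z x eu 0) (toChart (z 0) x u)| := by
  have h0 := coordS_smul_add (hs.hyp.wedge_ne (Nat.zero_le n)) (toChart (z 0) x u)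
  set a := coordS (orbitVec f wd z x es 0) (orbitVec f wd z x eu 0) (toChart (z 0) x u)
  set b := coordU (orbitVec f wd z x es 0) (orbitVec f wd z x eu 0) (toChart (z 0) x u)
  rw [orbitVec_zero, orbitVec_zero, ← map_smul, ← map_smul, ← map_add] at h0
  have h1 : a • es + b • eu = u := toChart_injective hz h0
  rw [tangentForm_toChart hz]
  refine ⟨?_, ?_, ?_⟩
  · have := abs_real_inner_le_norm es u
    rwa [hs.norm_es, one_mul] at this
  · rw [← h1, inner_add_right, inner_smul_right, inner_smul_right, real_inner_self_eq_norm_sq,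
      hs.norm_es]
    have h2 := abs_real_inner_le_norm es eu
    rw [hs.norm_es, hs.norm_eu, one_mul] at h2
    have : a * 1 ^ 2 + b * inner ℝ es eu - a = b * inner ℝ es eu := by ring
    rw [this, abs_mul]
    exact mul_le_of_le_one_right (abs_nonneg b) h2
  · rw [← h1]
    refine (norm_add_le _ _).trans ?_
    rw [norm_smul, norm_smul, hs.norm_es, hs.norm_eu, mul_one, mul_one, Real.norm_eq_abs,
      Real.norm_eq_abs]

/-- Unit vectors tangent to the leaves are almost parallel to the contracting direction. -/
theorem IsAdapted.leafVector_bound (h : IsAdapted ρ f 𝒜 wd z x B L lam ε β n es eu V)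
    (hβ : 40 * B ^ 4 * β ≤ 1) {κ : ℝ} (hκ : leafSlope B L lam β n ≤ κ) (hκ1 : 50 * κ ≤ 1)
    {y : M} (hy : InTube f wd x β lam n y) {s : ℝ} (hs : |s| = 1) {v : TangentSpace (𝓡 2) y}
    (hv1 : ‖v‖ = 1) (hv : wordDeriv f wd n y v ∈ V.dir (wordMap f wd n y))
    (hpos : 0 < s * coordS (orbitVec f wd z x es 0) (orbitVec f wd z x eu 0) (toChart (z 0) y v)) :
    9 / 10 ≤ s * tangentForm (z 0) x es (toChart (z 0) y v) ∧
      |coordU (orbitVec f wd z x es 0) (orbitVec f wd z x eu 0) (toChart (z 0) y v)| ≤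
        2 * κ * (s * tangentForm (z 0) x es (toChart (z 0) y v)) := by
  have hBp := h.bounds.pos
  have hg : GoodChart B (z 0) x := h.bounds.goodChart h.itinerary 0
  obtain ⟨h1, h2, h3⟩ := hy.chart h.bounds h.itinerary h.width_pos h.width_lt
    h.splitting.hyp.lam_pos.le (Nat.zero_le n)
  change y ∈ _ at h1
  change ‖extChartAt (𝓡 2) (z 0) y - extChartAt (𝓡 2) (z 0) x‖ ≤ _ at h2
  change extChartAt (𝓡 2) (z 0) y ∈ Metric.ball (extChartAt (𝓡 2) (z 0) x) B⁻¹ at h3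
  obtain ⟨u, hu⟩ := ofChart_surjective hg.mem_source (toChart (z 0) y v)
  have h4 := hg.abs_norm_sq_sub_le h1 h3 h2 hu
  have h5 : B ^ 3 * (2 * B * β * Real.exp (-lam * (0 : ℕ) / 2)) * ‖v‖ ^ 2 ≤ 1 / 20 := by
    rw [hv1]
    simp only [Nat.cast_zero, mul_zero, zero_div, Real.exp_zero]
    linarith
  rw [hv1] at h4 h5
  have h6 : 19 / 20 ≤ ‖u‖ ^ 2 := by
    have := (le_abs_self _).trans (h4.trans h5)
    linarith
  have h7 : 19 / 20 ≤ ‖u‖ := by nlinarith [norm_nonneg u]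
  obtain ⟨-, h8, h9⟩ := h.splitting.tangentForm_bounds hg.mem_source u
  rw [hu] at h8 h9
  have h10 := (h.tangent_bound hy hv).2
  set a := coordS (orbitVec f wd z x es 0) (orbitVec f wd z x eu 0) (toChart (z 0) y v)
  set b := coordU (orbitVec f wd z x es 0) (orbitVec f wd z x eu 0) (toChart (z 0) y v)
  set t := tangentForm (z 0) x es (toChart (z 0) y v)
  have h11 : |b| ≤ κ * |a| := h10.trans (by gcongr)
  have h12 : s * a = |a| := by
    rw [← abs_of_pos hpos, abs_mul, hs, one_mul]
  have h13 : |s * t - abs a| ≤ |b| := by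
    rw [← h12, ← mul_sub, abs_mul, hs, one_mul]
    exact h8
  have h14 := abs_le.1 h13
  have h15 : κ * |a| ≤ 1 / 50 * |a| := by
    have := abs_nonneg a
    gcongr
    linarith
  have hκ0 : 0 ≤ κ * |a| := (abs_nonneg b).trans h11
  have ha : 0 < |a| := by linarith [abs_nonneg b]
  have hκ2 : 0 ≤ κ := nonneg_of_mul_nonneg_left hκ0 ha
  refine ⟨by linarith, h11.trans ?_⟩
  have h16 : 1 / 2 * |a| ≤ s * t := by linarith
  nlinarith

/-- The leaf through `x` is a graph over the contracting direction, with small slope and of definite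
size: `P c` is the point of the leaf at which the coordinate `tangentForm` equals `c`. -/
theorem IsAdapted.exists_graph [CompactSpace M]
    (h : IsAdapted ρ f 𝒜 wd z x B L lam ε β n es eu V)
    (hβ : 40 * B ^ 4 * β ≤ 1) {κ : ℝ} (hκ : leafSlope B L lam β n ≤ κ) (hκ1 : 50 * κ ≤ 1)
    {T : ℝ} (hT : 0 < T) (hTβ : 4 * (leafConst B L * L ^ 4 * B ^ 2 * T) ≤ β) :
    ∃ P : ℝ → M, ∀ c, |c| ≤ 9 / 10 * T →
      P c ∈ fakeStableLeaf f wd n V x T ∧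
      tangentForm (z 0) x es (extChartAt (𝓡 2) (z 0) (P c) - extChartAt (𝓡 2) (z 0) x) = c ∧
      ∀ c', |c'| ≤ 9 / 10 * T → |coordU (orbitVec f wd z x es 0) (orbitVec f wd z x eu 0)
        (extChartAt (𝓡 2) (z 0) (P c) - extChartAt (𝓡 2) (z 0) (P c'))| ≤ 2 * κ * |c - c'| := by
  set e := orbitVec f wd z x es 0 with he
  set e' := orbitVec f wd z x eu 0 with he'
  set ξ := tangentForm (z 0) x es with hξ
  set ψ := extChartAt (𝓡 2) (z 0) with hψ
  have hlam := h.splitting.hyp.lam_pos.le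
  have hlc : 0 ≤ leafConst B L * L ^ 4 * B ^ 2 * T := by
    have := h.bounds.pos
    rw [leafConst]; positivity
  -- each half of the leaf is a graph
  have hside : ∀ s : ℝ, |s| = 1 → ∃ σ : ℝ → M, (∀ t ∈ Icc 0 T, σ t ∈ fakeStableLeaf f wd n V x T) ∧
      ContinuousOn (fun t => s * ξ (ψ (σ t) - ψ x)) (Icc 0 T) ∧
      s * ξ (ψ (σ 0) - ψ x) = 0 ∧ 9 / 10 * T ≤ s * ξ (ψ (σ T) - ψ x) ∧ σ 0 = x ∧
      ∀ t' ∈ Icc 0 T, ∀ t ∈ Icc 0 T, t' ≤ t →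
        |coordU e e' (ψ (σ t) - ψ (σ t'))| ≤ 2 * κ * (s * ξ (ψ (σ t) - ψ (σ t'))) := by
    intro s hs
    obtain ⟨σ, hσ, hpos⟩ := h.exists_leafCurve (s := s)
      (fun h0 => by rw [h0, abs_zero] at hs; exact zero_ne_one hs) hT hTβ
    have htube := h.leaf_inTube hσ (by linarith)
    let w : ℝ → Plane := fun t => toChart (z 0) (σ t) (velocityWithin σ (Icc 0 T) t)
    have hd : ∀ t ∈ Icc 0 T, HasDerivWithinAt (fun t => ψ (σ t)) (w t) (Icc 0 T) t := fun t ht =>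
      hasDerivWithinAt_coord ((hσ.contMDiffOn t ht).mdifferentiableWithinAt one_ne_zero)
        (uniqueDiffOn_Icc hT t ht) ((htube t ht).chart h.bounds h.itinerary h.width_pos h.width_lt
          hlam (Nat.zero_le n)).1
    have hw : ∀ t ∈ Icc 0 T, 9 / 10 ≤ s * ξ (w t) ∧ |coordU e e' (w t)| ≤ 2 * κ * (s * ξ (w t)) :=
      fun t ht => h.leafVector_bound hβ hκ hκ1 (htube t ht) hs (hσ.norm_velocity t ht)
        (hσ.mem_dir t ht) (hpos t ht)
    have hξd : ∀ t ∈ Icc 0 T, HasDerivWithinAt (fun t => s * ξ (ψ (σ t) - ψ x)) (s * ξ (w t))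
        (Icc 0 T) t := fun t ht =>
      (ξ.hasFDerivAt.comp_hasDerivWithinAt t ((hd t ht).sub_const (ψ x))).const_mul s
    have hUd : ∀ t ∈ Icc 0 T, HasDerivWithinAt (fun t => coordU e e' (ψ (σ t))) (coordU e e' (w t))
        (Icc 0 T) t := by
      intro t ht
      simp only [coordU_eq]
      exact ContinuousLinearMap.hasFDerivAt _ |>.comp_hasDerivWithinAt t (hd t ht)
    have hmono := monotoneOn_of_hasDerivWithinAt_nonneg (fun t ht => (hξd t ht).sub
      (((hasDerivWithinAt_id t (Icc 0 T)).const_mul (9 / 10 : ℝ))))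
      fun t ht => by linarith [(hw t ht).1]
    have hm1 := monotoneOn_of_hasDerivWithinAt_nonneg (fun t ht => ((hξd t ht).const_mul
      (2 * κ)).sub (hUd t ht)) fun t ht => by linarith [(abs_le.1 (hw t ht).2).2]
    have hm2 := monotoneOn_of_hasDerivWithinAt_nonneg (fun t ht => ((hξd t ht).const_mul
      (2 * κ)).add (hUd t ht)) fun t ht => by linarith [(abs_le.1 (hw t ht).2).1]
    have h0 : s * ξ (ψ (σ 0) - ψ x) = 0 := by rw [hσ.zero, sub_self, map_zero, mul_zero]
    refine ⟨σ, fun t ht => ⟨T, σ, hT, le_rfl, hσ.contMDiffOn, hσ.zero, ⟨t, ht, rfl⟩, fun r hr =>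
      ⟨hσ.norm_velocity r hr, ?_, hσ.mem_dir r hr⟩⟩, fun t ht => (hξd t ht).continuousWithinAt, h0,
      ?_, hσ.zero, fun t' ht' t ht htt => ?_⟩
    · obtain ⟨h1, h2, -⟩ := (htube r hr).chart h.bounds h.itinerary h.width_pos h.width_lt hlam
        le_rfl
      exact h.cone.mem_domain _ h1 (mem_closedBall_iff_norm.2 h2)
    · have := hmono ⟨le_rfl, hT.le⟩ ⟨hT.le, le_rfl⟩ hT.le
      simp only [Pi.sub_apply, id] at this
      rw [h0] at this
      linarith
    · have e1 := hm1 ht' ht htt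
      have e2 := hm2 ht' ht htt
      simp only [Pi.sub_apply, Pi.add_apply] at e1 e2
      have e3 : s * ξ (ψ (σ t) - ψ (σ t')) =
          s * ξ (ψ (σ t) - ψ x) - s * ξ (ψ (σ t') - ψ x) := by
        rw [← mul_sub, ← map_sub, sub_sub_sub_cancel_right]
      rw [e3, coordU_sub, abs_le]
      constructor <;> linarith
  obtain ⟨σ, hσ1, hσ2, hσ3, hσ4, hσ5, hσ6⟩ := hside 1 (by simp)
  obtain ⟨τ, hτ1, hτ2, hτ3, hτ4, hτ5, hτ6⟩ := hside (-1) (by simp)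
  -- the coordinate takes all values in between, by continuity
  have hex : ∀ c, |c| ≤ 9 / 10 * T → ∃ p, ξ (ψ p - ψ x) = c ∧
      ((0 ≤ c ∧ ∃ t ∈ Icc 0 T, σ t = p) ∨ (c ≤ 0 ∧ ∃ t ∈ Icc 0 T, τ t = p)) := by
    intro c hc
    rcases le_total 0 c with h0 | h0
    · rw [abs_of_nonneg h0] at hc
      obtain ⟨t, ht, htc⟩ := intermediate_value_Icc hT.le hσ2
        ⟨hσ3.le.trans h0, hc.trans hσ4⟩
      simp only [one_mul] at htc
      exact ⟨σ t, htc, Or.inl ⟨h0, t, ht, rfl⟩⟩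
    · rw [abs_of_nonpos h0] at hc
      obtain ⟨t, ht, htc⟩ := intermediate_value_Icc hT.le hτ2
        ⟨hτ3.le.trans (neg_nonneg.2 h0), hc.trans hτ4⟩
      simp only [neg_mul, one_mul, neg_inj] at htc
      exact ⟨τ t, htc, Or.inr ⟨h0, t, ht, rfl⟩⟩
  have : Nonempty M := ⟨x⟩
  choose! P hP1 hP2 using hex
  have hT0 : (0 : ℝ) ∈ Icc 0 T := ⟨le_rfl, hT.le⟩
  have hdiff : ∀ c, |c| ≤ 9 / 10 * T → ∀ c', |c'| ≤ 9 / 10 * T → ξ (ψ (P c) - ψ (P c')) = c - c' := by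
    intro c hc c' hc'
    rw [← sub_sub_sub_cancel_right _ _ (ψ x), map_sub, hP1 c hc, hP1 c' hc']
  have hswap : ∀ p q, |coordU e e' (p - q)| = |coordU e e' (q - p)| := by
    intro p q
    rw [coordU_sub, coordU_sub, abs_sub_comm]
  have hκ0 : 0 ≤ κ := by
    refine le_trans ?_ hκ
    have h1 := h.bounds.pos
    have h2 := h.splitting.hyp.L_pos
    have h3 := HypSeq.errConst_nonneg h2 h.splitting.hyp.lam_pos
    have h4 := h.width_pos
    rw [leafSlope]
    positivity
  have hsame : ∀ s : ℝ, |s| = 1 → ∀ σ : ℝ → M, (∀ t' ∈ Icc 0 T, ∀ t ∈ Icc 0 T, t' ≤ t →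
      |coordU e e' (ψ (σ t) - ψ (σ t'))| ≤ 2 * κ * (s * ξ (ψ (σ t) - ψ (σ t')))) →
      ∀ t' ∈ Icc 0 T, ∀ t ∈ Icc 0 T,
        |coordU e e' (ψ (σ t) - ψ (σ t'))| ≤ 2 * κ * |ξ (ψ (σ t) - ψ (σ t'))| := by
    intro s hs σ hσ t' ht' t ht
    have habs : ∀ r, s * r ≤ |r| := fun r => by
      refine (le_abs_self _).trans ?_
      rw [abs_mul, hs, one_mul]
    rcases le_total t' t with htt | htt
    · refine (hσ t' ht' t ht htt).trans ?_
      gcongr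
      exact habs _
    · rw [hswap, ← neg_sub (ψ (σ t')), map_neg, abs_neg]
      refine (hσ t ht t' ht' htt).trans ?_
      gcongr
      exact habs _
  have hκ2 : ∀ c, |c| ≤ 9 / 10 * T → |coordU e e' (ψ (P c) - ψ x)| ≤ 2 * κ * |c| := by
    intro c hc
    rcases hP2 c hc with ⟨h0, t, ht, htc⟩ | ⟨h0, t, ht, htc⟩
    · have := hσ6 0 hT0 t ht ht.1
      rw [hσ5, htc, hP1 c hc, one_mul] at this
      rwa [abs_of_nonneg h0]
    · have := hτ6 0 hT0 t ht ht.1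
      rw [hτ5, htc, hP1 c hc, neg_one_mul] at this
      rwa [abs_of_nonpos h0]
  have hopp : ∀ c c', |c| ≤ 9 / 10 * T → |c'| ≤ 9 / 10 * T → 0 ≤ c → c' ≤ 0 →
      |coordU e e' (ψ (P c) - ψ (P c'))| ≤ 2 * κ * |c - c'| := by
    intro c c' hc hc' h0 h0'
    have h1 := hκ2 c hc
    have h2 := hκ2 c' hc'
    rw [← sub_sub_sub_cancel_right _ _ (ψ x), coordU_sub]
    refine (norm_sub_le (_ : ℝ) _).trans ?_
    rw [Real.norm_eq_abs, Real.norm_eq_abs]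
    rw [abs_of_nonneg h0] at h1
    rw [abs_of_nonpos h0'] at h2
    rw [abs_of_nonneg (by linarith : 0 ≤ c - c')]
    linarith
  refine ⟨P, fun c hc => ⟨?_, hP1 c hc, fun c' hc' => ?_⟩⟩
  · rcases hP2 c hc with ⟨-, t, ht, htc⟩ | ⟨-, t, ht, htc⟩
    · rw [← htc]
      exact hσ1 t ht
    · rw [← htc]
      exact hτ1 t ht
  · rcases hP2 c hc with ⟨h0, t, ht, htc⟩ | ⟨h0, t, ht, htc⟩ <;>
      rcases hP2 c' hc' with ⟨h0', t', ht', htc'⟩ | ⟨h0', t', ht', htc'⟩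
    · have := hsame 1 (by simp) σ hσ6 t' ht' t ht
      rwa [htc, htc', hdiff c hc c' hc'] at this
    · exact hopp c c' hc hc' h0 h0'
    · rw [hswap, abs_sub_comm]
      exact hopp c' c hc' hc h0' h0
    · have := hsame (-1) (by simp) τ hτ6 t' ht' t ht
      rwa [htc, htc', hdiff c hc c' hc'] at this

end Graph

/-! ### Good curves in charts -/

section Curves

variable {M : Type*} [EMetricSpace M] [ChartedSpace Plane M] [IsManifold (𝓡 2) ∞ M]
  [RiemannianBundle (fun x : M => TangentSpace (𝓡 2) x)]
  [IsContMDiffRiemannianBundle (𝓡 2) ∞ Plane (fun x : M => TangentSpace (𝓡 2) x)]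
  {B C a b : ℝ} {z y : M} {γ : ℝ → M}

/-- The velocity of a curve, in the chart at `z`. -/
def chartVelocity (z : M) (γ : ℝ → M) (S : Set ℝ) (t : ℝ) : Plane :=
  toChart z (γ t) (velocityWithin γ S t)

theorem IsGoodCurve.lt (hγ : IsGoodCurve C a b γ) : a < b := by
  have := hγ.length_ge
  have := Real.exp_pos (-C)
  linarith

theorem IsGoodCurve.hasDerivWithinAt_coord (hγ : IsGoodCurve C a b γ) {t : ℝ} (ht : t ∈ Icc a b)
    (hs : γ t ∈ (chartAt Plane z).source) :
    HasDerivWithinAt (fun s => extChartAt (𝓡 2) z (γ s)) (chartVelocity z γ (Icc a b) t)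
      (Icc a b) t :=
  FakeStable.hasDerivWithinAt_coord ((hγ.contMDiffOn t ht).mdifferentiableWithinAt two_ne_zero)
    (uniqueDiffOn_Icc hγ.lt t ht) hs

theorem IsGoodCurve.norm_chartVelocity_le (hγ : IsGoodCurve C a b γ) (hg : GoodChart B z y) {t : ℝ}
    (ht : t ∈ Icc a b) (hs : γ t ∈ (chartAt Plane z).source)
    (hp : extChartAt (𝓡 2) z (γ t) ∈ Metric.ball (extChartAt (𝓡 2) z y) B⁻¹) :
    ‖chartVelocity z γ (Icc a b) t‖ ≤ B := by
  have h1 := hg.norm_toChart_le hs hp (velocityWithin γ (Icc a b) t)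
  have h2 := hγ.unit_speed t ht
  calc _ ≤ B * ‖velocityWithin γ (Icc a b) t‖ := h1
    _ = B := by rw [h2, mul_one]

theorem IsGoodCurve.contDiffWithinAt_coord (hγ : IsGoodCurve C a b γ) {t : ℝ} (ht : t ∈ Icc a b)
    (hs : γ t ∈ (chartAt Plane z).source) :
    ContDiffWithinAt ℝ 2 (fun s => extChartAt (𝓡 2) z (γ s)) (Icc a b) t := by
  rw [← contMDiffWithinAt_iff_contDiffWithinAt]
  have h1 : ContMDiffAt (𝓡 2) 𝓘(ℝ, Plane) 2 (extChartAt (𝓡 2) z) (γ t) :=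
    (contMDiffAt_extChartAt' (n := ∞) (by simpa using hs)).of_le ENat.LEInfty.out
  exact h1.comp_contMDiffWithinAt t (hγ.contMDiffOn t ht)

theorem IsGoodCurve.eventually_mem_source (hγ : IsGoodCurve C a b γ) {t : ℝ} (ht : t ∈ Icc a b)
    (hs : γ t ∈ (chartAt Plane z).source) :
    ∀ᶠ s in 𝓝[Icc a b] t, γ s ∈ (chartAt Plane z).source :=
  (hγ.contMDiffOn.continuousOn t ht).eventually ((chartAt Plane z).open_source.mem_nhds hs)

theorem IsGoodCurve.chartVelocity_eventuallyEq (hγ : IsGoodCurve C a b γ) {t : ℝ}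
    (ht : t ∈ Icc a b) (hs : γ t ∈ (chartAt Plane z).source) :
    chartVelocity z γ (Icc a b) =ᶠ[𝓝[Icc a b] t]
      derivWithin (fun s => extChartAt (𝓡 2) z (γ s)) (Icc a b) := by
  filter_upwards [hγ.eventually_mem_source ht hs, self_mem_nhdsWithin] with s hs hsI
  exact ((hγ.hasDerivWithinAt_coord hsI hs).derivWithin (uniqueDiffOn_Icc hγ.lt s hsI)).symm

theorem IsGoodCurve.contDiffWithinAt_chartVelocity (hγ : IsGoodCurve C a b γ) {t : ℝ}
    (ht : t ∈ Icc a b) (hs : γ t ∈ (chartAt Plane z).source) :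
    ContDiffWithinAt ℝ 1 (chartVelocity z γ (Icc a b)) (Icc a b) t := by
  have h1 : ContDiffWithinAt ℝ 1 (derivWithin (fun s => extChartAt (𝓡 2) z (γ s)) (Icc a b))
      (Icc a b) t :=
    (ContDiffWithinAt.fderivWithin_right (m := 1) (hγ.contDiffWithinAt_coord ht hs)
      (uniqueDiffOn_Icc hγ.lt) (by rw [one_add_one_eq_two]) ht).clm_apply contDiffWithinAt_const
  have h2 := hγ.chartVelocity_eventuallyEq ht hs
  exact h1.congr_of_eventuallyEq h2 (h2.self_of_nhdsWithin ht)

/-- The second derivative in the chart is the covariant acceleration, which the curvature controls,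
minus the quadratic form given by the Christoffel symbols. -/
theorem IsGoodCurve.exists_acceleration (hγ : IsGoodCurve C a b γ) (hg : GoodChart B z y) {t : ℝ}
    (ht : t ∈ Ioo a b) (hs : γ t ∈ (chartAt Plane z).source)
    (hp : extChartAt (𝓡 2) z (γ t) ∈ Metric.ball (extChartAt (𝓡 2) z y) B⁻¹) :
    ∃ w, HasDerivAt (chartVelocity z γ (Icc a b)) w t ∧ ‖w‖ ≤ B ^ 2 * Real.exp C + B ^ 3 := by
  have hB := hg.pos
  have htI : t ∈ Icc a b := Ioo_subset_Icc_self ht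
  have hnhds : Icc a b ∈ 𝓝 t := Icc_mem_nhds ht.1 ht.2
  have h1 := ((hγ.contDiffWithinAt_chartVelocity htI hs).contDiffAt hnhds).differentiableAt
    one_ne_zero |>.hasDerivAt
  set w := deriv (chartVelocity z γ (Icc a b)) t
  set d := chartVelocity z γ (Icc a b) t with hd
  have hvel : ∀ s ∈ Ioo a b, velocityWithin γ (Icc a b) s = velocity γ s := by
    intro s hs
    rw [velocityWithin, velocity, mfderivWithin_of_mem_nhds (Icc_mem_nhds hs.1 hs.2)]
  refine ⟨w, h1, ?_⟩
  have hsrc : ∀ᶠ s in 𝓝 t, γ s ∈ (chartAt Plane z).source := by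
    have := hγ.eventually_mem_source htI hs
    rwa [nhdsWithin_eq_nhds.2 hnhds] at this
  have hc := (hγ.hasDerivWithinAt_coord htI hs).hasDerivAt hnhds
  have hY : HasDerivAt (fun s => toChart z (γ s) (velocity γ s)) w t := by
    refine h1.congr_of_eventuallyEq ?_
    filter_upwards [Ioo_mem_nhds ht.1 ht.2] with s hs
    rw [chartVelocity, hvel s hs]
  have hdY : toChart z (γ t) (velocity γ t) = d := by rw [hd, chartVelocity, hvel t ht]
  have hpt := hg.ball_subset hp
  set p := extChartAt (𝓡 2) z (γ t) with hpdef
  set A := w + spray (gram z) p d d with hA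
  obtain ⟨u, hu⟩ := ofChart_surjective hs A
  have h2 := covDeriv_eq hsrc hc hY u
  rw [← hd, hdY, ← hpdef, hu] at h2
  have hinv : ∀ v, v ≠ 0 → 0 < gram z p v v := fun v hv => gram_pos hpt hv
  have h3 : gram z p A A = covDeriv γ (velocity γ) t (toChart (γ t) (γ t) u) := by
    rw [h2, ← apply_spray hinv]
    simp [hA]
  have h4 := hγ.curvature_le t ht (toChart (γ t) (γ t) u)
  have h5 : Real.sqrt (chartMetric (γ t) (extChartAt (𝓡 2) (γ t) (γ t))
      (toChart (γ t) (γ t) u) (toChart (γ t) (γ t) u)) = ‖u‖ := by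
    rw [← gram_apply, ← norm_sq_eq_gram (mem_chart_source Plane (γ t)), Real.sqrt_sq (norm_nonneg _)]
  rw [h5, ← h3] at h4
  have h6 := hg.norm_le_toChart hs hp u
  rw [hu] at h6
  have h7 := hg.lower p hp A
  have h8 : ‖A‖ ≤ B ^ 2 * Real.exp C := by
    have h9 : B⁻¹ * ‖A‖ ^ 2 ≤ Real.exp C * (B * ‖A‖) :=
      h7.trans ((le_abs_self _).trans (h4.trans (by gcongr)))
    rw [inv_mul_le_iff₀ hB] at h9
    rcases (norm_nonneg A).eq_or_lt with h0 | h0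
    · rw [← h0]; positivity
    · nlinarith
  have h10 : ‖d‖ ≤ B := hγ.norm_chartVelocity_le hg htI hs hp
  have h11 : ‖spray (gram z) p d d‖ ≤ B ^ 3 := by
    refine (ContinuousLinearMap.le_opNorm₂ _ _ _).trans ?_
    calc _ ≤ B * B * B := by
          gcongr
          exact hg.norm_spray p hp
      _ = B ^ 3 := by ring
  calc ‖w‖ = ‖A - spray (gram z) p d d‖ := by rw [hA, add_sub_cancel_right]
    _ ≤ _ := (norm_sub_le _ _).trans (add_le_add h8 h11)

/-- Mean value inequality for functions differentiable in the interior of an interval. -/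
theorem norm_sub_le_of_hasDerivAt_Ioo {E : Type*} [NormedAddCommGroup E] [NormedSpace ℝ E]
    {g : ℝ → E} {c d K : ℝ} (hcd : c ≤ d) (hg : ContinuousOn g (Icc c d))
    (hg' : ∀ t ∈ Ioo c d, ∃ w, HasDerivAt g w t ∧ ‖w‖ ≤ K) : ‖g d - g c‖ ≤ K * (d - c) := by
  rcases hcd.eq_or_lt with rfl | hcd
  · simp
  obtain ⟨l, hl1, hl2⟩ := exists_dual_vector'' ℝ (g d - g c)
  obtain ⟨t, ht, hs⟩ := exists_deriv_eq_slope (fun t => l (g t)) hcd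
    (l.continuous.comp_continuousOn hg) fun t ht => by
      obtain ⟨w, hw, -⟩ := hg' t ht
      exact (l.hasFDerivAt.comp_hasDerivAt t hw).differentiableAt.differentiableWithinAt
  obtain ⟨w, hw, hwK⟩ := hg' t ht
  rw [show deriv (fun t => l (g t)) t = l w from (l.hasFDerivAt.comp_hasDerivAt t hw).deriv,
    ← map_sub, hl2, eq_div_iff (by linarith)] at hs
  simp only [RCLike.ofReal_real_eq_id, id] at hs
  rw [← hs]
  have h1 : l w ≤ K := by
    refine (le_abs_self _).trans ((l.le_opNorm w).trans ?_)
    calc ‖l‖ * ‖w‖ ≤ 1 * ‖w‖ := by gcongr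
      _ ≤ K := by rwa [one_mul]
  gcongr

theorem IsGoodCurve.norm_chartVelocity_sub_le (hγ : IsGoodCurve C a b γ) (hg : GoodChart B z y)
    {c d : ℝ} (hJ : Icc c d ⊆ Icc a b) (hs : ∀ t ∈ Icc c d, γ t ∈ (chartAt Plane z).source ∧
      extChartAt (𝓡 2) z (γ t) ∈ Metric.ball (extChartAt (𝓡 2) z y) B⁻¹) {s t : ℝ}
    (hsJ : s ∈ Icc c d) (htJ : t ∈ Icc c d) :
    ‖chartVelocity z γ (Icc a b) t - chartVelocity z γ (Icc a b) s‖ ≤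
      (B ^ 2 * Real.exp C + B ^ 3) * |t - s| := by
  wlog hst : s ≤ t generalizing s t
  · rw [norm_sub_rev, abs_sub_comm]
    exact this htJ hsJ (le_of_not_ge hst)
  have hsub : Icc s t ⊆ Icc c d := Icc_subset_Icc hsJ.1 htJ.2
  rw [abs_of_nonneg (by linarith : 0 ≤ t - s)]
  refine norm_sub_le_of_hasDerivAt_Ioo hst (fun r hr => ?_) fun r hr => ?_
  · exact ((hγ.contDiffWithinAt_chartVelocity (hJ (hsub hr)) (hs r (hsub hr)).1).continuousWithinAt).mono
      (hsub.trans hJ)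
  · have hrI := hsub (Ioo_subset_Icc_self hr)
    refine hγ.exists_acceleration hg ⟨?_, ?_⟩ (hs r hrI).1 (hs r hrI).2
    · exact (hJ hsJ).1.trans_lt hr.1
    · exact hr.2.trans_le (hJ htJ).2

/-- A good curve is close to its tangent line. -/
theorem IsGoodCurve.norm_chord_sub_le (hγ : IsGoodCurve C a b γ) (hg : GoodChart B z y)
    {c d : ℝ} (hJ : Icc c d ⊆ Icc a b) (hs : ∀ t ∈ Icc c d, γ t ∈ (chartAt Plane z).source ∧
      extChartAt (𝓡 2) z (γ t) ∈ Metric.ball (extChartAt (𝓡 2) z y) B⁻¹) {s t t' : ℝ}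
    (hsJ : s ∈ Icc c d) (htJ : t ∈ Icc c d) (htJ' : t' ∈ Icc c d) {r : ℝ} (hr : |t - s| ≤ r)
    (hr' : |t' - s| ≤ r) :
    ‖extChartAt (𝓡 2) z (γ t) - extChartAt (𝓡 2) z (γ t') -
        (t - t') • chartVelocity z γ (Icc a b) s‖ ≤
      (B ^ 2 * Real.exp C + B ^ 3) * r * |t - t'| := by
  have hB := hg.pos
  have hsub : uIcc t' t ⊆ Icc c d := uIcc_subset_Icc htJ' htJ
  have hd : ∀ τ ∈ uIcc t' t, HasDerivWithinAt (fun τ => extChartAt (𝓡 2) z (γ τ) -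
      τ • chartVelocity z γ (Icc a b) s) (chartVelocity z γ (Icc a b) τ -
        chartVelocity z γ (Icc a b) s) (uIcc t' t) τ := by
    intro τ hτ
    refine ((hγ.hasDerivWithinAt_coord (hJ (hsub hτ)) (hs τ (hsub hτ)).1).mono
      (hsub.trans hJ)).sub ?_
    exact ((hasDerivWithinAt_id τ _).smul_const _).congr_deriv (one_smul _ _)
  have hbound : ∀ τ ∈ uIcc t' t, ‖chartVelocity z γ (Icc a b) τ -
        chartVelocity z γ (Icc a b) s‖ ≤ (B ^ 2 * Real.exp C + B ^ 3) * r := by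
    intro τ hτ
    refine (hγ.norm_chartVelocity_sub_le hg hJ hs hsJ (hsub hτ)).trans ?_
    gcongr
    rw [abs_le] at hr hr' ⊢
    rcases mem_uIcc.1 hτ with h | h <;> constructor <;> linarith [h.1, h.2]
  have key := (convex_uIcc t' t).norm_image_sub_le_of_norm_hasDerivWithin_le hd hbound
    left_mem_uIcc right_mem_uIcc
  rw [Real.norm_eq_abs] at key
  refine le_trans (le_of_eq (congrArg norm ?_)) key
  rw [sub_smul]
  abel

end Curves

/-! ### Transversality and chords -/

section Chords

variable {M : Type*} [EMetricSpace M] [ChartedSpace Plane M] [IsManifold (𝓡 2) ∞ M]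
variable {m : ℕ} {f : Fin m → M ≃ₘ^2⟮𝓡 2, 𝓡 2⟯ M} {wd : ℕ → Fin m}
variable [RiemannianBundle (fun x : M => TangentSpace (𝓡 2) x)] {ρ : M → ℝ} {𝒜 : FiniteAtlas M}
  {B : ℝ} {x : M} {z : ℕ → M} {L lam ε β : ℝ} {n : ℕ} {es eu : TangentSpace (𝓡 2) x}
  {V : LineField M}
  [IsContMDiffRiemannianBundle (𝓡 2) ∞ Plane (fun x : M => TangentSpace (𝓡 2) x)]
  [IsRiemannianManifold (𝓡 2) M] {C a b : ℝ} {γ : ℝ → M}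

theorem IsGoodCurve.edist_le (hγ : IsGoodCurve C a b γ) {s t : ℝ} (hs : s ∈ Icc a b)
    (ht : t ∈ Icc a b) : edist (γ s) (γ t) ≤ ENNReal.ofReal |t - s| := by
  wlog hst : s ≤ t generalizing s t
  · rw [edist_comm, abs_sub_comm]
    exact this ht hs (le_of_not_ge hst)
  rcases hst.eq_or_lt with rfl | hst
  · simp
  have hsub : Icc s t ⊆ Icc a b := Icc_subset_Icc hs.1 ht.2
  have h1 := edist_le_of_speed_le (κ := 1) hst.le ((hγ.contMDiffOn.mono hsub).of_le one_le_two)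
    fun r hr => by
      have h2 : velocityWithin γ (Icc s t) r = velocityWithin γ (Icc a b) r := by
        have h3 := ((hγ.contMDiffOn r (hsub hr)).mdifferentiableWithinAt
          two_ne_zero).mfderivWithin_mono (uniqueDiffOn_Icc hst r hr).uniqueMDiffWithinAt hsub
        rw [velocityWithin, velocityWithin, h3]
      rw [h2, hγ.unit_speed r (hsub hr)]
  rwa [one_mul, ← abs_of_pos (sub_pos.2 hst)] at h1

/-- The inner product with a unit vector, in the chart, is almost `1`-Lipschitz near `x`. -/
theorem GoodChart.abs_tangentForm_le {z : M} (h : GoodChart B z x) {v : TangentSpace (𝓡 2) x}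
    (hv : ‖v‖ = 1) {y : M} {r : ℝ} (hy : edist x y < ENNReal.ofReal r) (hr : B * r < B⁻¹)
    (hr' : 5 * (B ^ 3 * (B * r)) ≤ 1) :
    |tangentForm z x v (extChartAt (𝓡 2) z y - extChartAt (𝓡 2) z x)| ≤ 11 / 10 * r := by
  rw [IsRiemannianManifold.out (I := 𝓡 2) x y] at hy
  obtain ⟨η, h0, h1, hη, hlen⟩ := exists_lt_of_riemannianEDist_lt hy
  have hmem := h.path_mem hη h0 hlen hr
  have hBp := h.pos
  have key := abs_functional_le_pathELength (z := z) (κ := 11 / 10) zero_le_one hη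
    (fun t ht => (hmem t ht).1) (tangentForm z x v) (by norm_num) fun t ht u => by
      obtain ⟨u', hu'⟩ := ofChart_surjective h.mem_source (toChart z (η t) u)
      have h2 := h.abs_norm_sq_sub_le (hmem t ht).1
        (mem_ball_iff_norm.2 ((hmem t ht).2.trans hr)) (hmem t ht).2.le hu'
      rw [← hu', tangentForm_toChart h.mem_source]
      have h3 := abs_real_inner_le_norm v u'
      rw [hv, one_mul] at h3
      refine h3.trans (abs_le_of_sq_le_sq' ?_ (by positivity)).2
      have h4 := (abs_le.1 h2).1
      have h5 := mul_le_mul_of_nonneg_right hr' (sq_nonneg ‖u‖)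
      nlinarith [sq_nonneg ‖u‖]
  rw [h0, h1, ← map_sub] at key
  have hr0 : 0 < r := by
    by_contra hneg
    rw [ENNReal.ofReal_of_nonpos (not_lt.1 hneg)] at hlen
    exact not_lt_bot hlen
  have h6 : ENNReal.ofReal |tangentForm z x v (extChartAt (𝓡 2) z y - extChartAt (𝓡 2) z x)| ≤
      ENNReal.ofReal (11 / 10 * r) := by
    rw [ENNReal.ofReal_mul (by norm_num)]
    exact key.trans (by gcongr)
  exact (ENNReal.ofReal_le_ofReal_iff (by positivity)).1 h6

theorem IsSplitting.abs_coord_le (hs : IsSplitting f wd z x L lam ε n es eu) (w : Plane) :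
    |coordS (orbitVec f wd z x es 0) (orbitVec f wd z x eu 0) w| ≤ L ^ 2 * ‖w‖ ∧
      |coordU (orbitVec f wd z x es 0) (orbitVec f wd z x eu 0) w| ≤ L ^ 2 * ‖w‖ := by
  have hyp := hs.hyp
  have hL := hyp.L_pos
  constructor
  · refine (abs_coordS_le hL (hyp.es_ne 0 (Nat.zero_le n)) (hyp.eu_ne 0 (Nat.zero_le n))
      hs.angle_zero w).trans ?_
    rw [div_le_iff₀ (hyp.es_pos (Nat.zero_le n))]
    have := mul_le_mul_of_nonneg_left hyp.le_es_zero (by positivity : 0 ≤ L * ‖w‖)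
    linarith
  · refine (abs_coordU_le hL (hyp.es_ne 0 (Nat.zero_le n)) (hyp.eu_ne 0 (Nat.zero_le n))
      hs.angle_zero w).trans ?_
    rw [div_le_iff₀ (hyp.eu_pos (Nat.zero_le n))]
    have := mul_le_mul_of_nonneg_left hyp.le_eu_zero (by positivity : 0 ≤ L * ‖w‖)
    linarith

/-- The curve is transverse to the contracting direction, because the most contracted direction is
close to it and parallel transport to nearby points moves coordinates very little. -/
theorem IsSplitting.le_abs_coordU_chartVelocity (hs : IsSplitting f wd z x L lam ε n es eu)
    (h : UniformBounds ρ f 𝒜 B) (hz : IsItinerary f wd 𝒜 x z)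
    {S : Submodule ℝ (TangentSpace (𝓡 2) x)} (hS : IsMostContracted (wordDeriv f wd n x) S)
    {𝒞 : Set (TangentSpace (𝓡 2) x)} (hSC : (S : Set (TangentSpace (𝓡 2) x)) ⊆ 𝒞)
    (hγ : IsGoodCurve C a b γ) {θ r : ℝ} (hθ : 0 < θ) (htr : IsTransverse θ x 𝒞 r a b γ)
    {t : ℝ} (ht : t ∈ Icc a b) (hball : edist x (γ t) < ENNReal.ofReal r)
    (hr1 : 64 * B ^ 3 * r ≤ 1) (hr2 : 16 * B ^ 5 * r ≤ Real.sin (min θ (Real.pi / 2)))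
    (hn : 8 * B ^ 6 * L ^ 6 * Real.exp (-lam * n) ≤ Real.sin (min θ (Real.pi / 2))) :
    Real.sin (min θ (Real.pi / 2)) ≤ 8 * B ^ 2 * L ^ 4 *
      |coordU (orbitVec f wd z x es 0) (orbitVec f wd z x eu 0)
        (chartVelocity (z 0) γ (Icc a b) t)| := by
  have hBp := h.pos
  have hB1 := h.one_le
  have hyp := hs.hyp
  have hL := hyp.L_pos
  have hg : GoodChart B (z 0) x := h.goodChart hz 0
  have hr0 : 0 < r := by
    by_contra hneg
    rw [ENNReal.ofReal_of_nonpos (not_lt.1 hneg)] at hball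
    exact not_lt_bot hball
  obtain ⟨v, hv, hv0⟩ := hS.exists_ne_zero
  have hr3 : B * r < B⁻¹ := by
    rw [← one_div, lt_div_iff₀ hBp]
    have : B ^ 2 * r ≤ B ^ 3 * r := by
      have : B ^ 2 ≤ B ^ 3 := pow_le_pow_right₀ hB1 (by norm_num)
      gcongr
    have : 0 < B ^ 2 * r := by positivity
    nlinarith
  obtain ⟨hsrc, hnear⟩ := hg.mem_of_edist_lt hball hr3
  have hmem := mem_ball_iff_norm.2 (hnear.trans hr3)
  obtain ⟨w', hw', hclose⟩ := hg.exists_mem_transportCone hball hr1 (hSC hv)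
  have hcu := hs.coordU_mostContracted_le h hz hS hv
  set e := orbitVec f wd z x es 0 with he
  set e' := orbitVec f wd z x eu 0 with he'
  set g := chartVelocity (z 0) γ (Icc a b) t with hgdef
  set tv := toChart (z 0) x v with htv
  set tw := toChart (z 0) (γ t) w' with htw
  set θ₁ := Real.sin (min θ (Real.pi / 2)) with hθ₁
  have htv0 : 0 < ‖tv‖ := norm_pos_iff.2 fun h0 => hv0
    (toChart_injective hg.mem_source (h0.trans (map_zero _).symm))
  have hhalf : ‖tv‖ ≤ 2 * ‖tw‖ := by
    have h1 : 4 * B ^ 2 * r * ‖tv‖ ≤ 1 / 2 * ‖tv‖ := by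
      gcongr
      have : B ^ 2 * r ≤ B ^ 3 * r := by
        have : B ^ 2 ≤ B ^ 3 := pow_le_pow_right₀ hB1 (by norm_num)
        gcongr
      linarith
    have h2 := norm_sub_norm_le tv tw
    rw [norm_sub_rev] at h2
    linarith
  have hw0 : w' ≠ 0 := by
    rintro rfl
    rw [htw, map_zero, norm_zero] at hhalf
    linarith
  have hang := htr t ht (by rw [Metric.mem_eball, edist_comm]; exact hball) w' hw' hw0
  set γ' := velocityWithin γ (Icc a b) t with hγ'
  have hθ₁0 : 0 ≤ θ₁ := Real.sin_nonneg_of_nonneg_of_le_pi (le_min hθ.le (by positivity))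
    ((min_le_right _ _).trans (by linarith [Real.pi_pos]))
  have hsin : θ₁ ≤ Real.sin (lineAngle γ' w') := by
    refine Real.sin_le_sin_of_le_of_le_pi_div_two ?_ (lineAngle_le _ _)
      ((min_le_left _ _).trans hang)
    have := le_min hθ.le (by positivity : 0 ≤ Real.pi / 2)
    linarith [Real.pi_pos]
  have harea := (hg.area_bounds hsrc hmem γ' w').2
  rw [← sin_lineAngle_mul, show ‖γ'‖ = 1 from hγ.unit_speed t ht, one_mul] at harea
  have hgB : ‖g‖ ≤ B := hγ.norm_chartVelocity_le hg ht hsrc hmem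
  have hw1 := hg.norm_toChart_le hsrc hmem w'
  -- the transversality at `γ t`, in the chart; then `tw` is replaced by `tv`, and `tv` by `e`
  have h1 : θ₁ * ‖tw‖ ≤ B ^ 2 * |wedge g tw| := by
    calc θ₁ * ‖tw‖ ≤ θ₁ * (B * ‖w'‖) := by gcongr
      _ = B * (θ₁ * ‖w'‖) := by ring
      _ ≤ B * (B * |wedge g tw|) := by
          refine mul_le_mul_of_nonneg_left ?_ hBp.le
          exact (mul_le_mul_of_nonneg_right hsin (norm_nonneg w')).trans harea
      _ = _ := by ring
  have h2 : |wedge g tw| ≤ |wedge g tv| + B * (4 * B ^ 2 * r * ‖tv‖) := by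
    have e1 : wedge g tw = wedge g tv + wedge g (tw - tv) := by rw [map_sub]; ring
    rw [e1]
    refine (abs_add_le _ _).trans ?_
    gcongr
    exact (abs_wedge_le _ _).trans (by gcongr)
  have h3 : θ₁ * ‖tv‖ ≤ 4 * (B ^ 2 * |wedge g tv|) := by
    have e1 : θ₁ * ‖tv‖ ≤ 2 * (θ₁ * ‖tw‖) := by
      have := mul_le_mul_of_nonneg_left hhalf hθ₁0
      linarith
    have e2 : B ^ 2 * |wedge g tw| ≤ B ^ 2 * (|wedge g tv| + B * (4 * B ^ 2 * r * ‖tv‖)) := by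
      gcongr
    have e3 := mul_le_mul_of_nonneg_right hr2 (norm_nonneg tv)
    nlinarith
  have h4 : |wedge g tv| ≤ L ^ 2 * ‖tv‖ * |wedge g e| +
      B ^ 3 * L ^ 5 * Real.exp (-lam * n) * ‖tv‖ * (B * L) := by
    have e1 := coordS_smul_add (hyp.wedge_ne (Nat.zero_le n)) tv
    rw [← he, ← he'] at e1
    conv_lhs => rw [← e1]
    rw [map_add, map_smul, map_smul, smul_eq_mul, smul_eq_mul]
    refine (abs_add_le _ _).trans ?_
    rw [abs_mul, abs_mul]
    have e2 := (hs.abs_coord_le tv).1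
    have e3 : |wedge g e'| ≤ B * L := (abs_wedge_le _ _).trans
      (mul_le_mul hgB hyp.eu_zero_le (norm_nonneg _) hBp.le)
    gcongr
  have h5 : θ₁ ≤ 8 * B ^ 2 * L ^ 2 * |wedge g e| := by
    have e1 : B ^ 2 * |wedge g tv| ≤ B ^ 2 * (L ^ 2 * ‖tv‖ * |wedge g e| +
      B ^ 3 * L ^ 5 * Real.exp (-lam * n) * ‖tv‖ * (B * L)) := by gcongr
    have e2 := mul_le_mul_of_nonneg_right hn (norm_nonneg tv)
    refine le_of_mul_le_mul_right ?_ htv0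
    nlinarith
  have h6 : |wedge g e| ≤ L ^ 2 * |coordU e e' g| := by
    have hw : 0 < |wedge e e'| := abs_pos.2 (hyp.wedge_ne (Nat.zero_le n))
    rw [coordU, abs_div, wedge_swap g e, abs_neg, mul_div_assoc', le_div_iff₀ hw]
    have e1 : |wedge e e'| ≤ L ^ 2 := (abs_wedge_le _ _).trans (by
      rw [sq]
      exact mul_le_mul hyp.es_zero_le hyp.eu_zero_le (norm_nonneg _) hL.le)
    rw [mul_comm]
    gcongr
  calc θ₁ ≤ 8 * B ^ 2 * L ^ 2 * |wedge g e| := h5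
    _ ≤ 8 * B ^ 2 * L ^ 2 * (L ^ 2 * |coordU e e' g|) := by gcongr
    _ = _ := by ring

/-- The point `y` stays close to `x` until time `n`, and has then been contracted towards `x`. -/
structure IsLeafPoint (f : Fin m → M ≃ₘ^2⟮𝓡 2, 𝓡 2⟯ M) (wd : ℕ → Fin m) (z : ℕ → M) (x : M)
    (es : TangentSpace (𝓡 2) x) (β lam K : ℝ) (n : ℕ) (y : M) : Prop where
  inTube : InTube f wd x β lam n y
  contracted : ‖orbitPt f wd z y n - orbitPt f wd z x n‖ ≤ K * ‖orbitVec f wd z x es n‖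

/-- The points of leaves of time `n` or later are leaf points of time `n`. -/
theorem IsAdapted.isLeafPoint {n' : ℕ} (h : IsAdapted ρ f 𝒜 wd z x B L lam ε β n' es eu V)
    (hn : n ≤ n') {T : ℝ} (hTβ : 2 * (leafConst B L * L ^ 4 * B ^ 2 * T) ≤ β) {y : M}
    (hy : y ∈ fakeStableLeaf f wd n' V x T) :
    IsLeafPoint f wd z x es β lam (leafConst B L * (L ^ 2 * B) * Real.exp (5 * ε * n) * T) n y := by
  obtain ⟨T', σ, hT', hTT, hσ, h0, ⟨t, ht, rfl⟩, hV⟩ := hy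
  have hBp := h.bounds.pos
  have hL := h.splitting.hyp.L_pos
  have hlc : 0 ≤ leafConst B L := by rw [leafConst]; positivity
  have hleaf : IsLeafCurve f wd n' V x T' σ :=
    ⟨hT', hσ, h0, fun s hs => (hV s hs).1, fun s hs => (hV s hs).2.2⟩
  have htube := h.leaf_inTube hleaf (le_trans (by gcongr) hTβ)
  refine ⟨(htube t ht).mono hn, ?_⟩
  refine (h.leaf_contraction hleaf ht (fun s hs => htube s ⟨hs.1, hs.2.trans ht.2⟩) n hn).trans ?_
  have : t ≤ T := ht.2.trans hTT
  calc _ = leafConst B L * (L ^ 2 * B) * Real.exp (5 * ε * n) * t * ‖orbitVec f wd z x es n‖ := by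
        ring
    _ ≤ _ := by gcongr

/-- Two leaf points are very close in the expanding direction, if their chord is transverse to the
contracting direction: otherwise the expansion would separate them. -/
theorem IsSplitting.abs_coordU_sub_le (hs : IsSplitting f wd z x L lam ε n es eu)
    (h : UniformBounds ρ f 𝒜 B) (hz : IsItinerary f wd 𝒜 x z)
    (hβ : 0 < β) (hβ' : 2 * B ^ 2 * β < 1) {α K : ℝ} (hα : 0 ≤ α)
    (hβα : 4 * (2 * B ^ 2 * β * HypSeq.errConst L lam * (1 + α * L ^ 2)) ≤ 1) {y y' : M}
    (hy : IsLeafPoint f wd z x es β lam K n y) (hy' : IsLeafPoint f wd z x es β lam K n y')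
    (hyy : |coordS (orbitVec f wd z x es 0) (orbitVec f wd z x eu 0)
        (extChartAt (𝓡 2) (z 0) y - extChartAt (𝓡 2) (z 0) y')| ≤
      α * |coordU (orbitVec f wd z x es 0) (orbitVec f wd z x eu 0)
        (extChartAt (𝓡 2) (z 0) y - extChartAt (𝓡 2) (z 0) y')|) :
    |coordU (orbitVec f wd z x es 0) (orbitVec f wd z x eu 0)
        (extChartAt (𝓡 2) (z 0) y - extChartAt (𝓡 2) (z 0) y')| ≤
      4 * L * K * Real.exp (ε * n) * (‖orbitVec f wd z x es n‖ / ‖orbitVec f wd z x eu n‖) := by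
  have hBp := h.pos
  have hL := hs.hyp.L_pos
  have h1 := hs.hyp.expanding_bound (β := 2 * B ^ 2 * β)
    (w := fun k => orbitPt f wd z y k - orbitPt f wd z y' k) (by positivity)
    (fun k hk => hy.inTube.orbitPt_pseudo hy'.inTube h hz hβ hβ' hs.hyp.lam_pos.le hk) le_rfl hα
    hyy hβα
  refine h1.trans ?_
  have h2 : ‖orbitPt f wd z y n - orbitPt f wd z y' n‖ ≤ 2 * K * ‖orbitVec f wd z x es n‖ := by
    -- both points are close to `x_n`
    rw [← sub_sub_sub_cancel_right _ _ (orbitPt f wd z x n)]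
    refine (norm_sub_le _ _).trans ?_
    linarith [hy.contracted, hy'.contracted]
  have h3 := hs.hyp.eu_pos le_rfl
  rw [mul_div_assoc', div_le_div_iff_of_pos_right h3]
  calc _ ≤ 2 * L * Real.exp (ε * n) * (2 * K * ‖orbitVec f wd z x es n‖) := by gcongr
    _ = _ := by ring

end Chords

/-! ### Intersections of leaves with a transverse curve -/

section Intersections

variable {M : Type*} [EMetricSpace M] [ChartedSpace Plane M] [IsManifold (𝓡 2) ∞ M]
variable {m : ℕ} {f : Fin m → M ≃ₘ^2⟮𝓡 2, 𝓡 2⟯ M} {wd : ℕ → Fin m}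
variable [RiemannianBundle (fun x : M => TangentSpace (𝓡 2) x)] {ρ : M → ℝ} {𝒜 : FiniteAtlas M}
  {B : ℝ} {x : M} {z : ℕ → M} {L lam ε : ℝ} {n : ℕ} {es eu : TangentSpace (𝓡 2) x}
  [IsContMDiffRiemannianBundle (𝓡 2) ∞ Plane (fun x : M => TangentSpace (𝓡 2) x)]
  [IsRiemannianManifold (𝓡 2) M] {C a b : ℝ} {γ : ℝ → M} {W W' : Set M} {c₀ α r : ℝ}

/-- Points of `W` and `W'` whose chord is transverse to the contracting direction are closer than
`c r` in the expanding direction. -/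
def CloseAcross (z : M) (e e' : Plane) (α c r : ℝ) (W W' : Set M) : Prop :=
  ∀ p ∈ W, ∀ p' ∈ W', |coordS e e' (extChartAt (𝓡 2) z p - extChartAt (𝓡 2) z p')| ≤
    α * |coordU e e' (extChartAt (𝓡 2) z p - extChartAt (𝓡 2) z p')| →
    |coordU e e' (extChartAt (𝓡 2) z p - extChartAt (𝓡 2) z p')| ≤ c * r

/-- The chords of a short arc of a curve that is transverse to the contracting direction. -/
theorem IsSplitting.chord_bounds (hs : IsSplitting f wd z x L lam ε n es eu)
    (hg : GoodChart B (z 0) x) (hγ : IsGoodCurve C a b γ) {c d : ℝ} (hJ : Icc c d ⊆ Icc a b)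
    (hJs : ∀ t ∈ Icc c d, γ t ∈ (chartAt Plane (z 0)).source ∧
      extChartAt (𝓡 2) (z 0) (γ t) ∈ Metric.ball (extChartAt (𝓡 2) (z 0) x) B⁻¹) {s t : ℝ}
    (hsJ : s ∈ Icc c d) (htJ : t ∈ Icc c d) {ℓ : ℝ} (hst : |t - s| ≤ ℓ)
    (hℓ : (B ^ 2 * Real.exp C + B ^ 3) * ℓ ≤ B)
    (hℓ' : L ^ 2 * (B ^ 2 * Real.exp C + B ^ 3) * ℓ ≤ c₀ / 4) :
    ‖extChartAt (𝓡 2) (z 0) (γ t) - extChartAt (𝓡 2) (z 0) (γ s)‖ ≤ 2 * B * |t - s| ∧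
      |coordU (orbitVec f wd z x es 0) (orbitVec f wd z x eu 0)
        (extChartAt (𝓡 2) (z 0) (γ t) - extChartAt (𝓡 2) (z 0) (γ s)) -
        (t - s) * coordU (orbitVec f wd z x es 0) (orbitVec f wd z x eu 0)
          (chartVelocity (z 0) γ (Icc a b) s)| ≤ c₀ / 4 * |t - s| := by
  have hBp := hg.pos
  have h1 := hγ.norm_chord_sub_le hg hJ hJs hsJ htJ hsJ hst
    (by rw [sub_self, abs_zero]; exact (abs_nonneg _).trans hst)
  set D := extChartAt (𝓡 2) (z 0) (γ t) - extChartAt (𝓡 2) (z 0) (γ s)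
  set g := chartVelocity (z 0) γ (Icc a b) s
  have hgB : ‖g‖ ≤ B := hγ.norm_chartVelocity_le hg (hJ hsJ) (hJs s hsJ).1 (hJs s hsJ).2
  constructor
  · have h2 : ‖D‖ ≤ ‖D - (t - s) • g‖ + ‖(t - s) • g‖ := by
      have := norm_add_le (D - (t - s) • g) ((t - s) • g)
      rwa [sub_add_cancel] at this
    rw [norm_smul, Real.norm_eq_abs] at h2
    have h3 : |t - s| * ‖g‖ ≤ |t - s| * B := by gcongr
    have h4 := mul_le_mul_of_nonneg_right hℓ (abs_nonneg (t - s))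
    linarith
  · have h2 : coordU (orbitVec f wd z x es 0) (orbitVec f wd z x eu 0) D - (t - s) *
        coordU (orbitVec f wd z x es 0) (orbitVec f wd z x eu 0) g =
        coordU (orbitVec f wd z x es 0) (orbitVec f wd z x eu 0) (D - (t - s) • g) := by
      rw [coordU_eq _ _ (D - _), map_sub, map_smul, smul_eq_mul, ← coordU_eq, ← coordU_eq]
    rw [h2]
    refine ((hs.abs_coord_le _).2.trans (mul_le_mul_of_nonneg_left h1 (sq_nonneg L))).trans ?_
    have := mul_le_mul_of_nonneg_right hℓ' (abs_nonneg (t - s))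
    linarith

/-- An arc of the curve between `W` and `W'` is short. Its chord is transverse to the contracting
direction if the arc is almost straight, and longer arcs cannot stay in a small ball. -/
theorem IsSplitting.abs_sub_le_of_mem (hs : IsSplitting f wd z x L lam ε n es eu)
    (hg : GoodChart B (z 0) x) (hγ : IsGoodCurve C a b γ) {R ℓ : ℝ} (hR : B * R < B⁻¹)
    (hc₀ : 0 < c₀) (htr : ∀ t ∈ Icc a b, edist x (γ t) < ENNReal.ofReal R →
      c₀ ≤ |coordU (orbitVec f wd z x es 0) (orbitVec f wd z x eu 0)
        (chartVelocity (z 0) γ (Icc a b) t)|)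
    (hℓ0 : 0 < ℓ) (hℓ : (B ^ 2 * Real.exp C + B ^ 3) * ℓ ≤ B)
    (hℓ' : L ^ 2 * (B ^ 2 * Real.exp C + B ^ 3) * ℓ ≤ c₀ / 4)
    (hRℓ : 4 * (L ^ 2 * (B * R)) ≤ c₀ * ℓ) (hα : 4 * B * L ^ 2 ≤ α * c₀)
    (hW : CloseAcross (z 0) (orbitVec f wd z x es 0) (orbitVec f wd z x eu 0) α (c₀ / 2) r W W')
    {s t : ℝ} (hsI : s ∈ Icc a b) (htI : t ∈ Icc a b)
    (harc : γ '' uIcc s t ⊆ Metric.eball x (ENNReal.ofReal R)) (hsW : γ s ∈ W) (htW : γ t ∈ W') :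
    |s - t| ≤ r := by
  have hBp := hg.pos
  have hJ : uIcc s t ⊆ Icc a b := uIcc_subset_Icc hsI htI
  have hball : ∀ τ ∈ uIcc s t, edist x (γ τ) < ENNReal.ofReal R := fun τ hτ => by
    rw [edist_comm]
    exact harc ⟨τ, hτ, rfl⟩
  have hJs : ∀ τ ∈ uIcc s t, γ τ ∈ (chartAt Plane (z 0)).source ∧
      ‖extChartAt (𝓡 2) (z 0) (γ τ) - extChartAt (𝓡 2) (z 0) x‖ < B * R := fun τ hτ =>
    hg.mem_of_edist_lt (hball τ hτ) hR
  have hJs' : ∀ τ ∈ uIcc s t, γ τ ∈ (chartAt Plane (z 0)).source ∧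
      extChartAt (𝓡 2) (z 0) (γ τ) ∈ Metric.ball (extChartAt (𝓡 2) (z 0) x) B⁻¹ := fun τ hτ =>
    ⟨(hJs τ hτ).1, mem_ball_iff_norm.2 ((hJs τ hτ).2.trans hR)⟩
  have hs0 : s ∈ uIcc s t := left_mem_uIcc
  set e := orbitVec f wd z x es 0
  set e' := orbitVec f wd z x eu 0
  have htrs := htr s hsI (hball s hs0)
  -- chords of length at most `ℓ` are transverse
  have hchord : ∀ τ ∈ uIcc s t, |τ - s| ≤ ℓ →
      3 / 4 * c₀ * |τ - s| ≤
        |coordU e e' (extChartAt (𝓡 2) (z 0) (γ τ) - extChartAt (𝓡 2) (z 0) (γ s))| := by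
    intro τ hτ hτs
    have h1 := (hs.chord_bounds hg hγ hJ hJs' hs0 hτ hτs hℓ hℓ').2
    have h2 := abs_sub_abs_le_abs_sub ((τ - s) * coordU e e' (chartVelocity (z 0) γ (Icc a b) s))
      (coordU e e' (extChartAt (𝓡 2) (z 0) (γ τ) - extChartAt (𝓡 2) (z 0) (γ s)))
    rw [abs_sub_comm, abs_mul] at h2
    have h3 := mul_le_mul_of_nonneg_left htrs (abs_nonneg (τ - s))
    linarith
  rcases le_or_gt |t - s| ℓ with hle | hgt
  · have ht0 : t ∈ uIcc s t := right_mem_uIcc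
    have h1 := hchord t ht0 hle
    have h2 := (hs.chord_bounds hg hγ hJ hJs' hs0 ht0 hle hℓ hℓ').1
    have h3 := (hs.abs_coord_le (extChartAt (𝓡 2) (z 0) (γ t) - extChartAt (𝓡 2) (z 0) (γ s))).1
    have hneg : ∀ p q : Plane, |coordS e e' (p - q)| = |coordS e e' (q - p)| ∧
        |coordU e e' (p - q)| = |coordU e e' (q - p)| := by
      intro p q
      rw [coordU_sub, coordU_sub, coordS_sub, coordS_sub, abs_sub_comm,
        abs_sub_comm (coordU e e' p)]
      exact ⟨rfl, rfl⟩
    have h4 := hW (γ s) hsW (γ t) htW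
    rw [(hneg _ _).1, (hneg _ _).2] at h4
    have h5 : L ^ 2 * (2 * B * |t - s|) ≤ α * (3 / 4 * c₀ * |t - s|) := by
      have := mul_le_mul_of_nonneg_right hα (abs_nonneg (t - s))
      have : 0 ≤ B * L ^ 2 * |t - s| := by positivity
      linarith
    have hα0 : 0 ≤ α := by
      have h6 : 0 ≤ α * c₀ := le_trans (by positivity) hα
      exact nonneg_of_mul_nonneg_left h6 hc₀
    have h7 := h4 (h3.trans ((mul_le_mul_of_nonneg_left h2 (sq_nonneg L)).trans
      (h5.trans (mul_le_mul_of_nonneg_left h1 hα0))))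
    rw [abs_sub_comm]
    nlinarith [abs_nonneg (t - s)]
  · exfalso
    obtain ⟨τ, hτ, hτs⟩ : ∃ τ ∈ uIcc s t, |τ - s| = ℓ := by
      rcases le_total s t with hst | hst
      · rw [abs_of_nonneg (by linarith)] at hgt
        refine ⟨s + ℓ, ?_, by rw [add_sub_cancel_left, abs_of_pos hℓ0]⟩
        rw [uIcc_of_le hst]
        exact ⟨by linarith, by linarith⟩
      · rw [abs_of_nonpos (by linarith)] at hgt
        refine ⟨s - ℓ, ?_, by rw [sub_sub_cancel_left, abs_neg, abs_of_pos hℓ0]⟩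
        rw [uIcc_of_ge hst]
        exact ⟨by linarith, by linarith⟩
    have h1 := hchord τ hτ hτs.le
    have h2 := (hs.abs_coord_le (extChartAt (𝓡 2) (z 0) (γ τ) - extChartAt (𝓡 2) (z 0) (γ s))).2
    have h3 : ‖extChartAt (𝓡 2) (z 0) (γ τ) - extChartAt (𝓡 2) (z 0) (γ s)‖ ≤ 2 * (B * R) := by
      rw [← sub_sub_sub_cancel_right _ _ (extChartAt (𝓡 2) (z 0) x)]
      refine (norm_sub_le _ _).trans ?_
      linarith [(hJs τ hτ).2, (hJs s hs0).2]
    have h4 := mul_le_mul_of_nonneg_left h3 (sq_nonneg L)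
    rw [hτs] at h1
    have : 0 < c₀ * ℓ := by positivity
    linarith

/-- A curve that starts on `W` crosses the graph `W'`: in the expanding direction, the curve moves
faster than the distance between `W` and `W'`. -/
theorem IsSplitting.exists_mem_of_mem (hs : IsSplitting f wd z x L lam ε n es eu)
    (hg : GoodChart B (z 0) x) (hγ : IsGoodCurve C a b γ) {R ℓ δ κ : ℝ} (hR : R ≤ 2 * δ)
    (hδ : B * (3 * δ) < B⁻¹) (hδ' : 5 * (B ^ 3 * (B * (3 * δ))) ≤ 1) (hrδ : r ≤ δ)
    (htr : ∀ t ∈ Icc a b, edist x (γ t) < ENNReal.ofReal R →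
      c₀ ≤ |coordU (orbitVec f wd z x es 0) (orbitVec f wd z x eu 0)
        (chartVelocity (z 0) γ (Icc a b) t)|)
    (hr0 : 0 < r) (hrℓ : r ≤ ℓ) (hℓ : (B ^ 2 * Real.exp C + B ^ 3) * ℓ ≤ B)
    (hℓ' : L ^ 2 * (B ^ 2 * Real.exp C + B ^ 3) * ℓ ≤ c₀ / 4) (hα : 1 ≤ α)
    (hW : CloseAcross (z 0) (orbitVec f wd z x es 0) (orbitVec f wd z x eu 0) α (c₀ / 2) r W W')
    (hW's : ∀ p ∈ W', p ∈ (chartAt Plane (z 0)).source) (hκ0 : 0 ≤ κ) (hκ : 16 * κ * B ^ 2 ≤ c₀)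
    {P : ℝ → M} (hP : ∀ c, |c| ≤ 9 / 10 * (4 * δ) → P c ∈ W' ∧
      tangentForm (z 0) x es (extChartAt (𝓡 2) (z 0) (P c) - extChartAt (𝓡 2) (z 0) x) = c ∧
      ∀ c', |c'| ≤ 9 / 10 * (4 * δ) → |coordU (orbitVec f wd z x es 0) (orbitVec f wd z x eu 0)
        (extChartAt (𝓡 2) (z 0) (P c) - extChartAt (𝓡 2) (z 0) (P c'))| ≤ 2 * κ * |c - c'|)
    {s : ℝ} (hsub : Icc (s - r) (s + r) ⊆ Icc a b)
    (hball : edist x (γ s) < ENNReal.ofReal R) (hsW : γ s ∈ W) :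
    ∃ t ∈ Icc (s - r) (s + r), γ t ∈ W' := by
  have hBp := hg.pos
  have hs0 : s ∈ Icc (s - r) (s + r) := ⟨by linarith, by linarith⟩
  have hδ0 : 0 < δ := hr0.trans_le hrδ
  set ψ := extChartAt (𝓡 2) (z 0) with hψ
  set ξ := tangentForm (z 0) x es with hξ
  set e := orbitVec f wd z x es 0 with he
  set e' := orbitVec f wd z x eu 0 with he'
  have hnear : ∀ t ∈ Icc (s - r) (s + r), edist x (γ t) < ENNReal.ofReal (3 * δ) := by
    intro t ht
    have h1 := hγ.edist_le (hsub hs0) (hsub ht)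
    have h2 : |t - s| ≤ δ := (abs_le.2 ⟨by linarith [ht.1], by linarith [ht.2]⟩ : |t - s| ≤ r).trans hrδ
    calc edist x (γ t) ≤ edist x (γ s) + edist (γ s) (γ t) := edist_triangle _ _ _
      _ < ENNReal.ofReal (2 * δ) + ENNReal.ofReal δ :=
          ENNReal.add_lt_add_of_lt_of_le (ne_top_of_le_ne_top ENNReal.ofReal_ne_top h1)
            (hball.trans_le (ENNReal.ofReal_le_ofReal hR)) (h1.trans (ENNReal.ofReal_le_ofReal h2))
      _ = ENNReal.ofReal (3 * δ) := by
          rw [← ENNReal.ofReal_add (by linarith) hδ0.le]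
          ring_nf
  have hJs : ∀ t ∈ Icc (s - r) (s + r), γ t ∈ (chartAt Plane (z 0)).source ∧
      ψ (γ t) ∈ Metric.ball (ψ x) B⁻¹ := fun t ht => by
    have := hg.mem_of_edist_lt (hnear t ht) hδ
    exact ⟨this.1, mem_ball_iff_norm.2 (this.2.trans hδ)⟩
  let c : ℝ → ℝ := fun t => ξ (ψ (γ t) - ψ x)
  have hc : ∀ t ∈ Icc (s - r) (s + r), |c t| ≤ 9 / 10 * (4 * δ) := fun t ht => by
    have := hg.abs_tangentForm_le hs.norm_es (hnear t ht) hδ hδ'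
    linarith
  have hψc : ContinuousOn (fun t => ψ (γ t)) (Icc (s - r) (s + r)) := fun t ht =>
    ((hγ.hasDerivWithinAt_coord (hsub ht) (hJs t ht).1).continuousWithinAt).mono hsub
  have hcc : ContinuousOn c (Icc (s - r) (s + r)) :=
    ξ.continuous.comp_continuousOn (hψc.sub continuousOn_const)
  -- the signed distance, in the expanding direction, from `γ t` to the graph
  let G : ℝ → ℝ := fun t => coordU e e' (ψ (γ t) - ψ (P (c t)))
  have hGsub : ∀ t ∈ Icc (s - r) (s + r), |G t - G s -
      coordU e e' (ψ (γ t) - ψ (γ s))| ≤ 2 * κ * |c t - c s| := by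
    intro t ht
    have h1 := (hP (c t) (hc t ht)).2.2 (c s) (hc s hs0)
    have h2 : G t - G s - coordU e e' (ψ (γ t) - ψ (γ s)) =
        -coordU e e' (ψ (P (c t)) - ψ (P (c s))) := by
      simp only [G, coordU_sub]
      ring
    rw [h2, abs_neg]
    exact h1
  have hGc : ContinuousOn G (Icc (s - r) (s + r)) := by
    have h1 : ContinuousOn (fun u => coordU e e' (ψ (P u))) {u | |u| ≤ 9 / 10 * (4 * δ)} := by
      have : LipschitzOnWith (2 * κ).toNNReal (fun u => coordU e e' (ψ (P u)))
          {u | |u| ≤ 9 / 10 * (4 * δ)} := by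
        refine LipschitzOnWith.of_dist_le_mul fun u hu u' hu' => ?_
        rw [Real.dist_eq, Real.dist_eq, ← coordU_sub, Real.coe_toNNReal _ (by positivity)]
        exact (hP u hu).2.2 u' hu'
      exact this.continuousOn
    have h2 : ContinuousOn (fun t => coordU e e' (ψ (γ t))) (Icc (s - r) (s + r)) := by
      simp only [coordU_eq]
      exact (ContinuousLinearMap.continuous _).comp_continuousOn hψc
    refine (h2.sub (h1.comp hcc hc)).congr fun t _ => ?_
    simp only [G, coordU_sub]
    rfl
  -- a point where the two coordinates agree is a point of intersection
  have hzero : ∀ t ∈ Icc (s - r) (s + r), G t = 0 → γ t ∈ W' := by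
    intro t ht hGt
    obtain ⟨hPW, hPξ, -⟩ := hP (c t) (hc t ht)
    obtain ⟨u, hu⟩ := ofChart_surjective hg.mem_source (ψ (γ t) - ψ (P (c t)))
    obtain ⟨-, h1, h2⟩ := hs.tangentForm_bounds hg.mem_source u
    have h3 : ξ (ψ (γ t) - ψ (P (c t))) = 0 := by
      rw [← sub_sub_sub_cancel_right _ _ (ψ x), map_sub, hPξ]
      exact sub_self _
    rw [hu] at h1 h2
    have hGt' : coordU e e' (ψ (γ t) - ψ (P (c t))) = 0 := hGt
    rw [← hξ, h3, ← he, ← he', hGt', abs_zero, zero_sub, abs_neg] at h1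
    rw [← he, ← he', hGt', abs_zero, add_zero] at h2
    have h4 : u = 0 := norm_le_zero_iff.1 (h2.trans h1)
    rw [h4, map_zero] at hu
    have h5 : ψ (γ t) = ψ (P (c t)) := sub_eq_zero.1 hu.symm
    have h6 : γ t = P (c t) := by
      rw [← symm_coord (hJs t ht).1, ← symm_coord (hW's _ hPW)]
      exact congrArg _ h5
    rw [h6]
    exact hPW
  -- the value at `s` is small
  have hGs : |G s| ≤ c₀ / 2 * r := by
    obtain ⟨hPW, hPξ, -⟩ := hP (c s) (hc s hs0)
    refine hW _ hsW _ hPW ?_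
    obtain ⟨u, hu⟩ := ofChart_surjective hg.mem_source (ψ (γ s) - ψ (P (c s)))
    obtain ⟨-, h1, -⟩ := hs.tangentForm_bounds hg.mem_source u
    have h3 : ξ (ψ (γ s) - ψ (P (c s))) = 0 := by
      rw [← sub_sub_sub_cancel_right _ _ (ψ x), map_sub, hPξ]
      exact sub_self _
    rw [hu, ← hξ, h3, zero_sub, abs_neg] at h1
    refine h1.trans ?_
    exact le_mul_of_one_le_left (abs_nonneg _) hα
  set g := coordU e e' (chartVelocity (z 0) γ (Icc a b) s) with hgdef
  have htrs : c₀ ≤ |g| := htr s (hsub hs0) hball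
  have hmove : ∀ t ∈ Icc (s - r) (s + r), |G t - G s - (t - s) * g| ≤ c₀ / 2 * |t - s| := by
    intro t ht
    have hts : |t - s| ≤ ℓ := (abs_le.2 ⟨by linarith [ht.1], by linarith [ht.2]⟩ : |t - s| ≤ r).trans hrℓ
    obtain ⟨h1, h2⟩ := hs.chord_bounds hg hγ hsub hJs hs0 ht hts hℓ hℓ'
    have h3 := hGsub t ht
    have h4 : |c t - c s| ≤ B * (2 * B * |t - s|) := by
      have e1 : c t - c s = ξ (ψ (γ t) - ψ (γ s)) := by
        simp only [c, map_sub]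
        ring
      obtain ⟨u, hu⟩ := ofChart_surjective hg.mem_source (ψ (γ t) - ψ (γ s))
      have e2 := (hs.tangentForm_bounds hg.mem_source u).1
      have e3 := hg.norm_le_toChart hg.mem_source (Metric.mem_ball_self hg.inv_pos) u
      rw [hu] at e2 e3
      rw [e1]
      exact e2.trans (e3.trans (by gcongr))
    have h5 : 2 * κ * |c t - c s| ≤ c₀ / 4 * |t - s| := by
      have e1 : 2 * κ * |c t - c s| ≤ 2 * κ * (B * (2 * B * |t - s|)) := by gcongr
      have e2 := mul_le_mul_of_nonneg_right hκ (abs_nonneg (t - s))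
      linarith
    rw [abs_le] at h2 h3 ⊢
    constructor <;> linarith [h2.1, h2.2, h3.1, h3.2]
  have hp := hmove (s + r) ⟨by linarith, le_rfl⟩
  have hm := hmove (s - r) ⟨le_rfl, by linarith⟩
  rw [add_sub_cancel_left, abs_of_pos hr0] at hp
  rw [sub_sub_cancel_left, abs_neg, abs_of_pos hr0] at hm
  rw [abs_le] at hp hm hGs
  have hle : s - r ≤ s + r := by linarith
  -- `G` changes by at least `c₀ / 2 * r` in either direction, so it changes sign
  suffices h0 : (0 : ℝ) ∈ G '' Icc (s - r) (s + r) by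
    obtain ⟨t, ht, hGt⟩ := h0
    exact ⟨t, ht, hzero t ht hGt⟩
  rcases le_total 0 g with h0 | h0
  · rw [abs_of_nonneg h0] at htrs
    have h1 : c₀ * r ≤ r * g := by rw [mul_comm]; gcongr
    exact intermediate_value_Icc hle hGc ⟨by linarith, by linarith⟩
  · rw [abs_of_nonpos h0] at htrs
    have h1 : c₀ * r ≤ r * -g := by rw [mul_comm]; gcongr
    exact intermediate_value_Icc' hle hGc ⟨by linarith, by linarith⟩

end Intersections

/-! ### Choice of the constants -/

theorem eventually_mul_le_nhdsGT (K : ℝ) {b : ℝ} (hb : 0 < b) : ∀ᶠ t in 𝓝[>] (0 : ℝ), K * t ≤ b := by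
  have h : Tendsto (fun t : ℝ => K * t) (𝓝[>] 0) (𝓝 (K * 0)) :=
    (tendsto_id.const_mul K).mono_left nhdsWithin_le_nhds
  rw [mul_zero] at h
  exact (h.eventually_lt_const hb).mono fun _ h => h.le

theorem eventually_mul_exp_le {c : ℝ} (hc : 0 < c) (K : ℝ) {b : ℝ} (hb : 0 < b) :
    ∀ᶠ n : ℕ in atTop, K * Real.exp (-c * n) ≤ b := by
  have h1 : Tendsto (fun n : ℕ => -c * (n : ℝ)) atTop atBot :=
    tendsto_natCast_atTop_atTop.const_mul_atTop_of_neg (by linarith)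
  have h2 := (Real.tendsto_exp_atBot.comp h1).const_mul K
  rw [mul_zero] at h2
  exact (h2.eventually_lt_const hb).mono fun _ h => h.le

section Constants

variable {M : Type*} [EMetricSpace M] [ChartedSpace Plane M] [IsManifold (𝓡 2) ∞ M]
variable {m : ℕ} {f : Fin m → M ≃ₘ^2⟮𝓡 2, 𝓡 2⟯ M}
variable [RiemannianBundle (fun x : M => TangentSpace (𝓡 2) x)] {ρ : M → ℝ} {𝒜 : FiniteAtlas M}
  {B L lam ε β ν₁ ν₂ η C C₁ D₁ D₂ D₃ θ₀ : ℝ}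
  [IsContMDiffRiemannianBundle (𝓡 2) ∞ Plane (fun x : M => TangentSpace (𝓡 2) x)]
  [IsRiemannianManifold (𝓡 2) M]

/-- A tempered splitting and a smoothed image distribution of a large time are adapted to each
other. -/
theorem eventually_isAdapted (hB : UniformBounds ρ f 𝒜 B) (hlam : 0 < lam) (hβ : 0 < β)
    (hβ1 : 2 * B ^ 2 * β < 1)
    (hβ2 : 8 * (2 * B ^ 2 * β * HypSeq.errConst L lam * (1 + 4 * B ^ 3 * L ^ 2)) ≤ 1)
    (hην₁ : 8 * (η * ν₁) ≤ lam) (hην₂ : 0 < η * ν₂) (hD₁ : 0 < D₁) (hD₂ : 0 < D₂) :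
    ∀ᶠ n : ℕ in atTop, ∀ (wd : ℕ → Fin m) (z : ℕ → M) (x : M) (es eu : TangentSpace (𝓡 2) x)
      (K : Set M) (V : LineField M) (S : Submodule ℝ (TangentSpace (𝓡 2) x)),
      IsItinerary f wd 𝒜 x z → IsSplitting f wd z x L lam ε n es eu → x ∈ K →
      IsSmoothedImage f wd 𝒜 ν₁ ν₂ η D₁ D₂ D₃ n K V → IsMostContracted (wordDeriv f wd n x) S →
      IsAdapted ρ f 𝒜 wd z x B L lam ε β n es eu V := by
  have hBp := hB.pos
  have hgap : 0 < lam / 2 - η * ν₁ := by linarith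
  filter_upwards [eventually_mul_exp_le hlam (4 * B ^ 2 * L ^ 4) one_pos,
    eventually_mul_exp_le hην₂ D₃ (b := 1 / 4) (by norm_num),
    eventually_mul_exp_le hgap (B * (2 * B * β)) hD₁,
    eventually_mul_exp_le (c := lam / 2) (by positivity) (4 * B ^ 3 * (2 * B * β) * (16 * B ^ 6))
      one_pos,
    eventually_mul_exp_le hgap (4 * B ^ 3 * D₂ * (2 * B * β) * (16 * B ^ 6)) one_pos]
    with n h1 h2 h3 h4 h5 wd z x es eu K V S hz hs hx hV hS
  have e1 : Real.exp (-lam * n / 2) = Real.exp (-(lam / 2) * n) := by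
    congr 1
    ring
  have e2 : Real.exp (-(lam / 2) * n) =
      Real.exp (-(lam / 2 - η * ν₁) * n) * Real.exp (-(η * ν₁ * n)) := by
    rw [← Real.exp_add]
    congr 1
    ring
  have e3 : Real.exp (η * ν₁ * n) * Real.exp (-(lam / 2) * n) =
      Real.exp (-(lam / 2 - η * ν₁) * n) := by
    rw [← Real.exp_add]
    congr 1
    ring
  refine ⟨hB, hz, hs, hβ, hβ1, hβ2, ?_, ⟨_, hV.c2Norm_le⟩⟩
  refine isConeField_of_smoothedImage hs hB hz hV hx hS h1 ?_ (by positivity) ?_ ?_ hD₂.le ?_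
  · rwa [← neg_mul]
  · have h6 : Real.exp (-lam * n / 2) ≤ 1 := by
      rw [Real.exp_le_one_iff]
      have : 0 ≤ lam * n := by positivity
      linarith
    have h7 := mul_le_mul_of_nonneg_left h6 (by positivity : 0 ≤ 2 * B ^ 2 * β)
    linarith
  · rw [e1, e2, ← mul_assoc, ← mul_assoc]
    gcongr
  · rw [e1]
    have h6 : 4 * B ^ 3 * (1 + D₂ * Real.exp (η * ν₁ * n)) *
        (2 * B * β * Real.exp (-(lam / 2) * n)) * (16 * B ^ 6) =
        4 * B ^ 3 * (2 * B * β) * (16 * B ^ 6) * Real.exp (-(lam / 2) * n) +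
          4 * B ^ 3 * D₂ * (2 * B * β) * (16 * B ^ 6) *
            (Real.exp (η * ν₁ * n) * Real.exp (-(lam / 2) * n)) := by ring
    rw [h6, e3]
    linarith

set_option maxHeartbeats 800000 in
/-- The intersections of a curve with the fake stable leaves of times `n` and `n + 1` are close to
each other when `n` is large. -/
theorem eventually_intersectionsWithin [CompactSpace M] (hB : UniformBounds ρ f 𝒜 B)
    (hf : ∀ i, PreservesArea ρ (f i)) (hlam : 0 < lam) (hC₁ : 0 < C₁) (hε : 0 ≤ ε)
    (hε' : 1000 * ε ≤ lam) (hθ₀ : 0 < θ₀) (hην₁ : 8 * (η * ν₁) ≤ lam) (hην₂ : 0 < η * ν₂)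
    (hD₁ : 0 < D₁) (hD₂ : 0 < D₂) :
    ∃ δ₀ > 0, ∀ᶠ n : ℕ in atTop, ∀ δ, 0 < δ → δ ≤ δ₀ →
      ∀ (x : M) (𝒞 : Set (TangentSpace (𝓡 2) x)) (a b : ℝ) (γ : ℝ → M), IsGoodCurve C a b γ →
      IsTransverse θ₀ x 𝒞 (2 * δ) a b γ → ∀ wd : ℕ → Fin m,
      IsConeTempered f wd C₁ lam ε x 𝒞 n (n + 1) →
      ∀ (K K' : Set M) (V V' : LineField M), x ∈ K →
        IsSmoothedImage f wd 𝒜 ν₁ ν₂ η D₁ D₂ D₃ n K V → x ∈ K' →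
        IsSmoothedImage f wd 𝒜 ν₁ ν₂ η D₁ D₂ D₃ (n + 1) K' V' →
        IntersectionsWithin (fakeStableLeaf f wd n V x (4 * δ₀))
          (fakeStableLeaf f wd (n + 1) V' x (4 * δ₀)) x (2 * δ) a b γ
          (Real.exp (-1.99 * Real.log ‖wordDeriv f wd n x‖)) := by
  have hBp := hB.pos
  have hB1 := hB.one_le
  obtain ⟨L, hLdef⟩ : ∃ L, L = 2 * B ^ 3 * Real.exp C₁ := ⟨_, rfl⟩
  have hL : 0 < L := by rw [hLdef]; positivity
  obtain ⟨θ₁, hθ₁⟩ : ∃ θ₁, θ₁ = Real.sin (min θ₀ (Real.pi / 2)) := ⟨_, rfl⟩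
  have hθ₁0 : 0 < θ₁ := by
    rw [hθ₁]
    exact Real.sin_pos_of_pos_of_lt_pi (lt_min hθ₀ (by positivity))
      ((min_le_right _ _).trans_lt (by linarith [Real.pi_pos]))
  -- the transversality of the curve, the length of its almost straight arcs, the largest slope of
  -- the chords of such arcs, and the largest slope of the leaves
  obtain ⟨c₀, hc₀⟩ : ∃ c₀, c₀ = θ₁ / (8 * B ^ 2 * L ^ 4) := ⟨_, rfl⟩
  have hc₀0 : 0 < c₀ := by rw [hc₀]; positivity
  obtain ⟨ℓ, ⟨hℓ1, hℓ2⟩, hℓ0⟩ := (((eventually_mul_le_nhdsGT (B ^ 2 * Real.exp C + B ^ 3) hBp).and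
    (eventually_mul_le_nhdsGT (L ^ 2 * (B ^ 2 * Real.exp C + B ^ 3))
      (b := c₀ / 4) (by positivity))).and self_mem_nhdsWithin).exists
  obtain ⟨α, hα⟩ : ∃ α, α = max 1 (4 * B * L ^ 2 / c₀) := ⟨_, rfl⟩
  have hα1 : 1 ≤ α := hα ▸ le_max_left _ _
  have hα2 : 4 * B * L ^ 2 ≤ α * c₀ := by
    rw [← div_le_iff₀ hc₀0, hα]
    exact le_max_right _ _
  obtain ⟨κ, ⟨hκ1, hκ2⟩, hκ0⟩ := (((eventually_mul_le_nhdsGT 50 one_pos).and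
    (eventually_mul_le_nhdsGT (16 * B ^ 2) hc₀0)).and self_mem_nhdsWithin).exists
  -- the width of the tube
  obtain ⟨β, ⟨hβ1, hβ2, hβ3, hβ4, hβ5⟩, hβ0⟩ := (((eventually_mul_le_nhdsGT (2 * B ^ 2)
    (b := 1 / 2) (by norm_num)).and ((eventually_mul_le_nhdsGT
      (8 * (2 * B ^ 2 * HypSeq.errConst L lam * (1 + 4 * B ^ 3 * L ^ 2))) one_pos).and
    ((eventually_mul_le_nhdsGT (40 * B ^ 4) one_pos).and ((eventually_mul_le_nhdsGT
      (8 * B ^ 2 * HypSeq.errConst L lam * (1 + 4 * B ^ 3 * L ^ 2) * L ^ 2)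
      (b := κ / 2) (half_pos hκ0)).and (eventually_mul_le_nhdsGT
      (4 * (2 * B ^ 2 * HypSeq.errConst L lam * (1 + α * L ^ 2))) one_pos))))).and
    self_mem_nhdsWithin).exists
  -- the size of the leaves
  obtain ⟨δ₀, ⟨hδ1, hδ2, hδ3, hδ4, hδ5, hδ6⟩, hδ0⟩ := (((eventually_mul_le_nhdsGT
    (16 * (leafConst B L * L ^ 4 * B ^ 2)) hβ0).and ((eventually_mul_le_nhdsGT (128 * B ^ 3)
    one_pos).and ((eventually_mul_le_nhdsGT (32 * B ^ 5) hθ₁0).and ((eventually_mul_le_nhdsGT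
    (3 * B ^ 2) (b := 1 / 2) (by norm_num)).and ((eventually_mul_le_nhdsGT (15 * B ^ 4)
    one_pos).and (eventually_mul_le_nhdsGT (8 * (L ^ 2 * B)) (mul_pos hc₀0 hℓ0))))))).and
    self_mem_nhdsWithin).exists
  refine ⟨δ₀, hδ0, ?_⟩
  have hadapt := eventually_isAdapted (β := β) (L := L) (ε := ε) (ν₁ := ν₁) (ν₂ := ν₂) (η := η)
    (D₁ := D₁) (D₂ := D₂) (D₃ := D₃) hB hlam hβ0 (by linarith) (by linarith) hην₁ hην₂ hD₁ hD₂
  have hslope : ∀ᶠ n : ℕ in atTop, leafSlope B L lam β n ≤ κ := by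
    filter_upwards [eventually_mul_exp_le hlam (8 * B ^ 3 * L ^ 6) (half_pos hκ0)] with n hn
    rw [leafSlope]
    linarith
  filter_upwards [hadapt, (tendsto_add_atTop_nat 1).eventually hadapt, hslope,
    (tendsto_add_atTop_nat 1).eventually hslope,
    eventually_mul_exp_le hlam (8 * B ^ 6 * L ^ 6) hθ₁0,
    eventually_mul_exp_le hlam ((B * L ^ 2) ^ 2) hℓ0,
    eventually_mul_exp_le hlam ((B * L ^ 2) ^ 2) hδ0,
    eventually_mul_exp_le (c := 3 / 1000 * lam) (by positivity)
      (4 * L * (leafConst B L * (L ^ 2 * B) * (4 * δ₀)) * (4 * B ^ 8 * L ^ 15))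
      (b := c₀ / 2) (by positivity)]
    with n hn hn' hκn hκn' hn1 hn2 hn3 hn4 δ hδ hδδ x 𝒞 a b γ hγ htr wd hT K K' V V' hxK hV hxK' hV'
  obtain ⟨⟨es, eu, hes, heu, hexp, hcon, hang⟩, hmc⟩ := hT
  obtain ⟨z, hz⟩ := exists_itinerary f wd 𝒜 x
  obtain ⟨S, hS, hSC⟩ := hmc n le_rfl (Nat.le_succ n)
  obtain ⟨S', hS', -⟩ := hmc (n + 1) (Nat.le_succ n) le_rfl
  have hs' : IsSplitting f wd z x L lam ε (n + 1) es eu := by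
    refine ⟨hes, heu, ?_⟩
    rw [hLdef]
    exact hypSeq_of_tempered hB hz hC₁.le hlam hε (by linarith) hes heu hexp hcon hang
  have hs := hs'.mono (Nat.le_succ n)
  have hA := hn wd z x es eu K V S hz hs hxK hV hS
  have hA' := hn' wd z x es eu K' V' S' hz hs' hxK' hV' hS'
  have hg : GoodChart B (z 0) x := hB.goodChart hz 0
  obtain ⟨r, hr⟩ : ∃ r, r = Real.exp (-1.99 * Real.log ‖wordDeriv f wd n x‖) := ⟨_, rfl⟩
  have hr0 : 0 < r := by rw [hr]; exact Real.exp_pos _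
  have hrad := hs.radius_le hB hz
  have hratio := hs.ratio_le_radius hB hz hf hε'
  rw [← hr] at hrad hratio ⊢
  have hlc : 0 ≤ leafConst B L := by rw [leafConst]; positivity
  have hT0 : 0 < 4 * δ₀ := mul_pos four_pos hδ0
  have hTβ0 : 0 ≤ leafConst B L * L ^ 4 * B ^ 2 * (4 * δ₀) := by positivity
  have hTβ : 4 * (leafConst B L * L ^ 4 * B ^ 2 * (4 * δ₀)) ≤ β := by linarith
  have hTβ2 : 2 * (leafConst B L * L ^ 4 * B ^ 2 * (4 * δ₀)) ≤ β := by linarith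
  have hleaf : ∀ y ∈ fakeStableLeaf f wd n V x (4 * δ₀), IsLeafPoint f wd z x es β lam
      (leafConst B L * (L ^ 2 * B) * Real.exp (5 * ε * n) * (4 * δ₀)) n y := fun y hy =>
    hA.isLeafPoint le_rfl hTβ2 hy
  have hleaf' : ∀ y ∈ fakeStableLeaf f wd (n + 1) V' x (4 * δ₀), IsLeafPoint f wd z x es β lam
      (leafConst B L * (L ^ 2 * B) * Real.exp (5 * ε * n) * (4 * δ₀)) n y := fun y hy =>
    hA'.isLeafPoint (Nat.le_succ n) hTβ2 hy
  have hsrc : ∀ y, IsLeafPoint f wd z x es β lam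
      (leafConst B L * (L ^ 2 * B) * Real.exp (5 * ε * n) * (4 * δ₀)) n y →
      y ∈ (chartAt Plane (z 0)).source := fun y hy =>
    (hy.inTube.chart hB hz hβ0 (by linarith) hlam.le (Nat.zero_le n)).1
  have hclose : ∀ y y', IsLeafPoint f wd z x es β lam
      (leafConst B L * (L ^ 2 * B) * Real.exp (5 * ε * n) * (4 * δ₀)) n y →
      IsLeafPoint f wd z x es β lam
      (leafConst B L * (L ^ 2 * B) * Real.exp (5 * ε * n) * (4 * δ₀)) n y' →
      |coordS (orbitVec f wd z x es 0) (orbitVec f wd z x eu 0)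
        (extChartAt (𝓡 2) (z 0) y - extChartAt (𝓡 2) (z 0) y')| ≤
      α * |coordU (orbitVec f wd z x es 0) (orbitVec f wd z x eu 0)
        (extChartAt (𝓡 2) (z 0) y - extChartAt (𝓡 2) (z 0) y')| →
      |coordU (orbitVec f wd z x es 0) (orbitVec f wd z x eu 0)
        (extChartAt (𝓡 2) (z 0) y - extChartAt (𝓡 2) (z 0) y')| ≤ c₀ / 2 * r := by
    intro y y' hy hy' hyy
    refine (hs.abs_coordU_sub_le hB hz hβ0 (by linarith) (by linarith) (by linarith) hy hy'
      hyy).trans ?_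
    have e1 : Real.exp (6 * ε * n) = Real.exp (5 * ε * n) * Real.exp (ε * n) := by
      rw [← Real.exp_add]
      congr 1
      ring
    rw [e1] at hratio
    have e2 := mul_le_mul_of_nonneg_left hratio
      (by positivity : 0 ≤ 4 * L * (leafConst B L * (L ^ 2 * B) * (4 * δ₀)))
    have e3 := mul_le_mul_of_nonneg_right hn4 hr0.le
    have e4 : Real.exp (-(3 / 1000) * lam * n) = Real.exp (-(3 / 1000 * lam) * n) := by
      congr 1
      ring
    rw [e4] at e2
    linarith
  have hinv : B * (3 * δ₀) < B⁻¹ := by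
    rw [← one_div, lt_div_iff₀ hBp]
    linarith
  have hinv' : B * (2 * δ) < B⁻¹ := lt_of_le_of_lt (by gcongr; linarith) hinv
  have htrans : ∀ t ∈ Icc a b, edist x (γ t) < ENNReal.ofReal (2 * δ) →
      c₀ ≤ |coordU (orbitVec f wd z x es 0) (orbitVec f wd z x eu 0)
        (chartVelocity (z 0) γ (Icc a b) t)| := by
    intro t ht hball
    have h1 : 64 * B ^ 3 * (2 * δ) ≤ 128 * B ^ 3 * δ₀ := by
      have : B ^ 3 * δ ≤ B ^ 3 * δ₀ := by gcongr
      linarith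
    have h2 : 16 * B ^ 5 * (2 * δ) ≤ 32 * B ^ 5 * δ₀ := by
      have : B ^ 5 * δ ≤ B ^ 5 * δ₀ := by gcongr
      linarith
    have h3 := hs.le_abs_coordU_chartVelocity hB hz hS hSC hγ hθ₀ htr ht hball (h1.trans hδ2)
      (hθ₁ ▸ h2.trans hδ3) (hθ₁ ▸ hn1)
    rw [hc₀, div_le_iff₀ (by positivity), hθ₁]
    linarith
  obtain ⟨P, hP⟩ := hA.exists_graph hβ3 hκn hκ1 hT0 hTβ
  obtain ⟨P', hP'⟩ := hA'.exists_graph hβ3 hκn' hκ1 hT0 hTβ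
  have hswap : ∀ s, γ s ∈ Metric.eball x (ENNReal.ofReal (2 * δ)) →
      edist x (γ s) < ENNReal.ofReal (2 * δ) := fun s hs => by
    rw [edist_comm]
    exact hs
  refine ⟨fun s hsI t htI harc hsW htW => ?_, fun s hsub hball => ⟨fun hsW => ?_, fun hsW => ?_⟩⟩
  · refine hs.abs_sub_le_of_mem hg hγ hinv' hc₀0 htrans hℓ0 hℓ1 hℓ2 ?_ hα2
      (fun p hp p' hp' h => hclose p p' (hleaf p hp) (hleaf' p' hp') h) hsI htI harc hsW htW
    have : L ^ 2 * B * δ ≤ L ^ 2 * B * δ₀ := by gcongr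
    linarith
  · exact hs.exists_mem_of_mem hg hγ (by linarith) hinv (by linarith) (hrad.trans hn3) htrans hr0
      (hrad.trans hn2) hℓ1 hℓ2 hα1
      (fun p hp p' hp' h => hclose p p' (hleaf p hp) (hleaf' p' hp') h)
      (fun p hp => hsrc p (hleaf' p hp)) (le_of_lt hκ0) (by linarith) hP' hsub (hswap s hball) hsW
  · exact hs.exists_mem_of_mem hg hγ (by linarith) hinv (by linarith) (hrad.trans hn3) htrans hr0
      (hrad.trans hn2) hℓ1 hℓ2 hα1
      (fun p hp p' hp' h => hclose p p' (hleaf' p hp) (hleaf p' hp') h)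
      (fun p hp => hsrc p (hleaf p hp)) (le_of_lt hκ0) (by linarith) hP hsub (hswap s hball) hsW

end Constants

end FakeStable

end

theorem propositionB14 {M : Type*} [EMetricSpace M] [CompactSpace M]
    [ChartedSpace FakeStable.Plane M] [IsManifold (𝓡 2) ∞ M]
    [RiemannianBundle (fun x : M => TangentSpace (𝓡 2) x)]
    [IsContMDiffRiemannianBundle (𝓡 2) ∞ FakeStable.Plane (fun x : M => TangentSpace (𝓡 2) x)]
    [IsRiemannianManifold (𝓡 2) M]
    (ρ : M → ℝ) (hρ : ContMDiff (𝓡 2) 𝓘(ℝ, ℝ) ∞ ρ) (hρpos : ∀ x, 0 < ρ x)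
    {m : ℕ} (f : Fin m → M ≃ₘ^2⟮𝓡 2, 𝓡 2⟯ M) (hf : ∀ i, FakeStable.PreservesArea ρ (f i))
    (𝒜 : FakeStable.FiniteAtlas M)
    (lam C₁ θ₀ ν₁ ν₂ : ℝ) (hlam : 0 < lam) (hC₁ : 0 < C₁) (hθ₀ : 0 < θ₀)
    (hν₁ : 0 < ν₁) (hν₂ : 0 < ν₂) :
    ∃ ε₀ > 0, ∀ ε η C D₁ D₂ D₃ : ℝ, 0 ≤ ε → ε < ε₀ → 0 < η → η < ε₀ → 0 < C →
      0 < D₁ → 0 < D₂ → 0 < D₃ →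
      ∃ N : ℕ, ∃ δ₀ > 0, ∀ δ, 0 < δ → δ ≤ δ₀ →
        ∀ (x : M) (𝒞 : Set (TangentSpace (𝓡 2) x)), FakeStable.IsCone 𝒞 →
        ∀ (a b : ℝ) (γ : ℝ → M), FakeStable.IsGoodCurve C a b γ →
          (∃ t ∈ Icc a b, edist x (γ t) < ENNReal.ofReal δ) →
          FakeStable.IsTransverse θ₀ x 𝒞 (2 * δ) a b γ →
        ∀ (wd : ℕ → Fin m) (n : ℕ), N ≤ n →
          FakeStable.IsConeTempered f wd C₁ lam ε x 𝒞 n (n + 1) →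
        ∀ (K K' : Set M) (V V' : FakeStable.LineField M),
          x ∈ K → (∀ y ∈ K, FakeStable.IsTempered f wd C₁ lam ε n y) →
          FakeStable.IsSmoothedImage f wd 𝒜 ν₁ ν₂ η D₁ D₂ D₃ n K V →
          x ∈ K' → (∀ y ∈ K', FakeStable.IsTempered f wd C₁ lam ε (n + 1) y) →
          FakeStable.IsSmoothedImage f wd 𝒜 ν₁ ν₂ η D₁ D₂ D₃ (n + 1) K' V' →
          FakeStable.IntersectionsWithin
            (FakeStable.fakeStableLeaf f wd n V x (4 * δ₀))
            (FakeStable.fakeStableLeaf f wd (n + 1) V' x (4 * δ₀))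
            x (2 * δ) a b γ
            (Real.exp (-1.99 * Real.log ‖FakeStable.wordDeriv f wd n x‖)) := by
  obtain ⟨B, hB⟩ := (FakeStable.eventually_uniformBounds hρ.continuous hρpos f 𝒜).exists
  refine ⟨min (lam / 1000) (lam / (8 * ν₁)), lt_min (by positivity) (by positivity),
    fun ε η C D₁ D₂ D₃ hε hε' hη hη' hC hD₁ hD₂ hD₃ => ?_⟩
  have h1 : 1000 * ε ≤ lam := by linarith [hε'.trans_le (min_le_left _ _)]
  have h2 : 8 * (η * ν₁) ≤ lam := by
    have h := (lt_div_iff₀ (by positivity)).1 (hη'.trans_le (min_le_right _ _))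
    linarith
  obtain ⟨δ₀, hδ₀, h⟩ := FakeStable.eventually_intersectionsWithin (C := C) (D₃ := D₃) hB hf hlam
    hC₁ hε h1 hθ₀ h2 (mul_pos hη hν₂) hD₁ hD₂
  obtain ⟨N, hN⟩ := eventually_atTop.1 h
  exact ⟨N, δ₀, hδ₀, fun δ hδ hδδ x 𝒞 _ a b γ hγ _ htr wd n hn hT K K' V V' hxK _ hV hxK' _ hV' =>
    hN n hn δ hδ hδδ x 𝒞 a b γ hγ htr wd hT K K' V V' hxK hV hxK' hV'⟩
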